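/- Let $X$ be a topological groupoid, $\Lambda X$ its inertia groupoid (objects $(x,g)$ with $g\in\mathrm{aut}(x)$; arrows $(x,g)\to(y,h)$ are the arrows $f\colon x\to y$ with $fg=hf$), and let $\xi$ be the element of the center of $\Lambda X$ with $\xi_{(x,g)}=g$. Assume that $\xi$ has finite order $r$. Let $K_{Tate}(X)=K_{rot}(\Lambda X,\xi)$ be the Grothendieck ring of formal power series $\sum_{n\ge 0}V_nq^{n/r}$ of complex vector bundles over $\Lambda X$ such that $\xi$ acts on $V_n$ as $e^{2\pi i n/r}$. Write $S_t(V)=\sum_n S^n(V)\,t^n$ for the total Atiyah symmetric power of such series (symmetric powers of the graded bundle $\bigoplus_n V_nq^{n/r}$), and $S_t^{Tate}(V)=\sum_n S_n^{Tate}(V)\,t^n$ for the total symmetric power in Tate $K$-theory, that is, $S^{Tate}_t=\varepsilon_!\,\delta^*P^{Tate}$ with $P^{Tate}$ the power operation of Tate $K$-theory, $\delta$ the diagonal and $\varepsilon_!$ the transfer along $\varepsilon\colon\coprod_n X\times B\mathfrak S_n\to\coprod_n X$. Explicitly, the fibre of $S_n^{Tate}(V)$ at $(x,g)$ is the space of $\mathfrak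 S_n$-invariants in $$\bigoplus_{\sigma\in\mathfrak S_n}\ \bigotimes_{c\ \text{cycle of}\ \sigma}\ \bigoplus_{a\ge 0}\theta_{c,a}\,q^{a/(r|c|)},\qquad \theta_{c,a}=\Big\{(w_i)_{i\in c}\ \Big|\ w_i\in (V_a)_{(x,g^{|c|})},\ g\,w_i=e^{2\pi i a/(r|c|)}\,w_{\sigma(i)}\Big\}.$$ Then $S_t$ and $S_t^{Tate}$ extend to maps $K_{Tate}(X)\to K_{Tate}(X)[[t]]$ with $S_t(x+y)=S_t(x)S_t(y)$ and $S^{Tate}_t(x+y)=S^{Tate}_t(x)S^{Tate}_t(y)$. Define the Adams operations by $\sum_{m\ge1}\psi_m(x)t^m=t\,S_t'(x)/S_t(x)$, so that $S_t(x)=\exp\big(\sum_{m\ge 1}\psi_m(x)t^m/m\big)$ over $\mathbb Q$. For $d\geq 1$ let $\beta_d\colon K_{Tate}(X)\to K_{Tate}(X)$ be the additive map $\beta_d(F)=[\Pi_d^*F(q^{1/d})]^{\mathbb Z/d}$, where $\Pi_d\colon(x,g)\mapsto(x,g^d)$; for $F=\sum V_nq^{n/r}$ the coefficient of $q^{n/r}$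 in $\beta_d(F)$ is the subbundle of $\Pi_d^*V_{dn}$ on which $\xi$ acts as $e^{2\pi i n/r}$. Put $$T_m(F)=\sum_{ad=m}\tfrac1a\,\psi_a(\beta_d(F))\ \in\ \mathbb Q\otimes K_{Tate}(X).$$ Then for every $F\in K_{Tate}(X)$, in $(\mathbb Q\otimes K_{Tate}(X))[[t]]$, $$S_t^{Tate}(F)=\exp\Big(\sum_{m\ge1}T_m(F)\,t^m\Big).$$ Moreover, let $G$ be a finite group and $F\in K_{Tate}(\mathrm{pt}/\!\!/G)$. For commuting $g,h\in G$ let $F(g,h;\tau)$ be the formal $q$-series ($q=e^{2\pi i\tau}$) whose coefficients are the characters at $h$ of the coefficients of $F$ at the object $g$. Then the $T_m$ are the equivariant Hecke operators of generalized Moonshine: for $m\ge 1$, as formal series in rational powers of $q$, $$T_m(F)(g,h;\tau)=\frac1m\sum_{ad=m}\ \sum_{0\le b<d}F\Big(g^d,\;g^{-b}h^a;\;\frac{a\tau+b}{d}\Big),$$ where a term $c\,q^s$ of $F$ contributes $c\,e^{2\pi i sb/d}q^{sa/d}$. -/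

import Mathlib

open CategoryTheory Topology Filter TensorProduct

universe u v

noncomputable section

namespace OrbTate

/-! ### Topological groupoids -/

/-- The set of all arrows of a category. -/
structure Arr (X : Type u) [Category.{v} X] where
  src : X
  tgt : X
  hom : src ⟶ tgt

/-- The set of composable pairs of arrows of a category. -/
structure CompPair (X : Type u) [Category.{v} X] where
  a : X
  b : X
  c : X
  f : a ⟶ b
  g : b ⟶ c

/-- A (small) topological groupoid: a groupoid with a topology on its set of objects and a topology
on its set of arrows such that all structure maps are continuous.  The set of composable pairs
carries the subspace topology of the product of two copies of the space of arrows. -/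
class TopGpd (X : Type u) extends Groupoid.{v} X, TopologicalSpace X where
  arrTop : TopologicalSpace (Arr X)
  continuous_src : Continuous (fun f : Arr X => f.src)
  continuous_tgt : Continuous (fun f : Arr X => f.tgt)
  continuous_unit : Continuous (fun x : X => (⟨x, x, 𝟙 x⟩ : Arr X))
  continuous_inv : Continuous (fun f : Arr X => (⟨f.tgt, f.src, Groupoid.inv f.hom⟩ : Arr X))
  continuous_comp :
    Continuous[TopologicalSpace.induced
        (fun p : CompPair X => ((⟨p.a, p.b, p.f⟩ : Arr X), (⟨p.b, p.c, p.g⟩ : Arr X)))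
        inferInstance, inferInstance]
      (fun p : CompPair X => (⟨p.a, p.c, p.f ≫ p.g⟩ : Arr X))

attribute [instance] TopGpd.arrTop

lemma continuous_comp' {X : Type u} [TopGpd.{u, v} X] {T : Type*} [TopologicalSpace T]
    {a b c : T → X} (f : ∀ t, a t ⟶ b t) (g : ∀ t, b t ⟶ c t)
    (hf : Continuous fun t => (⟨a t, b t, f t⟩ : Arr X))
    (hg : Continuous fun t => (⟨b t, c t, g t⟩ : Arr X)) :
    Continuous fun t => (⟨a t, c t, f t ≫ g t⟩ : Arr X) := by
  let _ : TopologicalSpace (CompPair X) := TopologicalSpace.induced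
    (fun p : CompPair X => ((⟨p.a, p.b, p.f⟩ : Arr X), (⟨p.b, p.c, p.g⟩ : Arr X))) inferInstance
  have h2 : Continuous (fun t => (⟨a t, b t, c t, f t, g t⟩ : CompPair X)) :=
    continuous_induced_rng.2 (hf.prodMk hg)
  exact (TopGpd.continuous_comp (X := X)).comp h2

/-! ### The inertia groupoid -/

/-- Objects of the inertia groupoid `ΛX`: an object of `X` together with an automorphism. -/
structure Inertia (X : Type u) [Category.{v} X] where
  pt : X
  loop : pt ⟶ pt

namespace Inertia

variable {X : Type u} [TopGpd.{u, v} X]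

/-- Arrows `(x, g) ⟶ (y, h)` of `ΛX` are the arrows `f : x ⟶ y` of `X` with `f g = h f`. -/
@[ext]
structure Hom (a b : Inertia X) where
  arr : a.pt ⟶ b.pt
  comm : a.loop ≫ arr = arr ≫ b.loop

instance : Groupoid (Inertia X) where
  Hom := Hom
  id a := ⟨𝟙 _, by simp⟩
  comp f g := ⟨f.arr ≫ g.arr, by
    rw [← Category.assoc, f.comm, Category.assoc, g.comm, Category.assoc]⟩
  id_comp f := Hom.ext (Category.id_comp _)
  comp_id f := Hom.ext (Category.comp_id _)
  assoc f g h := Hom.ext (Category.assoc _ _ _)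
  inv f := ⟨Groupoid.inv f.arr, by
    have := f.comm
    rw [Groupoid.inv_eq_inv, IsIso.eq_inv_comp, ← Category.assoc, ← this]; simp⟩
  inv_comp f := Hom.ext (Groupoid.inv_comp _)
  comp_inv f := Hom.ext (Groupoid.comp_inv _)

@[simp] lemma id_arr (a : Inertia X) : Hom.arr (𝟙 a) = 𝟙 a.pt := rfl
@[simp] lemma comp_arr {a b c : Inertia X} (f : a ⟶ b) (g : b ⟶ c) :
    Hom.arr (f ≫ g) = Hom.arr f ≫ Hom.arr g := rfl

@[ext] lemma hom_ext {a b : Inertia X} {f g : a ⟶ b} (h : Hom.arr f = Hom.arr g) : f = g :=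
  Hom.ext h

/-- The automorphism belonging to an object of `ΛX`, as an arrow of `X`. -/
def loopArr (a : Inertia X) : Arr X := ⟨a.pt, a.pt, a.loop⟩

/-- The objects of `ΛX` form a subspace of the space of arrows of `X`. -/
instance : TopologicalSpace (Inertia X) := TopologicalSpace.induced loopArr inferInstance

/-- An arrow `f : (x, g) ⟶ (y, h)` of `ΛX` as the triple of arrows `(f, g, h)` of `X`. -/
def triple (F : Arr (Inertia X)) : Arr X × Arr X × Arr X :=
  (⟨F.src.pt, F.tgt.pt, Hom.arr F.hom⟩, loopArr F.src, loopArr F.tgt)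

lemma continuous_loopArr : Continuous (loopArr (X := X)) := continuous_induced_dom

/-- The arrows of `ΛX` form a subspace of the space of triples of arrows of `X`. -/
instance : TopologicalSpace (Arr (Inertia X)) := TopologicalSpace.induced triple inferInstance

lemma continuous_triple : Continuous (triple (X := X)) := continuous_induced_dom

instance : TopGpd (Inertia X) where
  arrTop := inferInstance
  continuous_src := continuous_induced_rng.2 (continuous_triple.snd.fst)
  continuous_tgt := continuous_induced_rng.2 (continuous_triple.snd.snd)
  continuous_unit := continuous_induced_rng.2 <|
    ((TopGpd.continuous_unit.comp (TopGpd.continuous_src.comp continuous_loopArr))).prodMk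
      (continuous_loopArr.prodMk continuous_loopArr)
  continuous_inv := continuous_induced_rng.2 <|
    (TopGpd.continuous_inv.comp continuous_triple.fst).prodMk
      (continuous_triple.snd.snd.prodMk continuous_triple.snd.fst)
  continuous_comp := by
    let _ : TopologicalSpace (CompPair (Inertia X)) := TopologicalSpace.induced
        (fun p : CompPair (Inertia X) =>
          ((⟨p.a, p.b, p.f⟩ : Arr (Inertia X)), (⟨p.b, p.c, p.g⟩ : Arr (Inertia X))))
        inferInstance
    have h : Continuous (fun p : CompPair (Inertia X) =>
          ((⟨p.a, p.b, p.f⟩ : Arr (Inertia X)), (⟨p.b, p.c, p.g⟩ : Arr (Inertia X)))) :=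
      continuous_induced_dom
    have h1 := continuous_triple.comp h.fst
    have h2 := continuous_triple.comp h.snd
    refine continuous_induced_rng.2 (Continuous.prodMk ?_ (Continuous.prodMk ?_ ?_))
    · exact continuous_comp' (fun p : CompPair (Inertia X) => Hom.arr p.f)
        (fun p => Hom.arr p.g) h1.fst h2.fst
    · exact h1.snd.fst
    · exact h2.snd.snd

/-- The center element `ξ` of `ΛX`: at the object `(x, g)` it is the arrow `g`. -/
def xi (X : Type u) [TopGpd.{u, v} X] : CatCenter (Inertia X) where
  app a := ⟨a.loop, rfl⟩
  naturality _ _ f := Hom.ext (Hom.comm f).symm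

@[simp] lemma xi_app_arr (a : Inertia X) : Hom.arr ((xi X).app a) = a.loop := rfl

lemma continuous_xi :
    Continuous (fun a : Inertia X => (⟨a, a, (xi X).app a⟩ : Arr (Inertia X))) :=
  continuous_induced_rng.2
    (continuous_loopArr.prodMk (continuous_loopArr.prodMk continuous_loopArr))

/-- The `k`-th power of an automorphism. -/
def loopPow {x : X} (g : x ⟶ x) : ℕ → (x ⟶ x)
  | 0 => 𝟙 x
  | k + 1 => loopPow g k ≫ g

lemma loopPow_comm {x y : X} {g : x ⟶ x} {h : y ⟶ y} {f : x ⟶ y} (H : g ≫ f = f ≫ h) (k : ℕ) :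
    loopPow g k ≫ f = f ≫ loopPow h k := by
  induction k with
  | zero => simp [loopPow]
  | succ k ih => rw [loopPow, loopPow, Category.assoc, H, ← Category.assoc, ih, Category.assoc]

/-- The `k`-th power map `Π_k : ΛX ⥤ ΛX`, which sends the object `(x, g)` to `(x, g ^ k)` and an
arrow `f` to `f`. -/
def powerMap (X : Type u) [TopGpd.{u, v} X] (k : ℕ) : Inertia X ⥤ Inertia X where
  obj a := ⟨a.pt, loopPow a.loop k⟩
  map {a b} f := ⟨Hom.arr (a := a) (b := b) f, loopPow_comm (Hom.comm (a := a) (b := b) f) k⟩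

lemma continuous_loopPow (k : ℕ) :
    Continuous fun a : Inertia X => (⟨a.pt, a.pt, loopPow a.loop k⟩ : Arr X) := by
  induction k with
  | zero => exact TopGpd.continuous_unit.comp (TopGpd.continuous_src.comp continuous_loopArr)
  | succ k ih => exact continuous_comp' _ _ ih continuous_loopArr

end Inertia

/-- A functor between topological groupoids is continuous if it is so on objects and arrows. -/
structure ContFunctor {X : Type*} {Y : Type*} [TopGpd X] [TopGpd Y] (Φ : X ⥤ Y) : Prop where
  obj : Continuous Φ.obj
  map : Continuous (fun f : Arr X => (⟨Φ.obj f.src, Φ.obj f.tgt, Φ.map f.hom⟩ : Arr Y))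

lemma contFunctor_powerMap (X : Type u) [TopGpd.{u, v} X] (k : ℕ) :
    ContFunctor (Inertia.powerMap X k) where
  obj := continuous_induced_rng.2 (Inertia.continuous_loopPow k)
  map := continuous_induced_rng.2 <|
    (Inertia.continuous_triple.fst).prodMk
      (((Inertia.continuous_loopPow k).comp TopGpd.continuous_src).prodMk
        ((Inertia.continuous_loopPow k).comp TopGpd.continuous_tgt))

/-! ### Vector bundles -/

/-- A family of complex vector spaces over a space `B`, together with the information which (set
theoretic) sections are continuous at which points: `contAt b` is the set of those sections that are
continuous at `b`. -/
structure Fam (B : Type u) where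
  fib : B → Type
  [acg : ∀ b, AddCommGroup (fib b)]
  [mod : ∀ b, Module ℂ (fib b)]
  contAt : B → Set (∀ b, fib b)

attribute [instance] Fam.acg Fam.mod

namespace Fam

variable {B : Type u} [TopologicalSpace B]

/-- The sections `e i` form a frame at `b`: their values at `b` are a basis of the fibre, and
a section is continuous at `b` iff near `b` it is a linear combination of the `e i` with coefficients
that are continuous at `b`. -/
def IsFrameAt (E : Fam B) {ι : Type} [Fintype ι] (e : ι → ∀ b, E.fib b) (b : B) : Prop :=
  (∃ β : Module.Basis ι ℂ (E.fib b), ∀ i, β i = e i b) ∧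
  ∀ s : ∀ b, E.fib b, s ∈ E.contAt b ↔ ∃ a : ι → B → ℂ,
    (∀ i, ContinuousAt (a i) b) ∧ ∀ᶠ y in 𝓝 b, s y = ∑ i, a i y • e i y

/-- Local triviality: every point has a neighbourhood over which there is a (finite) frame. -/
def LocallyTrivial (E : Fam B) : Prop :=
  ∀ b₀ : B, ∃ (ι : Type) (_ : Fintype ι) (e : ι → ∀ b, E.fib b), ∀ᶠ b in 𝓝 b₀, E.IsFrameAt e b

/-- Continuity at `t₀` of a section `s` of `E` along a map `φ : T → B`. -/
def ContAlong (E : Fam B) {T : Type*} [TopologicalSpace T] (φ : T → B) (s : ∀ t, E.fib (φ t))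
    (t₀ : T) : Prop :=
  ∃ (ι : Type) (_ : Fintype ι) (a : ι → T → ℂ) (u : ι → ∀ b, E.fib b),
    (∀ i, ContinuousAt (a i) t₀) ∧ (∀ i, u i ∈ E.contAt (φ t₀)) ∧
    ∀ᶠ t in 𝓝 t₀, s t = ∑ i, a i t • u i (φ t)

variable {T : Type*} [TopologicalSpace T]

lemma ContAlong.of_sum {E : Fam B} {φ : T → B} {s : ∀ t, E.fib (φ t)} {t₀ : T} {κ : Type}
    [Fintype κ] (c : κ → T → ℂ) (p : κ → ∀ t, E.fib (φ t)) (hc : ∀ k, ContinuousAt (c k) t₀)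
    (hp : ∀ k, E.ContAlong φ (p k) t₀) (hs : ∀ᶠ t in 𝓝 t₀, s t = ∑ k, c k t • p k t) :
    E.ContAlong φ s t₀ := by
  choose ι hι a u ha hu hpu using hp
  refine ⟨Σ k, ι k, inferInstance, fun x t => c x.1 t * a x.1 x.2 t, fun x => u x.1 x.2,
    fun x => (hc _).mul (ha _ _), fun x => hu _ _, ?_⟩
  filter_upwards [hs, eventually_all.2 hpu] with t h1 h2
  rw [h1, Fintype.sum_sigma]
  refine Finset.sum_congr rfl fun k _ => ?_
  rw [h2, Finset.smul_sum]
  simp [smul_smul]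

lemma ContAlong.of_mem {E : Fam B} {φ : T → B} {t₀ : T} {u : ∀ b, E.fib b}
    (hu : u ∈ E.contAt (φ t₀)) : E.ContAlong φ (fun t => u (φ t)) t₀ :=
  ⟨Unit, inferInstance, fun _ _ => 1, fun _ => u, fun _ => continuousAt_const, fun _ => hu,
    by simp⟩

lemma ContAlong.congr {E : Fam B} {φ : T → B} {s s' : ∀ t, E.fib (φ t)} {t₀ : T}
    (h : E.ContAlong φ s t₀) (hs : ∀ᶠ t in 𝓝 t₀, s' t = s t) : E.ContAlong φ s' t₀ := by
  obtain ⟨ι, i1, a, u, ha, hu, h⟩ := h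
  refine ⟨ι, i1, a, u, ha, hu, ?_⟩
  filter_upwards [h, hs] with t h1 h2
  rw [h2, h1]

lemma IsFrameAt.mem {E : Fam B} {ι : Type} [Fintype ι] {e : ι → ∀ b, E.fib b} {b : B}
    (h : E.IsFrameAt e b) (i : ι) : e i ∈ E.contAt b := by
  classical
  refine (h.2 _).2 ⟨fun j _ => if j = i then 1 else 0, fun j => continuousAt_const, ?_⟩
  simp

lemma IsFrameAt.along {E : Fam B} {ι : Type} [Fintype ι] {e : ι → ∀ b, E.fib b}
    {φ : T → B} {t₀ : T} (h : E.IsFrameAt e (φ t₀)) (hφ : ContinuousAt φ t₀)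
    {s : ∀ t, E.fib (φ t)} (hs : E.ContAlong φ s t₀) : ∃ a : ι → T → ℂ,
    (∀ i, ContinuousAt (a i) t₀) ∧ ∀ᶠ t in 𝓝 t₀, s t = ∑ i, a i t • e i (φ t) := by
  obtain ⟨κ, _, c, u, hc, hu, hs⟩ := hs
  choose a ha hua using fun k => (h.2 (u k)).1 (hu k)
  refine ⟨fun i t => ∑ k, c k t * a k i (φ t), fun i => ?_, ?_⟩
  · exact tendsto_finsetSum _ fun k _ => (hc k).mul ((ha k i).comp hφ)
  · filter_upwards [hs, hφ.eventually (eventually_all.2 hua)] with t h1 h2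
    rw [h1]
    simp_rw [h2, Finset.smul_sum, Finset.sum_smul, smul_smul]
    rw [Finset.sum_comm]

lemma LocallyTrivial.mem {E : Fam B} (h : E.LocallyTrivial) {b : B} {s : ∀ b, E.fib b}
    (hs : E.ContAlong (fun x => x) s b) : s ∈ E.contAt b := by
  obtain ⟨ι, _, e, he⟩ := h b
  have he := he.self_of_nhds
  exact (he.2 s).2 (IsFrameAt.along (φ := fun x => x) he continuousAt_id hs)

lemma LocallyTrivial.mem_congr {E : Fam B} (h : E.LocallyTrivial) {b : B} {s s' : ∀ b, E.fib b}
    (hs : s ∈ E.contAt b) (hss : ∀ᶠ x in 𝓝 b, s' x = s x) : s' ∈ E.contAt b :=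
  h.mem ((ContAlong.of_mem (φ := fun x => x) hs).congr hss)

lemma LocallyTrivial.zero_mem {E : Fam B} (h : E.LocallyTrivial) (b : B) :
    (fun _ => 0) ∈ E.contAt b :=
  h.mem ⟨Empty, inferInstance, fun _ _ => 0, fun _ _ => 0, fun i => i.elim, fun i => i.elim,
    by simp⟩

lemma LocallyTrivial.sum_mem {E : Fam B} (h : E.LocallyTrivial) {b : B} {κ : Type} [Fintype κ]
    {s : κ → ∀ b, E.fib b} (hs : ∀ k, s k ∈ E.contAt b) : (fun x => ∑ k, s k x) ∈ E.contAt b :=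
  h.mem ⟨κ, inferInstance, fun _ _ => 1, s, fun _ => continuousAt_const, hs, by simp⟩

lemma LocallyTrivial.smul_mem {E : Fam B} (h : E.LocallyTrivial) {b : B} {a : B → ℂ}
    (ha : ContinuousAt a b) {s : ∀ b, E.fib b} (hs : s ∈ E.contAt b) :
    (fun x => a x • s x) ∈ E.contAt b :=
  h.mem ⟨Unit, inferInstance, fun _ => a, fun _ => s, fun _ => ha, fun _ => hs, by simp⟩

/-- The fibrewise tensor product: its sections that are continuous at `b` are near `b` the finite
sums of sections `f ⊗ g` with `f` and `g` continuous at `b`. -/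
abbrev tensor (E F : Fam B) : Fam B where
  fib b := E.fib b ⊗[ℂ] F.fib b
  contAt b := {s | ∃ (κ : Type) (_ : Fintype κ) (f : κ → ∀ b, E.fib b) (g : κ → ∀ b, F.fib b),
    (∀ k, f k ∈ E.contAt b) ∧ (∀ k, g k ∈ F.contAt b) ∧
    ∀ᶠ y in 𝓝 b, s y = ∑ k, f k y ⊗ₜ[ℂ] g k y}

lemma tmul_mem {E F : Fam B} {b : B} {f : ∀ b, E.fib b} {g : ∀ b, F.fib b}
    (hf : f ∈ E.contAt b) (hg : g ∈ F.contAt b) :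
    (fun x => f x ⊗ₜ[ℂ] g x) ∈ (E.tensor F).contAt b :=
  ⟨Unit, inferInstance, fun _ => f, fun _ => g, fun _ => hf, fun _ => hg, by simp⟩

lemma ContAlong.tmul {E F : Fam B} {φ : T → B} {t₀ : T} {p : ∀ t, E.fib (φ t)}
    {q : ∀ t, F.fib (φ t)} (hp : E.ContAlong φ p t₀) (hq : F.ContAlong φ q t₀) :
    (E.tensor F).ContAlong φ (fun t => p t ⊗ₜ[ℂ] q t) t₀ := by
  obtain ⟨ι, _, a, u, ha, hu, hp⟩ := hp
  obtain ⟨κ, _, c, v, hc, hv, hq⟩ := hq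
  refine ⟨ι × κ, inferInstance, fun x t => a x.1 t * c x.2 t,
    fun x y => u x.1 y ⊗ₜ[ℂ] v x.2 y, fun x => (ha _).mul (hc _),
    fun x => tmul_mem (hu _) (hv _), ?_⟩
  filter_upwards [hp, hq] with t h1 h2
  rw [h1, h2, TensorProduct.sum_tmul, Fintype.sum_prod_type]
  refine Finset.sum_congr rfl fun i _ => ?_
  rw [TensorProduct.tmul_sum]
  refine Finset.sum_congr rfl fun j _ => ?_
  exact (TensorProduct.smul_tmul_smul _ _ _ _)

lemma IsFrameAt.tensor {E F : Fam B} {ι κ : Type} [Fintype ι] [Fintype κ] {e : ι → ∀ b, E.fib b}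
    {e' : κ → ∀ b, F.fib b} {b : B} (h : E.IsFrameAt e b) (h' : F.IsFrameAt e' b)
    (hE : E.LocallyTrivial) :
    (E.tensor F).IsFrameAt (fun (x : ι × κ) y => e x.1 y ⊗ₜ[ℂ] e' x.2 y) b := by
  constructor
  · obtain ⟨β, hβ⟩ := h.1
    obtain ⟨β', hβ'⟩ := h'.1
    exact ⟨β.tensorProduct β', fun x => by
      rw [Module.Basis.tensorProduct_apply', hβ, hβ']⟩
  · intro s
    constructor
    · rintro ⟨κ', _, f, g, hf, hg, hs⟩
      choose a ha hfa using fun k => (h.2 (f k)).1 (hf k)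
      choose c hc hgc using fun k => (h'.2 (g k)).1 (hg k)
      refine ⟨fun x y => ∑ k, a k x.1 y * c k x.2 y, fun x =>
        tendsto_finsetSum _ fun k _ => (ha k x.1).mul (hc k x.2), ?_⟩
      filter_upwards [hs, eventually_all.2 hfa, eventually_all.2 hgc] with y h1 h2 h3
      rw [h1]
      simp_rw [h2, h3, TensorProduct.sum_tmul, TensorProduct.tmul_sum, Finset.sum_smul]
      rw [Fintype.sum_prod_type, Finset.sum_comm]
      refine Finset.sum_congr rfl fun i _ => ?_
      rw [Finset.sum_comm]
      refine Finset.sum_congr rfl fun j _ => Finset.sum_congr rfl fun k _ => ?_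
      exact (TensorProduct.smul_tmul_smul _ _ _ _)
    · rintro ⟨a, ha, hs⟩
      refine ⟨ι × κ, inferInstance, fun x y => a x y • e x.1 y, fun x => e' x.2,
        fun x => hE.smul_mem (ha x) (h.mem _), fun x => h'.mem _, ?_⟩
      filter_upwards [hs] with y h1
      rw [h1]
      simp only [TensorProduct.smul_tmul']

lemma LocallyTrivial.tensor {E F : Fam B} (hE : E.LocallyTrivial) (hF : F.LocallyTrivial) :
    (E.tensor F).LocallyTrivial := by
  intro b
  obtain ⟨ι, _, e, he⟩ := hE b
  obtain ⟨κ, _, e', he'⟩ := hF b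
  exact ⟨ι × κ, inferInstance, _, by
    filter_upwards [he, he'] with y h h' using h.tensor h' hE⟩

/-- The fibrewise tensor product of a finite collection of families. -/
abbrev piTensor {J : Type} (E : J → Fam B) : Fam B where
  fib b := PiTensorProduct ℂ fun j => (E j).fib b
  contAt b := {s | ∃ (κ : Type) (_ : Fintype κ) (c : κ → B → ℂ) (f : κ → ∀ j b, (E j).fib b),
    (∀ k, ContinuousAt (c k) b) ∧ (∀ k j, f k j ∈ (E j).contAt b) ∧
    ∀ᶠ y in 𝓝 b, s y = ∑ k, c k y • PiTensorProduct.tprod ℂ fun j => f k j y}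

lemma tprod_mem {J : Type} {E : J → Fam B} {b : B} {f : ∀ j b, (E j).fib b}
    (hf : ∀ j, f j ∈ (E j).contAt b) :
    (fun y => PiTensorProduct.tprod ℂ fun j => f j y) ∈ (piTensor E).contAt b :=
  ⟨Unit, inferInstance, fun _ _ => 1, fun _ => f, fun _ => continuousAt_const, fun _ => hf, by simp⟩

lemma ContAlong.tprod {J : Type} [Fintype J] {E : J → Fam B} {φ : T → B} {t₀ : T}
    {p : ∀ j t, (E j).fib (φ t)} (hp : ∀ j, (E j).ContAlong φ (p j) t₀) :
    (piTensor E).ContAlong φ (fun t => PiTensorProduct.tprod ℂ fun j => p j t) t₀ := by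
  classical
  choose ι hι a u ha hu hp using hp
  refine ⟨∀ j, ι j, inferInstance, fun x t => ∏ j, a j (x j) t,
    fun x y => PiTensorProduct.tprod ℂ fun j => u j (x j) y,
    fun x => tendsto_finsetProd _ fun j _ => ha j (x j),
    fun x => tprod_mem fun j => hu j (x j), ?_⟩
  filter_upwards [eventually_all.2 hp] with t h1
  simp_rw [h1]
  rw [MultilinearMap.map_sum]
  refine Finset.sum_congr rfl fun x _ => ?_
  exact MultilinearMap.map_smul_univ _ _ _

lemma IsFrameAt.piTensor {J : Type} [Fintype J] [DecidableEq J] {E : J → Fam B} {ι : J → Type}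
    [∀ j, Fintype (ι j)] {e : ∀ j, ι j → ∀ b, (E j).fib b} {b : B}
    (h : ∀ j, (E j).IsFrameAt (e j) b) :
    (Fam.piTensor E).IsFrameAt
      (fun (x : ∀ j, ι j) y => PiTensorProduct.tprod ℂ fun j => e j (x j) y) b := by
  constructor
  · choose β hβ using fun j => (h j).1
    exact ⟨Basis.piTensorProduct β, fun x => by
      rw [Basis.piTensorProduct_apply]
      simp only [hβ]⟩
  · intro s
    constructor
    · rintro ⟨κ', _, c, f, hc, hf, hs⟩
      choose a ha hfa using fun k j => ((h j).2 (f k j)).1 (hf k j)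
      refine ⟨fun x y => ∑ k, c k y * ∏ j, a k j (x j) y, fun x =>
        tendsto_finsetSum _ fun k _ => (hc k).mul (tendsto_finsetProd _ fun j _ => ha k j (x j)), ?_⟩
      filter_upwards [hs, eventually_all.2 fun k => eventually_all.2 (hfa k)] with y h1 h2
      rw [h1]
      simp_rw [h2, Finset.sum_smul]
      rw [Finset.sum_comm]
      refine Finset.sum_congr rfl fun k _ => ?_
      rw [MultilinearMap.map_sum, Finset.smul_sum]
      refine Finset.sum_congr rfl fun x _ => ?_
      rw [MultilinearMap.map_smul_univ, smul_smul]
    · rintro ⟨a, ha, hs⟩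
      exact ⟨∀ j, ι j, inferInstance, a, fun x j => e j (x j), ha, fun x j => (h j).mem _, hs⟩

lemma LocallyTrivial.piTensor {J : Type} [Fintype J] {E : J → Fam B}
    (hE : ∀ j, (E j).LocallyTrivial) : (Fam.piTensor E).LocallyTrivial := by
  classical
  intro b
  choose ι hι e he using fun j => hE j b
  exact ⟨∀ j, ι j, inferInstance, _, by
    filter_upwards [eventually_all.2 he] with y h using IsFrameAt.piTensor h⟩

/-- The direct sum of two families. -/
abbrev prod (E F : Fam B) : Fam B where
  fib b := E.fib b × F.fib b
  contAt b := {s | (fun x => (s x).1) ∈ E.contAt b ∧ (fun x => (s x).2) ∈ F.contAt b}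

lemma LocallyTrivial.prod {E F : Fam B} (hE : E.LocallyTrivial) (hF : F.LocallyTrivial) :
    (E.prod F).LocallyTrivial := by
  intro b
  obtain ⟨ι, _, e, he⟩ := hE b
  obtain ⟨κ, _, e', he'⟩ := hF b
  refine ⟨ι ⊕ κ, inferInstance,
    fun x y => Sum.elim (fun i => (e i y, 0)) (fun k => (0, e' k y)) x, ?_⟩
  filter_upwards [he, he'] with y h h'
  refine ⟨?_, fun s => ?_⟩
  · obtain ⟨β, hβ⟩ := h.1
    obtain ⟨β', hβ'⟩ := h'.1
    refine ⟨β.prod β', fun x => ?_⟩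
    rw [Module.Basis.prod_apply]
    rcases x with i | k
    · simp [hβ]
    · simp [hβ']
  · constructor
    · rintro ⟨h1, h2⟩
      obtain ⟨a, ha, hs⟩ := (h.2 _).1 h1
      obtain ⟨a', ha', hs'⟩ := (h'.2 _).1 h2
      refine ⟨Sum.elim a a', fun x => by rcases x with i | k; exacts [ha i, ha' k], ?_⟩
      filter_upwards [hs, hs'] with z h3 h4
      refine Prod.ext ?_ ?_
      · rw [h3]; simp [Prod.fst_sum]
      · rw [h4]; simp [Prod.snd_sum]
    · rintro ⟨a, ha, hs⟩
      constructor
      · refine (h.2 _).2 ⟨fun i => a (Sum.inl i), fun i => ha _, ?_⟩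
        filter_upwards [hs] with z h3
        rw [h3]; simp [Prod.fst_sum]
      · refine (h'.2 _).2 ⟨fun i => a (Sum.inr i), fun i => ha _, ?_⟩
        filter_upwards [hs] with z h3
        rw [h3]; simp [Prod.snd_sum]

lemma ContAlong.prodMk {E F : Fam B} (hE : E.LocallyTrivial) (hF : F.LocallyTrivial)
    {φ : T → B} {t₀ : T} {p : ∀ t, E.fib (φ t)}
    {q : ∀ t, F.fib (φ t)} (hp : E.ContAlong φ p t₀) (hq : F.ContAlong φ q t₀) :
    (E.prod F).ContAlong φ (fun t => (p t, q t)) t₀ := by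
  obtain ⟨ι, _, a, u, ha, hu, hp⟩ := hp
  obtain ⟨κ, _, c, v, hc, hv, hq⟩ := hq
  refine ⟨ι ⊕ κ, inferInstance, Sum.elim a c,
    fun x y => Sum.elim (fun i => (u i y, 0)) (fun k => (0, v k y)) x,
    fun x => by rcases x with i | k; exacts [ha i, hc k],
    fun x => by
      rcases x with i | k
      exacts [⟨hu i, hF.zero_mem _⟩, ⟨hE.zero_mem _, hv k⟩], ?_⟩
  filter_upwards [hp, hq] with t h1 h2
  refine Prod.ext ?_ ?_
  · rw [h1]; simp [Prod.fst_sum]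
  · rw [h2]; simp [Prod.snd_sum]

/-- The direct sum of a finite collection of families. -/
abbrev pi {J : Type} (E : J → Fam B) : Fam B where
  fib b := ∀ j, (E j).fib b
  contAt b := {s | ∀ j, (fun x => s x j) ∈ (E j).contAt b}

lemma single_mem {J : Type} [DecidableEq J] {E : J → Fam B} (hE : ∀ j, (E j).LocallyTrivial)
    {b : B} {j : J} {s : ∀ b, (E j).fib b} (hs : s ∈ (E j).contAt b) :
    (fun x => (Pi.single j (s x) : ∀ j, (E j).fib x)) ∈ (pi E).contAt b := by
  intro i
  by_cases h : i = j
  · subst h; simpa using hs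
  · simpa [h] using (hE i).zero_mem b

lemma LocallyTrivial.pi {J : Type} [Fintype J] {E : J → Fam B}
    (hE : ∀ j, (E j).LocallyTrivial) : (Fam.pi E).LocallyTrivial := by
  classical
  intro b
  choose ι hι e he using fun j => hE j b
  refine ⟨Σ j, ι j, inferInstance, fun x y => Pi.single x.1 (e x.1 x.2 y), ?_⟩
  filter_upwards [eventually_all.2 he] with y h
  refine ⟨?_, fun s => ?_⟩
  · choose β hβ using fun j => (h j).1
    exact ⟨Pi.basis β, fun x => by simp [Pi.basis_apply, hβ]⟩
  · constructor
    · intro hs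
      choose a ha hsa using fun j => ((h j).2 _).1 (hs j)
      refine ⟨fun x => a x.1 x.2, fun x => ha _ _, ?_⟩
      filter_upwards [eventually_all.2 hsa] with z hz
      funext j
      rw [hz, Fintype.sum_sigma, Finset.sum_apply, Finset.sum_eq_single j]
      · simp [Finset.sum_apply]
      · intro j' _ hj
        simp [Finset.sum_apply, Pi.single_eq_of_ne' hj]
      · simp
    · rintro ⟨a, ha, hs⟩ j
      refine ((h j).2 _).2 ⟨fun i => a ⟨j, i⟩, fun i => ha _, ?_⟩
      filter_upwards [hs] with z hz
      rw [hz, Fintype.sum_sigma, Finset.sum_apply, Finset.sum_eq_single j]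
      · simp [Finset.sum_apply]
      · intro j' _ hj
        simp [Finset.sum_apply, Pi.single_eq_of_ne' hj]
      · simp

lemma ContAlong.pi {J : Type} [Fintype J] {E : J → Fam B} (hE : ∀ j, (E j).LocallyTrivial)
    {φ : T → B} {t₀ : T} {p : ∀ t, ∀ j, (E j).fib (φ t)}
    (hp : ∀ j, (E j).ContAlong φ (fun t => p t j) t₀) : (Fam.pi E).ContAlong φ p t₀ := by
  classical
  refine ContAlong.of_sum (κ := J) (fun _ _ => 1) (fun j t => Pi.single j (p t j))
    (fun _ => continuousAt_const) (fun j => ?_) (by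
      refine Eventually.of_forall fun t => ?_
      simp [Finset.univ_sum_single])
  obtain ⟨ι, _, a, u, ha, hu, h⟩ := hp j
  refine ⟨ι, inferInstance, a, fun i y => Pi.single j (u i y), ha,
    fun i => single_mem hE (hu i), ?_⟩
  filter_upwards [h] with t ht
  rw [ht]
  funext j'
  by_cases hj : j' = j
  · subst hj; simp [Finset.sum_apply]
  · simp [Finset.sum_apply, hj]

/-- The pullback of a family along a map. -/
abbrev pullback {C : Type*} (E : Fam B) [TopologicalSpace C] (φ : C → B) : Fam C where
  fib c := E.fib (φ c)
  contAt c := {s | E.ContAlong φ s c}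

lemma LocallyTrivial.pullback {C : Type*} [TopologicalSpace C] {E : Fam B}
    (hE : E.LocallyTrivial) {φ : C → B} (hφ : Continuous φ) : (E.pullback φ).LocallyTrivial := by
  intro c
  obtain ⟨ι, _, e, he⟩ := hE (φ c)
  refine ⟨ι, inferInstance, fun i y => e i (φ y), ?_⟩
  filter_upwards [hφ.continuousAt.eventually he] with y h
  refine ⟨h.1, fun s => ⟨fun hs => h.along hφ.continuousAt hs, ?_⟩⟩
  rintro ⟨a, ha, hs⟩
  exact ⟨ι, inferInstance, a, e, ha, fun i => h.mem i, hs⟩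

lemma ContAlong.pullback {C : Type*} [TopologicalSpace C] {E : Fam B}
    {φ : C → B} {ψ : T → C} {t₀ : T} {s : ∀ t, E.fib (φ (ψ t))}
    (h : E.ContAlong (fun t => φ (ψ t)) s t₀) : (E.pullback φ).ContAlong ψ s t₀ := by
  obtain ⟨ι, _, a, u, ha, hu, h⟩ := h
  exact ⟨ι, inferInstance, a, fun i y => u i (φ y), ha, fun i => ContAlong.of_mem (hu i), h⟩

lemma ContAlong.comp {C : Type*} [TopologicalSpace C] {E : Fam B} {φ : C → B} {ψ : T → C} {t₀ : T}
    (hψ : ContinuousAt ψ t₀) {s : ∀ c, E.fib (φ c)} (h : E.ContAlong φ s (ψ t₀)) :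
    E.ContAlong (fun t => φ (ψ t)) (fun t => s (ψ t)) t₀ := by
  obtain ⟨ι, _, a, u, ha, hu, h⟩ := h
  exact ⟨ι, inferInstance, fun i t => a i (ψ t), u, fun i => (ha i).comp hψ, hu, hψ.eventually h⟩

/-- A family of subspaces of a family. -/
abbrev sub (E : Fam B) (F : ∀ b, Submodule ℂ (E.fib b)) : Fam B where
  fib b := F b
  contAt b := {s | (fun x => (s x : E.fib x)) ∈ E.contAt b}

lemma frame_of_basis {E : Fam B} (hE : E.LocallyTrivial) {ι : Type} [Fintype ι]
    {e : ι → ∀ b, E.fib b} {b₀ : B}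
    (he : ∀ᶠ b in 𝓝 b₀, E.IsFrameAt e b) {κ : Type} [Fintype κ] (u : κ → ∀ b, E.fib b)
    (hu : ∀ᶠ b in 𝓝 b₀, ∀ k, u k ∈ E.contAt b)
    (hβ : ∃ β : Module.Basis κ ℂ (E.fib b₀), ∀ k, β k = u k b₀) :
    ∀ᶠ b in 𝓝 b₀, E.IsFrameAt u b := by
  classical
  obtain ⟨β, hβ⟩ := hβ
  obtain ⟨γ, hγ⟩ := he.self_of_nhds.1
  let σ : κ ≃ ι := β.indexEquiv γ
  have hbas : ∀ b, ∃ r : κ → κ → ℂ, E.IsFrameAt e b →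
      ((∀ k, u k b = ∑ l, r k l • e (σ l) b) ∧
        ∀ r' : κ → ℂ, ∀ k, u k b = ∑ l, r' l • e (σ l) b → r' = r k) := by
    intro b
    by_cases h : E.IsFrameAt e b
    · obtain ⟨δ, hδ⟩ := h.1
      have hδ' : ∀ l, (δ.reindex σ.symm) l = e (σ l) b := by simp [hδ]
      refine ⟨fun k l => (δ.reindex σ.symm).repr (u k b) l, fun _ => ⟨fun k => ?_, ?_⟩⟩
      · simp_rw [← hδ']
        exact ((δ.reindex σ.symm).sum_repr _).symm
      · intro r' k hr
        funext l
        simp_rw [← hδ'] at hr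
        change r' l = (δ.reindex σ.symm).repr (u k b) l
        rw [hr, Module.Basis.repr_sum_self]
    · exact ⟨0, fun h' => absurd h' h⟩
  choose A hA using hbas
  let M : B → Matrix κ κ ℂ := fun b => Matrix.of (A b)
  have hMc : ∀ᶠ b in 𝓝 b₀, ContinuousAt M b := by
    filter_upwards [he.eventually_nhds, hu] with b h1 h2
    refine continuousAt_pi.2 fun k => continuousAt_pi.2 fun l => ?_
    obtain ⟨a, ha, hs⟩ := (h1.self_of_nhds.2 _).1 (h2 k)
    refine (ha (σ l)).congr ?_
    filter_upwards [h1, hs] with y h3 h4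
    have := (hA y h3).2 (fun l => a (σ l) y) k (by
      rw [h4]; exact (Equiv.sum_comp σ fun i => a i y • e i y).symm)
    exact congrFun this l
  have hdet : ∀ᶠ b in 𝓝 b₀, ContinuousAt (fun b => (M b).det) b := by
    filter_upwards [hMc] with b h
    exact (Continuous.matrix_det continuous_id).continuousAt.comp h
  have hdet0 : (M b₀).det ≠ 0 := by
    have hγ' : ∀ l, (γ.reindex σ.symm) l = e (σ l) b₀ := by simp [hγ]
    have h1 : ((γ.reindex σ.symm).toMatrix β).transpose = M b₀ := by
      ext k l
      have := (hA b₀ he.self_of_nhds).2 (fun l => (γ.reindex σ.symm).repr (u k b₀) l) k (by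
        simp_rw [← hγ']
        exact ((γ.reindex σ.symm).sum_repr _).symm)
      rw [Matrix.transpose_apply, Module.Basis.toMatrix_apply, hβ]
      exact congrFun this l
    rw [← h1, Matrix.det_transpose]
    exact ((Matrix.isUnit_iff_isUnit_det _).1
      (IsUnit.of_mul_eq_one _ (Module.Basis.toMatrix_mul_toMatrix_flip _ _))).ne_zero
  have hdet1 : ∀ᶠ b in 𝓝 b₀, (M b).det ≠ 0 := hdet.self_of_nhds.eventually_ne hdet0
  filter_upwards [he.eventually_nhds, hu, hMc, hdet, hdet1.eventually_nhds] with b h1 h2 h3 h4 h5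
  have key : ∀ y, E.IsFrameAt e y → (M y).det ≠ 0 → ∀ l, e (σ l) y =
      ∑ k, ((M y).det⁻¹ * (M y).adjugate l k) • u k y := by
    intro y hy hd l
    simp_rw [(hA y hy).1, Finset.smul_sum, smul_smul]
    rw [Finset.sum_comm]
    simp_rw [← Finset.sum_smul]
    have h6 : ∀ j, ∑ k, (M y).det⁻¹ * (M y).adjugate l k * A y k j = if l = j then 1 else 0 := by
      intro j
      have h7 := congrFun (congrFun (Matrix.adjugate_mul (M y)) l) j
      rw [Matrix.mul_apply] at h7
      simp_rw [mul_assoc, ← Finset.mul_sum]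
      have h8 : ∑ k, (M y).adjugate l k * A y k j = ((M y).det • (1 : Matrix κ κ ℂ)) l j := h7
      rw [h8, Matrix.smul_apply, Matrix.one_apply, smul_eq_mul, ← mul_assoc, inv_mul_cancel₀ hd,
        one_mul]
    simp_rw [h6]
    simp
  refine ⟨?_, fun s => ⟨fun hs => ?_, ?_⟩⟩
  · obtain ⟨δ, hδ⟩ := h1.self_of_nhds.1
    have hsp : ⊤ ≤ Submodule.span ℂ (Set.range fun k => u k b) := by
      rw [← δ.span_eq, Submodule.span_le]
      rintro _ ⟨i, rfl⟩
      have := key b h1.self_of_nhds h5.self_of_nhds (σ.symm i)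
      rw [Equiv.apply_symm_apply] at this
      rw [SetLike.mem_coe, hδ, this]
      exact Submodule.sum_mem _ fun k _ => Submodule.smul_mem _ _ (Submodule.subset_span ⟨k, rfl⟩)
    have hc : Fintype.card κ = Module.finrank ℂ (E.fib b) := by
      rw [Module.finrank_eq_card_basis δ, Fintype.card_congr σ]
    exact ⟨basisOfTopLeSpanOfCardEqFinrank _ hsp hc, fun k => by
      rw [coe_basisOfTopLeSpanOfCardEqFinrank]⟩
  · obtain ⟨a, ha, hs⟩ := (h1.self_of_nhds.2 _).1 hs
    refine ⟨fun k y => ∑ l, a (σ l) y * ((M y).det⁻¹ * (M y).adjugate l k), fun k => ?_, ?_⟩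
    · refine tendsto_finsetSum _ fun l _ => (ha _).mul ((h4.inv₀ h5.self_of_nhds).mul ?_)
      have : ContinuousAt (fun y => (M y).adjugate) b :=
        (Continuous.matrix_adjugate continuous_id).continuousAt.comp h3
      exact continuousAt_pi.1 (continuousAt_pi.1 this l) k
    · filter_upwards [hs, h1, h5] with y h6 h7 h8
      rw [h6, ← Equiv.sum_comp σ]
      simp_rw [key y h7 h8, Finset.smul_sum, Finset.sum_smul, smul_smul]
      rw [Finset.sum_comm]
  · rintro ⟨a, ha, hs⟩
    exact hE.mem ⟨κ, inferInstance, a, u, ha, h2, hs⟩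

/-- A continuous family of subspaces that is the image of a continuous family of projections is
locally trivial. -/
lemma LocallyTrivial.sub {E : Fam B} (hE : E.LocallyTrivial) {F : ∀ b, Submodule ℂ (E.fib b)}
    (p : ∀ b, E.fib b →ₗ[ℂ] E.fib b)
    (hp : ∀ b, ∀ s ∈ E.contAt b, (fun x => p x (s x)) ∈ E.contAt b)
    (hF : ∀ b v, p b v ∈ F b) (hpF : ∀ b, ∀ v ∈ F b, p b v = v) : (E.sub F).LocallyTrivial := by
  classical
  intro b₀
  obtain ⟨ι, _, e, he⟩ := hE b₀
  obtain ⟨γ, hγ⟩ := he.self_of_nhds.1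
  have : FiniteDimensional ℂ (E.fib b₀) := Module.Finite.of_basis γ
  have hcompl : IsCompl (F b₀) (LinearMap.ker (p b₀)) := by
    constructor
    · rw [Submodule.disjoint_def]
      intro v hv hk
      rw [← hpF b₀ v hv]; exact hk
    · rw [codisjoint_iff, eq_top_iff]
      intro v _
      refine Submodule.mem_sup.2 ⟨p b₀ v, hF _ _, v - p b₀ v, ?_, by simp⟩
      rw [LinearMap.mem_ker, map_sub, hpF b₀ _ (hF _ _), sub_self]
  let κ₁ := Fin (Module.finrank ℂ (F b₀))
  let κ₂ := Fin (Module.finrank ℂ (LinearMap.ker (p b₀)))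
  let w₁ : Module.Basis κ₁ ℂ (F b₀) := Module.finBasis ℂ _
  let w₂ : Module.Basis κ₂ ℂ (LinearMap.ker (p b₀)) := Module.finBasis ℂ _
  let w : Module.Basis (κ₁ ⊕ κ₂) ℂ (E.fib b₀) :=
    (w₁.prod w₂).map (Submodule.prodEquivOfIsCompl _ _ hcompl)
  let t : κ₁ ⊕ κ₂ → ∀ b, E.fib b := fun k b => ∑ i, γ.repr (w k) i • e i b
  have ht0 : ∀ k, t k b₀ = w k := fun k => by
    have := γ.sum_repr (w k)
    simp_rw [hγ] at this
    exact this
  have ht : ∀ᶠ b in 𝓝 b₀, ∀ k, t k ∈ E.contAt b := by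
    filter_upwards [he] with b h k
    exact hE.mem ⟨ι, inferInstance, fun i _ => γ.repr (w k) i, e, fun _ => continuousAt_const,
      fun i => h.mem i, by simp [t]⟩
  have hw1 : ∀ k, p b₀ (w (Sum.inl k)) = w (Sum.inl k) := fun k => hpF _ _ (by simp [w])
  have hw2 : ∀ k, p b₀ (w (Sum.inr k)) = 0 := fun k => by
    have : w (Sum.inr k) ∈ LinearMap.ker (p b₀) := by simp [w]
    exact this
  let u : κ₁ ⊕ κ₂ → ∀ b, E.fib b := fun k b =>
    Sum.elim (fun k => p b (t (Sum.inl k) b)) (fun k => t (Sum.inr k) b - p b (t (Sum.inr k) b)) k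
  have hu : ∀ᶠ b in 𝓝 b₀, ∀ k, u k ∈ E.contAt b := by
    filter_upwards [ht] with b h k
    rcases k with k | k
    · exact hp _ _ (h _)
    · refine hE.mem ⟨Bool, inferInstance, fun i _ => if i then 1 else -1,
        fun i b => if i then t (Sum.inr k) b else p b (t (Sum.inr k) b),
        fun _ => continuousAt_const, fun i => ?_, ?_⟩
      · cases i
        · simpa using hp _ _ (h _)
        · simpa using h _
      · refine Eventually.of_forall fun y => ?_
        simp [u, sub_eq_add_neg]
  have hfr := frame_of_basis hE he u hu ⟨w, fun k => by
    rcases k with k | k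
    · simp only [u, Sum.elim_inl, ht0, hw1]
    · simp only [u, Sum.elim_inr, ht0, hw2, sub_zero]⟩
  refine ⟨κ₁, inferInstance, fun k b => ⟨p b (t (Sum.inl k) b), hF _ _⟩, ?_⟩
  have hpu : ∀ (b : B) (a : κ₁ ⊕ κ₂ → ℂ) (v : E.fib b), v ∈ F b → v = ∑ k, a k • u k b →
      v = ∑ k, a (Sum.inl k) • p b (t (Sum.inl k) b) := by
    intro b a v hv h
    have h1 := hpF b v hv
    rw [h, map_sum, Fintype.sum_sum_type] at h1
    simp only [u, Sum.elim_inl, Sum.elim_inr, map_smul, map_sub, hpF b _ (hF _ _), sub_self,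
      smul_zero, Finset.sum_const_zero, add_zero] at h1
    rw [h1, h]
  filter_upwards [hfr] with b h
  refine ⟨?_, fun s => ⟨fun hs => ?_, ?_⟩⟩
  · obtain ⟨δ, hδ⟩ := h.1
    have hli : LinearIndependent ℂ (fun k : κ₁ => (⟨p b (t (Sum.inl k) b), hF _ _⟩ : F b)) := by
      have h1 := δ.linearIndependent.comp Sum.inl Sum.inl_injective
      refine LinearIndependent.of_comp (F b).subtype ?_
      convert h1 using 1
      funext k
      simp [hδ, u]
    have hsp : ⊤ ≤ Submodule.span ℂ
        (Set.range (fun k : κ₁ => (⟨p b (t (Sum.inl k) b), hF _ _⟩ : F b))) := by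
      rintro ⟨v, hv⟩ _
      have h2 := hpu b (fun k => δ.repr v k) v hv (by
        simp_rw [← hδ]; exact (δ.sum_repr v).symm)
      have h3 : (⟨v, hv⟩ : F b) = ∑ k : κ₁, δ.repr v (Sum.inl k) •
          (⟨p b (t (Sum.inl k) b), hF _ _⟩ : F b) := by
        apply Subtype.ext
        simpa using h2
      rw [h3]
      exact Submodule.sum_mem _ fun k _ => Submodule.smul_mem _ _ (Submodule.subset_span ⟨k, rfl⟩)
    exact ⟨Module.Basis.mk hli hsp, fun k => by simp⟩
  · obtain ⟨a, ha, hs⟩ := (h.2 _).1 hs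
    refine ⟨fun k => a (Sum.inl k), fun k => ha _, ?_⟩
    filter_upwards [hs] with y hy
    apply Subtype.ext
    simpa using hpu y (fun k => a k y) _ (s y).2 hy
  · rintro ⟨a, ha, hs⟩
    refine hE.mem ⟨κ₁, inferInstance, a, fun k => u (Sum.inl k), ha, fun k => h.mem _, ?_⟩
    filter_upwards [hs] with y hy
    rw [hy]
    simp [u]

lemma ContAlong.sub {E : Fam B} {F : ∀ b, Submodule ℂ (E.fib b)}
    (p : ∀ b, E.fib b →ₗ[ℂ] E.fib b)
    (hp : ∀ b, ∀ s ∈ E.contAt b, (fun x => p x (s x)) ∈ E.contAt b)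
    (hF : ∀ b v, p b v ∈ F b) (hpF : ∀ b, ∀ v ∈ F b, p b v = v)
    {φ : T → B} {t₀ : T} {s : ∀ t, F (φ t)}
    (h : E.ContAlong φ (fun t => (s t : E.fib (φ t))) t₀) : (E.sub F).ContAlong φ s t₀ := by
  obtain ⟨ι, _, a, u, ha, hu, h⟩ := h
  refine ⟨ι, inferInstance, a, fun i b => ⟨p b (u i b), hF _ _⟩, ha, fun i => hp _ _ (hu i), ?_⟩
  filter_upwards [h] with t ht
  apply Subtype.ext
  have := hpF _ _ (s t).2
  rw [← this, ht, map_sum]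
  simp

end Fam

/-- A complex vector bundle over a topological groupoid `Y`: a locally trivial family of finite
dimensional complex vector spaces over the space of objects, on which the arrows of `Y` act
functorially, linearly and continuously. -/
structure VBundle (Y : Type u) [TopGpd.{u, v} Y] extends Fam Y where
  act : ∀ {x y : Y}, (x ⟶ y) → fib x →ₗ[ℂ] fib y
  act_id : ∀ (x : Y) (w : fib x), act (𝟙 x) w = w
  act_comp : ∀ {x y z : Y} (f : x ⟶ y) (g : y ⟶ z) (w : fib x), act (f ≫ g) w = act g (act f w)
  locallyTrivial : toFam.LocallyTrivial
  act_cont : ∀ (f₀ : Arr Y), ∀ s ∈ contAt f₀.src,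
    toFam.ContAlong (fun f : Arr Y => f.tgt) (fun f => act f.hom (s f.src)) f₀

namespace VBundle

variable {Y : Type u} [TopGpd.{u, v} Y]

lemma act_along (E : VBundle Y) {T : Type*} [TopologicalSpace T] (α : T → Arr Y) {t₀ : T}
    (hα : ContinuousAt α t₀) {p : ∀ t, E.fib (α t).src}
    (hp : E.ContAlong (fun t => (α t).src) p t₀) :
    E.ContAlong (fun t => (α t).tgt) (fun t => E.act (α t).hom (p t)) t₀ := by
  obtain ⟨ι, _, a, w, ha, hw, h⟩ := hp
  refine Fam.ContAlong.of_sum a (fun i t => E.act (α t).hom (w i (α t).src)) ha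
    (fun i => Fam.ContAlong.comp (φ := fun f : Arr Y => f.tgt) hα (E.act_cont (α t₀) (w i) (hw i)))
    ?_
  filter_upwards [h] with t ht
  rw [ht, map_sum]
  simp

/-- Isomorphisms of vector bundles: fibrewise linear isomorphisms that are compatible with the
action of the arrows and that preserve and reflect continuity of sections. -/
structure Iso (E F : VBundle Y) where
  equiv : ∀ y, E.fib y ≃ₗ[ℂ] F.fib y
  nat : ∀ {x y : Y} (f : x ⟶ y) (w : E.fib x), equiv y (E.act f w) = F.act f (equiv x w)
  cont : ∀ (y : Y) (s : ∀ y, E.fib y), s ∈ E.contAt y ↔ (fun x => equiv x (s x)) ∈ F.contAt y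

def Iso.refl (E : VBundle Y) : Iso E E where
  equiv _ := LinearEquiv.refl _ _
  nat _ _ := rfl
  cont _ _ := Iff.rfl

def Iso.symm {E F : VBundle Y} (i : Iso E F) : Iso F E where
  equiv y := (i.equiv y).symm
  nat f w := by rw [LinearEquiv.symm_apply_eq, i.nat, LinearEquiv.apply_symm_apply]
  cont y s := by rw [i.cont]; simp

def Iso.trans {E F G : VBundle Y} (i : Iso E F) (j : Iso F G) : Iso E G where
  equiv y := (i.equiv y).trans (j.equiv y)
  nat f w := by simp [i.nat, j.nat]
  cont y s := by rw [i.cont, j.cont]; rfl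

/-- The zero bundle. -/
abbrev zero (Y : Type u) [TopGpd.{u, v} Y] : VBundle Y where
  fib _ := PUnit
  contAt _ := Set.univ
  act _ := 0
  act_id _ _ := rfl
  act_comp _ _ _ := rfl
  locallyTrivial b := ⟨Empty, inferInstance, fun _ _ => 0, Eventually.of_forall fun b =>
    ⟨⟨Module.Basis.empty _, fun i => i.elim⟩, fun s => ⟨fun _ =>
      ⟨fun _ _ => 0, fun i => i.elim, Eventually.of_forall fun _ => rfl⟩, fun _ => trivial⟩⟩⟩
  act_cont f s _ := ⟨Empty, inferInstance, fun _ _ => 0, fun _ _ => 0, fun i => i.elim,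
    fun i => i.elim, Eventually.of_forall fun _ => rfl⟩

/-- The trivial line bundle. -/
abbrev one (Y : Type u) [TopGpd.{u, v} Y] : VBundle Y where
  fib _ := ℂ
  contAt b := {s | ContinuousAt s b}
  act _ := LinearMap.id
  act_id _ _ := rfl
  act_comp _ _ _ := rfl
  locallyTrivial b := ⟨Unit, inferInstance, fun _ _ => 1, Eventually.of_forall fun b =>
    ⟨⟨Module.Basis.singleton _ _, fun i => by simp⟩, fun s => ⟨fun hs =>
      ⟨fun _ => s, fun _ => hs, Eventually.of_forall fun _ => by simp⟩, fun ⟨a, ha, h⟩ =>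
        (ha ()).congr (by filter_upwards [h] with y hy; rw [hy]; simp)⟩⟩⟩
  act_cont f s hs := ⟨Unit, inferInstance, fun _ f => s f.src, fun _ _ => (1 : ℂ),
    fun _ => ContinuousAt.comp (g := s) (f := fun f : Arr Y => f.src) hs
      TopGpd.continuous_src.continuousAt,
    fun _ => continuousAt_const, Eventually.of_forall fun _ => by simp⟩

/-- The direct sum of two vector bundles. -/
abbrev prod (E F : VBundle Y) : VBundle Y where
  toFam := E.toFam.prod F.toFam
  act f := (E.act f).prodMap (F.act f)
  act_id x w := by simp [E.act_id, F.act_id]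
  act_comp f g w := by simp [E.act_comp, F.act_comp]
  locallyTrivial := E.locallyTrivial.prod F.locallyTrivial
  act_cont f₀ s hs := Fam.ContAlong.prodMk E.locallyTrivial F.locallyTrivial
    (E.act_cont f₀ _ hs.1) (F.act_cont f₀ _ hs.2)

/-- The tensor product of two vector bundles. -/
abbrev tensor (E F : VBundle Y) : VBundle Y where
  toFam := E.toFam.tensor F.toFam
  act f := TensorProduct.map (E.act f) (F.act f)
  act_id x w := by
    have h1 : E.act (𝟙 x) = LinearMap.id := LinearMap.ext (E.act_id x)
    have h2 : F.act (𝟙 x) = LinearMap.id := LinearMap.ext (F.act_id x)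
    rw [h1, h2, TensorProduct.map_id]; rfl
  act_comp f g w := by
    have h1 : E.act (f ≫ g) = E.act g ∘ₗ E.act f := LinearMap.ext (E.act_comp f g)
    have h2 : F.act (f ≫ g) = F.act g ∘ₗ F.act f := LinearMap.ext (F.act_comp f g)
    rw [h1, h2, TensorProduct.map_comp]; rfl
  locallyTrivial := E.locallyTrivial.tensor F.locallyTrivial
  act_cont := by
    rintro f₀ s ⟨κ, _, f, g, hf, hg, hs⟩
    refine Fam.ContAlong.of_sum (κ := κ) (fun _ _ => 1)
      (fun k a => E.act a.hom (f k a.src) ⊗ₜ[ℂ] F.act a.hom (g k a.src))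
      (fun _ => continuousAt_const)
      (fun k => Fam.ContAlong.tmul (E.act_cont f₀ _ (hf k)) (F.act_cont f₀ _ (hg k))) ?_
    filter_upwards [TopGpd.continuous_src.continuousAt.eventually hs] with a ha
    rw [ha, map_sum]
    simp

/-- The direct sum of finitely many vector bundles. -/
abbrev pi {J : Type} [Fintype J] (E : J → VBundle Y) : VBundle Y where
  toFam := Fam.pi fun j => (E j).toFam
  act f := LinearMap.pi fun j => (E j).act f ∘ₗ LinearMap.proj j
  act_id x w := by funext j; simp [(E j).act_id]
  act_comp f g w := by funext j; simp [(E j).act_comp]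
  locallyTrivial := Fam.LocallyTrivial.pi fun j => (E j).locallyTrivial
  act_cont f₀ s hs := Fam.ContAlong.pi (fun j => (E j).locallyTrivial)
    fun j => (E j).act_cont f₀ _ (hs j)

/-- The tensor product of finitely many vector bundles. -/
abbrev piTensor {J : Type} [Fintype J] (E : J → VBundle Y) : VBundle Y where
  toFam := Fam.piTensor fun j => (E j).toFam
  act f := PiTensorProduct.map fun j => (E j).act f
  act_id x w := by
    have h1 : ∀ j, (E j).act (𝟙 x) = LinearMap.id := fun j => LinearMap.ext ((E j).act_id x)
    simp_rw [h1]
    rw [PiTensorProduct.map_id]; rfl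
  act_comp f g w := by
    have h1 : ∀ j, (E j).act (f ≫ g) = (E j).act g ∘ₗ (E j).act f :=
      fun j => LinearMap.ext ((E j).act_comp f g)
    simp_rw [h1]
    rw [PiTensorProduct.map_comp]; rfl
  locallyTrivial := Fam.LocallyTrivial.piTensor fun j => (E j).locallyTrivial
  act_cont := by
    rintro f₀ s ⟨κ, _, c, f, hc, hf, hs⟩
    refine Fam.ContAlong.of_sum (κ := κ) (fun k a => c k a.src)
      (fun k a => PiTensorProduct.tprod ℂ fun j => (E j).act a.hom (f k j a.src))
      (fun k => ContinuousAt.comp (g := c k) (f := fun f : Arr Y => f.src) (hc k)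
        TopGpd.continuous_src.continuousAt)
      (fun k => Fam.ContAlong.tprod fun j => (E j).act_cont f₀ _ (hf k j)) ?_
    filter_upwards [TopGpd.continuous_src.continuousAt.eventually hs] with a ha
    rw [ha, map_sum]
    simp

/-- The pullback of a vector bundle along a continuous functor. -/
abbrev pull {Z : Type*} [TopGpd Z] (Φ : Z ⥤ Y) (hΦ : ContFunctor Φ) (E : VBundle Y) :
    VBundle Z where
  toFam := E.toFam.pullback Φ.obj
  act f := E.act (Φ.map f)
  act_id x w := by rw [Φ.map_id, E.act_id]
  act_comp f g w := by rw [Φ.map_comp, E.act_comp]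
  locallyTrivial := E.locallyTrivial.pullback hΦ.obj
  act_cont f₀ s hs := Fam.ContAlong.pullback (φ := Φ.obj) (ψ := fun f : Arr Z => f.tgt)
    (E.act_along (fun f : Arr Z => (⟨Φ.obj f.src, Φ.obj f.tgt, Φ.map f.hom⟩ : Arr Y))
      hΦ.map.continuousAt
      (Fam.ContAlong.comp (φ := Φ.obj) (ψ := fun f : Arr Z => f.src)
        TopGpd.continuous_src.continuousAt hs))

/-- The subbundle given by a family `F` of invariant subspaces, provided there is a continuous family
of projections onto `F`. -/
abbrev sub (E : VBundle Y) (F : ∀ y, Submodule ℂ (E.fib y))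
    (hact : ∀ {x y : Y} (f : x ⟶ y), ∀ w ∈ F x, E.act f w ∈ F y)
    (hF : ∃ p : ∀ y, E.fib y →ₗ[ℂ] E.fib y,
      (∀ y, ∀ s ∈ E.contAt y, (fun x => p x (s x)) ∈ E.contAt y) ∧
      (∀ y w, p y w ∈ F y) ∧ ∀ y, ∀ w ∈ F y, p y w = w) : VBundle Y where
  toFam := E.toFam.sub F
  act f := (E.act f).restrict (hact f)
  act_id x w := Subtype.ext (E.act_id x w)
  act_comp f g w := Subtype.ext (E.act_comp f g w)
  locallyTrivial := by
    obtain ⟨p, h1, h2, h3⟩ := hF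
    exact E.locallyTrivial.sub p h1 h2 h3
  act_cont f₀ s hs := by
    obtain ⟨p, h1, h2, h3⟩ := hF
    exact Fam.ContAlong.sub p h1 h2 h3 (E.act_cont f₀ _ hs)

/-! ### The semiring of isomorphism classes -/

instance setoid (Y : Type u) [TopGpd.{u, v} Y] : Setoid (VBundle Y) where
  r E F := Nonempty (Iso E F)
  iseqv := ⟨fun E => ⟨Iso.refl E⟩, fun ⟨i⟩ => ⟨i.symm⟩, fun ⟨i⟩ ⟨j⟩ => ⟨i.trans j⟩⟩

def prodCongr {E E' F F' : VBundle Y} (i : Iso E E') (j : Iso F F') :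
    Iso (E.prod F) (E'.prod F') where
  equiv y := (i.equiv y).prodCongr (j.equiv y)
  nat f w := Prod.ext (i.nat f w.1) (j.nat f w.2)
  cont y s := and_congr (i.cont y _) (j.cont y _)

def prodComm (E F : VBundle Y) : Iso (E.prod F) (F.prod E) where
  equiv y := LinearEquiv.prodComm ℂ _ _
  nat _ _ := rfl
  cont y s := and_comm

def prodAssoc (E F G : VBundle Y) : Iso ((E.prod F).prod G) (E.prod (F.prod G)) where
  equiv y := LinearEquiv.prodAssoc ℂ _ _ _
  nat _ _ := rfl
  cont y s := and_assoc

def zeroProd (E : VBundle Y) : Iso ((zero Y).prod E) E where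
  equiv y := LinearEquiv.uniqueProd
  nat _ _ := rfl
  cont y s := ⟨fun h => h.2, fun h => ⟨trivial, h⟩⟩

lemma tensor_map_mem {E F E' F' : VBundle Y} (φ : ∀ y, E.fib y →ₗ[ℂ] E'.fib y)
    (ψ : ∀ y, F.fib y →ₗ[ℂ] F'.fib y) (y : Y)
    (hφ : ∀ s ∈ E.contAt y, (fun x => φ x (s x)) ∈ E'.contAt y)
    (hψ : ∀ s ∈ F.contAt y, (fun x => ψ x (s x)) ∈ F'.contAt y)
    (s) (hs : s ∈ (E.tensor F).contAt y) :
    (fun x => TensorProduct.map (φ x) (ψ x) (s x)) ∈ (E'.tensor F').contAt y := by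
  obtain ⟨κ, _, f, g, hf, hg, hs⟩ := hs
  refine ⟨κ, inferInstance, _, _, fun k => hφ _ (hf k), fun k => hψ _ (hg k), ?_⟩
  filter_upwards [hs] with x hx
  rw [hx, map_sum]
  simp

def tensorCongr {E E' F F' : VBundle Y} (i : Iso E E') (j : Iso F F') :
    Iso (E.tensor F) (E'.tensor F') where
  equiv y := TensorProduct.congr (i.equiv y) (j.equiv y)
  nat f w := by
    induction w using TensorProduct.induction_on with
    | zero => simp
    | tmul a b => simp [i.nat, j.nat]
    | add a b ha hb => rw [map_add, map_add, ha, hb, map_add, map_add]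
  cont y s := by
    constructor
    · exact tensor_map_mem (fun y => (i.equiv y).toLinearMap) (fun y => (j.equiv y).toLinearMap) y
        (fun s hs => (i.cont y s).1 hs) (fun s hs => (j.cont y s).1 hs) s
    · intro h
      have := tensor_map_mem (fun y => (i.symm.equiv y).toLinearMap)
        (fun y => (j.symm.equiv y).toLinearMap) y
        (fun s hs => (i.symm.cont y s).1 hs) (fun s hs => (j.symm.cont y s).1 hs) _ h
      convert this using 2 with x
      exact ((TensorProduct.congr (i.equiv x) (j.equiv x)).symm_apply_apply (s x)).symm

lemma comm_mem {E F : VBundle Y} (y : Y) (s) (hs : s ∈ (E.tensor F).contAt y) :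
    (fun x => TensorProduct.comm ℂ _ _ (s x)) ∈ (F.tensor E).contAt y := by
  obtain ⟨κ, _, f, g, hf, hg, hs⟩ := hs
  refine ⟨κ, inferInstance, _, _, hg, hf, ?_⟩
  filter_upwards [hs] with x hx
  rw [hx, map_sum]
  simp

def tensorComm (E F : VBundle Y) : Iso (E.tensor F) (F.tensor E) where
  equiv y := TensorProduct.comm ℂ _ _
  nat f w := by
    induction w using TensorProduct.induction_on with
    | zero => simp
    | tmul a b => simp
    | add a b ha hb => rw [map_add, map_add, ha, hb, map_add, map_add]
  cont y s := ⟨comm_mem y s, fun h => by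
    have := comm_mem y _ h
    simpa using this⟩

def tensorAssoc (E F G : VBundle Y) : Iso ((E.tensor F).tensor G) (E.tensor (F.tensor G)) where
  equiv y := TensorProduct.assoc ℂ _ _ _
  nat f w := by
    exact (TensorProduct.map_map_assoc _ _ _ w).symm
  cont y s := by
    constructor
    · rintro ⟨κ, _, t, g, ht, hg, hs⟩
      choose ι hι f f' hf hf' ht using ht
      refine ⟨Σ k, ι k, inferInstance, fun x => f x.1 x.2, fun x y => f' x.1 x.2 y ⊗ₜ[ℂ] g x.1 y,
        fun x => hf _ _, fun x => Fam.tmul_mem (hf' _ _) (hg _), ?_⟩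
      filter_upwards [hs, eventually_all.2 ht] with x hx hx'
      rw [hx, map_sum, Fintype.sum_sigma]
      refine Finset.sum_congr rfl fun k _ => ?_
      rw [hx', TensorProduct.sum_tmul, map_sum]
      simp
    · rintro ⟨κ, _, f, t, hf, ht, hs⟩
      choose ι hι g g' hg hg' ht using ht
      refine ⟨Σ k, ι k, inferInstance, fun x y => f x.1 y ⊗ₜ[ℂ] g x.1 x.2 y, fun x => g' x.1 x.2,
        fun x => Fam.tmul_mem (hf _) (hg _ _), fun x => hg' _ _, ?_⟩
      filter_upwards [hs, eventually_all.2 ht] with x hx hx'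
      rw [← LinearEquiv.eq_symm_apply, map_sum] at hx
      rw [hx, Fintype.sum_sigma]
      refine Finset.sum_congr rfl fun k _ => ?_
      rw [hx', TensorProduct.tmul_sum, map_sum]
      simp

def oneTensor (E : VBundle Y) : Iso ((one Y).tensor E) E where
  equiv y := TensorProduct.lid ℂ _
  nat f w := by
    induction w using TensorProduct.induction_on with
    | zero => simp
    | tmul a b => simp
    | add a b ha hb => rw [map_add, map_add, ha, hb, map_add, map_add]
  cont y s := by
    constructor
    · rintro ⟨κ, _, f, g, hf, hg, hs⟩
      refine E.locallyTrivial.mem ⟨κ, inferInstance, f, g, hf, hg, ?_⟩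
      filter_upwards [hs] with x hx
      rw [hx, map_sum]
      simp
    · intro h
      refine ⟨Unit, inferInstance, fun _ _ => (1 : ℂ), fun _ x => TensorProduct.lid ℂ _ (s x),
        fun _ => continuousAt_const, fun _ => h, Eventually.of_forall fun x => ?_⟩
      have := (TensorProduct.lid ℂ (E.fib x)).symm_apply_apply (s x)
      rw [TensorProduct.lid_symm_apply] at this
      simp [this]

def zeroTensor (E : VBundle Y) : Iso ((zero Y).tensor E) (zero Y) where
  equiv y := LinearEquiv.ofSubsingleton _ _
  nat _ _ := rfl
  cont y s := ⟨fun _ => trivial, fun _ => ⟨Empty, inferInstance, fun i => i.elim, fun i => i.elim,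
    fun i => i.elim, fun i => i.elim, Eventually.of_forall fun x => Subsingleton.elim _ _⟩⟩

lemma prodLeft_tmul' {E F G : VBundle Y} (y : Y) (a : (E.prod F).fib y) (b : G.fib y) :
    TensorProduct.prodLeft ℂ ℂ (E.fib y) (F.fib y) (G.fib y) (a ⊗ₜ[ℂ] b) =
      (a.1 ⊗ₜ[ℂ] b, a.2 ⊗ₜ[ℂ] b) := TensorProduct.prodLeft_tmul _ _ _ _ _ a.1 a.2 b

def prodTensor (E F G : VBundle Y) :
    Iso ((E.prod F).tensor G) ((E.tensor G).prod (F.tensor G)) where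
  equiv y := TensorProduct.prodLeft ℂ ℂ _ _ _
  nat f w := by
    induction w using TensorProduct.induction_on with
    | zero => rw [map_zero, map_zero, map_zero, map_zero]
    | tmul a b => rw [prodLeft_tmul', TensorProduct.map_tmul, prodLeft_tmul']; simp
    | add a b ha hb => rw [map_add, map_add, ha, hb, map_add, map_add]
  cont y s := by
    constructor
    · rintro ⟨κ, _, f, g, hf, hg, hs⟩
      refine ⟨⟨κ, inferInstance, fun k x => (f k x).1, g, fun k => (hf k).1, hg, ?_⟩,
        ⟨κ, inferInstance, fun k x => (f k x).2, g, fun k => (hf k).2, hg, ?_⟩⟩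
      · filter_upwards [hs] with x hx
        rw [hx, map_sum]
        simp [Prod.fst_sum, prodLeft_tmul']
      · filter_upwards [hs] with x hx
        rw [hx, map_sum]
        simp [Prod.snd_sum, prodLeft_tmul']
    · rintro ⟨⟨κ, _, f, g, hf, hg, hs⟩, ⟨κ', _, f', g', hf', hg', hs'⟩⟩
      refine ⟨κ ⊕ κ', inferInstance,
        fun k x => Sum.elim (fun k => (f k x, 0)) (fun k => (0, f' k x)) k,
        fun k x => Sum.elim (fun k => g k x) (fun k => g' k x) k, ?_, ?_, ?_⟩
      · rintro (k | k)
        exacts [⟨hf k, F.locallyTrivial.zero_mem _⟩, ⟨E.locallyTrivial.zero_mem _, hf' k⟩]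
      · rintro (k | k)
        exacts [hg k, hg' k]
      · filter_upwards [hs, hs'] with x hx hx'
        rw [← (TensorProduct.prodLeft ℂ ℂ (E.fib x) (F.fib x) (G.fib x)).injective.eq_iff]
        refine Prod.ext ?_ ?_
        · rw [hx, map_sum]; simp [Prod.fst_sum]
        · rw [hx', map_sum]; simp [Prod.snd_sum]

end VBundle

/-- The set of isomorphism classes of vector bundles over `Y`. -/
def VectIso (Y : Type u) [TopGpd.{u, v} Y] := Quotient (VBundle.setoid Y)

namespace VectIso

variable {Y : Type u} [TopGpd.{u, v} Y]

/-- The isomorphism class of a bundle. -/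
def mk (E : VBundle Y) : VectIso Y := Quotient.mk _ E

lemma sound {E F : VBundle Y} (i : VBundle.Iso E F) : mk E = mk F := Quotient.sound ⟨i⟩

instance : Add (VectIso Y) :=
  ⟨Quotient.map₂ VBundle.prod fun _ _ ⟨i⟩ _ _ ⟨j⟩ => ⟨VBundle.prodCongr i j⟩⟩

instance : Mul (VectIso Y) :=
  ⟨Quotient.map₂ VBundle.tensor fun _ _ ⟨i⟩ _ _ ⟨j⟩ => ⟨VBundle.tensorCongr i j⟩⟩

instance : Zero (VectIso Y) := ⟨mk (VBundle.zero Y)⟩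

instance : One (VectIso Y) := ⟨mk (VBundle.one Y)⟩

/-- Isomorphism classes of vector bundles form a commutative semiring under `⊕` and `⊗`. -/
instance : CommSemiring (VectIso Y) where
  nsmul := nsmulRec
  npow := npowRec
  add_assoc := by
    rintro ⟨E⟩ ⟨F⟩ ⟨G⟩; exact sound (VBundle.prodAssoc E F G)
  zero_add := by rintro ⟨E⟩; exact sound (VBundle.zeroProd E)
  add_zero := by
    rintro ⟨E⟩; exact sound ((VBundle.prodComm _ _).trans (VBundle.zeroProd E))
  add_comm := by rintro ⟨E⟩ ⟨F⟩; exact sound (VBundle.prodComm E F)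
  left_distrib := by
    rintro ⟨E⟩ ⟨F⟩ ⟨G⟩
    exact sound ((VBundle.tensorComm _ _).trans ((VBundle.prodTensor F G E).trans
      (VBundle.prodCongr (VBundle.tensorComm _ _) (VBundle.tensorComm _ _))))
  right_distrib := by rintro ⟨E⟩ ⟨F⟩ ⟨G⟩; exact sound (VBundle.prodTensor E F G)
  zero_mul := by rintro ⟨E⟩; exact sound (VBundle.zeroTensor E)
  mul_zero := by
    rintro ⟨E⟩; exact sound ((VBundle.tensorComm _ _).trans (VBundle.zeroTensor E))
  mul_assoc := by rintro ⟨E⟩ ⟨F⟩ ⟨G⟩; exact sound (VBundle.tensorAssoc E F G)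
  one_mul := by rintro ⟨E⟩; exact sound (VBundle.oneTensor E)
  mul_one := by
    rintro ⟨E⟩; exact sound ((VBundle.tensorComm _ _).trans (VBundle.oneTensor E))
  mul_comm := by rintro ⟨E⟩ ⟨F⟩; exact sound (VBundle.tensorComm E F)

lemma mk_prod (E F : VBundle Y) : mk (E.prod F) = mk E + mk F := rfl
lemma mk_tensor (E F : VBundle Y) : mk (E.tensor F) = mk E * mk F := rfl
lemma mk_zero : mk (VBundle.zero Y) = 0 := rfl
lemma mk_one : mk (VBundle.one Y) = 1 := rfl

end VectIso

/-! ### The Grothendieck ring of a commutative semiring -/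

/-- The Grothendieck ring of a commutative semiring: its additive group is the Grothendieck group
of the additive monoid. -/
def GRing (R : Type u) [CommSemiring R] : Type u := Algebra.GrothendieckAddGroup R

namespace GRing

variable {R : Type u} [CommSemiring R] {A : Type*} [AddCommGroup A]

instance : AddCommGroup (GRing R) :=
  inferInstanceAs (AddCommGroup (Algebra.GrothendieckAddGroup R))

/-- The class of an element of `R`. -/
def of : R →+ GRing R := (Algebra.GrothendieckAddGroup.of : R →+ Algebra.GrothendieckAddGroup R)

/-- The universal property of the Grothendieck group. -/
def lift (f : R →+ A) : GRing R →+ A :=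
  (Algebra.GrothendieckAddGroup.lift f : Algebra.GrothendieckAddGroup R →+ A)

lemma lift_of (f : R →+ A) (r : R) : lift f (of r) = f r :=
  DFunLike.congr_fun (Algebra.GrothendieckAddGroup.lift.symm_apply_apply f) r

lemma exists_sub (x : GRing R) : ∃ a b : R, x = of a - of b := by
  induction x using AddLocalization.induction_on with
  | H y =>
    refine ⟨y.1, y.2, ?_⟩
    have h : ∀ a b : R, (AddLocalization.mk a (0 : (⊤ : AddSubmonoid R)) :
        Algebra.GrothendieckAddGroup R) - AddLocalization.mk b 0 =
          AddLocalization.mk (a + 0) ⟨0 + b, AddSubmonoid.mem_top _⟩ := fun a b =>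
      Algebra.GrothendieckAddGroup.mk_sub_mk a b 0 0
    have h' := h y.1 y.2
    rw [AddLocalization.mk_zero_eq_addMonoidOf_mk, AddLocalization.mk_zero_eq_addMonoidOf_mk] at h'
    refine Eq.trans ?_ h'.symm
    congr 1
    · exact (add_zero _).symm
    · exact Subtype.ext (zero_add _).symm

lemma induct {P : GRing R → Prop} (hof : ∀ r, P (of r)) (hsub : ∀ x y, P x → P y → P (x - y))
    (x : GRing R) : P x := by
  obtain ⟨a, b, rfl⟩ := exists_sub x
  exact hsub _ _ (hof a) (hof b)

/-- The biadditive extension of the multiplication of `R`. -/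
def mulHom : GRing R →+ GRing R →+ GRing R :=
  lift (A := GRing R →+ GRing R)
    { toFun := fun r => lift (of.comp (AddMonoidHom.mulLeft r))
      map_zero' := by
        ext x
        induction x using induct with
        | hof r => simp [lift_of]
        | hsub x y hx hy => rw [map_sub, map_sub, hx, hy]
      map_add' := fun r r' => by
        ext x
        induction x using induct with
        | hof r => simp [lift_of, add_mul]
        | hsub x y hx hy => rw [map_sub, map_sub, hx, hy] }

lemma mulHom_of (r r' : R) : mulHom (of r) (of r') = of (r * r') := by
  rw [mulHom, lift_of]
  exact lift_of _ _

instance : Mul (GRing R) := ⟨fun x y => mulHom x y⟩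
instance : One (GRing R) := ⟨of 1⟩

lemma mul_def (x y : GRing R) : x * y = mulHom x y := rfl
lemma of_mul (r r' : R) : of (r * r') = of r * of r' := (mulHom_of r r').symm

instance : CommRing (GRing R) where
  __ := (inferInstance : AddCommGroup (GRing R))
  left_distrib x y z := map_add (mulHom x) y z
  right_distrib x y z := by simp only [mul_def, map_add, AddMonoidHom.add_apply]
  zero_mul x := by simp only [mul_def, map_zero, AddMonoidHom.zero_apply]
  mul_zero x := map_zero (mulHom x)
  mul_assoc x y z := by
    simp only [mul_def]
    induction x using induct with
    | hsub x x' hx hx' => simp only [map_sub, AddMonoidHom.sub_apply, hx, hx']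
    | hof a =>
      induction y using induct with
      | hsub x x' hx hx' => simp only [map_sub, AddMonoidHom.sub_apply, hx, hx']
      | hof b =>
        induction z using induct with
        | hsub x x' hx hx' => simp only [map_sub, hx, hx']
        | hof c => simp only [mulHom_of, mul_assoc]
  one_mul x := by
    induction x using induct with
    | hsub x x' hx hx' => rw [mul_def] at *; rw [map_sub, hx, hx']
    | hof a => exact (mulHom_of _ _).trans (by rw [one_mul])
  mul_one x := by
    induction x using induct with
    | hsub x x' hx hx' => rw [mul_def] at *; rw [map_sub, AddMonoidHom.sub_apply, hx, hx']
    | hof a => exact (mulHom_of _ _).trans (by rw [mul_one])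
  mul_comm x y := by
    simp only [mul_def]
    induction x using induct with
    | hsub x x' hx hx' => simp only [map_sub, AddMonoidHom.sub_apply, hx, hx']
    | hof a =>
      induction y using induct with
      | hsub x x' hx hx' => simp only [map_sub, AddMonoidHom.sub_apply, hx, hx']
      | hof b => simp only [mulHom_of, mul_comm]

/-- Functoriality with respect to additive maps. -/
def map {S : Type*} [CommSemiring S] (f : R →+ S) : GRing R →+ GRing S := lift (of.comp f)

end GRing

/-! ### The rotation condition and `K_rot` -/

variable {Y : Type u} [TopGpd.{u, v} Y]

/-- The number `e^{2π i n / r}`, where `r` is the order of the center element `z`. -/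
def zetaPow {C : Type u} [Category.{v} C] (z : CatCenter C) (n : ℕ) : ℂ :=
  Complex.exp (2 * Real.pi * Complex.I * (n / orderOf z))

/-- A formal power series `∑ V_n q^{n/r}` of vector bundles satisfying the rotation condition with
respect to the center element `z` of order `r`: the center element acts on `V_n` as multiplication by
`e^{2π i n / r}`. -/
structure RotSeries (Y : Type u) [TopGpd.{u, v} Y] (z : CatCenter Y) where
  V : ℕ → VBundle Y
  rot : ∀ (n : ℕ) (y : Y) (w : (V n).fib y), (V n).act (z.app y) w = zetaPow z n • w

/-- The isomorphism classes of bundles on which `z` acts as multiplication by `lam`. -/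
def IsEigen (z : CatCenter Y) (lam : ℂ) (x : VectIso Y) : Prop :=
  ∃ E : VBundle Y, VectIso.mk E = x ∧ ∀ (y : Y) (w : E.fib y), E.act (z.app y) w = lam • w

lemma IsEigen.zero (z : CatCenter Y) (lam : ℂ) : IsEigen z lam 0 :=
  ⟨VBundle.zero Y, rfl, fun _ _ => rfl⟩

lemma IsEigen.add {z : CatCenter Y} {lam : ℂ} {a b : VectIso Y} (ha : IsEigen z lam a)
    (hb : IsEigen z lam b) : IsEigen z lam (a + b) := by
  obtain ⟨E, rfl, hE⟩ := ha
  obtain ⟨F, rfl, hF⟩ := hb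
  exact ⟨E.prod F, rfl, fun y w => Prod.ext (hE y w.1) (hF y w.2)⟩

lemma IsEigen.one (z : CatCenter Y) : IsEigen z 1 1 :=
  ⟨VBundle.one Y, rfl, fun _ _ => by simp⟩

lemma IsEigen.mul {z : CatCenter Y} {lam mu : ℂ} {a b : VectIso Y} (ha : IsEigen z lam a)
    (hb : IsEigen z mu b) : IsEigen z (lam * mu) (a * b) := by
  obtain ⟨E, rfl, hE⟩ := ha
  obtain ⟨F, rfl, hF⟩ := hb
  refine ⟨E.tensor F, rfl, fun y w => ?_⟩
  induction w using TensorProduct.induction_on with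
  | zero => simp
  | tmul e f =>
    rw [TensorProduct.map_tmul, hE, hF, TensorProduct.smul_tmul_smul]
  | add e f he hf => rw [map_add, he, hf, smul_add]

lemma IsEigen.sum {z : CatCenter Y} {lam : ℂ} {κ : Type*} (s : Finset κ) {a : κ → VectIso Y}
    (ha : ∀ k ∈ s, IsEigen z lam (a k)) : IsEigen z lam (∑ k ∈ s, a k) := by
  classical
  induction s using Finset.induction_on with
  | empty => simpa using IsEigen.zero z lam
  | insert k s hk ih =>
    rw [Finset.sum_insert hk]
    exact (ha k (Finset.mem_insert_self _ _)).add
      (ih fun k' hk' => ha k' (Finset.mem_insert_of_mem hk'))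

lemma zetaPow_zero (z : CatCenter Y) : zetaPow z 0 = 1 := by simp [zetaPow]

lemma zetaPow_add (z : CatCenter Y) (m n : ℕ) :
    zetaPow z (m + n) = zetaPow z m * zetaPow z n := by
  rw [zetaPow, zetaPow, zetaPow, ← Complex.exp_add]
  congr 1
  push_cast
  ring

lemma zetaPow_pow_orderOf {z : CatCenter Y} (hz : IsOfFinOrder z) (n : ℕ) :
    zetaPow z n ^ orderOf z = 1 := by
  have h : (orderOf z : ℂ) ≠ 0 := by exact_mod_cast hz.orderOf_pos.ne'
  rw [zetaPow, ← Complex.exp_nat_mul, Complex.exp_eq_one_iff]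
  exact ⟨n, by field_simp; push_cast; ring⟩

/-- The semiring of isomorphism classes of formal power series `∑ V_n q^{n/r}` satisfying the rotation
condition with respect to `z`, where `r` is the order of `z`. -/
def RotSemiring (Y : Type u) [TopGpd.{u, v} Y] (z : CatCenter Y) :
    Subsemiring (PowerSeries (VectIso Y)) where
  carrier := {F | ∀ n, IsEigen z (zetaPow z n) (PowerSeries.coeff n F)}
  zero_mem' n := by simpa using IsEigen.zero z _
  add_mem' hF hG n := by rw [map_add]; exact (hF n).add (hG n)
  one_mem' n := by
    rw [PowerSeries.coeff_one]
    split_ifs with h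
    · rw [h, zetaPow_zero]; exact IsEigen.one z
    · exact IsEigen.zero z _
  mul_mem' hF hG n := by
    rw [PowerSeries.coeff_mul]
    refine IsEigen.sum _ fun k hk => ?_
    rw [← Finset.HasAntidiagonal.mem_antidiagonal.1 hk, zetaPow_add]
    exact (hF _).mul (hG _)

/-- `K_rot(Y, z)`: the Grothendieck ring of formal power series of vector bundles satisfying the
rotation condition. -/
abbrev KRot (Y : Type u) [TopGpd.{u, v} Y] (z : CatCenter Y) := GRing (RotSemiring Y z)

namespace RotSeries

variable {z : CatCenter Y}

/-- The isomorphism class of a series. -/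
def cls (V : RotSeries Y z) : RotSemiring Y z :=
  ⟨PowerSeries.mk fun n => VectIso.mk (V.V n), fun n => ⟨V.V n, by simp, V.rot n⟩⟩

lemma exists_rep (F : RotSemiring Y z) : ∃ V : RotSeries Y z, V.cls = F := by
  choose V h1 h2 using F.2
  exact ⟨⟨V, h2⟩, Subtype.ext (PowerSeries.ext fun n => by simp [cls, h1])⟩

end RotSeries

/-! ### Subbundles of invariants -/

namespace VBundle

variable {Y : Type u} [TopGpd.{u, v} Y]

/-- Averaging over the powers of an automorphism of finite order. -/
lemma exists_proj_cyc (E : VBundle Y) (U : ∀ y, E.fib y →ₗ[ℂ] E.fib y)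
    (hc : ∀ y, ∀ s ∈ E.contAt y, (fun x => U x (s x)) ∈ E.contAt y)
    {N : ℕ} (hN : 0 < N) (hU : ∀ y, U y ^ N = 1) :
    ∃ p : ∀ y, E.fib y →ₗ[ℂ] E.fib y,
      (∀ y, ∀ s ∈ E.contAt y, (fun x => p x (s x)) ∈ E.contAt y) ∧
      (∀ y w, U y (p y w) = p y w) ∧ ∀ y w, U y w = w → p y w = w := by
  have hN' : (N : ℂ) ≠ 0 := by exact_mod_cast hN.ne'
  refine ⟨fun y => (N : ℂ)⁻¹ • ∑ l ∈ Finset.range N, U y ^ l, fun y s hs => ?_, fun y w => ?_,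
    fun y w hw => ?_⟩
  · have h1 : ∀ l : ℕ, (fun x => (U x ^ l) (s x)) ∈ E.contAt y := by
      intro l
      induction l with
      | zero => simpa using hs
      | succ l ih =>
        have := hc y _ ih
        simpa only [pow_succ', Module.End.mul_apply] using this
    have h2 := E.locallyTrivial.sum_mem (κ := Fin N) (fun l => h1 l)
    have h3 := E.locallyTrivial.smul_mem (a := fun _ => (N : ℂ)⁻¹) continuousAt_const h2
    convert h3 using 2 with x
    simp [Finset.sum_range]
  · have h1 : U y * ∑ l ∈ Finset.range N, U y ^ l = ∑ l ∈ Finset.range N, U y ^ l := by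
      rw [Finset.mul_sum]
      simp_rw [← pow_succ']
      have h2 := Finset.sum_range_succ' (fun l => U y ^ l) N
      rw [Finset.sum_range_succ, pow_zero, hU y] at h2
      exact (add_right_cancel h2).symm
    have h3 := LinearMap.congr_fun h1 w
    simp only [Module.End.mul_apply] at h3
    simp only [LinearMap.smul_apply, map_smul]
    rw [h3]
  · have h1 : ∀ l : ℕ, (U y ^ l) w = w := by
      intro l
      induction l with
      | zero => simp
      | succ l ih => rw [pow_succ', Module.End.mul_apply, ih, hw]
    simp [h1]
    rw [← Nat.cast_smul_eq_nsmul ℂ, smul_smul, inv_mul_cancel₀ hN', one_smul]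

lemma act_pow_app (E : VBundle Y) (z : CatCenter Y) (l : ℕ) (y : Y) :
    (E.act (z.app y) : Module.End ℂ (E.fib y)) ^ l = E.act ((z ^ l).app y) := by
  induction l with
  | zero => ext w; simpa using (E.act_id y w).symm
  | succ l ih =>
    rw [pow_succ', ih]
    ext w
    rw [Module.End.mul_apply, ← E.act_comp, pow_succ]
    congr 2
    rw [CatCenter.mul_app, z.naturality]

/-- The subbundle on which the center element `z` acts as multiplication by `lam`, where `z` has
finite order `r` and `lam ^ r = 1`. -/
abbrev eigen (z : CatCenter Y) (hzc : Continuous fun y : Y => (⟨y, y, z.app y⟩ : Arr Y))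
    (hz : IsOfFinOrder z) (lam : ℂ) (hlam : lam ^ orderOf z = 1) (E : VBundle Y) : VBundle Y :=
  E.sub (fun y => LinearMap.eqLocus (E.act (z.app y)) (lam • LinearMap.id))
    (fun {x y} f w hw => by
      rw [LinearMap.mem_eqLocus] at hw ⊢
      rw [← E.act_comp, z.naturality, E.act_comp, hw]
      simp)
    (by
      have h0 : lam ≠ 0 := fun h => by
        rw [h, zero_pow hz.orderOf_pos.ne'] at hlam
        exact zero_ne_one hlam
      obtain ⟨p, h1, h2, h3⟩ := E.exists_proj_cyc (fun y => lam⁻¹ • E.act (z.app y))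
        (fun y s hs => by
          have h1 := E.act_along (fun y : Y => (⟨y, y, z.app y⟩ : Arr Y)) hzc.continuousAt
            (Fam.ContAlong.of_mem (φ := fun y : Y => y) hs)
          exact E.locallyTrivial.smul_mem (a := fun _ => lam⁻¹) continuousAt_const
            (E.locallyTrivial.mem h1))
        hz.orderOf_pos (fun y => by
          rw [smul_pow, E.act_pow_app, pow_orderOf_eq_one, inv_pow, hlam, inv_one, one_smul]
          ext w
          exact E.act_id y w)
      refine ⟨p, h1, fun y w => ?_, fun y w hw => h3 y w ?_⟩
      · have := h2 y w
        rw [LinearMap.smul_apply, inv_smul_eq_iff₀ h0] at this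
        exact this
      · rw [LinearMap.smul_apply, inv_smul_eq_iff₀ h0]
        exact hw)

/-- The limit of a finite groupoid `I` of vector bundles: the subbundle of compatible families inside
the direct sum. -/
abbrev lim {I : Type} [Groupoid.{0} I] [Fintype I] [∀ i j : I, Fintype (i ⟶ j)]
    (D : I → VBundle Y) (T : ∀ {i j : I}, (i ⟶ j) → ∀ y, (D i).fib y →ₗ[ℂ] (D j).fib y)
    (hnat : ∀ {i j : I} (f : i ⟶ j) {x y : Y} (a : x ⟶ y) (w : (D i).fib x),
      T f y ((D i).act a w) = (D j).act a (T f x w))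
    (hcont : ∀ {i j : I} (f : i ⟶ j) (y : Y), ∀ s ∈ (D i).contAt y,
      (fun x => T f x (s x)) ∈ (D j).contAt y)
    (hcomp : ∀ {i j k : I} (f : i ⟶ j) (g : j ⟶ k) (y : Y) (w : (D i).fib y),
      T (f ≫ g) y w = T g y (T f y w)) : VBundle Y :=
  (pi D).sub
    (fun y =>
      { carrier := {w | ∀ (i j : I) (f : i ⟶ j), T f y (w i) = w j}
        zero_mem' := fun i j f => map_zero _
        add_mem' := fun {w w'} h h' i j f => by
          change T f y (w i + w' i) = w j + w' j
          rw [map_add, h i j f, h' i j f]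
        smul_mem' := fun c w h i j f => by
          change T f y (c • w i) = c • w j
          rw [map_smul, h i j f] })
    (fun {x y} a w hw i j f => by
      change T f y ((D i).act a (w i)) = (D j).act a (w j)
      rw [hnat, hw i j f])
    (by
      have hpos : ∀ j : I, (Fintype.card (Σ i : I, (i ⟶ j)) : ℂ) ≠ 0 := fun j => by
        have : 0 < Fintype.card (Σ i : I, (i ⟶ j)) := Fintype.card_pos_iff.2 ⟨⟨j, 𝟙 j⟩⟩
        exact_mod_cast this.ne'
      refine ⟨fun y => LinearMap.pi fun j => (Fintype.card (Σ i : I, (i ⟶ j)) : ℂ)⁻¹ •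
        ∑ x : (Σ i : I, (i ⟶ j)), T x.2 y ∘ₗ LinearMap.proj x.1, fun y s hs j => ?_,
        fun y w i j f => ?_, fun y w hw => ?_⟩
      · have h1 := (D j).locallyTrivial.sum_mem (κ := Σ i : I, (i ⟶ j))
          (fun x => hcont x.2 y _ (hs x.1))
        have h2 := (D j).locallyTrivial.smul_mem
          (a := fun _ => (Fintype.card (Σ i : I, (i ⟶ j)) : ℂ)⁻¹) continuousAt_const h1
        convert h2 using 2 with x
        simp
      · let σ : (Σ k : I, (k ⟶ i)) ≃ (Σ k : I, (k ⟶ j)) :=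
          Equiv.sigmaCongrRight fun k =>
            ⟨fun g => g ≫ f, fun g => g ≫ Groupoid.inv f, fun g => by simp, fun g => by simp⟩
        simp only [LinearMap.pi_apply, LinearMap.smul_apply, LinearMap.sum_apply, map_smul, map_sum,
          LinearMap.comp_apply, LinearMap.proj_apply]
        rw [Fintype.card_congr σ, ← Equiv.sum_comp σ]
        congr 1
        refine Finset.sum_congr rfl fun x _ => ?_
        exact (hcomp x.2 f y _).symm
      · funext j
        simp only [LinearMap.pi_apply, LinearMap.smul_apply, LinearMap.sum_apply,
          LinearMap.comp_apply, LinearMap.proj_apply]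
        rw [Finset.sum_congr rfl fun x _ => hw x.1 j x.2]
        simp only [Finset.sum_const, Finset.card_univ]
        rw [← Nat.cast_smul_eq_nsmul ℂ, smul_smul, inv_mul_cancel₀ (hpos j), one_smul])

end VBundle

/-- A system of tensor products of vector bundles, parametrized by a finite groupoid `I`: for every
object `i` of `I` a finite collection `Q i j`, `j ∈ J i`, of bundles, and for every arrow `i ⟶ i'` of
`I` a bijection `J i ≃ J i'` together with maps between the corresponding bundles. -/
structure TensorSystem (I : Type) [Groupoid.{0} I] (Y : Type u) [TopGpd.{u, v} Y] where
  J : I → Type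
  [fin : ∀ i, Fintype (J i)]
  Q : ∀ i, J i → VBundle Y
  e : ∀ {i i' : I}, (i ⟶ i') → (J i ≃ J i')
  e_comp : ∀ {i i' i'' : I} (f : i ⟶ i') (g : i' ⟶ i'') (j : J i), e (f ≫ g) j = e g (e f j)
  tr : ∀ {i i' : I} (f : i ⟶ i') (j : J i) (j' : J i'), e f j = j' →
    ∀ y, (Q i j).fib y →ₗ[ℂ] (Q i' j').fib y
  tr_nat : ∀ {i i' : I} (f : i ⟶ i') (j : J i) (j' : J i') (h : e f j = j') {x y : Y} (a : x ⟶ y)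
    (w : (Q i j).fib x), tr f j j' h y ((Q i j).act a w) = (Q i' j').act a (tr f j j' h x w)
  tr_cont : ∀ {i i' : I} (f : i ⟶ i') (j : J i) (j' : J i') (h : e f j = j') (y : Y),
    ∀ s ∈ (Q i j).contAt y, (fun x => tr f j j' h x (s x)) ∈ (Q i' j').contAt y
  tr_comp : ∀ {i i' i'' : I} (f : i ⟶ i') (g : i' ⟶ i'') (j : J i) (j' : J i') (j'' : J i'')
    (h : e f j = j') (h' : e g j' = j'') (h'' : e (f ≫ g) j = j'') (y : Y) (w : (Q i j).fib y),
    tr (f ≫ g) j j'' h'' y w = tr g j' j'' h' y (tr f j j' h y w)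

attribute [instance] TensorSystem.fin

namespace TensorSystem

variable {I : Type} [Groupoid.{0} I] {Y : Type u} [TopGpd.{u, v} Y] (S : TensorSystem I Y)

/-- The tensor product `⨂_j Q i j`. -/
abbrev tensorAt (i : I) : VBundle Y := VBundle.piTensor (S.Q i)

/-- The map `⨂_j Q i j → ⨂_{j'} Q i' j'` induced by an arrow `i ⟶ i'`. -/
def T {i i' : I} (f : i ⟶ i') (y : Y) :
    (S.tensorAt i).fib y →ₗ[ℂ] (S.tensorAt i').fib y :=
  (PiTensorProduct.reindex ℂ (fun j' => (S.Q i' j').fib y) (S.e f).symm).symm.toLinearMap ∘ₗ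
    PiTensorProduct.map fun j => S.tr f j (S.e f j) rfl y

lemma T_tprod {i i' : I} (f : i ⟶ i') (y : Y) (w : ∀ j, (S.Q i j).fib y)
    (w' : ∀ j', (S.Q i' j').fib y)
    (h : ∀ j j' (hj : S.e f j = j'), w' j' = S.tr f j j' hj y (w j)) :
    S.T f y (PiTensorProduct.tprod ℂ w) = PiTensorProduct.tprod ℂ w' := by
  rw [T, LinearMap.comp_apply, LinearEquiv.coe_coe, LinearEquiv.symm_apply_eq,
    PiTensorProduct.map_tprod, PiTensorProduct.reindex_tprod]
  congr 1
  funext j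
  exact (h j _ rfl).symm

lemma exists_transport {i i' : I} (f : i ⟶ i') (y : Y) (w : ∀ j, (S.Q i j).fib y) :
    ∃ w' : ∀ j', (S.Q i' j').fib y,
      ∀ j j' (hj : S.e f j = j'), w' j' = S.tr f j j' hj y (w j) := by
  refine ⟨fun j' => S.tr f ((S.e f).symm j') j' (Equiv.apply_symm_apply _ _) y (w _), ?_⟩
  rintro j j' hj
  have : j = (S.e f).symm j' := by rw [← hj, Equiv.symm_apply_apply]
  subst this
  rfl

lemma T_ext {i : I} {y : Y} {A : Type*} [AddCommGroup A] [Module ℂ A]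
    {φ ψ : (S.tensorAt i).fib y →ₗ[ℂ] A}
    (h : ∀ w, φ (PiTensorProduct.tprod ℂ w) = ψ (PiTensorProduct.tprod ℂ w)) : φ = ψ :=
  PiTensorProduct.ext (MultilinearMap.ext h)

lemma T_nat {i i' : I} (f : i ⟶ i') {x y : Y} (a : x ⟶ y) (w : (S.tensorAt i).fib x) :
    S.T f y ((S.tensorAt i).act a w) = (S.tensorAt i').act a (S.T f x w) := by
  refine LinearMap.congr_fun (S.T_ext (φ := S.T f y ∘ₗ (S.tensorAt i).act a)
    (ψ := (S.tensorAt i').act a ∘ₗ S.T f x) fun w => ?_) w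
  obtain ⟨w', hw'⟩ := S.exists_transport f x w
  rw [LinearMap.comp_apply, LinearMap.comp_apply, S.T_tprod f x w w' hw',
    PiTensorProduct.map_tprod, PiTensorProduct.map_tprod]
  refine S.T_tprod f y _ _ fun j j' hj => ?_
  rw [S.tr_nat, hw' j j' hj]

lemma T_comp {i i' i'' : I} (f : i ⟶ i') (g : i' ⟶ i'') (y : Y) (w : (S.tensorAt i).fib y) :
    S.T (f ≫ g) y w = S.T g y (S.T f y w) := by
  refine LinearMap.congr_fun (S.T_ext (φ := S.T (f ≫ g) y) (ψ := S.T g y ∘ₗ S.T f y)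
    fun w => ?_) w
  obtain ⟨w', hw'⟩ := S.exists_transport f y w
  obtain ⟨w'', hw''⟩ := S.exists_transport g y w'
  rw [LinearMap.comp_apply, S.T_tprod f y w w' hw', S.T_tprod g y w' w'' hw'']
  refine S.T_tprod _ y _ _ fun j j'' hj => ?_
  have h' : S.e g (S.e f j) = j'' := by rw [← S.e_comp, hj]
  rw [S.tr_comp f g j _ j'' rfl h' hj, hw'' _ _ h', hw' j _ rfl]

lemma T_cont {i i' : I} (f : i ⟶ i') (y : Y) (s) (hs : s ∈ (S.tensorAt i).contAt y) :
    (fun x => S.T f x (s x)) ∈ (S.tensorAt i').contAt y := by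
  obtain ⟨κ, _, c, t, hc, ht, hs⟩ := hs
  refine ⟨κ, inferInstance, c, fun k j' x => S.tr f ((S.e f).symm j') j'
    (Equiv.apply_symm_apply _ _) x (t k _ x), hc, fun k j' => S.tr_cont f _ _ _ y _ (ht k _), ?_⟩
  filter_upwards [hs] with x hx
  rw [hx, map_sum]
  refine Finset.sum_congr rfl fun k _ => ?_
  rw [map_smul]
  congr 1
  refine S.T_tprod f x _ _ fun j j' hj => ?_
  have : j = (S.e f).symm j' := by rw [← hj, Equiv.symm_apply_apply]
  subst this
  rfl

/-- The limit over `I` of the tensor products `⨂_j Q i j`. -/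
abbrev lim [Fintype I] [∀ i j : I, Fintype (i ⟶ j)] : VBundle Y :=
  VBundle.lim S.tensorAt (fun f y => S.T f y) (fun f _ _ a w => S.T_nat f a w)
    (fun f y s hs => S.T_cont f y s hs) (fun f g y w => S.T_comp f g y w)

end TensorSystem

/-! ### Symmetric powers of series of bundles -/

/-- The exponents of the `q`-degree `m` part of an `n`-th tensor power. -/
def SymIdx (n m : ℕ) : Type := {a : Fin n → ℕ // ∑ i, a i = m}

namespace SymIdx

variable {n m : ℕ}

instance : Finite (SymIdx n m) := by
  refine Finite.of_injective (β := Fin n → Fin (m + 1)) (fun a i => ⟨a.1 i, ?_⟩) ?_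
  · have h := Finset.single_le_sum (f := a.1) (fun _ _ => Nat.zero_le _) (Finset.mem_univ i)
    rw [a.2] at h
    omega
  · intro a b h
    exact Subtype.ext (funext fun i => congrArg Fin.val (congrFun h i))

instance : Fintype (SymIdx n m) := Fintype.ofFinite _

/-- The symmetric group on `n` letters permutes the exponents. -/
instance : Groupoid.{0} (SymIdx n m) where
  Hom a b := {τ : Equiv.Perm (Fin n) // ∀ i, a.1 i = b.1 (τ i)}
  id a := ⟨1, fun _ => rfl⟩
  comp f g := ⟨g.1 * f.1, fun i => (f.2 i).trans (g.2 _)⟩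
  inv {a b} f := ⟨f.1⁻¹, fun i => by
    rw [f.2]; exact congrArg b.1 (f.1.apply_symm_apply i).symm⟩
  id_comp _ := rfl
  comp_id _ := rfl
  assoc _ _ _ := rfl
  inv_comp f := Subtype.ext (mul_inv_cancel f.1)
  comp_inv f := Subtype.ext (inv_mul_cancel f.1)

instance (a b : SymIdx n m) : Fintype (a ⟶ b) :=
  Fintype.ofInjective (β := Equiv.Perm (Fin n)) Subtype.val Subtype.val_injective

end SymIdx

lemma VBundle.piTensor_act_tprod {Y : Type u} [TopGpd.{u, v} Y] {J : Type} [Fintype J]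
    (E : J → VBundle Y) {x y : Y} (f : x ⟶ y) (mu : J → ℂ) (lam : ℂ) (hlam : ∏ j, mu j = lam)
    (w : ∀ j, (E j).fib x) (w' : ∀ j, (E j).fib y) (h : ∀ j, (E j).act f (w j) = mu j • w' j) :
    (VBundle.piTensor E).act f (PiTensorProduct.tprod ℂ w) =
      lam • PiTensorProduct.tprod ℂ w' := by
  rw [PiTensorProduct.map_tprod, funext h, MultilinearMap.map_smul_univ, hlam]

lemma VBundle.piTensor_act_smul {Y : Type u} [TopGpd.{u, v} Y] {J : Type} [Fintype J]
    (E : J → VBundle Y) {y : Y} (f : y ⟶ y) (mu : J → ℂ) (lam : ℂ) (hlam : ∏ j, mu j = lam)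
    (h : ∀ j w, (E j).act f w = mu j • w) (w : (VBundle.piTensor E).fib y) :
    (VBundle.piTensor E).act f w = lam • w :=
  LinearMap.congr_fun (PiTensorProduct.ext (MultilinearMap.ext fun w =>
    VBundle.piTensor_act_tprod E f mu lam hlam w w fun j => h j _) :
      (VBundle.piTensor E).act f = lam • LinearMap.id) w

namespace RotSeries

variable {Y : Type u} [TopGpd.{u, v} Y] {z : CatCenter Y}

/-- The identity map between equal coefficients. -/
def tp (V : RotSeries Y z) {a b : ℕ} (h : a = b) (y : Y) : (V.V a).fib y →ₗ[ℂ] (V.V b).fib y := by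
  subst h
  exact LinearMap.id

lemma tp_act (V : RotSeries Y z) {a b : ℕ} (h : a = b) {x y : Y} (f : x ⟶ y)
    (w : (V.V a).fib x) : V.tp h y ((V.V a).act f w) = (V.V b).act f (V.tp h x w) := by
  subst h
  rfl

lemma tp_cont (V : RotSeries Y z) {a b : ℕ} (h : a = b) (y : Y) (s) (hs : s ∈ (V.V a).contAt y) :
    (fun x => V.tp h x (s x)) ∈ (V.V b).contAt y := by
  subst h
  exact hs

lemma tp_trans (V : RotSeries Y z) {a b c : ℕ} (h : a = b) (h' : b = c) (h'' : a = c) (y : Y)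
    (w : (V.V a).fib y) : V.tp h'' y w = V.tp h' y (V.tp h y w) := by
  subst h h'
  rfl

/-- The tensor products `V_{a 0} ⊗ ⋯ ⊗ V_{a (n-1)}` with `∑ a i = m`, permuted by the symmetric
group. -/
def symSystem (V : RotSeries Y z) (n m : ℕ) : TensorSystem (SymIdx n m) Y where
  J _ := Fin n
  Q a i := V.V (a.1 i)
  e f := f.1
  e_comp _ _ _ := rfl
  tr {a b} f j j' h y := V.tp ((f.2 j).trans (congrArg b.1 h)) y
  tr_nat f j j' h _ _ x w := V.tp_act _ x w
  tr_cont f j j' h y s hs := V.tp_cont _ y s hs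
  tr_comp f g j j' j'' h h' h'' y w := V.tp_trans _ _ _ y w

/-- The `n`-th symmetric power of the series `∑ V_a q^{a/r}`, i.e. the part of
`(∑ V_a q^{a/r})^{⊗ n}` that is invariant under the symmetric group.  Its coefficient in degree `m`
consists of the invariants of the symmetric group in the direct sum of all the bundles
`V_{a 0} ⊗ ⋯ ⊗ V_{a (n-1)}` with `∑ a i = m`. -/
def sym (n : ℕ) (V : RotSeries Y z) : RotSeries Y z where
  V m := (V.symSystem n m).lim
  rot m y w := by
    refine Subtype.ext (funext fun a => ?_)
    refine VBundle.piTensor_act_smul _ _ (fun i => zetaPow z (a.1 i)) (zetaPow z m) ?_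
      (fun i => V.rot (a.1 i) y) (w.1 a)
    have h2 : ∀ (s : Finset (Fin n)) (b : Fin n → ℕ),
        ∏ i ∈ s, zetaPow z (b i) = zetaPow z (∑ i ∈ s, b i) := by
      intro s b
      induction s using Finset.induction_on with
      | empty => simp [zetaPow_zero]
      | insert k s hk ih => rw [Finset.prod_insert hk, Finset.sum_insert hk, ih, zetaPow_add]
    exact (h2 _ _).trans (congrArg _ a.2)

end RotSeries

/-! ### Symmetric powers in Tate K-theory -/

/-- The set of orbits (cycles, including the fixed points) of a permutation. -/
def Orb {n : ℕ} (σ : Equiv.Perm (Fin n)) : Type := Quotient (Equiv.Perm.SameCycle.setoid σ)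

namespace Orb

variable {n : ℕ}

/-- The orbit of `i`. -/
def mk (σ : Equiv.Perm (Fin n)) (i : Fin n) : Orb σ := Quotient.mk _ i

lemma mk_eq {σ : Equiv.Perm (Fin n)} {i j : Fin n} : mk σ i = mk σ j ↔ σ.SameCycle i j :=
  Quotient.eq (r := Equiv.Perm.SameCycle.setoid σ)

lemma ind {σ : Equiv.Perm (Fin n)} {P : Orb σ → Prop} (h : ∀ i, P (mk σ i)) (c : Orb σ) : P c :=
  Quotient.inductionOn c h

lemma mk_apply (σ : Equiv.Perm (Fin n)) (i : Fin n) : mk σ (σ i) = mk σ i :=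
  mk_eq.2 (Equiv.Perm.sameCycle_apply_left.2 (Equiv.Perm.SameCycle.refl σ i))

instance (σ : Equiv.Perm (Fin n)) : Finite (Orb σ) :=
  inferInstanceAs (Finite (Quotient (Equiv.Perm.SameCycle.setoid σ)))

instance (σ : Equiv.Perm (Fin n)) : Fintype (Orb σ) := Fintype.ofFinite _

/-- The elements of an orbit. -/
abbrev Elt {σ : Equiv.Perm (Fin n)} (c : Orb σ) : Type := {i : Fin n // mk σ i = c}

instance {σ : Equiv.Perm (Fin n)} (c : Orb σ) : Fintype (Elt c) := Fintype.ofFinite _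

/-- The length of an orbit. -/
def len {σ : Equiv.Perm (Fin n)} (c : Orb σ) : ℕ := Nat.card (Elt c)

lemma len_pos {σ : Equiv.Perm (Fin n)} (c : Orb σ) : 0 < len c := by
  induction c using ind with
  | h i => exact Nat.card_pos_iff.2 ⟨⟨⟨i, rfl⟩⟩, inferInstance⟩

lemma len_le {σ : Equiv.Perm (Fin n)} (c : Orb σ) : len c ≤ n := by
  have := Nat.card_le_card_of_injective (Subtype.val : Elt c → Fin n) Subtype.val_injective
  exact this.trans_eq (by simp)

/-- The cyclic permutation that `σ` induces on an orbit. -/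
def rotate {σ : Equiv.Perm (Fin n)} (c : Orb σ) : Equiv.Perm (Elt c) :=
  σ.subtypePerm fun i => by rw [mk_apply]

lemma sameCycle_conj {σ σ' τ : Equiv.Perm (Fin n)} (h : τ * σ = σ' * τ) (i j : Fin n) :
    σ'.SameCycle (τ i) (τ j) ↔ σ.SameCycle i j := by
  have h1 : σ' = τ * σ * τ⁻¹ := by rw [h, mul_inv_cancel_right]
  rw [h1, Equiv.Perm.sameCycle_conj]
  simp

/-- The bijection between orbits induced by a permutation `τ` with `τ σ = σ' τ`. -/
def equiv {σ σ' : Equiv.Perm (Fin n)} (τ : Equiv.Perm (Fin n)) (h : τ * σ = σ' * τ) :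
    Orb σ ≃ Orb σ' :=
  Quotient.congr τ fun i j => (sameCycle_conj h i j).symm

lemma equiv_mk {σ σ' : Equiv.Perm (Fin n)} (τ : Equiv.Perm (Fin n)) (h : τ * σ = σ' * τ)
    (i : Fin n) : equiv τ h (mk σ i) = mk σ' (τ i) := rfl

lemma equiv_mk' {σ σ' : Equiv.Perm (Fin n)} (τ : Equiv.Perm (Fin n)) (h : τ * σ = σ' * τ)
    {c : Orb σ} {c' : Orb σ'} (hc : equiv τ h c = c') (i : Fin n) :
    mk σ (τ⁻¹ i) = c ↔ mk σ' i = c' := by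
  rw [← hc, ← (equiv τ h).injective.eq_iff, equiv_mk]
  exact iff_of_eq (congrArg (fun j => mk σ' j = _) (τ.apply_symm_apply i))

lemma len_equiv {σ σ' : Equiv.Perm (Fin n)} (τ : Equiv.Perm (Fin n)) (h : τ * σ = σ' * τ)
    {c : Orb σ} {c' : Orb σ'} (hc : equiv τ h c = c') : len c = len c' :=
  (Nat.card_congr ((τ⁻¹).subtypeEquiv fun i => (equiv_mk' τ h hc i).symm)).symm

end Orb

/-- The index set of the `q`-degree `m` part of an `n`-th symmetric power in Tate K-theory (in units of
`1 / r`): a permutation, i.e. an object of the inertia groupoid of the symmetric group, together with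
an exponent `a c` for every cycle `c`.  A cycle `c` of length `k` contributes `a c / k` to the
degree. -/
structure TateIdx (n m : ℕ) : Type where
  perm : Equiv.Perm (Fin n)
  a : Orb perm → ℕ
  sum_eq : ∑ c, (a c : ℚ) / Orb.len c = m

namespace TateIdx

variable {n m : ℕ}

lemma a_lt (p : TateIdx n m) (c : Orb p.perm) : p.a c < m * n + 1 := by
  have h1 : (p.a c : ℚ) / Orb.len c ≤ m := by
    rw [← p.sum_eq]
    exact Finset.single_le_sum (f := fun c => (p.a c : ℚ) / Orb.len c) (fun _ _ => by positivity)
      (Finset.mem_univ c)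
  have h2 : (0 : ℚ) < Orb.len c := by exact_mod_cast Orb.len_pos c
  rw [div_le_iff₀ h2] at h1
  have h3 : p.a c ≤ m * Orb.len c := by exact_mod_cast h1
  have h4 := Nat.mul_le_mul_left m (Orb.len_le c)
  omega

instance : Finite (TateIdx n m) := by
  refine Finite.of_injective (β := Σ σ : Equiv.Perm (Fin n), (Orb σ → Fin (m * n + 1)))
    (fun p => ⟨p.perm, fun c => ⟨p.a c, p.a_lt c⟩⟩) ?_
  rintro ⟨σ, a, ha⟩ ⟨σ', a', ha'⟩ h
  obtain ⟨h1, h2⟩ := Sigma.mk.inj h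
  dsimp only at h1
  subst h1
  have h3 : a = a' := funext fun c => congrArg Fin.val (congrFun (eq_of_heq h2) c)
  subst h3
  rfl

instance : Fintype (TateIdx n m) := Fintype.ofFinite _

/-- The symmetric group acts by conjugation on the permutations, and correspondingly on the
cycles. -/
instance : Groupoid.{0} (TateIdx n m) where
  Hom p p' := {τ : Equiv.Perm (Fin n) // τ * p.perm = p'.perm * τ ∧
    ∀ i, p.a (Orb.mk p.perm i) = p'.a (Orb.mk p'.perm (τ i))}
  id a := ⟨1, rfl, fun _ => rfl⟩
  comp f g := ⟨g.1 * f.1, by rw [mul_assoc, f.2.1, ← mul_assoc, g.2.1, mul_assoc],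
    fun i => (f.2.2 i).trans (g.2.2 _)⟩
  inv {p p'} f := ⟨f.1⁻¹, by rw [inv_mul_eq_iff_eq_mul, ← mul_assoc, f.2.1, mul_inv_cancel_right],
    fun i => by
      rw [f.2.2]
      exact congrArg (fun j => p'.a (Orb.mk p'.perm j)) (f.1.apply_symm_apply i).symm⟩
  id_comp _ := rfl
  comp_id _ := rfl
  assoc _ _ _ := rfl
  inv_comp f := Subtype.ext (mul_inv_cancel f.1)
  comp_inv f := Subtype.ext (inv_mul_cancel f.1)

instance (p p' : TateIdx n m) : Fintype (p ⟶ p') :=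
  Fintype.ofInjective (β := Equiv.Perm (Fin n)) Subtype.val Subtype.val_injective

lemma a_eq {p p' : TateIdx n m} (f : p ⟶ p') (c : Orb p.perm) (c' : Orb p'.perm)
    (h : Orb.equiv f.1 f.2.1 c = c') : p.a c = p'.a c' := by
  subst h
  induction c using Orb.ind with
  | h i => exact f.2.2 i

end TateIdx
namespace Inertia

variable {X : Type u} [TopGpd.{u, v} X]

lemma xi_pow_arr (k : ℕ) (a : Inertia X) : Hom.arr ((xi X ^ k).app a) = loopPow a.loop k := by
  induction k with
  | zero => rfl
  | succ k ih =>
    rw [pow_succ, CatCenter.mul_app, comp_arr, ih]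
    rfl

lemma powerMap_xi_pow (k : ℕ) (a : Inertia X) :
    (powerMap X k).map ((xi X ^ k).app a) = (xi X).app ((powerMap X k).obj a) :=
  hom_ext (xi_pow_arr k a)

end Inertia

namespace RotSeries

variable {X : Type u} [TopGpd.{u, v} X]

/-- The pullback of the coefficient `V_a` along the `k`-th power map. -/
abbrev pullPow (V : RotSeries (Inertia X) (Inertia.xi X)) (k a : ℕ) : VBundle (Inertia X) :=
  (V.V a).pull (Inertia.powerMap X k) (contFunctor_powerMap X k)

/-- The number `e^{2π i a / (r k)}`, where `r` is the order of `ξ`. -/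
def rootPow (X : Type u) [TopGpd.{u, v} X] (k a : ℕ) : ℂ :=
  Complex.exp (2 * Real.pi * Complex.I * (a / (orderOf (Inertia.xi X) * k)))

lemma rootPow_pow {k : ℕ} (hk : 0 < k) (a : ℕ) : rootPow X k a ^ k = zetaPow (Inertia.xi X) a := by
  have h : (k : ℂ) ≠ 0 := by exact_mod_cast hk.ne'
  rw [rootPow, zetaPow, ← Complex.exp_nat_mul]
  congr 1
  field_simp

lemma pullPow_act (V : RotSeries (Inertia X) (Inertia.xi X)) (k a : ℕ) (y : Inertia X)
    (w : (V.pullPow k a).fib y) :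
    (V.pullPow k a).act ((Inertia.xi X ^ k).app y) w = zetaPow (Inertia.xi X) a • w := by
  rw [← V.rot a ((Inertia.powerMap X k).obj y) w]
  exact congrArg (fun f => (V.V a).act f w) (Inertia.powerMap_xi_pow k y)

/-- The bundle over `ΛX` that a cycle `c` of length `k` and the summand `V_a q^{a/r}` of `V`
contribute to the power operation of Tate K-theory on the diagonal of the symmetric power of `X`.
Its fibre at `(x, g)` is the fibre of `V_a` at `(x, g ^ k)`, and the cyclic permutation of the cycle
acts on it as `e^{2π i a / (r k)} g⁻¹`.  In order to avoid the choice of a base point of the cycle, the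
elements of the fibre are written as the families `w i`, `i ∈ c`, such that
`g (w i) = e^{2π i a / (r k)} w (σ i)`; the permutations of the letters permute the indices. -/
abbrev theta (V : RotSeries (Inertia X) (Inertia.xi X)) {n : ℕ} {σ : Equiv.Perm (Fin n)}
    (c : Orb σ) (a : ℕ) : VBundle (Inertia X) :=
  (VBundle.pi fun _ : Orb.Elt c => V.pullPow (Orb.len c) a).sub
    (fun y =>
      { carrier := {w | ∀ i : Orb.Elt c, (V.pullPow (Orb.len c) a).act ((Inertia.xi X).app y) (w i) =
          rootPow X (Orb.len c) a • w (Orb.rotate c i)}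
        zero_mem' := fun i => by
          change (V.pullPow (Orb.len c) a).act ((Inertia.xi X).app y) 0 =
            rootPow X (Orb.len c) a • 0
          rw [map_zero, smul_zero]
        add_mem' := fun {w w'} h h' i => by
          change (V.pullPow (Orb.len c) a).act ((Inertia.xi X).app y) (w i + w' i) =
            rootPow X (Orb.len c) a • (w (Orb.rotate c i) + w' (Orb.rotate c i))
          rw [map_add, h i, h' i, smul_add]
        smul_mem' := fun t w h i => by
          change (V.pullPow (Orb.len c) a).act ((Inertia.xi X).app y) (t • w i) =
            rootPow X (Orb.len c) a • (t • w (Orb.rotate c i))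
          rw [map_smul, h i, smul_comm] })
    (fun {x y} f w hw i => by
      change (V.pullPow (Orb.len c) a).act ((Inertia.xi X).app y)
        ((V.pullPow (Orb.len c) a).act f (w i)) = rootPow X (Orb.len c) a •
          (V.pullPow (Orb.len c) a).act f (w (Orb.rotate c i))
      rw [← VBundle.act_comp, (Inertia.xi X).naturality, VBundle.act_comp, hw i, map_smul])
    (by
      have hk := Orb.len_pos c
      have hr : 0 < orderOf (Orb.rotate c) := orderOf_pos _
      have h0 : rootPow X (Orb.len c) a ≠ 0 := Complex.exp_ne_zero _
      let B : VBundle (Inertia X) := VBundle.pi fun _ : Orb.Elt c => V.pullPow (Orb.len c) a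
      let A : ∀ y, Module.End ℂ (B.fib y) := fun y => B.act ((Inertia.xi X).app y)
      let S : ∀ y, Module.End ℂ (B.fib y) := fun y =>
        LinearMap.funLeft ℂ ((V.pullPow (Orb.len c) a).fib y) ⇑(Orb.rotate c)⁻¹
      have hS : ∀ y (l : ℕ), S y ^ l = LinearMap.funLeft ℂ _ ⇑((Orb.rotate c)⁻¹ ^ l) := by
        intro y l
        induction l with
        | zero => rfl
        | succ l ih => rw [pow_succ, ih, pow_succ']; rfl
      have hAS : ∀ y, Commute (A y) (S y) := fun y => LinearMap.ext fun w => rfl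
      have hA : ∀ y, A y ^ Orb.len c = zetaPow (Inertia.xi X) a • (1 : Module.End ℂ (B.fib y)) := by
        intro y
        rw [VBundle.act_pow_app]
        refine LinearMap.ext fun w => funext fun i => ?_
        exact V.pullPow_act (Orb.len c) a y (w i)
      have hc : ∀ y, ∀ s ∈ B.contAt y,
          (fun x => ((rootPow X (Orb.len c) a)⁻¹ • (A x * S x)) (s x)) ∈ B.contAt y := by
        intro y s hs i
        have h1 := (V.pullPow (Orb.len c) a).act_along
          (fun y : Inertia X => (⟨y, y, (Inertia.xi X).app y⟩ : Arr (Inertia X)))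
          Inertia.continuous_xi.continuousAt
          (Fam.ContAlong.of_mem (φ := fun y : Inertia X => y) (hs ((Orb.rotate c)⁻¹ i)))
        exact (V.pullPow (Orb.len c) a).locallyTrivial.smul_mem
          (a := fun _ => (rootPow X (Orb.len c) a)⁻¹) continuousAt_const
          ((V.pullPow (Orb.len c) a).locallyTrivial.mem h1)
      have hU : ∀ y, ((rootPow X (Orb.len c) a)⁻¹ • (A y * S y)) ^
          (Orb.len c * orderOf (Orb.rotate c)) = 1 := by
        intro y
        have h6 : zetaPow (Inertia.xi X) a ≠ 0 := Complex.exp_ne_zero _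
        have h7 : ((Orb.rotate c)⁻¹) ^ (Orb.len c * orderOf (Orb.rotate c)) = 1 := by
          rw [mul_comm, pow_mul, inv_pow, pow_orderOf_eq_one, inv_one, one_pow]
        have h8 : S y ^ (Orb.len c * orderOf (Orb.rotate c)) = 1 := by rw [hS, h7]; rfl
        rw [smul_pow, (hAS y).mul_pow, h8, mul_one, pow_mul (A y), hA, smul_pow, one_pow, pow_mul,
          inv_pow, rootPow_pow hk, smul_smul, ← mul_pow, inv_mul_cancel₀ h6, one_pow, one_smul]
      obtain ⟨p, h1, h2, h3⟩ := B.exists_proj_cyc _ hc (Nat.mul_pos hk hr) hU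
      refine ⟨p, h1, fun y w i => ?_, fun y w hw => h3 y w (funext fun i => ?_)⟩
      · have h5 : (rootPow X (Orb.len c) a)⁻¹ • (V.pullPow (Orb.len c) a).act
            ((Inertia.xi X).app y) (p y w ((Orb.rotate c)⁻¹ (Orb.rotate c i))) =
              p y w (Orb.rotate c i) := congrFun (h2 y w) (Orb.rotate c i)
        rw [show (Orb.rotate c)⁻¹ (Orb.rotate c i) = i from (Orb.rotate c).symm_apply_apply i,
          inv_smul_eq_iff₀ h0] at h5
        exact h5
      · change (rootPow X (Orb.len c) a)⁻¹ • (V.pullPow (Orb.len c) a).act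
            ((Inertia.xi X).app y) (w ((Orb.rotate c)⁻¹ i)) = w i
        rw [hw, inv_smul_smul₀ h0]
        exact congrArg w ((Orb.rotate c).apply_symm_apply i))

/-- The identity map between equal pullbacks of equal coefficients. -/
def tpPow (V : RotSeries (Inertia X) (Inertia.xi X)) {k k' a a' : ℕ} (hk : k = k') (ha : a = a')
    (y : Inertia X) : (V.pullPow k a).fib y →ₗ[ℂ] (V.pullPow k' a').fib y := by
  subst hk ha
  exact LinearMap.id

lemma tpPow_act (V : RotSeries (Inertia X) (Inertia.xi X)) {k k' a a' : ℕ} (hk : k = k')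
    (ha : a = a') {x y : Inertia X} (f : x ⟶ y) (w : (V.pullPow k a).fib x) :
    V.tpPow hk ha y ((V.pullPow k a).act f w) = (V.pullPow k' a').act f (V.tpPow hk ha x w) := by
  subst hk ha
  rfl

lemma tpPow_cont (V : RotSeries (Inertia X) (Inertia.xi X)) {k k' a a' : ℕ} (hk : k = k')
    (ha : a = a') (y : Inertia X) (s) (hs : s ∈ (V.pullPow k a).contAt y) :
    (fun x => V.tpPow hk ha x (s x)) ∈ (V.pullPow k' a').contAt y := by
  subst hk ha
  exact hs

lemma tpPow_trans (V : RotSeries (Inertia X) (Inertia.xi X)) {k k' k'' a a' a'' : ℕ} (hk : k = k')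
    (ha : a = a') (hk' : k' = k'') (ha' : a' = a'') (hk'' : k = k'') (ha'' : a = a'')
    (y : Inertia X) (w : (V.pullPow k a).fib y) :
    V.tpPow hk'' ha'' y w = V.tpPow hk' ha' y (V.tpPow hk ha y w) := by
  subst hk ha hk' ha'
  rfl

lemma rotate_inv_conj {n : ℕ} {σ σ' : Equiv.Perm (Fin n)} (τ : Equiv.Perm (Fin n))
    (h : τ * σ = σ' * τ) (i : Fin n) : τ⁻¹ (σ' i) = σ (τ⁻¹ i) := by
  rw [Equiv.Perm.inv_eq_iff_eq]
  have := congrArg (fun f : Equiv.Perm (Fin n) => f (τ⁻¹ i)) h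
  simpa using this.symm

/-- The tensor products `⨂_c θ(c, a c)` over the cycles of a permutation, permuted by the symmetric
group. -/
def tateSystem (V : RotSeries (Inertia X) (Inertia.xi X)) (n m : ℕ) :
    TensorSystem (TateIdx n m) (Inertia X) where
  J p := Orb p.perm
  Q p c := V.theta c (p.a c)
  e f := Orb.equiv f.1 f.2.1
  e_comp f g c := by
    induction c using Orb.ind with
    | h i => rfl
  tr {p p'} f c c' h y :=
    { toFun := fun w => ⟨fun j => V.tpPow (Orb.len_equiv f.1 f.2.1 h) (TateIdx.a_eq f c c' h) y
          (w.1 ⟨f.1⁻¹ j.1, (Orb.equiv_mk' f.1 f.2.1 h j.1).2 j.2⟩), fun j => by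
        have hw := w.2 ⟨f.1⁻¹ j.1, (Orb.equiv_mk' f.1 f.2.1 h j.1).2 j.2⟩
        have hr : rootPow X (Orb.len c') (p'.a c') = rootPow X (Orb.len c) (p.a c) := by
          rw [Orb.len_equiv f.1 f.2.1 h, TateIdx.a_eq f c c' h]
        have hj : Orb.rotate c ⟨f.1⁻¹ j.1, (Orb.equiv_mk' f.1 f.2.1 h j.1).2 j.2⟩ =
            ⟨f.1⁻¹ (Orb.rotate c' j).1, (Orb.equiv_mk' f.1 f.2.1 h _).2 (Orb.rotate c' j).2⟩ :=
          Subtype.ext (rotate_inv_conj f.1 f.2.1 j.1).symm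
        rw [hj] at hw
        dsimp only
        rw [← V.tpPow_act, hw, map_smul, hr]⟩
      map_add' := fun w w' => Subtype.ext (funext fun j => map_add _ _ _)
      map_smul' := fun t w => Subtype.ext (funext fun j => map_smul _ _ _) }
  tr_nat f c c' h _ _ b w := Subtype.ext (funext fun j => V.tpPow_act _ _ b _)
  tr_cont f c c' h y s hs j := V.tpPow_cont _ _ y _ (hs _)
  tr_comp f g c c' c'' h h' h'' y w := Subtype.ext (funext fun j => V.tpPow_trans _ _ _ _ _ _ y _)

/-- The `n`-th symmetric power in Tate K-theory of the series `V = ∑ V_a q^{a/r}`: the power operation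
of Tate K-theory, restricted to the diagonal `ΛX × ΛB(S_n)` and pushed forward to `ΛX`.  Its fibre at
`(x, g)` is the space of invariants of the symmetric group in
`⨁_σ ⨂_{c cycle of σ} ⨁_a θ(c, a) q^{a/(r |c|)}`.  (The rotation condition forces the summands with
exponents outside `(1/r)ℕ` to have no nonzero invariants.) -/
def tateSym (n : ℕ) (V : RotSeries (Inertia X) (Inertia.xi X)) :
    RotSeries (Inertia X) (Inertia.xi X) where
  V m := (V.tateSystem n m).lim
  rot m y w := by
    refine Subtype.ext (funext fun p => ?_)
    let f : p ⟶ p := ⟨p.perm, rfl, fun i => congrArg p.a (Orb.mk_apply p.perm i).symm⟩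
    have key : ((V.tateSystem n m).tensorAt p).act ((Inertia.xi X).app y) ∘ₗ
        (V.tateSystem n m).T f y = zetaPow (Inertia.xi X) m • LinearMap.id := by
      refine (V.tateSystem n m).T_ext fun w => ?_
      obtain ⟨w', hw'⟩ := (V.tateSystem n m).exists_transport f y w
      rw [LinearMap.comp_apply, (V.tateSystem n m).T_tprod f y w w' hw']
      refine VBundle.piTensor_act_tprod _ _
        (fun c : Orb p.perm => rootPow X (Orb.len c) (p.a c)) _ ?_ w' w ?_
      · have h2 : ∀ c : Orb p.perm, rootPow X (Orb.len c) (p.a c) = Complex.exp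
            (2 * Real.pi * Complex.I / orderOf (Inertia.xi X) *
              ((p.a c : ℚ) / Orb.len c : ℚ)) := by
          intro c
          rw [rootPow]
          congr 1
          push_cast
          rw [div_mul_div_comm, mul_div_assoc]
        simp only [h2]
        rw [← Complex.exp_sum, ← Finset.mul_sum, ← Rat.cast_sum, p.sum_eq, zetaPow]
        congr 1
        push_cast
        rw [div_mul_eq_mul_div, mul_div_assoc]
      · intro c
        have hc : Orb.equiv f.1 f.2.1 c = c := by
          induction c using Orb.ind with
          | h i => exact Orb.mk_apply p.perm i
        have hw := hw' c c hc
        rw [hw]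
        refine Subtype.ext (funext fun i => ?_)
        have h4 := (w c).2 ⟨p.perm⁻¹ i.1, (Orb.equiv_mk' p.perm rfl hc i.1).2 i.2⟩
        have h5 : Orb.rotate c ⟨p.perm⁻¹ i.1, (Orb.equiv_mk' p.perm rfl hc i.1).2 i.2⟩ = i :=
          Subtype.ext (p.perm.apply_symm_apply i.1)
        rw [h5] at h4
        exact h4
    have h1 := LinearMap.congr_fun key (w.1 p)
    rw [LinearMap.comp_apply, w.2 p p f] at h1
    exact h1

end RotSeries
/-! ### The operators `β_k` -/

namespace VectIso

variable {Y : Type u} [TopGpd.{u, v} Y] {Z : Type u} [TopGpd.{u, v} Z]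

/-- The additive map on isomorphism classes induced by an additive construction. -/
def mapHom (Psi : VBundle Y → VBundle Z)
    (h : ∀ E F, VBundle.Iso E F → Nonempty (VBundle.Iso (Psi E) (Psi F)))
    (h0 : Nonempty (VBundle.Iso (Psi (VBundle.zero Y)) (VBundle.zero Z)))
    (hadd : ∀ E F, Nonempty (VBundle.Iso (Psi (E.prod F)) ((Psi E).prod (Psi F)))) :
    VectIso Y →+ VectIso Z where
  toFun := Quotient.map Psi fun E F ⟨i⟩ => h E F i
  map_zero' := Quotient.sound h0
  map_add' := by
    rintro ⟨E⟩ ⟨F⟩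
    exact Quotient.sound (hadd E F)

/-- Pullback of isomorphism classes of bundles along a continuous functor. -/
def pull (Phi : Z ⥤ Y) (hPhi : ContFunctor Phi) : VectIso Y →+ VectIso Z :=
  mapHom (VBundle.pull Phi hPhi)
    (fun E F i => ⟨{
      equiv := fun y => i.equiv (Phi.obj y)
      nat := fun f w => i.nat (Phi.map f) w
      cont := fun y s => by
        constructor
        · rintro ⟨κ, _, a, u, ha, hu, hs⟩
          refine ⟨κ, inferInstance, a, fun k x => i.equiv x (u k x), ha,
            fun k => (i.cont _ _).1 (hu k), ?_⟩
          filter_upwards [hs] with x hx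
          rw [hx, map_sum]
          simp
        · rintro ⟨κ, _, a, u, ha, hu, hs⟩
          refine ⟨κ, inferInstance, a, fun k x => (i.equiv x).symm (u k x), ha,
            fun k => (i.symm.cont _ _).1 (hu k), ?_⟩
          filter_upwards [hs] with x hx
          rw [← LinearEquiv.eq_symm_apply] at hx
          rw [hx, map_sum]
          simp }⟩)
    ⟨{ equiv := fun y => LinearEquiv.refl _ _
       nat := fun f w => rfl
       cont := fun y s => ⟨fun _ => trivial, fun _ => ⟨Empty, inferInstance, fun i => i.elim,
         fun i => i.elim, fun i => i.elim, fun i => i.elim, Eventually.of_forall fun x => rfl⟩⟩ }⟩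
    (fun E F => ⟨{
      equiv := fun y => LinearEquiv.refl _ _
      nat := fun f w => rfl
      cont := fun y s => by
        constructor
        · rintro ⟨κ, _, a, u, ha, hu, hs⟩
          refine ⟨⟨κ, inferInstance, a, fun k x => (u k x).1, ha, fun k => (hu k).1, ?_⟩,
            ⟨κ, inferInstance, a, fun k x => (u k x).2, ha, fun k => (hu k).2, ?_⟩⟩
          · filter_upwards [hs] with x hx
            have := congrArg Prod.fst hx
            simpa [Prod.fst_sum] using this
          · filter_upwards [hs] with x hx
            have := congrArg Prod.snd hx
            simpa [Prod.snd_sum] using this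
        · rintro ⟨⟨κ, _, a, u, ha, hu, hs⟩, ⟨κ', _, a', u', ha', hu', hs'⟩⟩
          refine ⟨κ ⊕ κ', inferInstance, Sum.elim a a',
            fun k x => Sum.elim (fun k => (u k x, 0)) (fun k => (0, u' k x)) k, ?_, ?_, ?_⟩
          · rintro (k | k)
            exacts [ha k, ha' k]
          · rintro (k | k)
            exacts [⟨hu k, F.locallyTrivial.zero_mem _⟩, ⟨E.locallyTrivial.zero_mem _, hu' k⟩]
          · filter_upwards [hs, hs'] with x hx hx'
            refine Prod.ext ?_ ?_
            · refine hx.trans ?_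
              simp [Prod.fst_sum]
            · refine hx'.trans ?_
              simp [Prod.snd_sum] }⟩)

/-- The class of the subbundle on which `z` acts as multiplication by `lam`. -/
def eigen (z : CatCenter Y) (hzc : Continuous fun y : Y => (⟨y, y, z.app y⟩ : Arr Y))
    (hz : IsOfFinOrder z) (lam : ℂ) (hlam : lam ^ orderOf z = 1) : VectIso Y →+ VectIso Y :=
  mapHom (VBundle.eigen z hzc hz lam hlam)
    (fun E F i => ⟨{
      equiv := fun y => (i.equiv y).submoduleMap _ |>.trans (LinearEquiv.ofEq _ _ (by
        ext w
        rw [Submodule.mem_map]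
        constructor
        · rintro ⟨w, hw, rfl⟩
          have hw' : E.act (z.app y) w = lam • w := hw
          change F.act (z.app y) (i.equiv y w) = lam • i.equiv y w
          rw [← i.nat, hw', map_smul]
        · intro hw
          have hw' : F.act (z.app y) w = lam • w := hw
          refine ⟨(i.equiv y).symm w, ?_, (i.equiv y).apply_symm_apply w⟩
          change E.act (z.app y) ((i.equiv y).symm w) = lam • (i.equiv y).symm w
          refine (i.symm.nat (z.app y) w).symm.trans ?_
          rw [hw']
          exact map_smul _ _ _))
      nat := fun f w => Subtype.ext (i.nat f w.1)
      cont := fun y s => i.cont y fun x => (s x).1 }⟩)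
    ⟨{ equiv := fun y => LinearEquiv.ofSubsingleton _ _
       nat := fun f w => rfl
       cont := fun y s => ⟨fun _ => trivial, fun _ => trivial⟩ }⟩
    (fun E F => ⟨{
      equiv := fun y =>
        { toFun := fun w => (⟨w.1.1, congrArg Prod.fst w.2⟩, ⟨w.1.2, congrArg Prod.snd w.2⟩)
          invFun := fun w => ⟨(w.1.1, w.2.1), Prod.ext w.1.2 w.2.2⟩
          map_add' := fun _ _ => rfl
          map_smul' := fun _ _ => rfl
          left_inv := fun _ => rfl
          right_inv := fun _ => rfl }
      nat := fun f w => rfl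
      cont := fun y s => Iff.rfl }⟩)

lemma isEigen_eigen (z : CatCenter Y) (hzc : Continuous fun y : Y => (⟨y, y, z.app y⟩ : Arr Y))
    (hz : IsOfFinOrder z) (lam : ℂ) (hlam : lam ^ orderOf z = 1) (x : VectIso Y) :
    IsEigen z lam (eigen z hzc hz lam hlam x) := by
  obtain ⟨E⟩ := x
  exact ⟨_, rfl, fun y w => Subtype.ext w.2⟩

end VectIso

/-- The center element `ξ` of the inertia groupoid `ΛX` has finite order (as is the case, e.g.,
for quotients by finite groups). -/
class FiniteRotation (X : Type u) [TopGpd.{u, v} X] : Prop where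
  isOfFinOrder : IsOfFinOrder (Inertia.xi X)

/-- Tate K-theory: `K_Tate(X) = K_rot(ΛX, ξ)`. -/
abbrev KTate (X : Type u) [TopGpd.{u, v} X] := KRot (Inertia X) (Inertia.xi X)

section Operators

variable {X : Type u} [TopGpd.{u, v} X] [FiniteRotation X]

/-- `β_k` on isomorphism classes of series: for `F = ∑ V_a q^{a/r}` the series `β_k(F)` is the part of
`Π_k^* F(q^{1/k}) = ∑ Π_k^* V_a q^{a/(r k)}` that satisfies the rotation condition.  In
`Π_k^* V_a` the `k`-th power of `ξ` acts as `e^{2π i a / r}`, so only multiples `a` of `k` lead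
to exponents for which that part can be nonzero.  The coefficient of `q^{m/r}` is the subbundle of
`Π_k^* V_{k m}` on which `ξ` acts as `e^{2π i m / r}`. -/
def betaSeries (k : ℕ) : RotSemiring (Inertia X) (Inertia.xi X) →+
    RotSemiring (Inertia X) (Inertia.xi X) where
  toFun F := ⟨PowerSeries.mk fun m =>
      VectIso.eigen (Inertia.xi X) Inertia.continuous_xi FiniteRotation.isOfFinOrder
        (zetaPow (Inertia.xi X) m) (zetaPow_pow_orderOf FiniteRotation.isOfFinOrder m)
        (VectIso.pull (Inertia.powerMap X k) (contFunctor_powerMap X k)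
          (PowerSeries.coeff (k * m) (F : PowerSeries (VectIso (Inertia X))))), fun m => by
    rw [PowerSeries.coeff_mk]
    exact VectIso.isEigen_eigen _ _ _ _ _ _⟩
  map_zero' := Subtype.ext (PowerSeries.ext fun m => by simp)
  map_add' F G := Subtype.ext (PowerSeries.ext fun m => by simp)

/-- The additive operation `β_k : K_Tate(X) → K_Tate(X)`,
`β_k(F) = [Π_k^* F(q^{1/k})]^{ℤ/k}`, where `Π_k` is the `k`-th power map of `ΛX`. -/
def beta (k : ℕ) : KTate X →+ KTate X := GRing.map (betaSeries k)

end Operators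

section Powers

variable {Y : Type u} [TopGpd.{u, v} Y] {z : CatCenter Y}

/-- The total power `∑ [op n V] t^n` of a series `V`. -/
def totalClass (op : ℕ → RotSeries Y z → RotSeries Y z) (V : RotSeries Y z) :
    PowerSeries (KRot Y z) :=
  PowerSeries.mk fun n => GRing.of (op n V).cls

lemma exists_sub_cls (x : KRot Y z) :
    ∃ V : RotSeries Y z × RotSeries Y z, x = GRing.of V.1.cls - GRing.of V.2.cls := by
  obtain ⟨a, b, rfl⟩ := GRing.exists_sub x
  obtain ⟨V, rfl⟩ := RotSeries.exists_rep a
  obtain ⟨W, rfl⟩ := RotSeries.exists_rep b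
  exact ⟨(V, W), rfl⟩

/-- The extension of a total power of bundles to virtual bundles: if `x = [V] - [W]`, then its value
at `x` is the quotient of the total powers of `V` and `W`. -/
def totalPower (op : ℕ → RotSeries Y z → RotSeries Y z) (x : KRot Y z) :
    PowerSeries (KRot Y z) :=
  totalClass op (exists_sub_cls x).choose.1 *
    PowerSeries.invOfUnit (totalClass op (exists_sub_cls x).choose.2) 1

/-- `S` is an exponential extension of the total power `op` of bundles: it takes sums to
products, and its value at the class of a series `V` of bundles is `∑ [op n V] t^n`. -/
structure IsExponentialExtension (op : ℕ → RotSeries Y z → RotSeries Y z)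
    (S : KRot Y z → PowerSeries (KRot Y z)) : Prop where
  map_add : ∀ x y, S (x + y) = S x * S y
  map_cls : ∀ V : RotSeries Y z, S (GRing.of V.cls) = totalClass op V

/-- The total Atiyah symmetric power `S_t` on `K_rot(Y, z)`. -/
def symT (x : KRot Y z) : PowerSeries (KRot Y z) := totalPower RotSeries.sym x

/-- The Adams operations on `K_rot(Y, z)`, which are defined by the generating function
`∑_{m ≥ 1} ψ_m(x) t^m = t S_t'(x) / S_t(x)`, i.e. `S_t(x) = exp(∑_{m ≥ 1} ψ_m(x) t^m / m)`. -/
def adams (m : ℕ) (x : KRot Y z) : KRot Y z :=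
  PowerSeries.coeff m
    (PowerSeries.mk (fun n => (n : KRot Y z) * PowerSeries.coeff n (symT x)) *
      PowerSeries.invOfUnit (symT x) 1)

/-- `exp(f)` for a formal power series `f` in `t` without constant term. -/
def expSeries {A : Type*} [CommRing A] [Algebra ℚ A] (f : PowerSeries A) : PowerSeries A :=
  PowerSeries.subst f (PowerSeries.exp A)

/-- The map from a ring to its rationalization. -/
def toRat {A : Type*} [CommRing A] : A →+* ℚ ⊗[ℤ] A :=
  (Algebra.TensorProduct.includeRight : A →ₐ[ℤ] ℚ ⊗[ℤ] A).toRingHom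

end Powers

/-- The total symmetric power `S_t^Tate` in Tate K-theory. -/
def tateSymT {X : Type u} [TopGpd.{u, v} X] (x : KTate X) : PowerSeries (KTate X) :=
  totalPower RotSeries.tateSym x

/-- The Hecke operators `T_m = ∑_{a d = m} (1/a) ψ_a β_d` of Tate K-theory. -/
def hecke {X : Type u} [TopGpd.{u, v} X] [FiniteRotation X] (m : ℕ) (x : KTate X) :
    ℚ ⊗[ℤ] KTate X :=
  ∑ p ∈ m.divisorsAntidiagonal, (1 / p.1 : ℚ) ⊗ₜ[ℤ] adams p.1 (beta p.2 x)
/-! ### Coefficient rings and characters -/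

/-- The groupoid `pt // G` of a discrete group `G`. -/
instance {G : Type u} [Group G] : TopGpd (SingleObj G) where
  toGroupoid := inferInstance
  toTopologicalSpace := ⊥
  arrTop := ⊥
  continuous_src := continuous_bot
  continuous_tgt := continuous_bot
  continuous_unit := continuous_bot
  continuous_inv := continuous_bot
  continuous_comp := by
    let _ : TopologicalSpace (Arr (SingleObj G)) := ⊥
    have h : DiscreteTopology (Arr (SingleObj G)) := ⟨rfl⟩
    rw [continuous_def]
    intro s _
    refine isOpen_induced_iff.2 ⟨{p | ∃ (x y w : SingleObj G) (f : x ⟶ y) (g : y ⟶ w),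
      p = (⟨x, y, f⟩, ⟨y, w, g⟩) ∧ (⟨x, w, f ≫ g⟩ : Arr (SingleObj G)) ∈ s}, isOpen_discrete _, ?_⟩
    ext p
    constructor
    · rintro ⟨x, y, w, f, g, h1, h2⟩
      obtain ⟨a, b, c, f', g'⟩ := p
      obtain ⟨h3, h4⟩ := Prod.mk.inj h1
      obtain ⟨rfl, rfl, h5⟩ := Arr.mk.inj h3
      obtain ⟨_, rfl, h6⟩ := Arr.mk.inj h4
      rw [← eq_of_heq h5, ← eq_of_heq h6] at h2
      exact h2
    · intro h1
      exact ⟨p.a, p.b, p.c, p.f, p.g, rfl, h1⟩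

instance {G : Type u} [Group G] [Finite G] : FiniteRotation (SingleObj G) where
  isOfFinOrder := by
    have := Fintype.ofFinite G
    refine isOfFinOrder_iff_pow_eq_one.2 ⟨Fintype.card G, Fintype.card_pos, ?_⟩
    refine CatCenter.ext _ _ fun a => Inertia.hom_ext ?_
    rw [Inertia.xi_pow_arr]
    have h : ∀ k, Inertia.loopPow a.loop k = (show G from a.loop) ^ k := by
      intro k
      induction k with
      | zero => exact (pow_zero (M := G) _).symm
      | succ k ih => rw [Inertia.loopPow, ih]; exact (pow_succ' (M := G) _ k).symm
    rw [h, pow_card_eq_one]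
    rfl

lemma VBundle.finite_fib {Y : Type u} [TopGpd.{u, v} Y] (E : VBundle Y) (y : Y) :
    Module.Finite ℂ (E.fib y) := by
  obtain ⟨ι, _, e, h⟩ := E.locallyTrivial y
  obtain ⟨⟨β, _⟩, _⟩ := h.self_of_nhds
  exact Module.Finite.of_basis β

section Characters

variable {G : Type u} [Group G]

/-- The object of the inertia groupoid of `pt // G` that is given by `g`. -/
def loopAt (g : G) : Inertia (SingleObj G) := ⟨SingleObj.star G, g⟩

/-- An element `h` of the centralizer of `g`, as an automorphism of the object `g`. -/
def centArrow {g h : G} (hc : Commute g h) : loopAt g ⟶ loopAt g :=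
  Inertia.Hom.mk (a := loopAt g) (b := loopAt g) h hc.eq.symm

/-- The character `(g, h) ↦ tr(h ∣ V_g)` of a bundle over the inertia groupoid of `pt // G`, i.e. of
a family of representations `V_g` of the centralizers. -/
def bundleChar {g h : G} (hc : Commute g h) : VectIso (Inertia (SingleObj G)) →+ ℂ where
  toFun := Quotient.lift (fun E => LinearMap.trace ℂ (E.fib (loopAt g)) (E.act (centArrow hc)))
    (fun E F ⟨i⟩ => by
      rw [← LinearMap.trace_conj' (E.act (centArrow hc)) (i.equiv (loopAt g))]
      congr 1
      ext w
      rw [LinearEquiv.conj_apply_apply, i.nat, LinearEquiv.apply_symm_apply])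
  map_zero' := map_zero (LinearMap.trace ℂ PUnit)
  map_add' := by
    rintro ⟨E⟩ ⟨F⟩
    have := E.finite_fib (loopAt g)
    have := F.finite_fib (loopAt g)
    exact LinearMap.trace_prodMap' _ _

/-- The character of the coefficient of `q^{n/r}` of an element of `K_Tate(pt // G)`, where `r` is
the order of `ξ`. -/
def coeffChar {g h : G} (hc : Commute g h) (n : ℕ) : KTate (SingleObj G) →+ ℂ :=
  GRing.lift
    { toFun := fun F => bundleChar hc
        (PowerSeries.coeff n (F : PowerSeries (VectIso (Inertia (SingleObj G)))))
      map_zero' := by simp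
      map_add' := fun F F' => by simp }

/-- The linear extension of the character to the rationalization of `K_Tate(pt // G)`. -/
def coeffCharRat {g h : G} (hc : Commute g h) (n : ℕ) : ℚ ⊗[ℤ] KTate (SingleObj G) →+ ℂ :=
  (TensorProduct.lift ((LinearMap.mul ℤ ℂ).compl₁₂
    (algebraMap ℚ ℂ).toIntAlgHom.toLinearMap (coeffChar hc n).toIntLinearMap)).toAddMonoidHom

lemma coeffCharRat_tmul {g h : G} (hc : Commute g h) (n : ℕ) (c : ℚ) (x : KTate (SingleObj G)) :
    coeffCharRat hc n (c ⊗ₜ x) = c * coeffChar hc n x := by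
  rfl

/-- Formal series `∑_{s ∈ ℚ} c_s q^s` (with `q = e^{2π i τ}`), depending on pairs of commuting elements
of `G`; `f hc s` is the coefficient of `q^s` of the series belonging to `hc : Commute g h`. -/
abbrev CharSeries (G : Type u) [Group G] : Type u := ∀ {g h : G}, Commute g h → ℚ → ℂ

/-- The `q`-expansion of the function `F(g, h; τ)` belonging to an element `F` of
`ℚ ⊗ K_Tate(pt // G)`: its coefficients are the characters of the coefficients of `F`. -/
def qExpansion (F : ℚ ⊗[ℤ] KTate (SingleObj G)) : CharSeries G := fun {_ _} hc s =>
  open Classical in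
  if H : ∃ n : ℕ, s = n / orderOf (Inertia.xi (SingleObj G)) then coeffCharRat hc H.choose F else 0

/-- The `q`-expansion of `f((a τ + b) / d)`, where `f(τ) = ∑ c_s q^s`: the term `c_s q^s` is replaced by
`c_s e^{2π i s b / d} q^{s a / d}`. -/
def substTau (a b d : ℕ) (c : ℚ → ℂ) : ℚ → ℂ := fun s =>
  Complex.exp (2 * Real.pi * Complex.I * ((s * d / a : ℚ) * b / d)) * c (s * d / a)

lemma commute_aux {g h : G} (hc : Commute g h) (a b d : ℕ) :
    Commute (g ^ d) ((g ^ b)⁻¹ * h ^ a) :=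
  (((Commute.refl g).pow_pow d b).inv_right).mul_right (hc.pow_pow d a)

/-- The equivariant Hecke operators of generalized Moonshine,
`(T_m f)(g, h; τ) = (1/m) ∑_{a d = m} ∑_{0 ≤ b < d} f(g^d, g^{-b} h^a; (a τ + b) / d)`. -/
def equivariantHecke (m : ℕ) (f : CharSeries G) : CharSeries G := fun {_ _} hc s =>
  (1 / m : ℂ) * ∑ p ∈ m.divisorsAntidiagonal, ∑ b ∈ Finset.range p.2,
    substTau p.1 b p.2 (f (commute_aux hc p.1 b p.2)) s

end Characters

end OrbTate

end

/-! The core is a product formula: S^Tate_t(F) = ∏_{k ≥ 1} S_{t^k}(β_k(F)).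

An index of the Tate power is a permutation with an exponent a(c) on each cycle c. Up to conjugation
it is a multiset of pairs (k, a), a length and an exponent. The rotation of one cycle of length k
fixes the index, and the rotation invariants of θ are the constant families, that is, the vectors of
V_a at (x, g^k) on which g acts as e^{2πi a/(rk)}. Since g^r = 1, such a vector vanishes unless k
divides a, and for a = kb these vectors form exactly the coefficient of q^{b/r} in β_k(V). What
remains of the symmetric group permutes cycles with equal (k, b). Hence the Tate power is the
ordinary symmetric power of the bundles β_k(V)_b, labelled by their bidegree (k, b) in t and q
(`RotSeries.nonempty_iso_tateSystem`, `RotSeries.mk_tateSym`).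

Invariants are handled throughout as limits over finite groupoids (`Diag`), compared by
`Diag.limIso`. A symmetric power of labelled bundles is the limit over the groupoid of label
sequences of a given bidegree (`LabelSet.SS`). For a disjoint union of label sets this groupoid
splits into products, and limits over products are tensor products (`Diag.lim_ext`), which gives the
exponential law `LabelSet.SS_sum`. Grouping the labels by k then yields the product formula, one
coefficient at a time with a finite truncation (`coeff_tateSymT`).

Both total powers are multiplicative with constant term 1, so they extend to virtual bundles
(`isExponentialExtension_totalPower`). The logarithmic derivative turns the product over k into a
sum and t ↦ t^k into a factor k. Its coefficient at t^m is therefore ∑_{ad=m} d ψ_a β_d, which is m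
T_m (`coeff_logD_tateSymT`). Over ℚ a series with constant term 1 is the exponential of the integral
of its logarithmic derivative (`eq_expSeries`).

The Moonshine formula combines two character identities. First, ψ_a replaces h by h^a and q by q^a
(`coeffChar_adams`): after splitting into eigenlines of h, the generating function of symmetric
powers is a product of geometric series. Second, β_d is an average over b (`sum_coeffChar_beta`):
the projection onto an eigenspace of g is the average of the powers of ω g⁻¹, whence the arguments
g^{-b} h and the phases. As (1/m) · d = 1/a, the two together give the Hecke operator. -/

noncomputable section

namespace OrbTate

/-! ### Logarithmic derivatives of power series -/

section logD

variable {A : Type*} [CommRing A]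

/-- The operator `t d/dt`. -/
def euler (S : PowerSeries A) : PowerSeries A :=
  PowerSeries.mk fun n => (n : A) * PowerSeries.coeff n S

lemma euler_eq (S : PowerSeries A) : euler S = PowerSeries.X * PowerSeries.derivative A S := by
  ext n
  rw [euler, PowerSeries.coeff_mk]
  rcases n with _ | n
  · simp
  · rw [PowerSeries.coeff_succ_X_mul, PowerSeries.coeff_derivative]
    push_cast
    ring

lemma euler_mul (S T : PowerSeries A) : euler (S * T) = euler S * T + S * euler T := by
  simp only [euler_eq, Derivation.leibniz, smul_eq_mul]
  ring

/-- The logarithmic derivative `t S' / S`. -/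
def logD (S : PowerSeries A) : PowerSeries A := euler S * PowerSeries.invOfUnit S 1

variable {S T : PowerSeries A}

lemma mul_inv_one (hS : PowerSeries.constantCoeff S = 1) : S * PowerSeries.invOfUnit S 1 = 1 :=
  PowerSeries.mul_invOfUnit S 1 hS

/-- Since S is invertible, t S'/S is the only solution L of the linear equation t S' = L S.
Logarithmic derivatives are computed below by solving this equation, without handling inverse
series. -/
lemma logD_eq_iff (hS : PowerSeries.constantCoeff S = 1) (L : PowerSeries A) :
    logD S = L ↔ euler S = L * S := by
  have h := mul_inv_one hS
  constructor
  · rintro rfl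
    rw [logD, mul_assoc, mul_comm _ S, h, mul_one]
  · intro h1
    rw [logD, h1, mul_assoc, h, mul_one]

lemma euler_eq_logD_mul (hS : PowerSeries.constantCoeff S = 1) : euler S = logD S * S :=
  (logD_eq_iff hS _).1 rfl

lemma logD_mul (hS : PowerSeries.constantCoeff S = 1) (hT : PowerSeries.constantCoeff T = 1) :
    logD (S * T) = logD S + logD T := by
  rw [logD_eq_iff (by rw [map_mul, hS, hT, one_mul]), euler_mul, euler_eq_logD_mul hS,
    euler_eq_logD_mul hT]
  ring

lemma logD_one : logD (1 : PowerSeries A) = 0 := by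
  rw [logD_eq_iff (map_one _), zero_mul]
  ext n
  rw [euler, PowerSeries.coeff_mk, PowerSeries.coeff_one]
  split_ifs with h <;> simp [h]

lemma constantCoeff_prod {κ : Type*} (s : Finset κ) {f : κ → PowerSeries A}
    (hf : ∀ k ∈ s, PowerSeries.constantCoeff (f k) = 1) :
    PowerSeries.constantCoeff (∏ k ∈ s, f k) = 1 := by
  rw [map_prod]
  exact Finset.prod_eq_one hf

lemma logD_prod {κ : Type*} (s : Finset κ) {f : κ → PowerSeries A}
    (hf : ∀ k ∈ s, PowerSeries.constantCoeff (f k) = 1) :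
    logD (∏ k ∈ s, f k) = ∑ k ∈ s, logD (f k) := by
  classical
  induction s using Finset.induction_on with
  | empty => exact logD_one
  | insert k s hk ih =>
    have hf' := fun k' hk' => hf k' (Finset.mem_insert_of_mem hk')
    rw [Finset.prod_insert hk, Finset.sum_insert hk,
      logD_mul (hf k (Finset.mem_insert_self _ _)) (constantCoeff_prod s hf'), ih hf']

lemma logD_map {B : Type*} [CommRing B] (f : A →+* B) (hS : PowerSeries.constantCoeff S = 1) :
    logD (PowerSeries.map f S) = PowerSeries.map f (logD S) := by
  have h : ∀ S : PowerSeries A, euler (PowerSeries.map f S) = PowerSeries.map f (euler S) := by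
    intro S
    ext n
    simp [euler]
  have h1 : PowerSeries.constantCoeff (PowerSeries.map f S) = 1 := by
    rw [← PowerSeries.coeff_zero_eq_constantCoeff_apply, PowerSeries.coeff_map,
      PowerSeries.coeff_zero_eq_constantCoeff_apply, hS, map_one]
  rw [logD_eq_iff h1, h, euler_eq_logD_mul hS, map_mul]

/-- Chain rule for t ↦ t^k. The factor k is the source of the weight d in the sum over ad = m. -/
lemma logD_expand {k : ℕ} (hk : k ≠ 0) (hS : PowerSeries.constantCoeff S = 1) :
    logD (PowerSeries.expand k hk S) = k • PowerSeries.expand k hk (logD S) := by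
  have h : ∀ S : PowerSeries A,
      euler (PowerSeries.expand k hk S) = k • PowerSeries.expand k hk (euler S) := by
    intro S
    ext n
    rw [map_nsmul, PowerSeries.coeff_expand, euler, PowerSeries.coeff_mk, PowerSeries.coeff_expand]
    split_ifs with h
    · obtain ⟨l, rfl⟩ := h
      rw [Nat.mul_div_cancel_left _ (Nat.pos_of_ne_zero hk), euler, PowerSeries.coeff_mk, nsmul_eq_mul]
      push_cast
      ring
    · simp
  rw [logD_eq_iff (by rw [PowerSeries.constantCoeff_expand, hS]), h, euler_eq_logD_mul hS, map_mul,
    smul_mul_assoc]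

/-- Congruence modulo t^(m+1) is compatible with products and, below, with inverses and logarithmic
derivatives. This allows the infinite product over cycle lengths to be truncated. -/
lemma coeff_mul_congr {S S' T T' : PowerSeries A} {m : ℕ}
    (hS : ∀ n ≤ m, PowerSeries.coeff n S = PowerSeries.coeff n S')
    (hT : ∀ n ≤ m, PowerSeries.coeff n T = PowerSeries.coeff n T') {n : ℕ} (hn : n ≤ m) :
    PowerSeries.coeff n (S * T) = PowerSeries.coeff n (S' * T') := by
  rw [PowerSeries.coeff_mul, PowerSeries.coeff_mul]
  refine Finset.sum_congr rfl fun x hx => ?_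
  have h := Finset.HasAntidiagonal.mem_antidiagonal.1 hx
  rw [hS _ (by omega), hT _ (by omega)]

lemma coeff_inv_congr (hS : PowerSeries.constantCoeff S = 1) (hT : PowerSeries.constantCoeff T = 1)
    {m : ℕ} (h : ∀ n ≤ m, PowerSeries.coeff n S = PowerSeries.coeff n T) {n : ℕ} (hn : n ≤ m) :
    PowerSeries.coeff n (PowerSeries.invOfUnit S 1) =
      PowerSeries.coeff n (PowerSeries.invOfUnit T 1) := by
  have h1 : PowerSeries.invOfUnit S 1 = PowerSeries.invOfUnit S 1 *
      (T * PowerSeries.invOfUnit T 1) := by rw [mul_inv_one hT, mul_one]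
  have h2 : PowerSeries.invOfUnit T 1 = PowerSeries.invOfUnit S 1 *
      (S * PowerSeries.invOfUnit T 1) := by
    rw [← mul_assoc, mul_comm _ S, mul_inv_one hS, one_mul]
  refine (congrArg _ h1).trans (Eq.trans ?_ (congrArg _ h2).symm)
  exact coeff_mul_congr (fun _ _ => rfl) (fun n hn => coeff_mul_congr (fun n hn => (h n hn).symm)
    (fun _ _ => rfl) hn) hn

lemma coeff_logD_congr (hS : PowerSeries.constantCoeff S = 1) (hT : PowerSeries.constantCoeff T = 1)
    {m : ℕ} (h : ∀ n ≤ m, PowerSeries.coeff n S = PowerSeries.coeff n T) :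
    PowerSeries.coeff m (logD S) = PowerSeries.coeff m (logD T) :=
  coeff_mul_congr (fun n hn => by rw [euler, euler, PowerSeries.coeff_mk, PowerSeries.coeff_mk, h n hn])
    (fun _ hn => coeff_inv_congr hS hT h hn) le_rfl

lemma constantCoeff_logD (S : PowerSeries A) : PowerSeries.coeff 0 (logD S) = 0 := by
  simp [logD, euler]

/-- A power series over a rational algebra is the exponential of the integral of its logarithmic
derivative. -/
lemma eq_expSeries [Algebra ℚ A] (hS : PowerSeries.constantCoeff S = 1) (f : PowerSeries A)
    (hf0 : PowerSeries.coeff 0 f = 0) (hf : euler f = logD S) : S = expSeries f := by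
  have hsub : PowerSeries.HasSubst f := PowerSeries.HasSubst.of_constantCoeff_zero' (by
    rwa [PowerSeries.coeff_zero_eq_constantCoeff_apply] at hf0)
  set T := expSeries f with hT
  have hT1 : euler T = logD S * T := by
    rw [euler_eq, hT, expSeries, PowerSeries.derivative_subst hsub, PowerSeries.derivative_exp, ← hf,
      euler_eq]
    ring
  have hT0 : PowerSeries.constantCoeff T = 1 := by
    -- The series exp - 1 has no constant term, so neither has its value at f.
    have h := PowerSeries.constantCoeff_subst_eq_zero (S := A) (a := f)
      (by rwa [PowerSeries.coeff_zero_eq_constantCoeff_apply] at hf0) (PowerSeries.exp A - 1) (by simp)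
    rw [← PowerSeries.coe_substAlgHom hsub, map_sub, map_one, map_sub, map_one, sub_eq_zero,
      PowerSeries.coe_substAlgHom] at h
    exact h
  -- S and T solve the same Euler equation, so their quotient has logarithmic derivative zero.
  have h1 : logD (S * PowerSeries.invOfUnit T 1) = 0 := by
    have h2 : logD (T * PowerSeries.invOfUnit T 1) = 0 := by rw [mul_inv_one hT0, logD_one]
    rw [logD_mul hT0 (by simp), (logD_eq_iff hT0 _).2 hT1] at h2
    rw [logD_mul hS (by simp), h2]
  have h2 : S * PowerSeries.invOfUnit T 1 = 1 := by
    have h0 : PowerSeries.constantCoeff (S * PowerSeries.invOfUnit T 1) = 1 := by simp [hS]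
    have h3 := (logD_eq_iff h0 _).1 h1
    rw [zero_mul] at h3
    ext n
    rcases n with _ | n
    · simpa using h0
    · have h4 := congrArg (PowerSeries.coeff (n + 1)) h3
      rw [euler, PowerSeries.coeff_mk, map_zero] at h4
      -- Dividing by n + 1 is where the rational algebra structure is needed.
      have h5 : ((n + 1 : ℚ)⁻¹) • (((n + 1 : ℕ) : A) *
          PowerSeries.coeff (n + 1) (S * PowerSeries.invOfUnit T 1)) = 0 := by rw [h4, smul_zero]
      rw [← nsmul_eq_mul, ← Nat.cast_smul_eq_nsmul ℚ, smul_smul] at h5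
      push_cast at h5
      rw [inv_mul_cancel₀ (by positivity), one_smul] at h5
      rw [h5, PowerSeries.coeff_one, if_neg (Nat.succ_ne_zero n)]
  calc S = S * PowerSeries.invOfUnit T 1 * T := by
        rw [mul_assoc, mul_comm _ T, mul_inv_one hT0, mul_one]
    _ = T := by rw [h2, one_mul]

/-- The exponential formula over the rationalization of a ring. -/
lemma map_toRat_eq_expSeries (hS : PowerSeries.constantCoeff S = 1) {f : PowerSeries (ℚ ⊗[ℤ] A)}
    (hf0 : PowerSeries.coeff 0 f = 0)
    (hf : ∀ m, 0 < m → PowerSeries.coeff m f = (1 / (m : ℚ)) ⊗ₜ[ℤ] PowerSeries.coeff m (logD S)) :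
    PowerSeries.map toRat S = expSeries f := by
  refine eq_expSeries ?_ f hf0 ?_
  · rw [← PowerSeries.coeff_zero_eq_constantCoeff_apply, PowerSeries.coeff_map,
      PowerSeries.coeff_zero_eq_constantCoeff_apply, hS, map_one]
  · rw [logD_map _ hS]
    ext m
    rw [euler, PowerSeries.coeff_mk, PowerSeries.coeff_map]
    rcases Nat.eq_zero_or_pos m with rfl | hm
    · rw [constantCoeff_logD, map_zero, Nat.cast_zero, zero_mul]
    · rw [hf m hm, ← nsmul_eq_mul, TensorProduct.smul_tmul']
      have h : m • (1 / (m : ℚ)) = 1 := by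
        have : (m : ℚ) ≠ 0 := by positivity
        rw [nsmul_eq_mul]
        field_simp
      rw [h]
      rfl

end logD

/-! ### Isomorphisms and reindexed tensor products of bundles -/

namespace VBundle

variable {Y : Type u} [TopGpd.{u, v} Y]

/-- A fibrewise bijective, equivariant and continuous linear map of vector bundles is an
isomorphism. -/
def Iso.ofBijective {E F : VBundle Y} (φ : ∀ y, E.fib y →ₗ[ℂ] F.fib y)
    (hφ : ∀ y, Function.Bijective (φ y))
    (nat : ∀ {x y : Y} (f : x ⟶ y) (w : E.fib x), φ y (E.act f w) = F.act f (φ x w))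
    (cont : ∀ (y : Y), ∀ s ∈ E.contAt y, (fun x => φ x (s x)) ∈ F.contAt y) : Iso E F where
  equiv y := LinearEquiv.ofBijective (φ y) (hφ y)
  nat := nat
  cont y s := by
    refine ⟨cont y s, fun h => ?_⟩
    obtain ⟨ι, _, e, he⟩ := E.locallyTrivial y
    obtain ⟨κ, _, e', he'⟩ := F.locallyTrivial y
    obtain ⟨β, hβ⟩ := he.self_of_nhds.1
    -- The image of a local frame of E is a local frame of F, because it is a basis at y. The
    -- continuous coefficients of the image section in this frame are then coefficients of s itself.
    have hfr := Fam.frame_of_basis F.locallyTrivial he' (fun i y => φ y (e i y))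
      (by filter_upwards [he] with b hb i using cont b _ (hb.mem i))
      ⟨β.map (LinearEquiv.ofBijective (φ y) (hφ y)), fun i => by simp [hβ]⟩
    obtain ⟨a, ha, hs⟩ := (hfr.self_of_nhds.2 _).1 h
    refine (he.self_of_nhds.2 s).2 ⟨a, ha, ?_⟩
    filter_upwards [hs] with x hx
    refine (hφ x).1 ?_
    rw [map_sum]
    simpa using hx

/-- The linear map between tensor products that is induced by a bijection of the index sets and maps
between the factors. -/
def reT {A A' : Type} [Fintype A] [Fintype A'] {P : A → VBundle Y} {P' : A' → VBundle Y}
    (κ : A' ≃ A) (f : ∀ a' y, (P (κ a')).fib y →ₗ[ℂ] (P' a').fib y) (y : Y) :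
    (piTensor P).fib y →ₗ[ℂ] (piTensor P').fib y :=
  (PiTensorProduct.map fun a' => f a' y) ∘ₗ
    (PiTensorProduct.reindex ℂ (fun a => (P a).fib y) κ.symm).toLinearMap

section reT

variable {A A' A'' : Type} [Fintype A] [Fintype A'] [Fintype A''] {P : A → VBundle Y}
  {P' : A' → VBundle Y} {P'' : A'' → VBundle Y}

lemma reT_tprod (κ : A' ≃ A) (f : ∀ a' y, (P (κ a')).fib y →ₗ[ℂ] (P' a').fib y) (y : Y)
    (w : ∀ a, (P a).fib y) :
    reT κ f y (PiTensorProduct.tprod ℂ w) =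
      PiTensorProduct.tprod ℂ (fun a' => f a' y (w (κ a'))) := by
  rw [reT, LinearMap.comp_apply, LinearEquiv.coe_coe, PiTensorProduct.reindex_tprod]
  exact PiTensorProduct.map_tprod _ _

lemma piTensor_ext {y : Y} {W : Type*} [AddCommGroup W] [Module ℂ W]
    {φ ψ : (piTensor P).fib y →ₗ[ℂ] W}
    (h : ∀ w, φ (PiTensorProduct.tprod ℂ w) = ψ (PiTensorProduct.tprod ℂ w)) : φ = ψ :=
  PiTensorProduct.ext (MultilinearMap.ext h)

lemma reT_nat (κ : A' ≃ A) (f : ∀ a' y, (P (κ a')).fib y →ₗ[ℂ] (P' a').fib y)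
    (hf : ∀ a' {x y : Y} (b : x ⟶ y) w, f a' y ((P (κ a')).act b w) = (P' a').act b (f a' x w))
    {x y : Y} (b : x ⟶ y) (w : (piTensor P).fib x) :
    reT κ f y ((piTensor P).act b w) = (piTensor P').act b (reT κ f x w) := by
  refine LinearMap.congr_fun (piTensor_ext (φ := reT κ f y ∘ₗ (piTensor P).act b)
    (ψ := (piTensor P').act b ∘ₗ reT κ f x) fun w => ?_) w
  rw [LinearMap.comp_apply, LinearMap.comp_apply, PiTensorProduct.map_tprod, reT_tprod, reT_tprod,
    PiTensorProduct.map_tprod]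
  exact congrArg _ (funext fun a' => hf a' b _)

lemma reT_cont (κ : A' ≃ A) (f : ∀ a' y, (P (κ a')).fib y →ₗ[ℂ] (P' a').fib y)
    (hf : ∀ a' y, ∀ s ∈ (P (κ a')).contAt y, (fun x => f a' x (s x)) ∈ (P' a').contAt y)
    (y : Y) (s) (hs : s ∈ (piTensor P).contAt y) :
    (fun x => reT κ f x (s x)) ∈ (piTensor P').contAt y := by
  obtain ⟨K, _, c, t, hc, ht, hs⟩ := hs
  refine ⟨K, inferInstance, c, fun k a' x => f a' x (t k (κ a') x), hc,
    fun k a' => hf a' y _ (ht k _), ?_⟩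
  filter_upwards [hs] with x hx
  rw [hx, map_sum]
  refine Finset.sum_congr rfl fun k _ => ?_
  rw [map_smul, reT_tprod]

end reT

end VBundle

/-! ### Limits over finite groupoids -/

/-- A functor from a groupoid `I` to vector bundles over `Y`, up to the action of identities. -/
structure Diag (I : Type) [Groupoid.{0} I] (Y : Type u) [TopGpd.{u, v} Y] where
  D : I → VBundle Y
  T : ∀ {i j : I}, (i ⟶ j) → ∀ y, (D i).fib y →ₗ[ℂ] (D j).fib y
  nat : ∀ {i j : I} (f : i ⟶ j) {x y : Y} (a : x ⟶ y) (w : (D i).fib x),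
    T f y ((D i).act a w) = (D j).act a (T f x w)
  cont : ∀ {i j : I} (f : i ⟶ j) (y : Y), ∀ s ∈ (D i).contAt y,
    (fun x => T f x (s x)) ∈ (D j).contAt y
  comp : ∀ {i j k : I} (f : i ⟶ j) (g : j ⟶ k) (y : Y) (w : (D i).fib y),
    T (f ≫ g) y w = T g y (T f y w)

/-- The diagram of tensor products of a system. -/
def TensorSystem.diag {I : Type} [Groupoid.{0} I] {Y : Type u} [TopGpd.{u, v} Y]
    (S : TensorSystem I Y) : Diag I Y where
  D := S.tensorAt
  T f y := S.T f y
  nat f _ _ a w := S.T_nat f a w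
  cont f y s hs := S.T_cont f y s hs
  comp f g y w := S.T_comp f g y w

namespace Diag

variable {Y : Type u} [TopGpd.{u, v} Y] {I J : Type} [Groupoid.{0} I] [Groupoid.{0} J]

/-- Compatible families. -/
def IsSec (A : Diag I Y) {y : Y} (w : ∀ i, (A.D i).fib y) : Prop :=
  ∀ (i j : I) (f : i ⟶ j), A.T f y (w i) = w j

/-- The part of a groupoid on which a function has a given value. -/
def Fiber {K : Type} (κ : I → K) (k : K) : Type := {i : I // κ i = k}

instance {K : Type} (κ : I → K) (k : K) : Groupoid.{0} (Fiber κ k) where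
  Hom i j := (i.1 ⟶ j.1)
  id i := 𝟙 i.1
  comp f g := f ≫ g
  id_comp := Category.id_comp
  comp_id := Category.comp_id
  assoc := Category.assoc
  inv f := Groupoid.inv f
  inv_comp := Groupoid.inv_comp
  comp_inv := Groupoid.comp_inv

/-- The restriction of a diagram. -/
def restrict {K : Type} (A : Diag I Y) (κ : I → K) (k : K) : Diag (Fiber κ k) Y where
  D i := A.D i.1
  T {i j} f := A.T (i := i.1) (j := j.1) f
  nat {i j} f := A.nat (i := i.1) (j := j.1) f
  cont {i j} f := A.cont (i := i.1) (j := j.1) f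
  comp {i j k} f g := A.comp (i := i.1) (j := j.1) (k := k.1) f g

variable [Fintype I] [∀ i j : I, Fintype (i ⟶ j)] [Fintype J] [∀ i j : J, Fintype (i ⟶ j)]

instance {K : Type} (κ : I → K) (k : K) : Fintype (Fiber κ k) :=
  Fintype.ofInjective (β := I) Subtype.val Subtype.val_injective

instance {K : Type} (κ : I → K) (k : K) (i j : Fiber κ k) : Fintype (i ⟶ j) :=
  inferInstanceAs (Fintype (i.1 ⟶ j.1))

/-- The limit of a diagram. -/
abbrev lim (A : Diag I Y) : VBundle Y := VBundle.lim A.D A.T A.nat A.cont A.comp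

/-- The comparison of the limits of two diagrams along a map of the index groupoids. -/
theorem limIso (A : Diag I Y) (B : Diag J Y) (F : J → I)
    (q : ∀ j y, (A.D (F j)).fib y →ₗ[ℂ] (B.D j).fib y)
    (ι : ∀ j y, (B.D j).fib y →ₗ[ℂ] (A.D (F j)).fib y)
    (q_nat : ∀ j {x y : Y} (a : x ⟶ y) w, q j y ((A.D (F j)).act a w) = (B.D j).act a (q j x w))
    (q_cont : ∀ j y, ∀ s ∈ (A.D (F j)).contAt y, (fun x => q j x (s x)) ∈ (B.D j).contAt y)
    (hqι : ∀ j y v, q j y (ι j y v) = v)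
    (hιq : ∀ j y (w : ∀ i, (A.D i).fib y), A.IsSec w → ι j y (q j y (w (F j))) = w (F j))
    (hmap : ∀ {j j' : J} (g : j ⟶ j'), ∃ f : F j ⟶ F j', ∀ y v,
      q j' y (A.T f y v) = B.T g y (q j y v))
    (hlift : ∀ {j j' : J} (f : F j ⟶ F j'), ∃ g : j ⟶ j', ∀ y v,
      A.T f y (ι j y v) = ι j' y (B.T g y v))
    (hsurj : ∀ i, (∃ j, Nonempty (F j ⟶ i)) ∨
      ∀ y (w : ∀ i, (A.D i).fib y), A.IsSec w → w i = 0) :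
    Nonempty (VBundle.Iso A.lim B.lim) := by
  -- The map w ↦ (q (w (F j)))_j is well defined by `hmap`. The map ι need only invert q on values
  -- of compatible families, and an index out of reach of F is allowed as long as every compatible
  -- family vanishes there. The Tate indices use both relaxations.
  classical
  refine ⟨VBundle.Iso.ofBijective (fun y =>
    { toFun := fun w => ⟨fun j => q j y (w.1 (F j)), fun j j' g => ?_⟩
      map_add' := fun w w' => Subtype.ext (funext fun j => map_add (q j y) _ _)
      map_smul' := fun c w => Subtype.ext (funext fun j => map_smul (q j y) _ _) }) (fun y => ⟨?_, ?_⟩)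
    (fun f w => Subtype.ext (funext fun j => q_nat j f _)) fun y s hs j => q_cont j y _ (hs (F j))⟩
  · obtain ⟨f, hf⟩ := hmap g
    rw [← hf, w.2 _ _ f]
  · rw [injective_iff_map_eq_zero]
    intro w hw
    have h0 : ∀ j, w.1 (F j) = 0 := fun j => by
      have h1 : q j y (w.1 (F j)) = 0 := congrFun (congrArg Subtype.val hw) j
      rw [← hιq j y w.1 w.2, h1, map_zero]
    refine Subtype.ext (funext fun i => ?_)
    rcases hsurj i with ⟨j, ⟨f⟩⟩ | h
    · rw [← w.2 _ _ f, h0, map_zero]; rfl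
    · exact h y w.1 w.2
  · intro u
    -- A preimage of u: transport its values along any arrow from the image of F, and take zero at
    -- the unreachable indices.
    let t : ∀ i, (A.D i).fib y := fun i =>
      if h : ∃ j, Nonempty (F j ⟶ i) then A.T h.choose_spec.some y (ι _ y (u.1 h.choose)) else 0
    -- Two arrows into i from F j and F j' differ by an arrow between them, which `hlift` realises
    -- in J. Compatibility of u then shows independence of the choice.
    have ht : ∀ {i j} (f : F j ⟶ i), t i = A.T f y (ι j y (u.1 j)) := by
      intro i j f
      have h : ∃ j, Nonempty (F j ⟶ i) := ⟨j, ⟨f⟩⟩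
      obtain ⟨g, hg⟩ := hlift (h.choose_spec.some ≫ Groupoid.inv f)
      simp only [t, dif_pos h]
      have h2 : h.choose_spec.some = (h.choose_spec.some ≫ Groupoid.inv f) ≫ f := by simp
      conv_lhs => rw [h2]
      rw [A.comp, hg, u.2 _ _ g]
    refine ⟨⟨t, fun i i' f => ?_⟩, Subtype.ext (funext fun j => ?_)⟩
    · by_cases h : ∃ j, Nonempty (F j ⟶ i)
      · obtain ⟨j, ⟨f'⟩⟩ := h
        rw [ht f', ht (f' ≫ f), A.comp]
      · have h' : ¬ ∃ j, Nonempty (F j ⟶ i') := by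
          rintro ⟨j, ⟨f'⟩⟩
          exact h ⟨j, ⟨f' ≫ Groupoid.inv f⟩⟩
        simp only [t, dif_neg h, dif_neg h', map_zero]
    · change q j y (t (F j)) = u.1 j
      -- A diagram need not send 𝟙 to the identity map, so the identity arrow is lifted to J and
      -- absorbed by the compatibility of u.
      obtain ⟨g, hg⟩ := hlift (𝟙 (F j))
      rw [ht (𝟙 _), hg, u.2 _ _ g, hqι]

/-- The comparison of limits along an equivalence of index groupoids. -/
theorem limIso_of_equiv (A : Diag I Y) (B : Diag J Y) (F : J → I)
    (q : ∀ j y, (A.D (F j)).fib y →ₗ[ℂ] (B.D j).fib y)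
    (ι : ∀ j y, (B.D j).fib y →ₗ[ℂ] (A.D (F j)).fib y)
    (q_nat : ∀ j {x y : Y} (a : x ⟶ y) w, q j y ((A.D (F j)).act a w) = (B.D j).act a (q j x w))
    (q_cont : ∀ j y, ∀ s ∈ (A.D (F j)).contAt y, (fun x => q j x (s x)) ∈ (B.D j).contAt y)
    (hqι : ∀ j y v, q j y (ι j y v) = v) (hιq : ∀ j y v, ι j y (q j y v) = v)
    (φ : ∀ {j j' : J}, (j ⟶ j') → (F j ⟶ F j'))
    (hφ : ∀ {j j' : J} (g : j ⟶ j'), ∀ y v, q j' y (A.T (φ g) y v) = B.T g y (q j y v))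
    (hfull : ∀ {j j' : J} (f : F j ⟶ F j'), ∃ g : j ⟶ j', φ g = f)
    (hsurj : ∀ i, ∃ j, Nonempty (F j ⟶ i)) :
    Nonempty (VBundle.Iso A.lim B.lim) := by
  refine limIso A B F q ι q_nat q_cont hqι (fun j y w _ => hιq j y _) (fun g => ⟨φ g, hφ g⟩)
    (fun {j j'} f => ?_) (fun i => Or.inl (hsurj i))
  obtain ⟨g, rfl⟩ := hfull f
  refine ⟨g, fun y v => ?_⟩
  rw [← hιq j' y (A.T _ y _), hφ, hqι]

/-! ### Decomposition of the index groupoid -/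

/-- If a function to a finite set is constant on the connected components of the index groupoid, then
a limit is the direct sum of the limits over the parts. -/
theorem lim_restrict {K : Type} [Fintype K] (A : Diag I Y) (κ : I → K)
    (hκ : ∀ {i j : I}, (i ⟶ j) → κ i = κ j) :
    Nonempty (VBundle.Iso A.lim (VBundle.pi fun k => (A.restrict κ k).lim)) := by
  refine ⟨VBundle.Iso.ofBijective (fun y =>
    { toFun := fun w k => ⟨fun i => w.1 i.1, fun i j f => w.2 i.1 j.1 f⟩
      map_add' := fun _ _ => rfl
      map_smul' := fun _ _ => rfl }) (fun y => ⟨fun w w' h => ?_, fun u => ?_⟩)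
    (fun f w => rfl) fun y s hs k i => hs i.1⟩
  · refine Subtype.ext (funext fun i => ?_)
    exact congrFun (congrArg Subtype.val (congrFun h (κ i))) ⟨i, rfl⟩
  · refine ⟨⟨fun i => (u (κ i)).1 ⟨i, rfl⟩, fun i j f => ?_⟩, ?_⟩
    · have h1 := (u (κ j)).2 ⟨i, hκ f⟩ ⟨j, rfl⟩ f
      have h2 : ∀ (k : K) (h : κ i = k), (u k).1 ⟨i, h⟩ = (u (κ i)).1 ⟨i, rfl⟩ := by
        rintro _ rfl; rfl
      rw [h2] at h1
      exact h1
    · funext k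
      refine Subtype.ext (funext fun i => ?_)
      obtain ⟨i, rfl⟩ := i
      rfl

/-! ### Tensor products of limits -/

/-- The average over all arrows with source `i`, as a compatible family. -/
def avg (A : Diag I Y) (y : Y) (i : I) : (A.D i).fib y →ₗ[ℂ] A.lim.fib y where
  toFun v := ⟨fun j => (Fintype.card (Σ i : I, (i ⟶ j)) : ℂ)⁻¹ • ∑ f : i ⟶ j, A.T f y v,
    fun j k g => by
      let σ : (Σ i : I, (i ⟶ j)) ≃ (Σ i : I, (i ⟶ k)) :=
        Equiv.sigmaCongrRight fun i =>
          ⟨fun f => f ≫ g, fun f => f ≫ Groupoid.inv g, fun g => by simp, fun g => by simp⟩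
      let ρ : (i ⟶ j) ≃ (i ⟶ k) :=
        ⟨fun f => f ≫ g, fun f => f ≫ Groupoid.inv g, fun g => by simp, fun g => by simp⟩
      change A.T g y ((Fintype.card (Σ i : I, (i ⟶ j)) : ℂ)⁻¹ • ∑ f : i ⟶ j, A.T f y v) =
        (Fintype.card (Σ i : I, (i ⟶ k)) : ℂ)⁻¹ • ∑ f : i ⟶ k, A.T f y v
      rw [Fintype.card_congr σ, map_smul, map_sum, ← Equiv.sum_comp ρ]
      congr 1
      exact Finset.sum_congr rfl fun f _ => (A.comp f g y v).symm⟩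
  map_add' v w := Subtype.ext (funext fun j => by
    simp only [map_add, Finset.sum_add_distrib, smul_add]; rfl)
  map_smul' c v := Subtype.ext (funext fun j => by
    simp only [map_smul, ← Finset.smul_sum, RingHom.id_apply]
    rw [smul_comm]; rfl)

lemma avg_apply (A : Diag I Y) (y : Y) (i j : I) (v : (A.D i).fib y) :
    (A.avg y i v).1 j = (Fintype.card (Σ i : I, (i ⟶ j)) : ℂ)⁻¹ • ∑ f : i ⟶ j, A.T f y v := rfl

lemma card_ne_zero (j : I) : (Fintype.card (Σ i : I, (i ⟶ j)) : ℂ) ≠ 0 := by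
  have : 0 < Fintype.card (Σ i : I, (i ⟶ j)) := Fintype.card_pos_iff.2 ⟨⟨j, 𝟙 j⟩⟩
  exact_mod_cast this.ne'

/-- All transports of a compatible family to j equal its value at j, and they are counted by the
arrows into j from anywhere. This count is the normalisation in `avg`. -/
lemma sum_avg (A : Diag I Y) (y : Y) (w : A.lim.fib y) : ∑ i, A.avg y i (w.1 i) = w := by
  refine Subtype.ext (funext fun j => ?_)
  have h1 : (∑ i, A.avg y i (w.1 i)).1 j = ∑ i, (A.avg y i (w.1 i)).1 j := by
    rw [Submodule.coe_sum, Finset.sum_apply]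
  have h2 : ∀ i, (A.avg y i (w.1 i)).1 j =
      (Fintype.card (Σ i : I, (i ⟶ j)) : ℂ)⁻¹ • ∑ f : i ⟶ j, w.1 j := fun i => by
    rw [avg_apply]
    exact congrArg _ (Finset.sum_congr rfl fun f _ => w.2 i j f)
  rw [h1, Finset.sum_congr rfl fun i _ => h2 i, ← Finset.smul_sum]
  simp only [Finset.sum_const, Finset.card_univ]
  rw [← Finset.sum_smul, ← Fintype.card_sigma, ← Nat.cast_smul_eq_nsmul ℂ, smul_smul,
    inv_mul_cancel₀ (card_ne_zero j), one_smul]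

/-- The external tensor product of two diagrams. -/
abbrev ext (A : Diag I Y) (B : Diag J Y) : Diag (I × J) Y where
  D i := (A.D i.1).tensor (B.D i.2)
  T f y := TensorProduct.map (A.T f.1 y) (B.T f.2 y)
  nat {i j} f x y a w := by
    induction w using TensorProduct.induction_on with
    | zero => simp
    | tmul v w => simp only [TensorProduct.map_tmul, A.nat, B.nat]
    | add v w hv hw => simp only [map_add, hv, hw]
  cont {i j} f y s hs := VBundle.tensor_map_mem (fun y => A.T f.1 y) (fun y => B.T f.2 y) y
    (A.cont f.1 y) (B.cont f.2 y) s hs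
  comp {i j k} f g y w := by
    induction w using TensorProduct.induction_on with
    | zero => simp
    | tmul v w => simp only [TensorProduct.map_tmul, prod_comp, A.comp, B.comp]
    | add v w hv hw => simp only [map_add, hv, hw]

instance (i j : I × J) : Fintype (i ⟶ j) :=
  inferInstanceAs (Fintype ((i.1 ⟶ j.1) × (i.2 ⟶ j.2)))

/-- Evaluation of a compatible family. -/
def ev (A : Diag I Y) (y : Y) (i : I) : A.lim.fib y →ₗ[ℂ] (A.D i).fib y where
  toFun w := w.1 i
  map_add' _ _ := rfl
  map_smul' _ _ := rfl

/-- The canonical map from the tensor product of two limits. -/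
def extMap (A : Diag I Y) (B : Diag J Y) (y : Y) :
    (A.lim.tensor B.lim).fib y →ₗ[ℂ] (A.ext B).lim.fib y where
  toFun w := ⟨fun i => TensorProduct.map (A.ev y i.1) (B.ev y i.2) w, fun i j f => by
    change TensorProduct.map (A.T f.1 y) (B.T f.2 y)
      (TensorProduct.map (A.ev y i.1) (B.ev y i.2) w) =
        TensorProduct.map (A.ev y j.1) (B.ev y j.2) w
    induction w using TensorProduct.induction_on with
    | zero => simp
    | tmul v w =>
      change TensorProduct.map (A.T f.1 y) (B.T f.2 y) (v.1 i.1 ⊗ₜ w.1 i.2) =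
        v.1 j.1 ⊗ₜ w.1 j.2
      rw [TensorProduct.map_tmul, v.2 _ _ f.1, w.2 _ _ f.2]
    | add v w hv hw => simp only [map_add, hv, hw]⟩
  map_add' v w := Subtype.ext (funext fun i => map_add _ _ _)
  map_smul' c v := Subtype.ext (funext fun i => map_smul _ _ _)

/-- The inverse applies the two averages to every component and sums. One composite is the identity
by `sum_avg` on pure tensors. The other is the average over the product groupoid, which fixes
compatible families. -/
lemma extMap_bijective (A : Diag I Y) (B : Diag J Y) (y : Y) :
    Function.Bijective (extMap A B y) := by
  let ψ : (A.ext B).lim.fib y → (A.lim.tensor B.lim).fib y := fun x =>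
    ∑ i : I × J, TensorProduct.map (A.avg y i.1) (B.avg y i.2) (x.1 i)
  refine Function.bijective_iff_has_inverse.2 ⟨ψ, fun x => ?_, fun x => ?_⟩
  · have h0 : ∀ (x : (A.lim.tensor B.lim).fib y), ψ (extMap A B y x) =
        ∑ i : I × J, TensorProduct.map (A.avg y i.1) (B.avg y i.2)
          (TensorProduct.map (A.ev y i.1) (B.ev y i.2) x) := fun x => rfl
    rw [h0]
    induction x using TensorProduct.induction_on with
    | zero => simp
    | tmul v w =>
      have h1 : ∑ i : I × J, TensorProduct.map (A.avg y i.1) (B.avg y i.2)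
          (TensorProduct.map (A.ev y i.1) (B.ev y i.2) (v ⊗ₜ w)) =
          (∑ i, A.avg y i (v.1 i)) ⊗ₜ[ℂ] (∑ j, B.avg y j (w.1 j)) := by
        rw [TensorProduct.sum_tmul, Fintype.sum_prod_type]
        refine Finset.sum_congr rfl fun i _ => ?_
        rw [TensorProduct.tmul_sum]
        rfl
      rw [h1, sum_avg, sum_avg]
    | add v w hv hw =>
      simp only [map_add, Finset.sum_add_distrib] at hv hw ⊢
      rw [hv, hw]
  · refine Subtype.ext (funext fun i => ?_)
    have h1 : (extMap A B y (ψ x)).1 i = ∑ k : I × J, TensorProduct.map (A.ev y i.1) (B.ev y i.2)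
        (TensorProduct.map (A.avg y k.1) (B.avg y k.2) (x.1 k)) := map_sum
          (TensorProduct.map (A.ev y i.1) (B.ev y i.2)) _ _
    -- Evaluating after averaging gives the normalised sum over arrows of the product groupoid,
    -- since such arrows are pairs of arrows.
    have h2 : ∀ (k : I × J) (z : ((A.ext B).D k).fib y),
        TensorProduct.map (A.ev y i.1) (B.ev y i.2)
          (TensorProduct.map (A.avg y k.1) (B.avg y k.2) z) =
        ((Fintype.card (Σ k : I, (k ⟶ i.1)) : ℂ)⁻¹ * (Fintype.card (Σ k : J, (k ⟶ i.2)) : ℂ)⁻¹) •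
          ∑ f : (k ⟶ i), (A.ext B).T f y z := by
      intro k z
      induction z using TensorProduct.induction_on with
      | zero => simp
      | tmul v w =>
        change ((Fintype.card (Σ k : I, (k ⟶ i.1)) : ℂ)⁻¹ • ∑ f : k.1 ⟶ i.1, A.T f y v) ⊗ₜ[ℂ]
          ((Fintype.card (Σ k : J, (k ⟶ i.2)) : ℂ)⁻¹ • ∑ f : k.2 ⟶ i.2, B.T f y w) = _
        rw [TensorProduct.smul_tmul_smul, TensorProduct.sum_tmul]
        congr 1
        simp_rw [TensorProduct.tmul_sum]
        exact (Fintype.sum_prod_type (fun f : (k.1 ⟶ i.1) × (k.2 ⟶ i.2) =>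
          A.T f.1 y v ⊗ₜ[ℂ] B.T f.2 y w)).symm
      | add v w hv hw => simp only [map_add, hv, hw, Finset.sum_add_distrib, smul_add]
    have h3 : ∀ k : I × J, ∑ f : (k ⟶ i), (A.ext B).T f y (x.1 k) =
        Fintype.card (k ⟶ i) • x.1 i := fun k => by
      rw [Finset.sum_congr rfl fun f _ => x.2 k i f, Finset.sum_const, Finset.card_univ]
    have h4 : ∀ k : I × J, Fintype.card (k ⟶ i) =
        Fintype.card (k.1 ⟶ i.1) * Fintype.card (k.2 ⟶ i.2) := fun k =>
      Fintype.card_prod (k.1 ⟶ i.1) (k.2 ⟶ i.2)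
    rw [h1, Finset.sum_congr rfl fun k _ => h2 k (x.1 k), ← Finset.smul_sum,
      Finset.sum_congr rfl fun k _ => h3 k, ← Finset.sum_smul, ← Nat.cast_smul_eq_nsmul ℂ,
      smul_smul]
    -- The number of arrows into a pair is the product of the two numbers, so the normalisations
    -- cancel.
    have h5 : ((∑ k : I × J, Fintype.card (k ⟶ i) : ℕ) : ℂ) =
        Fintype.card (Σ k : I, (k ⟶ i.1)) * Fintype.card (Σ k : J, (k ⟶ i.2)) := by
      simp_rw [h4]
      rw [Fintype.card_sigma, Fintype.card_sigma, Fintype.sum_prod_type, ← Nat.cast_mul,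
        Finset.sum_mul_sum]
    rw [h5, ← mul_inv, inv_mul_cancel₀ (mul_ne_zero (card_ne_zero _) (card_ne_zero _)), one_smul]

/-- The tensor product of two limits is the limit of the external tensor product. -/
theorem lim_ext (A : Diag I Y) (B : Diag J Y) :
    Nonempty (VBundle.Iso (A.lim.tensor B.lim) (A.ext B).lim) :=
  ⟨VBundle.Iso.ofBijective (extMap A B) (extMap_bijective A B) (fun {x y} f w => by
      refine Subtype.ext (funext fun i => ?_)
      change TensorProduct.map (A.ev y i.1) (B.ev y i.2) ((A.lim.tensor B.lim).act f w) =
        TensorProduct.map ((A.D i.1).act f) ((B.D i.2).act f)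
          (TensorProduct.map (A.ev x i.1) (B.ev x i.2) w)
      induction w using TensorProduct.induction_on with
      | zero => simp
      | tmul v w => rfl
      | add v w hv hw => simp only [map_add, hv, hw])
    fun y s hs i => VBundle.tensor_map_mem (E := A.lim) (F := B.lim) (fun y => A.ev y i.1)
      (fun y => B.ev y i.2) y (fun s hs => hs i.1) (fun s hs => hs i.2) s hs⟩

end Diag

/-- Induction over finite types up to bijection: the empty type gives the zero bundle, and `Option`
adds one summand. -/
lemma VectIso.mk_pi {Y : Type u} [TopGpd.{u, v} Y] {K : Type} [Fintype K] (E : K → VBundle Y) :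
    VectIso.mk (VBundle.pi E) = ∑ k, VectIso.mk (E k) := by
  classical
  refine Fintype.induction_empty_option (P := fun K _ => ∀ E : K → VBundle Y,
    VectIso.mk (VBundle.pi E) = ∑ k, VectIso.mk (E k)) ?_ ?_ ?_ K E
  · intro α β _ e ih E
    have := Fintype.ofEquiv β e.symm
    rw [← Equiv.sum_comp e]
    refine Eq.trans ?_ ((ih fun a => E (e a)).trans (Finset.sum_congr (by ext; simp) fun _ _ => rfl))
    exact VectIso.sound (VBundle.Iso.ofBijective (fun y =>
      LinearMap.pi fun a => LinearMap.proj (e a)) (fun y =>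
        ⟨fun v w h => funext fun b => by
          obtain ⟨a, rfl⟩ := e.surjective b
          exact congrFun h a, fun v => ⟨fun b => e.apply_symm_apply b ▸ v (e.symm b), funext fun a => by
          have : ∀ (a' : α) (h : e a' = e a), (h ▸ v a' : (E (e a)).fib y) = v a := by
            intro a' h
            obtain rfl := e.injective h
            rfl
          exact this _ _⟩⟩) (fun f w => rfl) fun y s hs a => hs (e a))
  · intro E
    rw [Fintype.sum_empty]
    exact VectIso.sound (VBundle.Iso.ofBijective (fun y => 0)
      (fun y => ⟨fun v w _ => funext fun i => i.elim, fun v => ⟨0, rfl⟩⟩) (fun f w => rfl)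
      fun y s hs => trivial)
  · intro α _ ih E
    rw [Fintype.sum_option, ← ih fun a => E (some a)]
    exact VectIso.sound (VBundle.Iso.ofBijective
      (F := (E none).prod (VBundle.pi fun a => E (some a)))
      (fun y => (LinearMap.proj none).prod (LinearMap.pi fun a => LinearMap.proj (some a)))
      (fun y => ⟨fun v w h => funext fun b => by
        rcases b with _ | a
        · exact congrArg Prod.fst h
        · exact congrFun (congrArg Prod.snd h) a, fun v =>
          ⟨fun b => match b with | none => v.1 | some a => v.2 a, rfl⟩⟩) (fun f w => rfl)
      fun y s hs => ⟨hs none, fun a => hs (some a)⟩)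

/-! ### Symmetric powers of labelled collections of bundles -/

section castE

variable {Y : Type u} [TopGpd.{u, v} Y] {L : Type} (E : L → VBundle Y)

/-- The identity map between members with equal labels of a collection of bundles. -/
def castE {l l' : L} (h : l = l') (y : Y) : (E l).fib y →ₗ[ℂ] (E l').fib y := by
  subst h
  exact LinearMap.id

lemma castE_castE {l l' l'' : L} (h : l = l') (h' : l' = l'') (y : Y) (w : (E l).fib y) :
    castE E h' y (castE E h y w) = castE E (h.trans h') y w := by
  subst h h'
  rfl

lemma castE_act {l l' : L} (h : l = l') {x y : Y} (f : x ⟶ y) (w : (E l).fib x) :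
    castE E h y ((E l).act f w) = (E l').act f (castE E h x w) := by
  subst h
  rfl

lemma castE_cont {l l' : L} (h : l = l') (y : Y) (s) (hs : s ∈ (E l).contAt y) :
    (fun x => castE E h x (s x)) ∈ (E l').contAt y := by
  subst h
  exact hs

lemma castE_congr {A : Type} {lab : A → L} {y : Y} (w : ∀ a, (E (lab a)).fib y) {a a' : A} {l : L}
    (h : lab a = l) (h' : lab a' = l) (ha : a = a') : castE E h y (w a) = castE E h' y (w a') := by
  subst ha
  rfl

lemma castE_map {L' : Type} (e : L' → L) {E' : L' → VBundle Y} {y : Y}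
    (φ : ∀ l, (E (e l)).fib y →ₗ[ℂ] (E' l).fib y) {l l' : L'} (h : l = l')
    (h' : e l = e l') (w : (E (e l)).fib y) :
    φ l' (castE E h' y w) = castE E' h y (φ l w) := by
  subst h
  rfl

variable {A A' A'' : Type} [Fintype A] [Fintype A'] [Fintype A''] {lab : A → L} {lab' : A' → L}
  {lab'' : A'' → L}

/-- The map between tensor products that is induced by a label preserving bijection. -/
def permT (κ : A' ≃ A) (h : ∀ a', lab (κ a') = lab' a') (y : Y) :
    (VBundle.piTensor fun a => E (lab a)).fib y →ₗ[ℂ]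
      (VBundle.piTensor fun a => E (lab' a)).fib y :=
  VBundle.reT (P := fun a => E (lab a)) (P' := fun a => E (lab' a)) κ (fun a' y => castE E (h a') y) y

lemma permT_tprod (κ : A' ≃ A) (h : ∀ a', lab (κ a') = lab' a') (y : Y)
    (w : ∀ a, (E (lab a)).fib y) : permT E κ h y (PiTensorProduct.tprod ℂ w) =
      PiTensorProduct.tprod ℂ fun a' => castE E (h a') y (w (κ a')) :=
  VBundle.reT_tprod _ _ _ _

lemma permT_nat (κ : A' ≃ A) (h : ∀ a', lab (κ a') = lab' a') {x y : Y} (b : x ⟶ y)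
    (w : (VBundle.piTensor fun a => E (lab a)).fib x) :
    permT E κ h y ((VBundle.piTensor fun a => E (lab a)).act b w) =
      (VBundle.piTensor fun a => E (lab' a)).act b (permT E κ h x w) :=
  VBundle.reT_nat _ _ (fun a' _ _ b w => castE_act E (h a') b w) b w

lemma permT_cont (κ : A' ≃ A) (h : ∀ a', lab (κ a') = lab' a') (y : Y) (s)
    (hs : s ∈ (VBundle.piTensor fun a => E (lab a)).contAt y) :
    (fun x => permT E κ h x (s x)) ∈ (VBundle.piTensor fun a => E (lab' a)).contAt y :=
  VBundle.reT_cont _ _ (fun a' y s hs => castE_cont E (h a') y s hs) y s hs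

lemma permT_permT (κ : A' ≃ A) (h : ∀ a', lab (κ a') = lab' a') (κ' : A'' ≃ A')
    (h' : ∀ a'', lab' (κ' a'') = lab'' a'') (κ'' : A'' ≃ A) (h'' : ∀ a'', lab (κ'' a'') = lab'' a'')
    (hκ : ∀ a, κ'' a = κ (κ' a)) (y : Y) (w : (VBundle.piTensor fun a => E (lab a)).fib y) :
    permT E κ' h' y (permT E κ h y w) = permT E κ'' h'' y w := by
  refine LinearMap.congr_fun (VBundle.piTensor_ext (φ := permT E κ' h' y ∘ₗ permT E κ h y)
    (ψ := permT E κ'' h'' y) fun w => ?_) w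
  rw [LinearMap.comp_apply, permT_tprod, permT_tprod, permT_tprod]
  exact congrArg _ (funext fun a => (castE_castE E _ _ _ _).trans
    (castE_congr E w _ _ (hκ a).symm))

lemma permT_eq_self (κ : A ≃ A) (h : ∀ a, lab (κ a) = lab a) (hκ : ∀ a, κ a = a) (y : Y)
    (w : (VBundle.piTensor fun a => E (lab a)).fib y) : permT E κ h y w = w := by
  refine LinearMap.congr_fun (VBundle.piTensor_ext (φ := permT E κ h y)
    (ψ := LinearMap.id) fun w => ?_) w
  rw [permT_tprod]
  exact congrArg _ (funext fun a => castE_congr E w (h a) rfl (hκ a))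

/-- The map between tensor products that is induced by maps between the factors. -/
def mapT {P P' : A → VBundle Y} (f : ∀ a y, (P a).fib y →ₗ[ℂ] (P' a).fib y) (y : Y) :
    (VBundle.piTensor P).fib y →ₗ[ℂ] (VBundle.piTensor P').fib y :=
  PiTensorProduct.map fun a => f a y

lemma mapT_tprod {P P' : A → VBundle Y} (f : ∀ a y, (P a).fib y →ₗ[ℂ] (P' a).fib y) (y : Y)
    (w : ∀ a, (P a).fib y) : mapT f y (PiTensorProduct.tprod ℂ w) =
      PiTensorProduct.tprod ℂ (fun a => f a y (w a)) :=
  PiTensorProduct.map_tprod _ _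

lemma mapT_nat {P P' : A → VBundle Y} (f : ∀ a y, (P a).fib y →ₗ[ℂ] (P' a).fib y)
    (hf : ∀ a {x y : Y} (b : x ⟶ y) w, f a y ((P a).act b w) = (P' a).act b (f a x w))
    {x y : Y} (b : x ⟶ y) (w : (VBundle.piTensor P).fib x) :
    mapT f y ((VBundle.piTensor P).act b w) = (VBundle.piTensor P').act b (mapT f x w) := by
  refine LinearMap.congr_fun (VBundle.piTensor_ext (φ := mapT f y ∘ₗ (VBundle.piTensor P).act b)
    (ψ := (VBundle.piTensor P').act b ∘ₗ mapT f x) fun w => ?_) w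
  rw [LinearMap.comp_apply, LinearMap.comp_apply, PiTensorProduct.map_tprod, mapT_tprod, mapT_tprod,
    PiTensorProduct.map_tprod]
  exact congrArg _ (funext fun a => hf a b _)

lemma mapT_cont {P P' : A → VBundle Y} (f : ∀ a y, (P a).fib y →ₗ[ℂ] (P' a).fib y)
    (hf : ∀ a y, ∀ s ∈ (P a).contAt y, (fun x => f a x (s x)) ∈ (P' a).contAt y)
    (y : Y) (s) (hs : s ∈ (VBundle.piTensor P).contAt y) :
    (fun x => mapT f x (s x)) ∈ (VBundle.piTensor P').contAt y := by
  obtain ⟨K, _, c, t, hc, ht, hs⟩ := hs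
  refine ⟨K, inferInstance, c, fun k a x => f a x (t k a x), hc, fun k a => hf a y _ (ht k _), ?_⟩
  filter_upwards [hs] with x hx
  rw [hx, map_sum]
  refine Finset.sum_congr rfl fun k _ => ?_
  rw [map_smul, mapT_tprod]

lemma mapT_mapT_of_inv {P P' : A → VBundle Y} (f : ∀ a y, (P a).fib y →ₗ[ℂ] (P' a).fib y)
    (f' : ∀ a y, (P' a).fib y →ₗ[ℂ] (P a).fib y) (y : Y) (h : ∀ a v, f' a y (f a y v) = v)
    (w : (VBundle.piTensor P).fib y) : mapT f' y (mapT f y w) = w := by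
  refine LinearMap.congr_fun (VBundle.piTensor_ext (φ := mapT f' y ∘ₗ mapT f y)
    (ψ := LinearMap.id) fun w => ?_) w
  rw [LinearMap.comp_apply, mapT_tprod, mapT_tprod]
  exact congrArg _ (funext fun a => h a _)

/-- A family of maps that depends only on the label commutes with label preserving bijections. This
makes maps of labelled bundles compatible with the arrows of `MIdx`. -/
lemma mapT_permT {L' : Type} {e : L' → L} {E' : L' → VBundle Y}
    (φ : ∀ l y, (E (e l)).fib y →ₗ[ℂ] (E' l).fib y) {lab : A → L'} {lab' : A' → L'}
    (κ : A' ≃ A) (h : ∀ a', lab (κ a') = lab' a') (h' : ∀ a', e (lab (κ a')) = e (lab' a')) (y : Y)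
    (w : (VBundle.piTensor fun a => E (e (lab a))).fib y) :
    mapT (P' := fun a => E' (lab' a)) (fun a => φ (lab' a)) y
        (permT E (lab := fun a => e (lab a)) (lab' := fun a => e (lab' a)) κ h' y w) =
      permT E' κ h y (mapT (P' := fun a => E' (lab a)) (fun a => φ (lab a)) y w) := by
  refine LinearMap.congr_fun (VBundle.piTensor_ext
    (φ := mapT (P' := fun a => E' (lab' a)) (fun a => φ (lab' a)) y ∘ₗ
      permT E (lab := fun a => e (lab a)) (lab' := fun a => e (lab' a)) κ h' y)
    (ψ := permT E' κ h y ∘ₗ mapT (P' := fun a => E' (lab a)) (fun a => φ (lab a)) y) fun w => ?_) w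
  rw [LinearMap.comp_apply, LinearMap.comp_apply, permT_tprod, mapT_tprod, mapT_tprod, permT_tprod]
  exact congrArg _ (funext fun a => castE_map E e (fun l => φ l y) _ _ _)

end castE

/-- A set of labels with bidegrees `(k, b)`, such that `k` is positive and only finitely many labels
lie below any given bound. -/
structure LabelSet where
  car : Type
  k : car → ℕ
  b : car → ℕ
  k_pos : ∀ l, 0 < k l
  fin : ∀ n m, Finite {l : car // k l ≤ n ∧ b l ≤ m}

/-- Finite sequences of labels of total bidegree `(n, m)`. -/
structure MIdx (Λ : LabelSet) (n m : ℕ) : Type where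
  N : ℕ
  lab : Fin N → Λ.car
  hk : ∑ i, Λ.k (lab i) = n
  hb : ∑ i, Λ.b (lab i) = m

namespace MIdx

variable {Λ : LabelSet} {n m : ℕ}

lemma k_le (p : MIdx Λ n m) (i : Fin p.N) : Λ.k (p.lab i) ≤ n :=
  (Finset.single_le_sum (f := fun i => Λ.k (p.lab i)) (fun _ _ => Nat.zero_le _)
    (Finset.mem_univ i)).trans_eq p.hk

lemma b_le (p : MIdx Λ n m) (i : Fin p.N) : Λ.b (p.lab i) ≤ m :=
  (Finset.single_le_sum (f := fun i => Λ.b (p.lab i)) (fun _ _ => Nat.zero_le _)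
    (Finset.mem_univ i)).trans_eq p.hb

/-- Every label contributes at least 1 to the first degree. Bounded length together with
`LabelSet.fin` makes the groupoid of sequences finite. -/
lemma N_le (p : MIdx Λ n m) : p.N ≤ n := by
  have h : ∑ _i : Fin p.N, 1 ≤ ∑ i, Λ.k (p.lab i) := Finset.sum_le_sum fun i _ => Λ.k_pos _
  rw [p.hk] at h
  simpa using h

instance : Finite (MIdx Λ n m) := by
  have := Λ.fin n m
  refine Finite.of_injective (β := Σ N : Fin (n + 1), (Fin N → {l : Λ.car // Λ.k l ≤ n ∧ Λ.b l ≤ m}))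
    (fun p => ⟨⟨p.N, Nat.lt_succ_of_le p.N_le⟩, fun i => ⟨p.lab i, p.k_le i, p.b_le i⟩⟩) ?_
  rintro ⟨N, a, h1, h2⟩ ⟨N', a', h1', h2'⟩ h
  obtain ⟨h3, h4⟩ := Sigma.mk.inj h
  obtain rfl : N = N' := congrArg Fin.val h3
  have h5 : a = a' := funext fun i => congrArg Subtype.val (congrFun (eq_of_heq h4) i)
  subst h5
  rfl

instance : Fintype (MIdx Λ n m) := Fintype.ofFinite _

/-- The arrows are the label preserving bijections. -/
instance : Groupoid.{0} (MIdx Λ n m) where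
  Hom p p' := {τ : Fin p.N ≃ Fin p'.N // ∀ i, p.lab i = p'.lab (τ i)}
  id p := ⟨Equiv.refl _, fun _ => rfl⟩
  comp f g := ⟨f.1.trans g.1, fun i => (f.2 i).trans (g.2 _)⟩
  inv {p p'} f := ⟨f.1.symm, fun i => by rw [f.2, f.1.apply_symm_apply]⟩
  id_comp _ := rfl
  comp_id _ := rfl
  assoc _ _ _ := rfl
  inv_comp f := Subtype.ext f.1.symm_trans_self
  comp_inv f := Subtype.ext f.1.self_trans_symm

instance (p p' : MIdx Λ n m) : Fintype (p ⟶ p') :=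
  Fintype.ofInjective (β := Fin p.N ≃ Fin p'.N) Subtype.val Subtype.val_injective

lemma lab_symm {p p' : MIdx Λ n m} (f : p ⟶ p') (i : Fin p'.N) :
    p.lab (f.1.symm i) = p'.lab i := by
  rw [f.2, f.1.apply_symm_apply]

end MIdx

namespace LabelSet

variable {Y : Type u} [TopGpd.{u, v} Y] (Λ : LabelSet)

/-- The tensor products of the bundles belonging to the sequences of labels of bidegree `(n, m)`. -/
def diag (E : Λ.car → VBundle Y) (n m : ℕ) : Diag (MIdx Λ n m) Y where
  D p := VBundle.piTensor fun i => E (p.lab i)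
  T {p p'} f y := permT E (lab := p.lab) (lab' := p'.lab) f.1.symm (MIdx.lab_symm f) y
  nat {p p'} f _ _ a w := permT_nat E (lab := p.lab) (lab' := p'.lab) f.1.symm (MIdx.lab_symm f) a w
  cont {p p'} f y s hs :=
    permT_cont E (lab := p.lab) (lab' := p'.lab) f.1.symm (MIdx.lab_symm f) y s hs
  comp {p p' p''} f g y w := (permT_permT E (lab := p.lab) (lab' := p'.lab) (lab'' := p''.lab)
    f.1.symm (MIdx.lab_symm f) g.1.symm (MIdx.lab_symm g) (f ≫ g).1.symm (MIdx.lab_symm (f ≫ g))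
      (fun _ => rfl) y w).symm

/-- The part of bidegree `(n, m)` of the total symmetric power of a labelled collection of bundles. -/
def SS (E : Λ.car → VBundle Y) (n m : ℕ) : VBundle Y := (Λ.diag E n m).lim

lemma diag_T {E : Λ.car → VBundle Y} {n m : ℕ} {p p' : MIdx Λ n m} (f : p ⟶ p') (y : Y)
    (w : ∀ i, (E (p.lab i)).fib y) :
    (Λ.diag E n m).T f y (PiTensorProduct.tprod ℂ w) = PiTensorProduct.tprod ℂ fun i =>
      castE E (MIdx.lab_symm f i) y (w (f.1.symm i)) :=
  permT_tprod E (lab := p.lab) (lab' := p'.lab) f.1.symm (MIdx.lab_symm f) y w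

/-- Invariance under isomorphisms of the bundles and injective reindexing of the labels. -/
theorem SS_reindex {Λ Λ' : LabelSet} (e : Λ'.car → Λ.car) (he : Function.Injective e)
    {E : Λ.car → VBundle Y} {E' : Λ'.car → VBundle Y}
    (i : ∀ l, Nonempty (VBundle.Iso (E (e l)) (E' l))) {n m n' m' : ℕ}
    (hw : ∀ N (lab : Fin N → Λ'.car), (∑ i, Λ.k (e (lab i)) = n ∧ ∑ i, Λ.b (e (lab i)) = m) ↔
      (∑ i, Λ'.k (lab i) = n' ∧ ∑ i, Λ'.b (lab i) = m'))
    (hs : ∀ l, Λ.k l ≤ n → Λ.b l ≤ m → l ∈ Set.range e) :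
    VectIso.mk (Λ.SS E n m) = VectIso.mk (Λ'.SS E' n' m') := by
  have i := fun l => (i l).some
  -- The hypothesis `hw` compares degrees of whole sequences and not of single labels, so the first
  -- degree may be rescaled, as `SS_column` does.
  let F : MIdx Λ' n' m' → MIdx Λ n m := fun p =>
    ⟨p.N, fun j => e (p.lab j), ((hw _ _).2 ⟨p.hk, p.hb⟩).1, ((hw _ _).2 ⟨p.hk, p.hb⟩).2⟩
  let φ : ∀ l y, (E (e l)).fib y →ₗ[ℂ] (E' l).fib y := fun l y => ((i l).equiv y).toLinearMap
  let ψ : ∀ l y, (E' l).fib y →ₗ[ℂ] (E (e l)).fib y := fun l y => ((i l).equiv y).symm.toLinearMap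
  let q : ∀ (p : MIdx Λ' n' m') y, (VBundle.piTensor fun j => E (e (p.lab j))).fib y →ₗ[ℂ]
      (VBundle.piTensor fun j => E' (p.lab j)).fib y := fun p => mapT fun j => φ (p.lab j)
  let ι : ∀ (p : MIdx Λ' n' m') y, (VBundle.piTensor fun j => E' (p.lab j)).fib y →ₗ[ℂ]
      (VBundle.piTensor fun j => E (e (p.lab j))).fib y := fun p => mapT fun j => ψ (p.lab j)
  refine Quotient.sound (Diag.limIso_of_equiv (Λ.diag E n m) (Λ'.diag E' n' m') F q ι
    (fun p x y a w => mapT_nat _ (fun j _ _ b w => (i (p.lab j)).nat b w) a w)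
    (fun p y s hs => mapT_cont _ (fun j y s hs => ((i (p.lab j)).cont y s).1 hs) y s hs)
    (fun p y w => mapT_mapT_of_inv _ _ y (fun j v => ((i (p.lab j)).equiv y).apply_symm_apply v) w)
    (fun p y w => mapT_mapT_of_inv _ _ y (fun j v => ((i (p.lab j)).equiv y).symm_apply_apply v) w)
    (fun {p p'} g => (⟨g.1, fun j => congrArg e (g.2 j)⟩ : F p ⟶ F p'))
    (fun {p p'} g y w => mapT_permT E φ (lab := p.lab) (lab' := p'.lab) _ _ _ y w)
    (fun {p p'} f => ⟨⟨f.1, fun j => he (f.2 j)⟩, rfl⟩) fun p => ?_)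
  -- Each label of a sequence of bidegree (n, m) has bidegree at most (n, m), so only the labels
  -- below that bound must lie in the range of e.
  choose f hf using fun j => hs (p.lab j) (p.k_le j) (p.b_le j)
  have h := (hw p.N f).1 ⟨by simp_rw [hf]; exact p.hk, by simp_rw [hf]; exact p.hb⟩
  exact ⟨⟨p.N, f, h.1, h.2⟩, ⟨⟨Equiv.refl _, fun j => hf j⟩⟩⟩

end LabelSet

lemma castE_comp {Y : Type u} [TopGpd.{u, v} Y] {L L' : Type} (E : L → VBundle Y) (e : L' → L)
    {l l' : L'} (h : l = l') (h' : e l = e l') (y : Y) (w : (E (e l)).fib y) :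
    castE (fun l => E (e l)) h y w = castE E h' y w := by
  subst h
  rfl

/-! ### Refinement and disjoint union of label sets -/

namespace LabelSet

variable {Y : Type u} [TopGpd.{u, v} Y] (Λ : LabelSet)

/-- The replacement of every label by finitely many labels of the same bidegree. -/
def sigma (I : Λ.car → Type) [∀ l, Finite (I l)] : LabelSet where
  car := Σ l, I l
  k x := Λ.k x.1
  b x := Λ.b x.1
  k_pos x := Λ.k_pos x.1
  fin n m := by
    have := Λ.fin n m
    exact Finite.of_injective
      (β := Σ l : {l : Λ.car // Λ.k l ≤ n ∧ Λ.b l ≤ m}, I l.1)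
      (fun x => ⟨⟨x.1.1, x.2⟩, x.1.2⟩) (by
        rintro ⟨⟨l, x⟩, h⟩ ⟨⟨l', x'⟩, h'⟩ h1
        obtain ⟨h2, h3⟩ := Sigma.mk.inj h1
        obtain rfl : l = l' := congrArg Subtype.val h2
        obtain rfl := eq_of_heq h3
        rfl)

/-- If every bundle of a labelled collection is a direct sum of finitely many bundles, then the
collection may be replaced by the collection of all summands. -/
theorem SS_sigma (I : Λ.car → Type) [∀ l, Fintype (I l)] {E : Λ.car → VBundle Y}
    {E' : ∀ l, I l → VBundle Y}
    (pr : ∀ l x y, (E l).fib y →ₗ[ℂ] (E' l x).fib y)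
    (inc : ∀ l x y, (E' l x).fib y →ₗ[ℂ] (E l).fib y)
    (pr_nat : ∀ l x {y y' : Y} (a : y ⟶ y') w,
      pr l x y' ((E l).act a w) = (E' l x).act a (pr l x y w))
    (pr_cont : ∀ l x y, ∀ s ∈ (E l).contAt y, (fun z => pr l x z (s z)) ∈ (E' l x).contAt y)
    (pr_inc : ∀ l x y v, pr l x y (inc l x y v) = v)
    (pr_inc_ne : ∀ l x x' y v, x ≠ x' → pr l x y (inc l x' y v) = 0)
    (sum_inc_pr : ∀ l y v, ∑ x, inc l x y (pr l x y v) = v) (n m : ℕ) :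
    VectIso.mk (Λ.SS E n m) = VectIso.mk ((Λ.sigma I).SS (fun x => E' x.1 x.2) n m) := by
  classical
  -- For every choice s of a summand at each position, the tensor products of the projections and of
  -- the inclusions. By the three facts below, expanding ⨂ (⊕ E') gives a direct sum decomposition
  -- indexed by s.
  let P : ∀ {N : ℕ} (lab : Fin N → Λ.car) (s : ∀ i, I (lab i)) y,
      (VBundle.piTensor fun i => E (lab i)).fib y →ₗ[ℂ]
        (VBundle.piTensor fun i => E' (lab i) (s i)).fib y :=
    fun lab s => mapT fun i => pr (lab i) (s i)
  let Q : ∀ {N : ℕ} (lab : Fin N → Λ.car) (s : ∀ i, I (lab i)) y,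
      (VBundle.piTensor fun i => E' (lab i) (s i)).fib y →ₗ[ℂ]
        (VBundle.piTensor fun i => E (lab i)).fib y :=
    fun lab s => mapT fun i => inc (lab i) (s i)
  have hPQ : ∀ {N : ℕ} (lab : Fin N → Λ.car) (s : ∀ i, I (lab i)) y v,
      P lab s y (Q lab s y v) = v := fun lab s y v =>
    mapT_mapT_of_inv _ _ y (fun i v => pr_inc _ _ _ _) v
  have hPQ' : ∀ {N : ℕ} (lab : Fin N → Λ.car) (s s' : ∀ i, I (lab i)) y v, s ≠ s' →
      P lab s y (Q lab s' y v) = 0 := by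
    intro N lab s s' y v hs
    obtain ⟨i, hi⟩ := Function.ne_iff.1 hs
    refine LinearMap.congr_fun (VBundle.piTensor_ext (φ := P lab s y ∘ₗ Q lab s' y)
      (ψ := 0) fun w => ?_) v
    rw [LinearMap.comp_apply, mapT_tprod, mapT_tprod]
    exact MultilinearMap.map_coord_zero _ i (pr_inc_ne _ _ _ _ _ hi)
  have hQP : ∀ {N : ℕ} (lab : Fin N → Λ.car) y v, ∑ s, Q lab s y (P lab s y v) = v := by
    intro N lab y v
    have h := LinearMap.congr_fun (VBundle.piTensor_ext
      (φ := ∑ s, Q lab s y ∘ₗ P lab s y) (ψ := LinearMap.id) fun w => ?_) v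
    · rw [LinearMap.sum_apply] at h
      exact h
    · rw [LinearMap.sum_apply]
      have h1 : ∀ s : (∀ i, I (lab i)), (Q lab s y ∘ₗ P lab s y) (PiTensorProduct.tprod ℂ w) =
          PiTensorProduct.tprod ℂ fun i => inc (lab i) (s i) y (pr (lab i) (s i) y (w i)) := by
        intro s
        rw [LinearMap.comp_apply, mapT_tprod, mapT_tprod]
      rw [Finset.sum_congr rfl fun s _ => h1 s, LinearMap.id_apply]
      refine (MultilinearMap.map_sum (PiTensorProduct.tprod ℂ) (fun (i : Fin N) (x : I (lab i)) =>
        inc (lab i) x y (pr (lab i) x y (w i)))).symm.trans ?_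
      exact congrArg _ (funext fun i => sum_inc_pr _ _ _)
  let F : MIdx (Λ.sigma I) n m → MIdx Λ n m := fun p => ⟨p.N, fun i => (p.lab i).1, p.hk, p.hb⟩
  let φ : ∀ {p p' : MIdx (Λ.sigma I) n m}, (p ⟶ p') → (F p ⟶ F p') :=
    fun {p p'} g => ⟨g.1, fun i => congrArg Sigma.fst (g.2 i)⟩
  let q : ∀ (p : MIdx (Λ.sigma I) n m) y, ((Λ.diag E n m).D (F p)).fib y →ₗ[ℂ]
      (((Λ.sigma I).diag (fun x => E' x.1 x.2) n m).D p).fib y :=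
    fun p => P (fun i => (p.lab i).1) (fun i => (p.lab i).2)
  have hq : ∀ {p p' : MIdx (Λ.sigma I) n m} (g : p ⟶ p') y v,
      q p' y ((Λ.diag E n m).T (φ g) y v) =
        ((Λ.sigma I).diag (fun x => E' x.1 x.2) n m).T g y (q p y v) :=
    fun {p p'} g y v => mapT_permT E (e := Sigma.fst) (E' := fun x : (Σ l, I l) => E' x.1 x.2)
      (fun x => pr x.1 x.2) (lab := p.lab) (lab' := p'.lab) _ _ _ y v
  refine VectIso.sound (VBundle.Iso.ofBijective (E := (Λ.diag E n m).lim)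
    (F := ((Λ.sigma I).diag (fun x => E' x.1 x.2) n m).lim) (fun y =>
      { toFun := fun w => ⟨fun p => q p y (w.1 (F p)), fun p p' g => ?_⟩
        map_add' := fun w w' => Subtype.ext (funext fun p => map_add (q p y) _ _)
        map_smul' := fun c w => Subtype.ext (funext fun p => map_smul (q p y) _ _) })
      (fun y => ⟨fun w w' h => ?_, fun u => ?_⟩)
    (fun f w => Subtype.ext (funext fun p => mapT_nat
      (P := fun i => E (p.lab i).1) (P' := fun i => E' (p.lab i).1 (p.lab i).2)
      (fun i => pr (p.lab i).1 (p.lab i).2) (fun i _ _ a w => pr_nat _ _ a w) f _))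
    fun y s hs p => mapT_cont
      (P := fun i => E (p.lab i).1) (P' := fun i => E' (p.lab i).1 (p.lab i).2)
      (fun i => pr (p.lab i).1 (p.lab i).2) (fun i y s hs => pr_cont _ _ y s hs) y _ (hs (F p)))
  · exact (hq g y _).symm.trans (congrArg _ (w.2 _ _ (φ g)))
  · refine Subtype.ext (funext fun p => ?_)
    rw [← hQP p.lab y (w.1 p), ← hQP p.lab y (w'.1 p)]
    refine Finset.sum_congr rfl fun s _ => congrArg _ ?_
    exact congrFun (congrArg Subtype.val h) (⟨p.N, fun i => ⟨p.lab i, s i⟩, p.hk, p.hb⟩)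
  · let S : ∀ (p : MIdx Λ n m) (s : ∀ i, I (p.lab i)), MIdx (Λ.sigma I) n m :=
      fun p s => ⟨p.N, fun i => ⟨p.lab i, s i⟩, p.hk, p.hb⟩
    let t : ∀ p : MIdx Λ n m, ((Λ.diag E n m).D p).fib y := fun p =>
      ∑ s, Q p.lab s y (u.1 (S p s))
    have ht : ∀ (p : MIdx Λ n m) (s : ∀ i, I (p.lab i)), P p.lab s y (t p) = u.1 (S p s) := by
      intro p s
      refine (map_sum (P p.lab s y) _ _).trans ?_
      refine (Finset.sum_eq_single s (fun s' _ h => hPQ' _ _ _ _ _ h.symm)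
        (fun h => absurd (Finset.mem_univ _) h)).trans ?_
      exact hPQ _ _ _ _
    refine ⟨⟨t, fun p p' f => ?_⟩, Subtype.ext (funext fun p => ht (F p) fun i => (p.lab i).2)⟩
    -- The compatibility of t can be tested on each summand, where it is the compatibility of u
    -- along a lifted arrow.
    have h1 : ∀ v v' : ((Λ.diag E n m).D p').fib y,
        (∀ s, P p'.lab s y v = P p'.lab s y v') → v = v' := by
      intro v v' h
      rw [← hQP p'.lab y v, ← hQP p'.lab y v']
      exact Finset.sum_congr rfl fun s _ => congrArg _ (h s)
    refine h1 _ _ fun s => ?_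
    -- Substituting lab = lab' ∘ τ lets the choice s of summands be pulled back along τ without any
    -- transport.
    obtain ⟨N, lab, h2, h3⟩ := p
    obtain ⟨τ, hτ⟩ := f
    change Fin N ≃ Fin p'.N at τ
    change ∀ i, lab i = p'.lab (τ i) at hτ
    obtain rfl : lab = fun i => p'.lab (τ i) := funext hτ
    let j : MIdx (Λ.sigma I) n m := ⟨N, fun i => ⟨p'.lab (τ i), s (τ i)⟩, h2, h3⟩
    let g : j ⟶ S p' s := ⟨τ, fun i => rfl⟩
    refine (hq g y (t (F j))).trans ?_
    refine (congrArg _ (ht (F j) fun i => s (τ i))).trans ?_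
    exact (u.2 _ _ g).trans (ht p' s).symm

/-- The disjoint union of two sets of labels. -/
abbrev sum (Λ Λ' : LabelSet) : LabelSet where
  car := Λ.car ⊕ Λ'.car
  k := Sum.elim Λ.k Λ'.k
  b := Sum.elim Λ.b Λ'.b
  k_pos l := by
    rcases l with l | l
    exacts [Λ.k_pos l, Λ'.k_pos l]
  fin n m := by
    have := Λ.fin n m
    have := Λ'.fin n m
    exact Finite.of_surjective
      (α := {l : Λ.car // Λ.k l ≤ n ∧ Λ.b l ≤ m} ⊕ {l : Λ'.car // Λ'.k l ≤ n ∧ Λ'.b l ≤ m})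
      (Sum.elim (fun l => ⟨Sum.inl l.1, l.2⟩) (fun l => ⟨Sum.inr l.1, l.2⟩)) (by
        rintro ⟨l | l, h⟩
        exacts [⟨Sum.inl ⟨l, h⟩, rfl⟩, ⟨Sum.inr ⟨l, h⟩, rfl⟩])

section sum

variable {Λ} {Λ' : LabelSet} {n m : ℕ}

/-- A bijection that respects the two sides restricts to each of them, as does its inverse. This is
the reason why arrows between concatenated sequences are pairs of arrows. -/
lemma exists_sumCongr {A B A' B' : Type} (τ : A ⊕ B ≃ A' ⊕ B')
    (hτ : ∀ x, (τ x).isLeft = x.isLeft) : ∃ (τ₁ : A ≃ A') (τ₂ : B ≃ B'), τ = Equiv.sumCongr τ₁ τ₂ := by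
  have h1 : ∀ a, ∃ a', τ (Sum.inl a) = Sum.inl a' := fun a =>
    Sum.isLeft_iff.1 (hτ (Sum.inl a))
  have h2 : ∀ b, ∃ b', τ (Sum.inr b) = Sum.inr b' := fun b =>
    Sum.isRight_iff.1 (Sum.not_isLeft.1 (by rw [hτ]; simp))
  have h3 : ∀ x, (τ.symm x).isLeft = x.isLeft := fun x => by
    rw [← hτ, τ.apply_symm_apply]
  have h4 : ∀ a', ∃ a, τ (Sum.inl a) = Sum.inl a' := fun a' => by
    obtain ⟨a, ha⟩ := Sum.isLeft_iff.1 (h3 (Sum.inl a'))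
    exact ⟨a, by rw [← ha, τ.apply_symm_apply]⟩
  have h5 : ∀ b', ∃ b, τ (Sum.inr b) = Sum.inr b' := fun b' => by
    obtain ⟨b, hb⟩ := Sum.isRight_iff.1 ((Sum.not_isLeft (x := τ.symm (Sum.inr b'))).1 (by rw [h3]; simp))
    exact ⟨b, by rw [← hb, τ.apply_symm_apply]⟩
  choose f hf using h1
  choose g hg using h2
  refine ⟨Equiv.ofBijective f ⟨fun a a' h => ?_, fun a' => ?_⟩,
    Equiv.ofBijective g ⟨fun a a' h => ?_, fun b' => ?_⟩, Equiv.ext fun x => ?_⟩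
  · exact Sum.inl_injective (τ.injective (by rw [hf, hf, h]))
  · obtain ⟨a, ha⟩ := h4 a'
    exact ⟨a, Sum.inl_injective (by rw [← hf, ha])⟩
  · exact Sum.inr_injective (τ.injective (by rw [hg, hg, h]))
  · obtain ⟨a, ha⟩ := h5 b'
    exact ⟨a, Sum.inr_injective (by rw [← hg, ha])⟩
  · rcases x with a | b
    exacts [hf a, hg b]

/-- The bidegrees of the two parts of a sequence of labels. -/
def parts (p : MIdx (Λ.sum Λ') n m) :
    Finset.HasAntidiagonal.antidiagonal n × Finset.HasAntidiagonal.antidiagonal m :=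
  (⟨(∑ i, Sum.elim Λ.k (fun _ => 0) (p.lab i), ∑ i, Sum.elim (fun _ => 0) Λ'.k (p.lab i)), by
    rw [Finset.HasAntidiagonal.mem_antidiagonal, ← Finset.sum_add_distrib]
    refine Eq.trans (Finset.sum_congr rfl fun i _ => ?_) p.hk
    change _ = Sum.elim Λ.k Λ'.k (p.lab i)
    rcases p.lab i with l | l <;> simp⟩,
  ⟨(∑ i, Sum.elim Λ.b (fun _ => 0) (p.lab i), ∑ i, Sum.elim (fun _ => 0) Λ'.b (p.lab i)), by
    rw [Finset.HasAntidiagonal.mem_antidiagonal, ← Finset.sum_add_distrib]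
    refine Eq.trans (Finset.sum_congr rfl fun i _ => ?_) p.hb
    change _ = Sum.elim Λ.b Λ'.b (p.lab i)
    rcases p.lab i with l | l <;> simp⟩)

lemma parts_eq {p p' : MIdx (Λ.sum Λ') n m} (f : p ⟶ p') : parts p = parts p' := by
  have h : ∀ w : Λ.car ⊕ Λ'.car → ℕ, ∑ i, w (p.lab i) = ∑ i, w (p'.lab i) := fun w => by
    rw [← Equiv.sum_comp f.1]
    exact Finset.sum_congr rfl fun i _ => congrArg w (f.2 i)
  exact Prod.ext (Subtype.ext (Prod.ext (h _) (h _))) (Subtype.ext (Prod.ext (h _) (h _)))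

/-- The concatenation of two sequences of labels. -/
def concat {N N' : ℕ} (a : Fin N → Λ.car) (b : Fin N' → Λ'.car) : Fin (N + N') → (Λ.sum Λ').car :=
  fun i => Sum.map a b (finSumFinEquiv.symm i)

lemma concat_apply {N N' : ℕ} (a : Fin N → Λ.car) (b : Fin N' → Λ'.car) (x : Fin N ⊕ Fin N') :
    concat a b (finSumFinEquiv x) = Sum.map a b x := by
  rw [concat, Equiv.symm_apply_apply]

lemma sum_concat {N N' : ℕ} (a : Fin N → Λ.car) (b : Fin N' → Λ'.car) (w : Λ.car ⊕ Λ'.car → ℕ) :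
    ∑ i, w (concat a b i) = ∑ i, w (Sum.inl (a i)) + ∑ i, w (Sum.inr (b i)) := by
  rw [← Equiv.sum_comp finSumFinEquiv, Fintype.sum_sum_type]
  simp [concat]

variable {E : (Λ.sum Λ').car → VBundle Y}

/-- The decomposition of the tensor product of the bundles belonging to a concatenation. -/
def splitT {N N' : ℕ} (a : Fin N → Λ.car) (b : Fin N' → Λ'.car) (y : Y) :
    (VBundle.piTensor fun i => E (concat a b i)).fib y →ₗ[ℂ]
      ((VBundle.piTensor fun i => E (Sum.inl (a i))).tensor
        (VBundle.piTensor fun i => E (Sum.inr (b i)))).fib y :=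
  (PiTensorProduct.tmulEquivDep ℂ fun x => (E (Sum.map a b x)).fib y).symm.toLinearMap ∘ₗ
    permT E (lab' := Sum.map a b) finSumFinEquiv (concat_apply a b) y

/-- The inverse of `splitT`. -/
def joinT {N N' : ℕ} (a : Fin N → Λ.car) (b : Fin N' → Λ'.car) (y : Y) :
    ((VBundle.piTensor fun i => E (Sum.inl (a i))).tensor
        (VBundle.piTensor fun i => E (Sum.inr (b i)))).fib y →ₗ[ℂ]
      (VBundle.piTensor fun i => E (concat a b i)).fib y :=
  permT E (lab := Sum.map a b) (lab' := concat a b) finSumFinEquiv.symm (fun _ => rfl) y ∘ₗ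
    (PiTensorProduct.tmulEquivDep ℂ fun x => (E (Sum.map a b x)).fib y).toLinearMap

lemma splitT_tprod {N N' : ℕ} (a : Fin N → Λ.car) (b : Fin N' → Λ'.car) (y : Y)
    (w : ∀ i, (E (concat a b i)).fib y) : splitT a b y (PiTensorProduct.tprod ℂ w) =
      PiTensorProduct.tprod ℂ (fun i => castE E (concat_apply a b (Sum.inl i)) y (w (finSumFinEquiv (Sum.inl i))))
        ⊗ₜ[ℂ]
      PiTensorProduct.tprod ℂ
        (fun i => castE E (concat_apply a b (Sum.inr i)) y (w (finSumFinEquiv (Sum.inr i)))) :=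
  (congrArg (PiTensorProduct.tmulEquivDep ℂ fun x => (E (Sum.map a b x)).fib y).symm
    (permT_tprod E (lab := concat a b) (lab' := Sum.map a b) finSumFinEquiv (concat_apply a b) y
      w)).trans (PiTensorProduct.tmulEquivDep_symm_apply ℂ
        (fun x => (E (Sum.map a b x)).fib y) _)

lemma splitT_joinT {N N' : ℕ} (a : Fin N → Λ.car) (b : Fin N' → Λ'.car) (y : Y) (w) :
    splitT (E := E) a b y (joinT a b y w) = w := by
  have h := permT_permT E (lab := Sum.map a b) (lab' := concat a b) (lab'' := Sum.map a b)
    finSumFinEquiv.symm (fun x => rfl) finSumFinEquiv (concat_apply a b) (Equiv.refl _)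
    (fun _ => rfl) (fun x => by simp) y (PiTensorProduct.tmulEquivDep ℂ _ w)
  replace h := h.trans (permT_eq_self E (lab := Sum.map a b) _ _ (fun _ => rfl) y _)
  exact (congrArg (PiTensorProduct.tmulEquivDep ℂ fun x => (E (Sum.map a b x)).fib y).symm h).trans
    (LinearEquiv.symm_apply_apply _ _)

lemma joinT_splitT {N N' : ℕ} (a : Fin N → Λ.car) (b : Fin N' → Λ'.car) (y : Y) (w) :
    joinT (E := E) a b y (splitT a b y w) = w := by
  have h := permT_permT E (lab := concat a b) (lab' := Sum.map a b) (lab'' := concat a b)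
    finSumFinEquiv (concat_apply a b) finSumFinEquiv.symm (fun x => rfl) (Equiv.refl _)
    (fun _ => rfl) (fun x => by simp) y w
  refine Eq.trans ?_ (h.trans (permT_eq_self E (lab := concat a b) _ _ (fun _ => rfl) y _))
  exact congrArg (permT E (lab := Sum.map a b) (lab' := concat a b) finSumFinEquiv.symm _ y)
    (LinearEquiv.apply_symm_apply _ _)

lemma splitT_nat {N N' : ℕ} (a : Fin N → Λ.car) (b : Fin N' → Λ'.car) {x y : Y} (f : x ⟶ y) (w) :
    splitT a b y ((VBundle.piTensor fun i => E (concat a b i)).act f w) =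
      ((VBundle.piTensor fun i => E (Sum.inl (a i))).tensor
        (VBundle.piTensor fun i => E (Sum.inr (b i)))).act f (splitT a b x w) := by
  refine LinearMap.congr_fun (VBundle.piTensor_ext
    (φ := splitT a b y ∘ₗ (VBundle.piTensor fun i => E (concat a b i)).act f)
    (ψ := ((VBundle.piTensor fun i => E (Sum.inl (a i))).tensor
        (VBundle.piTensor fun i => E (Sum.inr (b i)))).act f ∘ₗ splitT a b x) fun w => ?_) w
  rw [LinearMap.comp_apply, LinearMap.comp_apply, PiTensorProduct.map_tprod, splitT_tprod,
    splitT_tprod]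
  refine Eq.trans ?_ (congrArg₂ (fun v v' => v ⊗ₜ[ℂ] v')
    (PiTensorProduct.map_tprod (fun i => (E (Sum.inl (a i))).act f) _)
    (PiTensorProduct.map_tprod (fun i => (E (Sum.inr (b i))).act f) _)).symm
  exact congrArg₂ (fun v v' => PiTensorProduct.tprod ℂ v ⊗ₜ[ℂ] PiTensorProduct.tprod ℂ v')
    (funext fun i => castE_act E _ f _) (funext fun i => castE_act E _ f _)

lemma splitT_cont {N N' : ℕ} (a : Fin N → Λ.car) (b : Fin N' → Λ'.car) (y : Y) (s)
    (hs : s ∈ (VBundle.piTensor fun i => E (concat a b i)).contAt y) :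
    (fun x => splitT a b x (s x)) ∈ ((VBundle.piTensor fun i => E (Sum.inl (a i))).tensor
        (VBundle.piTensor fun i => E (Sum.inr (b i)))).contAt y := by
  -- The scalar coefficients of a section are absorbed into the left tensor factor.
  have h1 := fun k => (VBundle.piTensor fun i => E (Sum.inl (a i))).locallyTrivial.smul_mem (b := y)
    (a := k)
  obtain ⟨K, _, c, t, hc, ht, hs⟩ := hs
  refine ⟨K, inferInstance, _, _, fun k => h1 (c k) (hc k) (Fam.tprod_mem
    (f := fun i x => castE E (concat_apply a b (Sum.inl i)) x (t k (finSumFinEquiv (Sum.inl i)) x))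
    fun i => castE_cont E _ y _ (ht k _)), fun k => Fam.tprod_mem
    (f := fun i x => castE E (concat_apply a b (Sum.inr i)) x (t k (finSumFinEquiv (Sum.inr i)) x))
    fun i => castE_cont E _ y _ (ht k _), ?_⟩
  filter_upwards [hs] with x hx
  rw [hx, map_sum]
  refine Finset.sum_congr rfl fun k _ => ?_
  rw [map_smul, splitT_tprod]
  rfl

/-- Sort the positions by the side of their label. Up to isomorphism every sequence is thus a
concatenation, which is essential surjectivity in `SS_sum`. -/
lemma exists_concat (p : MIdx (Λ.sum Λ') n m) : ∃ (N N' : ℕ) (a : Fin N → Λ.car)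
    (b : Fin N' → Λ'.car) (τ : Fin (N + N') ≃ Fin p.N), ∀ i, concat a b i = p.lab (τ i) := by
  let A := {i : Fin p.N // (p.lab i).isLeft = true}
  let B := {i : Fin p.N // ¬ (p.lab i).isLeft = true}
  let eA : Fin (Fintype.card A) ≃ A := (Fintype.equivFin A).symm
  let eB : Fin (Fintype.card B) ≃ B := (Fintype.equivFin B).symm
  choose a ha using fun i : A => Sum.isLeft_iff.1 i.2
  choose b hb using fun i : B => Sum.isRight_iff.1 (Sum.not_isLeft.1 i.2)
  refine ⟨Fintype.card A, Fintype.card B, fun i => a (eA i), fun i => b (eB i),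
    finSumFinEquiv.symm.trans ((Equiv.sumCongr eA eB).trans (Equiv.sumCompl _)), fun i => ?_⟩
  obtain ⟨x, rfl⟩ := finSumFinEquiv.surjective i
  rw [concat_apply]
  rcases x with x | x
  · rw [Equiv.trans_apply, Equiv.symm_apply_apply]
    exact (ha (eA x)).symm
  · rw [Equiv.trans_apply, Equiv.symm_apply_apply]
    exact (hb (eB x)).symm

/-- The symmetric power of the union of two collections of bundles. -/
theorem SS_sum (E : (Λ.sum Λ').car → VBundle Y) (n m : ℕ) :
    VectIso.mk ((Λ.sum Λ').SS E n m) =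
      ∑ x ∈ Finset.HasAntidiagonal.antidiagonal n, ∑ y ∈ Finset.HasAntidiagonal.antidiagonal m,
        VectIso.mk (Λ.SS (fun l => E (Sum.inl l)) x.1 y.1) *
          VectIso.mk (Λ'.SS (fun l => E (Sum.inr l)) x.2 y.2) := by
  -- Relabelling preserves the bidegrees of both halves, so the limit is a direct sum over them. On
  -- each part the groupoid of sequences is equivalent, by concatenation, to a product of two such
  -- groupoids, and `Diag.lim_ext` turns the limit into a tensor product.
  refine Eq.trans (VectIso.sound (((Λ.sum Λ').diag E n m).lim_restrict parts parts_eq).some) ((VectIso.mk_pi _).trans ?_)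
  rw [Fintype.sum_prod_type]
  rw [← Finset.sum_coe_sort (Finset.HasAntidiagonal.antidiagonal n)]
  refine Finset.sum_congr rfl fun x _ => ?_
  rw [← Finset.sum_coe_sort (Finset.HasAntidiagonal.antidiagonal m)]
  refine Finset.sum_congr rfl fun y _ => ?_
  obtain ⟨⟨n1, n2⟩, hn⟩ := x
  obtain ⟨⟨m1, m2⟩, hm⟩ := y
  refine Eq.trans ?_ (Quotient.sound ((Λ.diag (fun l => E (Sum.inl l)) n1 m1).lim_ext
    (Λ'.diag (fun l => E (Sum.inr l)) n2 m2))).symm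
  have hkw : ∀ (p : MIdx Λ n1 m1 × MIdx Λ' n2 m2) (w : Λ.car ⊕ Λ'.car → ℕ),
      ∑ i, w (concat p.1.lab p.2.lab i) =
        ∑ i, w (Sum.inl (p.1.lab i)) + ∑ i, w (Sum.inr (p.2.lab i)) :=
    fun p w => sum_concat _ _ w
  have hn' := Finset.HasAntidiagonal.mem_antidiagonal.1 hn
  have hm' := Finset.HasAntidiagonal.mem_antidiagonal.1 hm
  let F₀ : MIdx Λ n1 m1 × MIdx Λ' n2 m2 → MIdx (Λ.sum Λ') n m := fun p =>
    ⟨p.1.N + p.2.N, concat p.1.lab p.2.lab,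
      (hkw p _).trans ((congrArg₂ (· + ·) p.1.hk p.2.hk).trans hn'),
      (hkw p _).trans ((congrArg₂ (· + ·) p.1.hb p.2.hb).trans hm')⟩
  have hF : ∀ p, parts (F₀ p) = (⟨(n1, n2), hn⟩, ⟨(m1, m2), hm⟩) := fun p => by
    refine Prod.ext (Subtype.ext (Prod.ext ?_ ?_)) (Subtype.ext (Prod.ext ?_ ?_))
    · exact (hkw p _).trans ((congrArg₂ (· + ·) p.1.hk (by simp)).trans (add_zero _))
    · exact (hkw p _).trans ((congrArg₂ (· + ·) (by simp) p.2.hk).trans (zero_add _))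
    · exact (hkw p _).trans ((congrArg₂ (· + ·) p.1.hb (by simp)).trans (add_zero _))
    · exact (hkw p _).trans ((congrArg₂ (· + ·) (by simp) p.2.hb).trans (zero_add _))
  have hφ : ∀ {p p' : MIdx Λ n1 m1 × MIdx Λ' n2 m2} (g : p ⟶ p') (i : Fin (p.1.N + p.2.N)),
      concat p.1.lab p.2.lab i = concat p'.1.lab p'.2.lab (finSumFinEquiv
        (Equiv.sumCongr g.1.1 g.2.1 (finSumFinEquiv.symm i))) := fun {p p'} g i => by
    obtain ⟨x, rfl⟩ := finSumFinEquiv.surjective i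
    rw [Equiv.symm_apply_apply, concat_apply, concat_apply]
    rcases x with x | x
    exacts [congrArg Sum.inl (g.1.2 x), congrArg Sum.inr (g.2.2 x)]
  let φ : ∀ {p p' : MIdx Λ n1 m1 × MIdx Λ' n2 m2}, (p ⟶ p') → (F₀ p ⟶ F₀ p') := fun {p p'} g =>
    ⟨finSumFinEquiv.symm.trans ((Equiv.sumCongr g.1.1 g.2.1).trans finSumFinEquiv), hφ g⟩
  refine VectIso.sound (Nonempty.some <| Diag.limIso_of_equiv
    (((Λ.sum Λ').diag E n m).restrict parts (⟨(n1, n2), hn⟩, ⟨(m1, m2), hm⟩))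
    ((Λ.diag (fun l => E (Sum.inl l)) n1 m1).ext (Λ'.diag (fun l => E (Sum.inr l)) n2 m2))
    (fun p => ⟨F₀ p, hF p⟩) (fun p => splitT p.1.lab p.2.lab) (fun p => joinT p.1.lab p.2.lab)
    (fun p x y a w => splitT_nat _ _ a w) (fun p y s hs => splitT_cont _ _ y s hs)
    (fun p y w => splitT_joinT _ _ y w) (fun p y w => joinT_splitT _ _ y w)
    (fun {p p'} g => φ g) (fun {p p'} g y w => ?_) (fun {p p'} f => ?_) fun p => ?_)
  · refine LinearMap.congr_fun (VBundle.piTensor_ext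
      (φ := splitT p'.1.lab p'.2.lab y ∘ₗ ((Λ.sum Λ').diag E n m).T (φ g) y)
      (ψ := ((Λ.diag (fun l => E (Sum.inl l)) n1 m1).ext
        (Λ'.diag (fun l => E (Sum.inr l)) n2 m2)).T g y ∘ₗ splitT p.1.lab p.2.lab y) fun w => ?_) w
    refine (congrArg (splitT p'.1.lab p'.2.lab y) (diag_T _ (φ g) y w)).trans
      ((splitT_tprod _ _ _ _).trans ?_)
    refine Eq.trans ?_ (congrArg (((Λ.diag (fun l => E (Sum.inl l)) n1 m1).ext
        (Λ'.diag (fun l => E (Sum.inr l)) n2 m2)).T g y)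
        (splitT_tprod p.1.lab p.2.lab y w)).symm
    refine Eq.trans ?_ (congrArg₂ (TensorProduct.tmul ℂ
      (M := (VBundle.piTensor fun i => E (Sum.inl (p'.1.lab i))).fib y)
      (N := (VBundle.piTensor fun i => E (Sum.inr (p'.2.lab i))).fib y))
      (diag_T Λ (E := fun l => E (Sum.inl l)) g.1 y _)
      (diag_T Λ' (E := fun l => E (Sum.inr l)) g.2 y _)).symm
    refine congrArg₂ (fun v v' => PiTensorProduct.tprod ℂ v ⊗ₜ[ℂ] PiTensorProduct.tprod ℂ v')
      (funext fun i => ?_) (funext fun i => ?_)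
    · refine (castE_castE E _ _ y _).trans (Eq.trans ?_ ((castE_comp E Sum.inl _ (congrArg Sum.inl (MIdx.lab_symm g.1 i)) y _).trans
        (castE_castE E _ _ y _)).symm)
      refine castE_congr E w _ _ ?_
      exact congrArg (fun z => finSumFinEquiv ((Equiv.sumCongr g.1.1 g.2.1).symm z))
        (Equiv.symm_apply_apply finSumFinEquiv (Sum.inl i))
    · refine (castE_castE E _ _ y _).trans (Eq.trans ?_ ((castE_comp E Sum.inr _ (congrArg Sum.inr (MIdx.lab_symm g.2 i)) y _).trans
        (castE_castE E _ _ y _)).symm)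
      refine castE_congr E w _ _ ?_
      exact congrArg (fun z => finSumFinEquiv ((Equiv.sumCongr g.1.1 g.2.1).symm z))
        (Equiv.symm_apply_apply finSumFinEquiv (Sum.inr i))
  · obtain ⟨τ, hτ⟩ := f
    change Fin (p.1.N + p.2.N) ≃ Fin (p'.1.N + p'.2.N) at τ
    change ∀ i, concat p.1.lab p.2.lab i = concat p'.1.lab p'.2.lab (τ i) at hτ
    -- Fullness: an arrow preserves labels, and a label knows its side, so τ cannot mix the two
    -- halves.
    have h1 : ∀ x, (finSumFinEquiv.symm (τ (finSumFinEquiv x))).isLeft = x.isLeft := fun x => by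
      have h := hτ (finSumFinEquiv x)
      rw [concat_apply] at h
      have h' := congrArg Sum.isLeft h
      rw [concat, Sum.isLeft_map, Sum.isLeft_map] at h'
      exact h'.symm
    obtain ⟨τ₁, τ₂, hτ'⟩ := exists_sumCongr ((finSumFinEquiv.trans τ).trans finSumFinEquiv.symm) h1
    have h2 : ∀ x, τ (finSumFinEquiv x) = finSumFinEquiv (Equiv.sumCongr τ₁ τ₂ x) := fun x => by
      rw [← hτ']
      simp
    have h3 : ∀ x, Sum.map p.1.lab p.2.lab x =
        Sum.map p'.1.lab p'.2.lab (Equiv.sumCongr τ₁ τ₂ x) := fun x => by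
      rw [← concat_apply, ← concat_apply, hτ, h2]
    refine ⟨(⟨τ₁, fun i => Sum.inl_injective (h3 (Sum.inl i))⟩,
      ⟨τ₂, fun i => Sum.inr_injective (h3 (Sum.inr i))⟩), Subtype.ext (Equiv.ext fun i => ?_)⟩
    obtain ⟨x, rfl⟩ := finSumFinEquiv.surjective i
    refine Eq.trans ?_ (h2 x).symm
    exact congrArg (fun z => finSumFinEquiv (Equiv.sumCongr τ₁ τ₂ z)) (Equiv.symm_apply_apply _ x)
  · obtain ⟨⟨M, lab, h1, h2⟩, hp⟩ := p
    obtain ⟨N, N', a, b, τ, hτ⟩ := exists_concat ⟨M, lab, h1, h2⟩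
    -- Any weight on labels has the same sum over the sorted sequence. The four weights supported on
    -- one side recover the prescribed bidegrees.
    have h3 : ∀ w : Λ.car ⊕ Λ'.car → ℕ, ∑ i, w (Sum.inl (a i)) + ∑ i, w (Sum.inr (b i)) =
        ∑ i, w (lab i) := fun w => by
      rw [← sum_concat, ← Equiv.sum_comp τ]
      exact Finset.sum_congr rfl fun i _ => congrArg w (hτ i)
    have h4 := congrArg (fun z => (z.1.1, z.2.1)) hp
    obtain ⟨h5, h6⟩ := Prod.mk.inj h4
    obtain ⟨h7, h8⟩ := Prod.mk.inj h5
    obtain ⟨h9, h10⟩ := Prod.mk.inj h6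
    refine ⟨(⟨N, a, ?_, ?_⟩, ⟨N', b, ?_, ?_⟩), ⟨⟨τ, hτ⟩⟩⟩
    · exact Eq.trans (by simpa using h3 (Sum.elim Λ.k fun _ => 0)) h7
    · exact Eq.trans (by simpa using h3 (Sum.elim Λ.b fun _ => 0)) h9
    · exact Eq.trans (by simpa using h3 (Sum.elim (fun _ => 0) Λ'.k)) h8
    · exact Eq.trans (by simpa using h3 (Sum.elim (fun _ => 0) Λ'.b)) h10

end sum

end LabelSet

/-! ### Generating functions of symmetric powers -/

/-- The limit over a connected groupoid that acts trivially at an object. -/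
theorem Diag.lim_of_connected {Y : Type u} [TopGpd.{u, v} Y] {I : Type} [Groupoid.{0} I] [Fintype I]
    [∀ i j : I, Fintype (i ⟶ j)] (A : Diag I Y) (i₀ : I) (hI : ∀ i, Nonempty (i₀ ⟶ i))
    (hT : ∀ (f : i₀ ⟶ i₀) y v, A.T f y v = v) : Nonempty (VBundle.Iso A.lim (A.D i₀)) := by
  have g := fun i => (hI i).some
  refine ⟨VBundle.Iso.ofBijective (fun y => A.ev y i₀) (fun y => ⟨fun w w' h => ?_, fun v => ?_⟩)
    (fun _ _ => rfl) fun y s hs => hs i₀⟩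
  · refine Subtype.ext (funext fun i => ?_)
    rw [← w.2 i₀ i (g i), ← w'.2 i₀ i (g i)]
    exact congrArg _ h
  · refine ⟨⟨fun i => A.T (g i) y v, fun i j f => ?_⟩, hT _ y v⟩
    -- Two routes from i₀ to j differ by a loop at i₀, which acts trivially.
    calc A.T f y (A.T (g i) y v) = A.T (g i ≫ f) y v := (A.comp _ _ _ _).symm
      _ = A.T ((g i ≫ f ≫ Groupoid.inv (g j)) ≫ g j) y v := by simp
      _ = A.T (g j) y v := by rw [A.comp, hT]

lemma VBundle.piTensor_of_isEmpty {Y : Type u} [TopGpd.{u, v} Y] {J : Type} [Fintype J] [IsEmpty J]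
    (E : J → VBundle Y) : Nonempty (VBundle.Iso (VBundle.piTensor E) (VBundle.one Y)) := by
  refine ⟨VBundle.Iso.ofBijective (E := VBundle.piTensor E) (F := VBundle.one Y)
    (fun y => (PiTensorProduct.isEmptyEquiv J).toLinearMap)
    (fun y => (PiTensorProduct.isEmptyEquiv J).bijective) (fun {x y} f w => ?_) fun y s hs => ?_⟩
  · refine LinearMap.congr_fun (VBundle.piTensor_ext
      (φ := (PiTensorProduct.isEmptyEquiv J).toLinearMap ∘ₗ (VBundle.piTensor E).act f)
      (ψ := (PiTensorProduct.isEmptyEquiv J).toLinearMap) fun w => ?_) w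
    rw [LinearMap.comp_apply, PiTensorProduct.map_tprod]
    exact (PiTensorProduct.isEmptyEquiv_apply_tprod (R := ℂ) J _).trans
      (PiTensorProduct.isEmptyEquiv_apply_tprod (R := ℂ) J _).symm
  · obtain ⟨K, _, c, t, hc, -, hs⟩ := hs
    change ContinuousAt (fun x => (PiTensorProduct.isEmptyEquiv J).toLinearMap (s x)) y
    refine ContinuousAt.congr (f := fun x => ∑ k, c k x) (tendsto_finsetSum _ fun k _ => hc k) ?_
    filter_upwards [hs] with x hx
    rw [hx, map_sum]
    refine Finset.sum_congr rfl fun k _ => ?_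
    rw [map_smul]
    exact ((congrArg _ (PiTensorProduct.isEmptyEquiv_apply_tprod (R := ℂ) J _)).trans (mul_one _)).symm

namespace LabelSet

variable {Y : Type u} [TopGpd.{u, v} Y]

lemma SS_eq_zero (Λ : LabelSet) (E : Λ.car → VBundle Y) {n m : ℕ} (h : IsEmpty (MIdx Λ n m)) :
    VectIso.mk (Λ.SS E n m) = 0 :=
  VectIso.sound (F := VBundle.zero Y) (VBundle.Iso.ofBijective (E := (Λ.diag E n m).lim)
    (fun _ => 0)
    (fun _ => ⟨fun _ _ _ => Subtype.ext (funext fun p => h.elim p), fun _ => ⟨0, rfl⟩⟩)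
    (fun _ _ => rfl) fun _ _ _ => trivial)

/-- The generating function of the symmetric powers of a labelled collection of bundles. -/
def sgen (Λ : LabelSet) (E : Λ.car → VBundle Y) : PowerSeries (PowerSeries (VectIso Y)) :=
  PowerSeries.mk fun n => PowerSeries.mk fun m => VectIso.mk (Λ.SS E n m)

lemma coeff_sgen (Λ : LabelSet) (E : Λ.car → VBundle Y) (n m : ℕ) :
    PowerSeries.coeff m (PowerSeries.coeff n (Λ.sgen E)) = VectIso.mk (Λ.SS E n m) := by
  rw [sgen, PowerSeries.coeff_mk, PowerSeries.coeff_mk]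

/-- The double sum in `SS_sum` is the Cauchy product in both variables. -/
lemma sgen_sum (Λ Λ' : LabelSet) (E : (Λ.sum Λ').car → VBundle Y) :
    (Λ.sum Λ').sgen E = Λ.sgen (fun l => E (Sum.inl l)) * Λ'.sgen (fun l => E (Sum.inr l)) := by
  ext n m
  rw [coeff_sgen, SS_sum, PowerSeries.coeff_mul, map_sum]
  refine Finset.sum_congr rfl fun x _ => ?_
  rw [PowerSeries.coeff_mul]
  exact Finset.sum_congr rfl fun y _ => by rw [coeff_sgen, coeff_sgen]

/-- If there are no labels, then only the empty tensor product remains. -/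
lemma sgen_of_isEmpty (Λ : LabelSet) [IsEmpty Λ.car] (E : Λ.car → VBundle Y) : Λ.sgen E = 1 := by
  have h0 : ∀ {n m : ℕ} (p : MIdx Λ n m), p.N = 0 := fun p => by
    by_contra h
    exact isEmptyElim (p.lab ⟨0, Nat.pos_of_ne_zero h⟩)
  have h1 : ∀ {n m : ℕ} (p : MIdx Λ n m), n = 0 ∧ m = 0 := fun p => by
    obtain ⟨N, lab, hk, hb⟩ := p
    obtain rfl : N = 0 := h0 ⟨N, lab, hk, hb⟩
    exact ⟨by simpa using hk.symm, by simpa using hb.symm⟩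
  ext n m
  rw [coeff_sgen, PowerSeries.coeff_one]
  by_cases hn : n = 0 ∧ m = 0
  · obtain ⟨rfl, rfl⟩ := hn
    rw [if_pos rfl, PowerSeries.coeff_one, if_pos rfl]
    let p₀ : MIdx Λ 0 0 := ⟨0, fun i => i.elim0, by simp, by simp⟩
    refine (VectIso.sound (Nonempty.some <| (Λ.diag E 0 0).lim_of_connected p₀ (fun p => ?_)
      fun f y v => ?_)).trans (VectIso.sound (VBundle.piTensor_of_isEmpty (J := Fin 0) _).some)
    · obtain ⟨N, lab, hk, hb⟩ := p
      obtain rfl : N = 0 := h0 ⟨N, lab, hk, hb⟩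
      exact ⟨⟨Equiv.refl _, fun i => i.elim0⟩⟩
    · exact permT_eq_self E (lab := p₀.lab) _ _ (fun i => i.elim0) y v
  · rw [SS_eq_zero _ _ ⟨fun p => hn (h1 p)⟩]
    split_ifs with h
    · rw [PowerSeries.coeff_one, if_neg fun h' => hn ⟨h, h'⟩]
    · rfl

/-- The labels of bidegrees `(k + 1, b)`, `b ∈ ℕ`. -/
abbrev column (k : ℕ) : LabelSet where
  car := ℕ
  k _ := k + 1
  b l := l
  k_pos _ := Nat.succ_pos k
  fin _ m := Finite.of_injective (β := Fin (m + 1)) (fun l => ⟨l.1, Nat.lt_succ_of_le l.2.2⟩)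
    fun _ _ h => Subtype.ext (congrArg Fin.val h)

/-- All labels have first degree k + 1, so a sequence of length l has first degree (k + 1) l. The
column is the ordinary symmetric power with t replaced by t^(k+1). -/
lemma SS_column (k : ℕ) (E : ℕ → VBundle Y) (n m : ℕ) :
    VectIso.mk ((column k).SS E n m) =
      if k + 1 ∣ n then VectIso.mk ((column 0).SS E (n / (k + 1)) m) else 0 := by
  split_ifs with h
  · obtain ⟨l, rfl⟩ := h
    rw [Nat.mul_div_cancel_left _ (Nat.succ_pos k)]
    refine SS_reindex (Λ := column k) (Λ' := column 0) (fun l : ℕ => l) (fun _ _ h => h)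
      (fun l => ⟨VBundle.Iso.refl _⟩) (fun N lab => and_congr ?_ Iff.rfl)
      (fun l _ _ => ⟨l, rfl⟩)
    simp only [Finset.sum_const, Finset.card_univ, Fintype.card_fin, smul_eq_mul, zero_add, mul_one]
    rw [mul_comm]
    exact Nat.mul_right_inj (Nat.succ_ne_zero k)
  · refine SS_eq_zero _ _ ⟨fun p => h ?_⟩
    rw [← p.hk]
    exact Finset.dvd_sum fun i _ => dvd_rfl

end LabelSet

namespace RotSeries

variable {Y : Type u} [TopGpd.{u, v} Y] {z : CatCenter Y}

lemma tp_eq_castE (V : RotSeries Y z) {a b : ℕ} (h : a = b) (y : Y) (w : (V.V a).fib y) :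
    V.tp h y w = castE V.V h y w := by
  subst h
  rfl

/-- The symmetric powers of a series of bundles in terms of sequences of labels. -/
theorem mk_sym (V : RotSeries Y z) (n m : ℕ) :
    VectIso.mk ((sym n V).V m) = VectIso.mk ((LabelSet.column 0).SS V.V n m) := by
  symm
  let Λ := LabelSet.column 0
  -- In column 0 every label has first degree 1, so a sequence of first degree n has length n and is
  -- just a family of n exponents.
  let F : SymIdx n m → MIdx Λ n m := fun a => ⟨n, a.1, by simp [Λ], a.2⟩
  let φ : ∀ {a b : SymIdx n m}, (a ⟶ b) → (F a ⟶ F b) := fun {a b} f => ⟨f.1, f.2⟩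
  refine VectIso.sound (Nonempty.some <| Diag.limIso_of_equiv (Λ.diag V.V n m)
    (V.symSystem n m).diag F (fun _ _ => LinearMap.id) (fun _ _ => LinearMap.id)
    (fun _ _ _ _ _ => rfl) (fun _ _ _ hs => hs) (fun _ _ _ => rfl) (fun _ _ _ => rfl) φ
    (fun {a b} g y w => ?_) (fun {a b} f => ⟨⟨f.1, f.2⟩, rfl⟩) fun p => ?_)
  · refine LinearMap.congr_fun (VBundle.piTensor_ext (φ := (Λ.diag V.V n m).T (φ g) y)
      (ψ := (V.symSystem n m).T g y) fun w => ?_) w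
    refine (LabelSet.diag_T Λ (φ g) y w).trans
      ((V.symSystem n m).T_tprod g y w _ fun j j' hj => ?_).symm
    refine Eq.trans ?_ (tp_eq_castE _ _ _ _).symm
    exact castE_congr V.V w _ _ (by
      change g.1.symm j' = j
      rw [← hj]
      exact g.1.symm_apply_apply j)
  · obtain ⟨N, lab, hk, hb⟩ := p
    obtain rfl : N = n := by simpa [Λ] using hk
    exact ⟨⟨lab, hb⟩, ⟨⟨Equiv.refl _, fun _ => rfl⟩⟩⟩

end RotSeries

namespace LabelSet

variable {Y : Type u} [TopGpd.{u, v} Y]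

theorem sgen_congr {Λ Λ' : LabelSet} (e : Λ'.car ≃ Λ.car) (hk : ∀ l, Λ.k (e l) = Λ'.k l)
    (hb : ∀ l, Λ.b (e l) = Λ'.b l) {E : Λ.car → VBundle Y} {E' : Λ'.car → VBundle Y}
    (i : ∀ l, Nonempty (VBundle.Iso (E (e l)) (E' l))) : Λ.sgen E = Λ'.sgen E' := by
  ext n m
  rw [coeff_sgen, coeff_sgen]
  exact SS_reindex e e.injective i (fun N lab => by simp only [hk, hb])
    fun l _ _ => e.surjective l

/-- Doubling every label separates the two summands by `SS_sigma`. The doubled label set is a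
disjoint union, so `sgen_sum` applies. -/
theorem sgen_prod (Λ : LabelSet) {E E' E'' : Λ.car → VBundle Y}
    (i : ∀ l, Nonempty (VBundle.Iso (E l) ((E' l).prod (E'' l)))) :
    Λ.sgen E = Λ.sgen E' * Λ.sgen E'' := by
  let EE : (l : Λ.car) → Bool → VBundle Y := fun l x => cond x (E' l) (E'' l)
  have h1 : Λ.sgen (fun l => (E' l).prod (E'' l)) =
      (Λ.sigma fun _ => Bool).sgen fun x => EE x.1 x.2 := by
    ext n m
    rw [coeff_sgen, coeff_sgen]
    refine SS_sigma Λ (fun _ => Bool) (E := fun l => (E' l).prod (E'' l)) (E' := EE)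
      (fun l x y => match x with
        | true => LinearMap.fst ℂ ((E' l).fib y) ((E'' l).fib y)
        | false => LinearMap.snd ℂ ((E' l).fib y) ((E'' l).fib y))
      (fun l x y => match x with
        | true => LinearMap.inl ℂ ((E' l).fib y) ((E'' l).fib y)
        | false => LinearMap.inr ℂ ((E' l).fib y) ((E'' l).fib y)) ?_ ?_ ?_ ?_ ?_ n m
    · rintro l (_ | _) y y' a w <;> rfl
    · rintro l (_ | _) y s hs
      exacts [hs.2, hs.1]
    · rintro l (_ | _) y w <;> rfl
    · rintro l (_ | _) (_ | _) y w h <;> first | exact absurd rfl h | rfl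
    · intro l y w
      rw [Fintype.sum_bool]
      exact Prod.ext (add_zero _) (zero_add _)
  rw [sgen_congr (Equiv.refl _) (fun _ => rfl) (fun _ => rfl) i, h1]
  refine Eq.trans ?_ (sgen_sum Λ Λ (Sum.elim E' E''))
  refine sgen_congr (Λ := Λ.sigma fun _ => Bool) (Λ' := Λ.sum Λ)
    { toFun := Sum.elim (fun l => ⟨l, true⟩) (fun l => ⟨l, false⟩)
      invFun := fun x => cond x.2 (Sum.inl x.1) (Sum.inr x.1)
      left_inv := by rintro (l | l) <;> rfl
      right_inv := by rintro ⟨l, _ | _⟩ <;> rfl } ?_ ?_ ?_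
  · rintro (l | l) <;> rfl
  · rintro (l | l) <;> rfl
  · rintro (l | l)
    exacts [⟨VBundle.Iso.refl _⟩, ⟨VBundle.Iso.refl _⟩]

/-- Labels have positive first degree, so none occurs in degree 0, and the label set may be replaced
by the empty one. -/
lemma coeff_zero_sgen (Λ : LabelSet) (E : Λ.car → VBundle Y) :
    PowerSeries.coeff 0 (Λ.sgen E) = 1 := by
  let Λ' : LabelSet := ⟨Empty, fun _ => 0, fun _ => 0, fun l => l.elim, fun _ _ => inferInstance⟩
  have : IsEmpty Λ'.car := inferInstanceAs (IsEmpty Empty)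
  have h := sgen_of_isEmpty Λ' (Y := Y) fun l => l.elim
  have h1 : PowerSeries.coeff 0 (Λ'.sgen (Y := Y) fun l => l.elim) = 1 := by rw [h]; simp
  rw [← h1]
  ext m
  rw [coeff_sgen, coeff_sgen]
  refine SS_reindex (fun l : Λ'.car => l.elim) (fun l => l.elim) (fun l => l.elim) (fun N lab => ?_)
    fun l hl _ => absurd (Λ.k_pos l) (by omega)
  have : IsEmpty (Fin N) := ⟨fun i => (lab i).elim⟩
  simp

end LabelSet

/-! ### Extension of total powers to virtual bundles -/

namespace GRing

variable {R : Type u} [CommSemiring R]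

/-- The canonical ring homomorphism to the Grothendieck ring. -/
def ofHom : R →+* GRing R where
  toFun := of
  map_one' := rfl
  map_mul' := of_mul
  map_zero' := map_zero _
  map_add' := map_add _

lemma exists_of_eq {a b : R} (h : of a = of b) : ∃ c, a + c = b + c := by
  obtain ⟨c, hc⟩ := (AddLocalization.addMonoidOf (⊤ : AddSubmonoid R)).eq_iff_exists.1 h
  exact ⟨c.1, by rw [add_comm a, add_comm b]; exact hc⟩

end GRing

section exponential

variable {Y : Type u} [TopGpd.{u, v} Y] {z : CatCenter Y}

/-- The total power of a series of bundles, before passing to the Grothendieck ring. -/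
def totalSer (op : ℕ → RotSeries Y z → RotSeries Y z) (V : RotSeries Y z) :
    PowerSeries (RotSemiring Y z) :=
  PowerSeries.mk fun n => (op n V).cls

lemma totalClass_eq (op : ℕ → RotSeries Y z → RotSeries Y z) (V : RotSeries Y z) :
    totalClass op V = PowerSeries.map GRing.ofHom (totalSer op V) := by
  ext n
  rw [totalClass, PowerSeries.coeff_mk, PowerSeries.coeff_map, totalSer, PowerSeries.coeff_mk]
  rfl

/-- A total power of bundles that takes sums to products extends to virtual bundles. -/
theorem isExponentialExtension_totalPower {op : ℕ → RotSeries Y z → RotSeries Y z}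
    (h0 : ∀ V, PowerSeries.constantCoeff (totalClass op V) = 1)
    (hadd : ∀ U V W : RotSeries Y z, U.cls = V.cls + W.cls →
      totalClass op U = totalClass op V * totalClass op W) :
    IsExponentialExtension op (totalPower op) := by
  have hinv := fun V => mul_inv_one (h0 V)
  -- The quotient does not depend on how x is written as a difference. Equality of two differences
  -- holds in the semiring only after adding some C, but the total power of C is an invertible
  -- series and cancels.
  have key : ∀ (V W : RotSeries Y z) (x : KRot Y z), x = GRing.of V.cls - GRing.of W.cls →
      totalPower op x = totalClass op V * PowerSeries.invOfUnit (totalClass op W) 1 := by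
    intro V W x hx
    rw [totalPower]
    have hx' := (exists_sub_cls x).choose_spec
    set V' := (exists_sub_cls x).choose.1
    set W' := (exists_sub_cls x).choose.2
    obtain ⟨A, hA⟩ := RotSeries.exists_rep (V.cls + W'.cls)
    obtain ⟨B, hB⟩ := RotSeries.exists_rep (V'.cls + W.cls)
    have h1 : GRing.of A.cls = GRing.of B.cls := by
      rw [hA, hB, map_add, map_add]
      rw [hx, sub_eq_sub_iff_add_eq_add] at hx'
      exact hx'
    obtain ⟨c, hc⟩ := GRing.exists_of_eq h1
    obtain ⟨C, rfl⟩ := RotSeries.exists_rep c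
    obtain ⟨D, hD⟩ := RotSeries.exists_rep (A.cls + C.cls)
    have h2 : totalClass op A = totalClass op B := by
      have h3 := (hadd D A C hD).symm.trans (hadd D B C (hD.trans hc))
      have h4 := congrArg (· * PowerSeries.invOfUnit (totalClass op C) 1) h3
      simpa only [mul_assoc, hinv, mul_one] using h4
    rw [hadd A V W' hA, hadd B V' W hB] at h2
    calc totalClass op V' * PowerSeries.invOfUnit (totalClass op W') 1
        = (totalClass op V' * totalClass op W) * PowerSeries.invOfUnit (totalClass op W') 1 *
            PowerSeries.invOfUnit (totalClass op W) 1 := by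
          linear_combination (-(totalClass op V' * PowerSeries.invOfUnit (totalClass op W') 1)) *
            hinv W
      _ = totalClass op V * PowerSeries.invOfUnit (totalClass op W) 1 := by
          rw [← h2]
          linear_combination (totalClass op V * PowerSeries.invOfUnit (totalClass op W) 1) * hinv W'
  -- For a zero class the total power is idempotent and invertible.
  have hz : ∀ V Z : RotSeries Y z, Z.cls = 0 → totalClass op Z = 1 := fun V Z hZ => by
    have h1 := hadd Z Z Z (by rw [hZ, add_zero])
    have h2 := congrArg (· * PowerSeries.invOfUnit (totalClass op Z) 1) h1
    simpa only [mul_assoc, hinv, mul_one] using h2.symm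
  refine ⟨fun x y => ?_, fun V => ?_⟩
  · obtain ⟨⟨V, W⟩, hx⟩ := exists_sub_cls x
    obtain ⟨⟨V', W'⟩, hy⟩ := exists_sub_cls y
    obtain ⟨A, hA⟩ := RotSeries.exists_rep (V.cls + V'.cls)
    obtain ⟨B, hB⟩ := RotSeries.exists_rep (W.cls + W'.cls)
    rw [key V W x hx, key V' W' y hy, key A B (x + y) (by
      rw [hx, hy, hA, hB, map_add, map_add]; abel), hadd A V V' hA]
    have hB' := hinv B
    rw [hadd B W W' hB] at hB' ⊢
    have h1 := hinv W
    have h2 := hinv W'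
    set a := totalClass op W
    set b := totalClass op W'
    set a' := PowerSeries.invOfUnit a 1
    set b' := PowerSeries.invOfUnit b 1
    set c := PowerSeries.invOfUnit (a * b) 1
    -- Inverses are unique, so the inverse of the product is the product of the inverses.
    have h3 : c = a' * b' := by
      linear_combination (-c * b * b') * h1 + (-c) * h2 + a' * b' * hB'
    rw [h3]
    ring
  · obtain ⟨Z, hZ⟩ := RotSeries.exists_rep (0 : RotSemiring Y z)
    rw [key V Z _ (by rw [hZ, map_zero, sub_zero])]
    have h1 := hinv Z
    rw [hz V Z hZ, one_mul] at h1
    rw [hz V Z hZ, h1, mul_one]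

/-- Adding the class of W to x = [V] - [W] leads to a total power of bundles, where the constant
terms are known. -/
lemma IsExponentialExtension.constantCoeff {op : ℕ → RotSeries Y z → RotSeries Y z}
    {S : KRot Y z → PowerSeries (KRot Y z)} (hS : IsExponentialExtension op S)
    (h0 : ∀ V, PowerSeries.constantCoeff (totalClass op V) = 1) (x : KRot Y z) :
    PowerSeries.constantCoeff (S x) = 1 := by
  obtain ⟨⟨V, W⟩, hx⟩ := exists_sub_cls x
  have h1 := hS.map_add x (GRing.of W.cls)
  rw [hx, sub_add_cancel, hS.map_cls, hS.map_cls, ← hx] at h1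
  have h2 := congrArg PowerSeries.constantCoeff h1
  rw [map_mul, h0, h0, mul_one] at h2
  exact h2.symm

/-- The inclusion of the series satisfying the rotation condition. -/
def unrot : PowerSeries (RotSemiring Y z) →+* PowerSeries (PowerSeries (VectIso Y)) :=
  PowerSeries.map (RotSemiring Y z).subtype

/-- Generating functions of labelled collections ignore the rotation condition. Identities are
proved for them and pulled back to `RotSemiring` by injectivity. -/
lemma unrot_injective : Function.Injective (unrot (Y := Y) (z := z)) := by
  intro S T h
  ext n : 1
  have h1 := congrArg (PowerSeries.coeff n) h
  rw [unrot, PowerSeries.coeff_map, PowerSeries.coeff_map] at h1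
  exact Subtype.ext h1

lemma unrot_sym (V : RotSeries Y z) :
    unrot (totalSer RotSeries.sym V) = (LabelSet.column 0).sgen V.V := by
  refine PowerSeries.ext fun n => PowerSeries.ext fun m => ?_
  rw [LabelSet.coeff_sgen, ← RotSeries.mk_sym, unrot, PowerSeries.coeff_map, totalSer,
    PowerSeries.coeff_mk]
  exact PowerSeries.coeff_mk m fun m => VectIso.mk ((RotSeries.sym n V).V m)

lemma constantCoeff_sym (V : RotSeries Y z) :
    PowerSeries.constantCoeff (totalClass RotSeries.sym V) = 1 := by
  have h := LabelSet.coeff_zero_sgen (LabelSet.column 0) V.V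
  rw [← unrot_sym, unrot, PowerSeries.coeff_map] at h
  rw [totalClass_eq, ← PowerSeries.coeff_zero_eq_constantCoeff_apply, PowerSeries.coeff_map,
    show PowerSeries.coeff 0 (totalSer RotSeries.sym V) = 1 from Subtype.ext h, map_one]

/-- Before passing to the Grothendieck ring, coefficients are isomorphism classes, so an equality of
classes yields actual isomorphisms in each degree. -/
lemma exists_iso_of_cls {U V W : RotSeries Y z} (h : U.cls = V.cls + W.cls) (n : ℕ) :
    Nonempty (VBundle.Iso (U.V n) ((V.V n).prod (W.V n))) := by
  have h1 := congrArg (fun F : RotSemiring Y z => PowerSeries.coeff n (F : PowerSeries (VectIso Y))) h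
  rw [RotSeries.cls, RotSeries.cls, RotSeries.cls] at h1
  simp only [Subsemiring.coe_add, map_add, PowerSeries.coeff_mk] at h1
  exact Quotient.exact h1

lemma totalClass_sym_add (U V W : RotSeries Y z) (h : U.cls = V.cls + W.cls) :
    totalClass RotSeries.sym U = totalClass RotSeries.sym V * totalClass RotSeries.sym W := by
  rw [totalClass_eq, totalClass_eq, totalClass_eq, ← map_mul]
  congr 1
  apply unrot_injective
  rw [map_mul, unrot_sym, unrot_sym, unrot_sym]
  exact LabelSet.sgen_prod _ (exists_iso_of_cls h)

theorem isExponentialExtension_symT :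
    IsExponentialExtension RotSeries.sym (symT : KRot Y z → PowerSeries (KRot Y z)) :=
  isExponentialExtension_totalPower constantCoeff_sym totalClass_sym_add

lemma constantCoeff_symT (x : KRot Y z) : PowerSeries.constantCoeff (symT x) = 1 :=
  isExponentialExtension_symT.constantCoeff constantCoeff_sym x

lemma adams_eq (m : ℕ) (x : KRot Y z) : adams m x = PowerSeries.coeff m (logD (symT x)) := rfl

theorem map_toRat_symT (x : KRot Y z) : PowerSeries.map toRat (symT x) =
    expSeries (PowerSeries.mk fun m => (1 / (m : ℚ)) ⊗ₜ[ℤ] adams m x) :=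
  map_toRat_eq_expSeries (constantCoeff_symT x)
    -- At m = 0 the factor 1 / 0 is 0 in ℚ, as an exponent without constant term requires.
    (by rw [PowerSeries.coeff_mk, Nat.cast_zero, div_zero, TensorProduct.zero_tmul])
    fun m _ => PowerSeries.coeff_mk _ _

lemma adams_add (m : ℕ) (x y : KRot Y z) : adams m (x + y) = adams m x + adams m y := by
  rw [adams_eq, isExponentialExtension_symT.map_add,
    logD_mul (constantCoeff_symT x) (constantCoeff_symT y), map_add]
  rfl

end exponential

/-! ### Cycles of permutations -/

section cycles

/-- Transitive actions of cyclic groups on sets of the same size are isomorphic. -/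
lemma exists_conj_of_isCycleOn {A A' : Type} [Fintype A] [Fintype A'] {r : Equiv.Perm A}
    {r' : Equiv.Perm A'} (hr : r.IsCycleOn (Finset.univ : Finset A))
    (hr' : r'.IsCycleOn (Finset.univ : Finset A')) (h : Fintype.card A = Fintype.card A')
    (x : A) (x' : A') : ∃ ε : A ≃ A', ∀ i, ε (r i) = r' (ε i) := by
  -- The number j y counts steps from x to y. The bijection sends r^j x to r'^j x'. This is
  -- consistent because both cycles have the same length, modulo which the steps are determined.
  choose j _ hj using fun y => hr.exists_pow_eq (Finset.mem_univ x) (Finset.mem_univ y)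
  have hmod : ∀ n, (r' ^ j ((r ^ n) x)) x' = (r' ^ n) x' := fun n => by
    rw [hr'.pow_apply_eq_pow_apply (Finset.mem_univ x'), Finset.card_univ, ← h, ← Finset.card_univ,
      ← hr.pow_apply_eq_pow_apply (Finset.mem_univ x), hj]
  let ε : A → A' := fun y => (r' ^ j y) x'
  have hε : Function.Injective ε := fun y y' hy => by
    have h1 := (hr'.pow_apply_eq_pow_apply (Finset.mem_univ x')).1 hy
    rw [Finset.card_univ, ← h, ← Finset.card_univ,
      ← hr.pow_apply_eq_pow_apply (Finset.mem_univ x), hj, hj] at h1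
    exact h1
  refine ⟨Equiv.ofBijective ε ((Fintype.bijective_iff_injective_and_card ε).2 ⟨hε, h⟩), fun i => ?_⟩
  change (r' ^ j (r i)) x' = r' ((r' ^ j i) x')
  obtain ⟨n, _, rfl⟩ := hr.exists_pow_eq (Finset.mem_univ x) (Finset.mem_univ i)
  rw [hmod, ← Equiv.Perm.mul_apply, ← pow_succ', hmod, pow_succ', Equiv.Perm.mul_apply]

lemma sum_pow_of_isCycleOn {A : Type} [Fintype A] {r : Equiv.Perm A}
    (hr : r.IsCycleOn (Finset.univ : Finset A)) {M : Type*} [AddCommMonoid M] (f : A → M) (x : A) :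
    ∑ l : Fin (Fintype.card A), f ((r ^ (l : ℕ)) x) = ∑ a, f a := by
  refine Fintype.sum_bijective (fun l : Fin (Fintype.card A) => (r ^ (l : ℕ)) x)
    ((Fintype.bijective_iff_injective_and_card _).2 ⟨fun l l' h => ?_, by simp⟩) _ _ fun _ => rfl
  have h1 := (hr.pow_apply_eq_pow_apply (Finset.mem_univ x)).1 h
  rw [Finset.card_univ] at h1
  exact Fin.ext (Nat.ModEq.eq_of_lt_of_lt h1 l.2 l'.2)

namespace Orb

variable {n : ℕ} {σ : Equiv.Perm (Fin n)}

lemma len_eq_card (c : Orb σ) : len c = Fintype.card (Elt c) := Nat.card_eq_fintype_card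

lemma rotate_pow_val (c : Orb σ) (l : ℕ) (i : Elt c) : ((rotate c ^ l) i).1 = (σ ^ l) i.1 := by
  induction l with
  | zero => rfl
  | succ l ih => rw [pow_succ', pow_succ', Equiv.Perm.mul_apply, Equiv.Perm.mul_apply, ← ih]; rfl

lemma rotate_isCycleOn (c : Orb σ) : (rotate c).IsCycleOn (Finset.univ : Finset (Elt c)) := by
  refine ⟨?_, fun i _ j _ => ?_⟩
  · rw [Finset.coe_univ]
    exact Set.bijOn_univ.2 (rotate c).bijective
  · obtain ⟨l, hl⟩ := (mk_eq.1 (i.2.trans j.2.symm)).exists_nat_pow_eq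
    exact ⟨l, Subtype.ext (by rw [zpow_natCast, rotate_pow_val, hl])⟩

lemma nonempty_elt (c : Orb σ) : Nonempty (Elt c) := by
  induction c using ind with
  | h i => exact ⟨⟨i, rfl⟩⟩

lemma sum_len (σ : Equiv.Perm (Fin n)) : ∑ c : Orb σ, len c = n := by
  simp_rw [len_eq_card]
  rw [← Fintype.card_sigma, Fintype.card_congr (Equiv.sigmaFiberEquiv (mk σ)), Fintype.card_fin]

/-- There are permutations with arbitrary cycle lengths. -/
lemma exists_perm {N : ℕ} (k : Fin N → ℕ) (hk : ∀ i, 0 < k i) (h : ∑ i, k i = n) :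
    ∃ (σ : Equiv.Perm (Fin n)) (e : Fin N ≃ Orb σ), ∀ i, len (e i) = k i := by
  have := fun i => NeZero.of_pos (hk i)
  have : ∀ i, Fintype (ZMod (k i)) := fun i => ZMod.fintype (k i)
  -- The model is a disjoint union of cyclic groups ℤ/k_i with the shift by 1 on each, transported
  -- to Fin n. Its orbits are the summands.
  let ε : (Σ i, ZMod (k i)) ≃ Fin n := Fintype.equivFinOfCardEq (by
    rw [Fintype.card_sigma, ← h]
    exact Finset.sum_congr rfl fun i _ => ZMod.card _)
  let ρ : Equiv.Perm (Σ i, ZMod (k i)) := Equiv.sigmaCongrRight fun i => Equiv.addRight 1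
  have hρ : ∀ (l : ℕ) x, (ρ ^ l) x = ⟨x.1, x.2 + l⟩ := by
    intro l x
    induction l with
    | zero => rw [pow_zero, Nat.cast_zero, add_zero]; rfl
    | succ l ih =>
      rw [pow_succ', Equiv.Perm.mul_apply, ih]
      push_cast
      rw [← add_assoc]
      rfl
  have hσ : ∀ (l : ℕ) x, (ε.permCongr ρ ^ l) x = ε ((ρ ^ l) (ε.symm x)) := by
    intro l x
    induction l with
    | zero => simp
    | succ l ih => rw [pow_succ', Equiv.Perm.mul_apply, ih]; simp [pow_succ']
  let σ := ε.permCongr ρ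
  have h1 : ∀ x y, mk σ x = mk σ y ↔ (ε.symm x).1 = (ε.symm y).1 := by
    intro x y
    rw [mk_eq]
    constructor
    · intro h
      obtain ⟨l, hl⟩ := h.exists_nat_pow_eq
      rw [hσ, hρ] at hl
      rw [← hl, Equiv.symm_apply_apply]
    · intro h
      -- Within one summand ℤ/k the difference of the two residues is the number of shifts from x to
      -- y.
      refine ⟨((ε.symm y).2 - h ▸ (ε.symm x).2 : ZMod (k (ε.symm y).1)).val, ?_⟩
      rw [zpow_natCast, hσ, hρ, ← Equiv.eq_symm_apply]
      generalize ε.symm x = x' at *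
      generalize ε.symm y = y' at *
      obtain ⟨i, x'⟩ := x'
      obtain ⟨i', y'⟩ := y'
      dsimp only at h
      subst h
      simp
  refine ⟨σ, Equiv.ofBijective (fun i => mk σ (ε ⟨i, 0⟩)) ⟨fun i i' hi => ?_, fun c => ?_⟩, fun i => ?_⟩
  · simpa using (h1 _ _).1 hi
  · induction c using ind with
    | h x => exact ⟨(ε.symm x).1, (h1 _ _).2 (by simp)⟩
  · change Nat.card {x // mk σ x = mk σ (ε ⟨i, 0⟩)} = k i
    have e : {x // mk σ x = mk σ (ε ⟨i, 0⟩)} ≃ ZMod (k i) :=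
      (ε.symm.subtypeEquiv (q := fun x => x.1 = i) fun x => by rw [h1]; simp).trans
        (Equiv.sigmaSubtype i)
    rw [Nat.card_congr e, Nat.card_zmod]

end Orb

namespace TateIdx

variable {n m : ℕ}

/-- Arrows may be prescribed on the cycles. -/
lemma exists_hom_of_equiv {p p' : TateIdx n m} (γ : Orb p.perm ≃ Orb p'.perm)
    (ha : ∀ c, p.a c = p'.a (γ c)) (ε : ∀ c, Orb.Elt c ≃ Orb.Elt (γ c))
    (hε : ∀ c i, ε c (Orb.rotate c i) = Orb.rotate (γ c) (ε c i)) :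
    ∃ f : p ⟶ p', ∀ c (i : Orb.Elt c), f.1 i.1 = (ε c i).1 := by
  let τ : Equiv.Perm (Fin n) := (Equiv.sigmaFiberEquiv (Orb.mk p.perm)).symm.trans
    ((Equiv.sigmaCongr γ ε).trans (Equiv.sigmaFiberEquiv (Orb.mk p'.perm)))
  have hτ : ∀ c (i : Orb.Elt c), τ i.1 = (ε c i).1 := by
    rintro c ⟨i, rfl⟩
    rfl
  have h1 : ∀ i, τ (p.perm i) = p'.perm (τ i) := fun i => by
    have h := hτ _ (Orb.rotate (Orb.mk p.perm i) ⟨i, rfl⟩)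
    rw [hε] at h
    exact h.trans (congrArg p'.perm (hτ _ ⟨i, rfl⟩).symm)
  refine ⟨⟨τ, Equiv.ext h1, fun i => ?_⟩, hτ⟩
  rw [ha]
  exact congrArg p'.a ((ε _ ⟨i, rfl⟩).2.symm.trans (congrArg (Orb.mk p'.perm) (hτ _ ⟨i, rfl⟩).symm))

/-- Cycles of equal length are isomorphic as sets with rotation, so a bijection of cycles that
respects lengths and exponents is induced by a conjugating permutation. -/
lemma exists_hom {p p' : TateIdx n m} (γ : Orb p.perm ≃ Orb p'.perm)
    (ha : ∀ c, p.a c = p'.a (γ c)) (hl : ∀ c, Orb.len c = Orb.len (γ c)) :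
    ∃ f : p ⟶ p', ∀ c, Orb.equiv f.1 f.2.1 c = γ c := by
  choose ε hε using fun c => exists_conj_of_isCycleOn (Orb.rotate_isCycleOn c)
    (Orb.rotate_isCycleOn (γ c)) (by rw [← Orb.len_eq_card, ← Orb.len_eq_card, hl])
    (Orb.nonempty_elt c).some (Orb.nonempty_elt (γ c)).some
  obtain ⟨f, hf⟩ := exists_hom_of_equiv γ ha ε hε
  refine ⟨f, fun c => ?_⟩
  induction c using Orb.ind with
  | h i =>
    rw [Orb.equiv_mk, hf _ ⟨i, rfl⟩]
    exact (ε _ _).2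

/-- Rotating every cycle by its own amount commutes with the permutation. These automorphisms of p
impose rotation invariance cycle by cycle. -/
lemma exists_hom_rotate (p : TateIdx n m) (l : Orb p.perm → ℕ) :
    ∃ f : p ⟶ p, ∀ c (i : Orb.Elt c), f.1 i.1 = ((Orb.rotate c ^ l c) i).1 :=
  exists_hom_of_equiv (Equiv.refl _) (fun _ => rfl) (fun c => Orb.rotate c ^ l c) fun c i => by
    change (Orb.rotate c ^ l c * Orb.rotate c) i = (Orb.rotate c * Orb.rotate c ^ l c) i
    rw [← pow_succ, ← pow_succ']

end TateIdx

end cycles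

/-! ### Symmetric powers in Tate K-theory in terms of the operators `β_k` -/

namespace RotSeries

variable {X : Type u} [TopGpd.{u, v} X] (V : RotSeries (Inertia X) (Inertia.xi X))

section theta

variable {n : ℕ} {σ : Equiv.Perm (Fin n)}

/-- ξ sends each entry to the next one times a common root of unity, so the sum over the cycle is an
eigenvector. -/
lemma act_sum_theta (c : Orb σ) (a : ℕ) (y : Inertia X) (w : (V.theta c a).fib y) :
    (V.pullPow (Orb.len c) a).act ((Inertia.xi X).app y) (∑ j, w.1 j) =
      rootPow X (Orb.len c) a • ∑ j, w.1 j := by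
  rw [map_sum, Finset.smul_sum, ← Equiv.sum_comp (Orb.rotate c)
    (fun j => rootPow X (Orb.len c) a • w.1 j)]
  exact Finset.sum_congr rfl fun j _ => w.2 j

/-- The symmetrization over the rotations of a cycle. -/
def symOp (c : Orb σ) (a : ℕ) (y : Inertia X) : (V.theta c a).fib y →ₗ[ℂ] (V.theta c a).fib y where
  toFun w := ⟨fun _ => ∑ j, w.1 j, fun _ => V.act_sum_theta c a y w⟩
  map_add' _ _ := Subtype.ext (funext fun _ => Finset.sum_add_distrib)
  map_smul' t w := Subtype.ext (funext fun _ => (Finset.smul_sum (r := t) (f := w.1)).symm)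

/-- The action of the rotations of a cycle. -/
def thetaRot (c : Orb σ) (a l : ℕ) (y : Inertia X) :
    (V.theta c a).fib y →ₗ[ℂ] (V.theta c a).fib y where
  toFun w := ⟨fun j => w.1 ((Orb.rotate c ^ l)⁻¹ j), fun j => by
    refine (w.2 _).trans (congrArg (fun i => rootPow X (Orb.len c) a • w.1 i) ?_)
    change (Orb.rotate c * (Orb.rotate c ^ l)⁻¹) j = ((Orb.rotate c ^ l)⁻¹ * Orb.rotate c) j
    rw [((Commute.refl (Orb.rotate c)).pow_right l).inv_right.eq]⟩
  map_add' _ _ := rfl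
  map_smul' _ _ := rfl

/-- The rotations of a cycle carry each entry once to every place, so summing over them replaces
every entry by the total sum. -/
lemma sum_thetaRot (c : Orb σ) (a : ℕ) (y : Inertia X) (w : (V.theta c a).fib y) :
    ∑ l : Fin (Fintype.card (Orb.Elt c)), V.thetaRot c a l y w = V.symOp c a y w := by
  refine Subtype.ext (funext fun j => ?_)
  rw [Submodule.coe_sum, Finset.sum_apply]
  have h : (Orb.rotate c)⁻¹.IsCycleOn (Finset.univ : Finset (Orb.Elt c)) :=
    (Orb.rotate_isCycleOn c).inv
  refine Eq.trans (Finset.sum_congr rfl fun l _ => ?_) (sum_pow_of_isCycleOn h w.1 j)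
  rw [inv_pow]
  rfl

/-- Applying ξ a total of r times is the identity, so a nonzero eigenvector forces e^{2πi a/k} = 1,
that is, k ∣ a. This is how the finite order of ξ removes the fractional exponents. -/
lemma eq_zero_of_act_pullPow [FiniteRotation X] {k : ℕ} (hk : 0 < k) {a : ℕ} (h : ¬ k ∣ a)
    {y : Inertia X} {t : (V.pullPow k a).fib y}
    (ht : (V.pullPow k a).act ((Inertia.xi X).app y) t = rootPow X k a • t) : t = 0 := by
  set r := orderOf (Inertia.xi X)
  have hr : (r : ℂ) ≠ 0 := by
    exact_mod_cast (FiniteRotation.isOfFinOrder (X := X)).orderOf_pos.ne'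
  have hk : (k : ℂ) ≠ 0 := by exact_mod_cast hk.ne'
  have h1 : ∀ l : ℕ, ((V.pullPow k a).act ((Inertia.xi X).app y) ^ l) t = rootPow X k a ^ l • t := by
    intro l
    induction l with
    | zero => simp
    | succ l ih => rw [pow_succ, Module.End.mul_apply, ht, map_smul, ih, smul_smul, pow_succ']
  have h2 := h1 r
  rw [VBundle.act_pow_app, pow_orderOf_eq_one] at h2
  have h3 : t = rootPow X k a ^ r • t := ((V.pullPow k a).act_id y t).symm.trans h2
  have h5 : (rootPow X k a ^ r - 1) • t = 0 := by rw [sub_smul, ← h3, one_smul, sub_self]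
  refine (smul_eq_zero.1 h5).resolve_left fun h5 => ?_
  rw [sub_eq_zero, rootPow, ← Complex.exp_nat_mul, Complex.exp_eq_one_iff] at h5
  obtain ⟨N, hN⟩ := h5
  have h6 : (a : ℂ) = N * k := by
    have h7 : (r : ℂ) * (a / (r * k)) = N := by
      apply mul_left_cancel₀ Complex.two_pi_I_ne_zero
      linear_combination hN
    rw [← h7]
    field_simp
  have h8 : (a : ℤ) = N * k := by exact_mod_cast h6
  exact h (by exact_mod_cast (Dvd.intro_left N h8.symm : (k : ℤ) ∣ a))

lemma symOp_eq_zero [FiniteRotation X] (c : Orb σ) (a : ℕ) (h : ¬ Orb.len c ∣ a) (y : Inertia X) :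
    V.symOp c a y = 0 :=
  LinearMap.ext fun w => Subtype.ext (funext fun _ =>
    V.eq_zero_of_act_pullPow (Orb.len_pos c) h (V.act_sum_theta c a y w))

lemma T_rotate {m : ℕ} {p : TateIdx n m} (l : Orb p.perm → ℕ) (f : p ⟶ p)
    (hf : ∀ c (i : Orb.Elt c), f.1 i.1 = ((Orb.rotate c ^ l c) i).1) (y : Inertia X)
    (w : ∀ c, (V.theta c (p.a c)).fib y) :
    (V.tateSystem n m).T f y (PiTensorProduct.tprod ℂ w) =
      PiTensorProduct.tprod ℂ fun c => V.thetaRot c (p.a c) (l c) y (w c) := by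
  refine (V.tateSystem n m).T_tprod f y w _ fun c c' hc => ?_
  have h : Orb.equiv f.1 f.2.1 c = c := by
    induction c using Orb.ind with
    | h i =>
      rw [Orb.equiv_mk, hf _ ⟨i, rfl⟩]
      exact ((Orb.rotate _ ^ l _) ⟨i, rfl⟩).2
  obtain rfl : c = c' := h.symm.trans hc
  refine Subtype.ext (funext fun j => congrArg (w c).1 (Subtype.ext ?_))
  change ((Orb.rotate c ^ l c)⁻¹ j).1 = f.1⁻¹ j.1
  rw [Equiv.Perm.eq_inv_iff_eq]
  refine (hf c _).trans (congrArg Subtype.val ?_)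
  exact (Orb.rotate c ^ l c).apply_symm_apply j

/-- The symmetrization over the rotations of all cycles. -/
def symAll {m : ℕ} (p : TateIdx n m) (y : Inertia X) :
    ((V.tateSystem n m).tensorAt p).fib y →ₗ[ℂ] ((V.tateSystem n m).tensorAt p).fib y :=
  PiTensorProduct.map fun c : Orb p.perm => V.symOp c (p.a c) y

lemma symAll_tprod {m : ℕ} (p : TateIdx n m) (y : Inertia X)
    (w : ∀ c : Orb p.perm, (V.theta c (p.a c)).fib y) :
    V.symAll p y (PiTensorProduct.tprod ℂ w) =
      PiTensorProduct.tprod ℂ fun c => V.symOp c (p.a c) y (w c) :=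
  PiTensorProduct.map_tprod _ _

/-- Compatible families are invariant under the rotations of the cycles. -/
lemma symAll_of_isSec {m : ℕ} {y : Inertia X} {w : ∀ p, ((V.tateSystem n m).diag.D p).fib y}
    (hw : (V.tateSystem n m).diag.IsSec w) (p : TateIdx n m) :
    V.symAll p y (w p) = (∏ c : Orb p.perm, (Fintype.card (Orb.Elt c) : ℂ)) • w p := by
  classical
  choose f hf using fun l : (∀ c : Orb p.perm, Fin (Fintype.card (Orb.Elt c))) =>
    p.exists_hom_rotate fun c => (l c : ℕ)
  -- Expanding the tensor product of the sums over rotations gives one term for each tuple of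
  -- rotation amounts. Each term is the action of an automorphism of p, which fixes the value of a
  -- compatible family.
  have h1 : V.symAll p y = ∑ l, (V.tateSystem n m).T (f l) y := by
    refine (V.tateSystem n m).T_ext fun w => ?_
    refine Eq.trans ?_ (LinearMap.sum_apply _ _ _).symm
    refine (V.symAll_tprod p y w).trans ?_
    refine Eq.trans ?_ (Finset.sum_congr rfl fun l _ => (V.T_rotate _ (f l) (hf l) y w).symm)
    refine Eq.trans ?_ (MultilinearMap.map_sum (PiTensorProduct.tprod ℂ)
      (fun c (l : Fin (Fintype.card (Orb.Elt c))) => V.thetaRot c (p.a c) l y (w c)))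
    exact congrArg _ (funext fun c => (V.sum_thetaRot c (p.a c) y (w c)).symm)
  refine (LinearMap.congr_fun h1 (w p)).trans ((LinearMap.sum_apply _ _ _).trans
    ((Finset.sum_congr rfl fun l _ => hw p p (f l)).trans ?_))
  rw [Finset.sum_const, Finset.card_univ, Fintype.card_pi, ← Nat.cast_smul_eq_nsmul ℂ]
  simp

end theta

end RotSeries

namespace RotSeries

variable {X : Type u} [TopGpd.{u, v} X] (V : RotSeries (Inertia X) (Inertia.xi X))

lemma tpPow_tpPow {k k' a a' : ℕ} (hk : k = k') (ha : a = a') (hk' : k' = k) (ha' : a' = a)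
    (y : Inertia X) (w : (V.pullPow k a).fib y) : V.tpPow hk' ha' y (V.tpPow hk ha y w) = w := by
  subst hk ha
  rfl

/-- For a = k b the length cancels, and the eigenvalue imposed by θ becomes the one of the rotation
condition at q^{b/r}. This is the link between θ and `betaRep`. -/
lemma rootPow_mul {k : ℕ} (hk : 0 < k) (b : ℕ) :
    rootPow X k (k * b) = zetaPow (Inertia.xi X) b := by
  have h : (k : ℂ) ≠ 0 := by exact_mod_cast hk.ne'
  rw [rootPow, zetaPow, Nat.cast_mul, mul_comm (orderOf (Inertia.xi X) : ℂ),
    mul_div_mul_left _ _ h]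

variable [FiniteRotation X]

/-- The series of bundles `[Π_k^* V(q^{1/k})]^{ℤ/k}`. -/
def betaRep (k : ℕ) : RotSeries (Inertia X) (Inertia.xi X) where
  V b := VBundle.eigen (Inertia.xi X) Inertia.continuous_xi FiniteRotation.isOfFinOrder
    (zetaPow (Inertia.xi X) b) (zetaPow_pow_orderOf FiniteRotation.isOfFinOrder b)
    (V.pullPow k (k * b))
  rot _ _ w := Subtype.ext w.2

lemma cls_betaRep (k : ℕ) : (V.betaRep k).cls = betaSeries k V.cls := by
  refine Subtype.ext (PowerSeries.ext fun m => (PowerSeries.coeff_mk m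
    (fun m => VectIso.mk ((V.betaRep k).V m))).trans ?_)
  refine Eq.trans ?_ (PowerSeries.coeff_mk m fun m => VectIso.eigen (Inertia.xi X)
    Inertia.continuous_xi FiniteRotation.isOfFinOrder (zetaPow (Inertia.xi X) m)
    (zetaPow_pow_orderOf FiniteRotation.isOfFinOrder m)
    (VectIso.pull (Inertia.powerMap X k) (contFunctor_powerMap X k)
      (PowerSeries.coeff (k * m) (V.cls : PowerSeries (VectIso (Inertia X)))))).symm
  have h : PowerSeries.coeff (k * m) (V.cls : PowerSeries (VectIso (Inertia X))) =
    VectIso.mk (V.V (k * m)) := PowerSeries.coeff_mk (k * m) fun m => VectIso.mk (V.V m)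
  rw [h]
  rfl

section labels

variable {L : Type} (kk bb : L → ℕ)

/-- The bundles belonging to labels of bidegrees `(k, b)`. -/
abbrev lbun (l : L) : VBundle (Inertia X) := (V.betaRep (kk l)).V (bb l)

variable {kk bb} {n : ℕ} {σ : Equiv.Perm (Fin n)}

/-- The average over a cycle, as an element of the pullback along a power map. -/
def avgSum (c : Orb σ) {a : ℕ} (l : L) (hk : Orb.len c = kk l) (ha : a = kk l * bb l)
    (y : Inertia X) : (V.theta c a).fib y →ₗ[ℂ] (V.pullPow (kk l) (kk l * bb l)).fib y where
  toFun w := (kk l : ℂ)⁻¹ • V.tpPow hk ha y (∑ j, w.1 j)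
  map_add' w w' := by
    rw [← smul_add, ← map_add, ← Finset.sum_add_distrib]
    rfl
  map_smul' t w := by
    have h : ∑ j, (t • w).1 j = t • ∑ j, w.1 j := (Finset.smul_sum (r := t) (f := w.1)).symm
    rw [RingHom.id_apply, h, map_smul, smul_comm]

/-- The average over a cycle. -/
def avgTheta (c : Orb σ) {a : ℕ} (l : L) (hk : Orb.len c = kk l) (ha : a = kk l * bb l)
    (y : Inertia X) : (V.theta c a).fib y →ₗ[ℂ] (V.lbun kk bb l).fib y :=
  (V.avgSum c l hk ha y).codRestrict _ fun w => by
    have hr : rootPow X (Orb.len c) a = zetaPow (Inertia.xi X) (bb l) := by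
      rw [hk, ha, rootPow_mul (hk ▸ Orb.len_pos c)]
    have h : (V.pullPow (kk l) (kk l * bb l)).act ((Inertia.xi X).app y)
        (V.tpPow hk ha y (∑ j, w.1 j)) =
          zetaPow (Inertia.xi X) (bb l) • V.tpPow hk ha y (∑ j, w.1 j) := by
      rw [← V.tpPow_act, V.act_sum_theta, map_smul]
      exact congrArg (· • V.tpPow hk ha y (∑ j, w.1 j)) hr
    refine (map_smul _ _ _).trans ((congrArg _ h).trans ?_)
    exact smul_comm _ _ _

/-- The constant families over a cycle. -/
def constTheta (c : Orb σ) {a : ℕ} (l : L) (hk : Orb.len c = kk l) (ha : a = kk l * bb l)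
    (y : Inertia X) : (V.lbun kk bb l).fib y →ₗ[ℂ] (V.theta c a).fib y where
  toFun v := ⟨fun _ => V.tpPow hk.symm ha.symm y v.1, fun _ => by
    have hr : rootPow X (Orb.len c) a = zetaPow (Inertia.xi X) (bb l) := by
      rw [hk, ha, rootPow_mul (hk ▸ Orb.len_pos c)]
    rw [← V.tpPow_act, hr, ← map_smul]
    exact congrArg _ v.2⟩
  map_add' v v' := Subtype.ext (funext fun _ => map_add _ _ _)
  map_smul' t v := Subtype.ext (funext fun _ => map_smul _ _ _)

lemma avgTheta_nat (c : Orb σ) {a : ℕ} (l : L) (hk : Orb.len c = kk l) (ha : a = kk l * bb l)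
    {x y : Inertia X} (f : x ⟶ y) (w : (V.theta c a).fib x) :
    V.avgTheta c l hk ha y ((V.theta c a).act f w) =
      (V.lbun kk bb l).act f (V.avgTheta c l hk ha x w) := by
  refine Subtype.ext ?_
  change (kk l : ℂ)⁻¹ • V.tpPow hk ha y (∑ j, (V.pullPow (Orb.len c) a).act f (w.1 j)) =
    (V.pullPow (kk l) (kk l * bb l)).act f ((kk l : ℂ)⁻¹ • V.tpPow hk ha x (∑ j, w.1 j))
  rw [map_smul, ← V.tpPow_act, map_sum ((V.pullPow (Orb.len c) a).act f)]

lemma avgTheta_cont (c : Orb σ) {a : ℕ} (l : L) (hk : Orb.len c = kk l) (ha : a = kk l * bb l)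
    (y : Inertia X) (s) (hs : s ∈ (V.theta c a).contAt y) :
    (fun x => V.avgTheta c l hk ha x (s x)) ∈ (V.lbun kk bb l).contAt y :=
  (V.pullPow (kk l) (kk l * bb l)).locallyTrivial.smul_mem (a := fun _ => (kk l : ℂ)⁻¹)
    continuousAt_const (V.tpPow_cont hk ha y _
      ((V.pullPow (Orb.len c) a).locallyTrivial.sum_mem fun j => hs j))

lemma avgTheta_constTheta (c : Orb σ) {a : ℕ} (l : L) (hk : Orb.len c = kk l)
    (ha : a = kk l * bb l) (y : Inertia X) (v : (V.lbun kk bb l).fib y) :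
    V.avgTheta c l hk ha y (V.constTheta c l hk ha y v) = v := by
  refine Subtype.ext ?_
  change (kk l : ℂ)⁻¹ • V.tpPow hk ha y (∑ _j : Orb.Elt c, V.tpPow hk.symm ha.symm y v.1) = v.1
  have h0 : (kk l : ℂ) ≠ 0 := by
    have := Orb.len_pos c
    exact_mod_cast (hk ▸ this).ne'
  rw [Finset.sum_const, map_nsmul, V.tpPow_tpPow, Finset.card_univ, ← Nat.cast_smul_eq_nsmul ℂ,
    smul_smul, ← Orb.len_eq_card, show (Orb.len c : ℂ) = kk l from congrArg _ hk,
    inv_mul_cancel₀ h0, one_smul]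

/-- In this order the composite is not the identity but the projection onto the rotation invariants.
It is the identity only on values of compatible families, which is all that `Diag.limIso` asks for.
-/
lemma constTheta_avgTheta (c : Orb σ) {a : ℕ} (l : L) (hk : Orb.len c = kk l)
    (ha : a = kk l * bb l) (y : Inertia X) (w : (V.theta c a).fib y) :
    V.constTheta c l hk ha y (V.avgTheta c l hk ha y w) =
      (Fintype.card (Orb.Elt c) : ℂ)⁻¹ • V.symOp c a y w := by
  refine Subtype.ext (funext fun _ => ?_)
  change V.tpPow hk.symm ha.symm y ((kk l : ℂ)⁻¹ • V.tpPow hk ha y (∑ j, w.1 j)) =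
    (Fintype.card (Orb.Elt c) : ℂ)⁻¹ • ∑ j, w.1 j
  rw [map_smul, V.tpPow_tpPow, ← Orb.len_eq_card, show (Orb.len c : ℂ) = kk l from congrArg _ hk]

/-- Transport along an arrow only relabels the entries of a cycle, and a sum does not see that. -/
lemma avgTheta_tr {m : ℕ} {p p' : TateIdx n m} (f : p ⟶ p') (c : Orb p.perm) (c' : Orb p'.perm)
    (h : Orb.equiv f.1 f.2.1 c = c') (l : L) (hk : Orb.len c = kk l) (ha : p.a c = kk l * bb l)
    (hk' : Orb.len c' = kk l) (ha' : p'.a c' = kk l * bb l)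
    (y : Inertia X) (w : (V.theta c (p.a c)).fib y) :
    V.avgTheta c' l hk' ha' y ((V.tateSystem n m).tr f c c' h y w) = V.avgTheta c l hk ha y w := by
  refine Subtype.ext ?_
  change (kk l : ℂ)⁻¹ • V.tpPow hk' ha' y (∑ j : Orb.Elt c', V.tpPow (Orb.len_equiv f.1 f.2.1 h)
    (TateIdx.a_eq f c c' h) y (w.1 ⟨f.1⁻¹ j.1, (Orb.equiv_mk' f.1 f.2.1 h j.1).2 j.2⟩)) =
      (kk l : ℂ)⁻¹ • V.tpPow hk ha y (∑ j, w.1 j)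
  rw [← map_sum, ← V.tpPow_trans _ _ _ _ hk ha]
  congr 2
  exact Equiv.sum_comp ((f.1⁻¹).subtypeEquiv fun i => (Orb.equiv_mk' f.1 f.2.1 h i).symm) w.1

lemma tr_constTheta {m : ℕ} {p p' : TateIdx n m} (f : p ⟶ p') (c : Orb p.perm) (c' : Orb p'.perm)
    (h : Orb.equiv f.1 f.2.1 c = c') (l : L) (hk : Orb.len c = kk l) (ha : p.a c = kk l * bb l)
    (hk' : Orb.len c' = kk l) (ha' : p'.a c' = kk l * bb l)
    (y : Inertia X) (v : (V.lbun kk bb l).fib y) :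
    (V.tateSystem n m).tr f c c' h y (V.constTheta c l hk ha y v) =
      V.constTheta c' l hk' ha' y v :=
  Subtype.ext (funext fun _ => (V.tpPow_trans _ _ _ _ _ _ y _).symm)

end labels

end RotSeries

/-- The labels of bidegrees `(k, b)` with `1 ≤ k ≤ K`. -/
abbrev LabelSet.block (K : ℕ) : LabelSet where
  car := Fin K × ℕ
  k l := l.1 + 1
  b l := l.2
  k_pos _ := Nat.succ_pos _
  fin _ m := Finite.of_injective (β := Fin K × Fin (m + 1))
    (fun l => ⟨l.1.1, l.1.2, Nat.lt_succ_of_le l.2.2⟩) fun _ _ h =>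
      Subtype.ext (Prod.ext (Prod.mk.inj h).1 (congrArg Fin.val (Prod.mk.inj h).2))

lemma LabelSet.SS_eq_lim {Y : Type u} [TopGpd.{u, v} Y] (Λ : LabelSet) (E : Λ.car → VBundle Y)
    (n m : ℕ) : Λ.SS E n m = (Λ.diag E n m).lim := rfl

lemma VectIso.mk_eq_of_iso {Y : Type u} [TopGpd.{u, v} Y] {E F E' F' : VBundle Y} (hE : E' = E)
    (hF : F' = F) (h : Nonempty (VBundle.Iso E F)) : VectIso.mk E' = VectIso.mk F' := by
  subst hE hF
  exact Quotient.sound h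

namespace RotSeries

variable {X : Type u} [TopGpd.{u, v} X] (V : RotSeries (Inertia X) (Inertia.xi X))

lemma tateSym_V (n m : ℕ) : (tateSym n V).V m = (V.tateSystem n m).diag.lim := by
  change (V.tateSystem n m).lim = _
  rfl

variable [FiniteRotation X]

section labels

variable {L : Type} {kk bb : L → ℕ} {n : ℕ} {σ : Equiv.Perm (Fin n)}

lemma avgTheta_tprod_constTheta {A : Type} [Fintype A] (e : A ≃ Orb σ) {a : Orb σ → ℕ}
    (lab : A → L) (hk : ∀ i, Orb.len (e i) = kk (lab i))
    (ha : ∀ i, a (e i) = kk (lab i) * bb (lab i))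
    (hk' : ∀ c, Orb.len c = kk (lab (e.symm c)))
    (ha' : ∀ c, a c = kk (lab (e.symm c)) * bb (lab (e.symm c))) (y : Inertia X)
    (v : ∀ i, (V.lbun kk bb (lab i)).fib y) (i : A) :
    V.avgTheta (e i) (lab i) (hk i) (ha i) y
      (V.constTheta (e i) (lab (e.symm (e i))) (hk' _) (ha' _) y (v (e.symm (e i)))) = v i := by
  -- The index e.symm (e i) equals i only propositionally. Generalising it removes the transport
  -- from the statement.
  have h : ∀ i' (_ : i' = i) (h1 : Orb.len (e i) = kk (lab i'))
      (h2 : a (e i) = kk (lab i') * bb (lab i')), V.avgTheta (e i) (lab i) (hk i) (ha i) y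
      (V.constTheta (e i) (lab i') h1 h2 y (v i')) = v i := by
    rintro _ rfl h1 h2
    exact V.avgTheta_constTheta _ _ _ _ _ _
  exact h _ (e.symm_apply_apply i) _ _

lemma constTheta_avgTheta_of_eq {a : Orb σ → ℕ} {c c' : Orb σ} (h : c' = c) (l : L)
    (hk : Orb.len c = kk l) (ha : a c = kk l * bb l) (hk' : Orb.len c' = kk l)
    (ha' : a c' = kk l * bb l) (y : Inertia X) (w : ∀ c, (V.theta c (a c)).fib y) :
    V.constTheta c l hk ha y (V.avgTheta c' l hk' ha' y (w c')) =
      (Fintype.card (Orb.Elt c) : ℂ)⁻¹ • V.symOp c (a c) y (w c) := by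
  subst h
  exact V.constTheta_avgTheta _ _ _ _ _ _

lemma avgTheta_tr_eq_castE {m : ℕ} {p p' : TateIdx n m} (f : p ⟶ p') (c : Orb p.perm)
    (c' : Orb p'.perm) (h : Orb.equiv f.1 f.2.1 c = c') {l l' : L} (hl : l = l')
    (hk : Orb.len c = kk l) (ha : p.a c = kk l * bb l)
    (hk' : Orb.len c' = kk l') (ha' : p'.a c' = kk l' * bb l')
    (y : Inertia X) (w : (V.theta c (p.a c)).fib y) :
    V.avgTheta c' l' hk' ha' y ((V.tateSystem n m).tr f c c' h y w) =
      castE (V.lbun kk bb) hl y (V.avgTheta c l hk ha y w) := by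
  subst hl
  exact V.avgTheta_tr f c c' h l hk ha hk' ha' y w

lemma tr_constTheta_eq_castE {m : ℕ} {p p' : TateIdx n m} (f : p ⟶ p') (c : Orb p.perm)
    (c' : Orb p'.perm) (h : Orb.equiv f.1 f.2.1 c = c') {l l' : L} (hl : l = l')
    (hk : Orb.len c = kk l) (ha : p.a c = kk l * bb l)
    (hk' : Orb.len c' = kk l') (ha' : p'.a c' = kk l' * bb l')
    (y : Inertia X) (v : (V.lbun kk bb l).fib y) :
    V.constTheta c' l' hk' ha' y (castE (V.lbun kk bb) hl y v) =
      (V.tateSystem n m).tr f c c' h y (V.constTheta c l hk ha y v) := by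
  subst hl
  exact (V.tr_constTheta f c c' h l hk ha hk' ha' y v).symm

variable {m : ℕ} (p : TateIdx n m) {A : Type} [Fintype A] (e : A ≃ Orb p.perm) (lab : A → L)

/-- The average over all cycles. -/
def avgAll (hk : ∀ i, Orb.len (e i) = kk (lab i))
    (ha : ∀ i, p.a (e i) = kk (lab i) * bb (lab i)) (y : Inertia X) :
    ((V.tateSystem n m).diag.D p).fib y →ₗ[ℂ]
      (VBundle.piTensor fun i => V.lbun kk bb (lab i)).fib y :=
  VBundle.reT (P := fun c : Orb p.perm => V.theta c (p.a c)) (P' := fun i => V.lbun kk bb (lab i)) e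
    (fun i => V.avgTheta (e i) (lab i) (hk i) (ha i)) y

/-- The tensor products of the constant families. -/
def constAll (hk : ∀ c, Orb.len c = kk (lab (e.symm c)))
    (ha : ∀ c, p.a c = kk (lab (e.symm c)) * bb (lab (e.symm c))) (y : Inertia X) :
    (VBundle.piTensor fun i => V.lbun kk bb (lab i)).fib y →ₗ[ℂ]
      ((V.tateSystem n m).diag.D p).fib y :=
  VBundle.reT (P := fun i => V.lbun kk bb (lab i)) (P' := fun c : Orb p.perm => V.theta c (p.a c))
    e.symm (fun c => V.constTheta c (lab (e.symm c)) (hk c) (ha c)) y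

lemma avgAll_tprod (hk : ∀ i, Orb.len (e i) = kk (lab i))
    (ha : ∀ i, p.a (e i) = kk (lab i) * bb (lab i)) (y : Inertia X)
    (w : ∀ c : Orb p.perm, (V.theta c (p.a c)).fib y) :
    V.avgAll p e lab hk ha y (PiTensorProduct.tprod ℂ w) =
      PiTensorProduct.tprod ℂ fun i => V.avgTheta (e i) (lab i) (hk i) (ha i) y (w (e i)) :=
  VBundle.reT_tprod (P := fun c : Orb p.perm => V.theta c (p.a c))
    (P' := fun i => V.lbun kk bb (lab i)) _ _ y w

lemma constAll_tprod (hk : ∀ c, Orb.len c = kk (lab (e.symm c)))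
    (ha : ∀ c, p.a c = kk (lab (e.symm c)) * bb (lab (e.symm c))) (y : Inertia X)
    (v : ∀ i, (V.lbun kk bb (lab i)).fib y) :
    V.constAll p e lab hk ha y (PiTensorProduct.tprod ℂ v) = PiTensorProduct.tprod ℂ fun c =>
      V.constTheta c (lab (e.symm c)) (hk c) (ha c) y (v (e.symm c)) :=
  VBundle.reT_tprod (P := fun i => V.lbun kk bb (lab i))
    (P' := fun c : Orb p.perm => V.theta c (p.a c)) _ _ y v

lemma avgAll_nat (hk : ∀ i, Orb.len (e i) = kk (lab i))
    (ha : ∀ i, p.a (e i) = kk (lab i) * bb (lab i)) {x y : Inertia X} (b : x ⟶ y)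
    (w : ((V.tateSystem n m).diag.D p).fib x) :
    V.avgAll p e lab hk ha y (((V.tateSystem n m).diag.D p).act b w) =
      (VBundle.piTensor fun i => V.lbun kk bb (lab i)).act b (V.avgAll p e lab hk ha x w) :=
  VBundle.reT_nat (P := fun c : Orb p.perm => V.theta c (p.a c))
    (P' := fun i => V.lbun kk bb (lab i)) e
    (fun i => V.avgTheta (e i) (lab i) (hk i) (ha i))
    (fun i _ _ b w => V.avgTheta_nat (e i) (lab i) (hk i) (ha i) b w) b w

lemma avgAll_cont (hk : ∀ i, Orb.len (e i) = kk (lab i))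
    (ha : ∀ i, p.a (e i) = kk (lab i) * bb (lab i)) (y : Inertia X) (s)
    (hs : s ∈ ((V.tateSystem n m).diag.D p).contAt y) :
    (fun x => V.avgAll p e lab hk ha x (s x)) ∈
      (VBundle.piTensor fun i => V.lbun kk bb (lab i)).contAt y :=
  VBundle.reT_cont (P := fun c : Orb p.perm => V.theta c (p.a c))
    (P' := fun i => V.lbun kk bb (lab i)) e
    (fun i => V.avgTheta (e i) (lab i) (hk i) (ha i))
    (fun i y s hs => V.avgTheta_cont (e i) (lab i) (hk i) (ha i) y s hs) y s hs

lemma avgAll_constAll (hk : ∀ i, Orb.len (e i) = kk (lab i))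
    (ha : ∀ i, p.a (e i) = kk (lab i) * bb (lab i)) (hk' : ∀ c, Orb.len c = kk (lab (e.symm c)))
    (ha' : ∀ c, p.a c = kk (lab (e.symm c)) * bb (lab (e.symm c))) (y : Inertia X)
    (v : (VBundle.piTensor fun i => V.lbun kk bb (lab i)).fib y) :
    V.avgAll p e lab hk ha y (V.constAll p e lab hk' ha' y v) = v := by
  refine LinearMap.congr_fun (VBundle.piTensor_ext (P := fun i => V.lbun kk bb (lab i))
    (φ := V.avgAll p e lab hk ha y ∘ₗ V.constAll p e lab hk' ha' y) (ψ := LinearMap.id)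
    fun v => ?_) v
  refine (congrArg _ (V.constAll_tprod p e lab hk' ha' y v)).trans
    ((V.avgAll_tprod p e lab hk ha y _).trans ?_)
  exact congrArg _ (funext fun i => V.avgTheta_tprod_constTheta e lab hk ha hk' ha' y v i)

/-- Cycle by cycle the composite is the symmetrization divided by the length. By `symAll_of_isSec`
symmetrization multiplies compatible families by the product of the lengths. -/
lemma constAll_avgAll (hk : ∀ i, Orb.len (e i) = kk (lab i))
    (ha : ∀ i, p.a (e i) = kk (lab i) * bb (lab i)) (hk' : ∀ c, Orb.len c = kk (lab (e.symm c)))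
    (ha' : ∀ c, p.a c = kk (lab (e.symm c)) * bb (lab (e.symm c))) {y : Inertia X}
    {w : ∀ p, ((V.tateSystem n m).diag.D p).fib y} (hw : (V.tateSystem n m).diag.IsSec w) :
    V.constAll p e lab hk' ha' y (V.avgAll p e lab hk ha y (w p)) = w p := by
  have h1 : V.constAll p e lab hk' ha' y ∘ₗ V.avgAll p e lab hk ha y =
      (∏ c : Orb p.perm, (Fintype.card (Orb.Elt c) : ℂ)⁻¹) • V.symAll p y := by
    refine (V.tateSystem n m).T_ext fun w => ?_
    refine (congrArg _ (V.avgAll_tprod p e lab hk ha y w)).trans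
      ((V.constAll_tprod p e lab hk' ha' y _).trans ?_)
    refine Eq.trans ?_ (congrArg ((∏ c : Orb p.perm, (Fintype.card (Orb.Elt c) : ℂ)⁻¹) • ·)
      (V.symAll_tprod p y w)).symm
    refine Eq.trans ?_ (MultilinearMap.map_smul_univ (PiTensorProduct.tprod ℂ)
      (fun c : Orb p.perm => (Fintype.card (Orb.Elt c) : ℂ)⁻¹) _)
    exact congrArg _ (funext fun c => V.constTheta_avgTheta_of_eq (e.apply_symm_apply c)
      _ _ _ _ _ y w)
  refine (LinearMap.congr_fun h1 (w p)).trans ?_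
  refine (congrArg ((∏ c : Orb p.perm, (Fintype.card (Orb.Elt c) : ℂ)⁻¹) • ·)
    (V.symAll_of_isSec hw p)).trans ?_
  refine (smul_smul _ _ _).trans ?_
  rw [← Finset.prod_mul_distrib, Finset.prod_eq_one, one_smul]
  intro c _
  have := Orb.len_pos c
  rw [Orb.len_eq_card] at this
  exact inv_mul_cancel₀ (by exact_mod_cast this.ne')

/-- Averages forget the positions inside a cycle, so of an arrow only its effect on the set of
cycles survives. -/
lemma avgAll_T {p p' : TateIdx n m} {A' : Type} [Fintype A'] (e : A ≃ Orb p.perm)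
    (e' : A' ≃ Orb p'.perm) {lab : A → L} {lab' : A' → L} (hk : ∀ i, Orb.len (e i) = kk (lab i))
    (ha : ∀ i, p.a (e i) = kk (lab i) * bb (lab i))
    (hk' : ∀ i, Orb.len (e' i) = kk (lab' i))
    (ha' : ∀ i, p'.a (e' i) = kk (lab' i) * bb (lab' i)) (f : p ⟶ p') (κ : A' ≃ A)
    (hκ : ∀ i, Orb.equiv f.1 f.2.1 (e (κ i)) = e' i) (hl : ∀ i, lab (κ i) = lab' i)
    (y : Inertia X) (w : ((V.tateSystem n m).diag.D p).fib y) :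
    V.avgAll p' e' lab' hk' ha' y ((V.tateSystem n m).diag.T f y w) =
      permT (V.lbun kk bb) κ hl y (V.avgAll p e lab hk ha y w) := by
  refine LinearMap.congr_fun ((V.tateSystem n m).T_ext
    (φ := V.avgAll p' e' lab' hk' ha' y ∘ₗ (V.tateSystem n m).T f y)
    (ψ := permT (V.lbun kk bb) κ hl y ∘ₗ V.avgAll p e lab hk ha y) fun w => ?_) w
  obtain ⟨w', hw'⟩ := (V.tateSystem n m).exists_transport f y w
  refine (congrArg (V.avgAll p' e' lab' hk' ha' y)
    ((V.tateSystem n m).T_tprod f y w w' hw')).trans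
    ((V.avgAll_tprod p' e' lab' hk' ha' y w').trans ?_)
  refine Eq.trans ?_ (congrArg (permT (V.lbun kk bb) κ hl y)
    (V.avgAll_tprod p e lab hk ha y w)).symm
  refine Eq.trans ?_ (permT_tprod (V.lbun kk bb) κ hl y _).symm
  refine congrArg _ (funext fun i' => ?_)
  refine (congrArg _ (hw' _ _ (hκ i'))).trans ?_
  exact V.avgTheta_tr_eq_castE f _ _ _ (hl i') _ _ _ _ y _

lemma T_constAll {p p' : TateIdx n m} {A' : Type} [Fintype A'] (e : A ≃ Orb p.perm)
    (e' : A' ≃ Orb p'.perm) {lab : A → L} {lab' : A' → L}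
    (hk : ∀ c, Orb.len c = kk (lab (e.symm c)))
    (ha : ∀ c, p.a c = kk (lab (e.symm c)) * bb (lab (e.symm c)))
    (hk' : ∀ c, Orb.len c = kk (lab' (e'.symm c)))
    (ha' : ∀ c, p'.a c = kk (lab' (e'.symm c)) * bb (lab' (e'.symm c))) (f : p ⟶ p') (κ : A' ≃ A)
    (hκ : ∀ i, Orb.equiv f.1 f.2.1 (e (κ i)) = e' i) (hl : ∀ i, lab (κ i) = lab' i)
    (y : Inertia X) (v : (VBundle.piTensor fun i => V.lbun kk bb (lab i)).fib y) :
    (V.tateSystem n m).diag.T f y (V.constAll p e lab hk ha y v) =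
      V.constAll p' e' lab' hk' ha' y (permT (V.lbun kk bb) κ hl y v) := by
  refine LinearMap.congr_fun (VBundle.piTensor_ext (P := fun i => V.lbun kk bb (lab i))
    (φ := (V.tateSystem n m).T f y ∘ₗ V.constAll p e lab hk ha y)
    (ψ := V.constAll p' e' lab' hk' ha' y ∘ₗ permT (V.lbun kk bb) κ hl y) fun v => ?_) v
  refine (congrArg ((V.tateSystem n m).T f y) (V.constAll_tprod p e lab hk ha y v)).trans ?_
  refine Eq.trans ?_ ((congrArg (V.constAll p' e' lab' hk' ha' y)
    (permT_tprod (V.lbun kk bb) κ hl y v)).trans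
      (V.constAll_tprod p' e' lab' hk' ha' y _)).symm
  refine (V.tateSystem n m).T_tprod f y _ _ fun c c' hc => ?_
  have hi : κ (e'.symm c') = e.symm c := by
    refine e.eq_symm_apply.2 ?_
    refine (Orb.equiv f.1 f.2.1).injective ((hκ _).trans ?_)
    exact (e'.apply_symm_apply c').trans hc.symm
  have hl' : lab (e.symm c) = lab' (e'.symm c') := by rw [← hi, hl]
  refine (congrArg (V.constTheta c' (lab' (e'.symm c')) (hk' c') (ha' c') y)
    (castE_congr (V.lbun kk bb) (lab := lab) v (hl (e'.symm c')) hl' hi)).trans ?_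
  exact V.tr_constTheta_eq_castE f c c' hc hl' _ _ _ _ y _

end labels

/-- A permutation with exponents on its cycles is, up to conjugation, a family of pairs (k, a).
Rotation invariance kills it unless each k divides its a. Writing a = k b, the invariants of θ are
the degree b coefficient of `betaRep k`, so a label of bidegree (k, b) stands for such a cycle. The
label must be determined by its bidegree, so that arrows between permutations preserve labels, and
all lengths up to n must occur. -/
theorem nonempty_iso_tateSystem {n : ℕ} (m : ℕ) (Λ : LabelSet)
    (hinj : ∀ l l', Λ.k l = Λ.k l' → Λ.b l = Λ.b l' → l = l')
    (hsurj : ∀ k b, 0 < k → k ≤ n → ∃ l, Λ.k l = k ∧ Λ.b l = b) :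
    Nonempty (VBundle.Iso (V.tateSystem n m).diag.lim (Λ.diag (V.lbun Λ.k Λ.b) n m).lim) := by
  classical
  -- A permutation whose cycles have the lengths prescribed by the labels. The total first degree n
  -- makes it a permutation of n letters.
  choose σ e he using fun p : MIdx Λ n m =>
    Orb.exists_perm (fun i => Λ.k (p.lab i)) (fun i => Λ.k_pos _) p.hk
  have hlen : ∀ (p : MIdx Λ n m) (c : Orb (σ p)), Orb.len c = Λ.k (p.lab ((e p).symm c)) := fun p c =>
    (congrArg Orb.len ((e p).apply_symm_apply c)).symm.trans (he p _)
  -- With a = k b a cycle contributes a / k = b to the q-degree, so the degrees add up to m.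
  let F : MIdx Λ n m → TateIdx n m := fun p =>
    ⟨σ p, fun c => Λ.k (p.lab ((e p).symm c)) * Λ.b (p.lab ((e p).symm c)), by
      refine Eq.trans ?_ (congrArg (Nat.cast (R := ℚ)) p.hb)
      rw [← Equiv.sum_comp (e p), Nat.cast_sum]
      refine Finset.sum_congr rfl fun i _ => ?_
      have h0 : (Λ.k (p.lab i) : ℚ) ≠ 0 := by exact_mod_cast (Λ.k_pos (p.lab i)).ne'
      rw [he, Equiv.symm_apply_apply, Nat.cast_mul, mul_div_cancel_left₀ _ h0]⟩
  have hFa : ∀ (p : MIdx Λ n m) (i : Fin p.N), (F p).a (e p i) = Λ.k (p.lab i) * Λ.b (p.lab i) := fun p i => by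
    change Λ.k (p.lab ((e p).symm (e p i))) * Λ.b (p.lab ((e p).symm (e p i))) = _
    rw [Equiv.symm_apply_apply]
  refine Diag.limIso (V.tateSystem n m).diag (Λ.diag (V.lbun Λ.k Λ.b) n m) F
    (fun p => V.avgAll (F p) (e p) p.lab (he p) (hFa p))
    (fun p => V.constAll (F p) (e p) p.lab (hlen p) (fun _ => rfl))
    (fun p x y b w => V.avgAll_nat (F p) (e p) p.lab (he p) (hFa p) b w)
    (fun p y s hs => V.avgAll_cont (F p) (e p) p.lab (he p) (hFa p) y s hs)
    (fun p y v => V.avgAll_constAll (F p) (e p) p.lab (he p) (hFa p) (hlen p) (fun _ => rfl) y v)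
    (fun p y w hw => V.constAll_avgAll (F p) (e p) p.lab (he p) (hFa p) (hlen p) (fun _ => rfl) hw)
    ?_ ?_ ?_
  · intro p p' g
    -- A bijection of labels prescribes a bijection of cycles of equal length and exponent. The
    -- conjugating permutation is not unique, but averages do not depend on it.
    obtain ⟨f, hf⟩ := TateIdx.exists_hom (p := F p) (p' := F p')
      ((e p).symm.trans (g.1.trans (e p'))) (fun c => by
        refine Eq.trans ?_ (hFa p' _).symm
        rw [← g.2]) (fun c => by
        refine (hlen p c).trans (Eq.trans ?_ (he p' _).symm)
        rw [← g.2])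
    have hf' : ∀ i', Orb.equiv f.1 f.2.1 (e p (g.1.symm i')) = e p' i' := fun i' =>
      (hf _).trans (by simp)
    exact ⟨f, fun y w => V.avgAll_T (p := F p) (p' := F p') (kk := Λ.k) (bb := Λ.b) (lab := p.lab)
      (lab' := p'.lab) (e p) (e p') (he p) (hFa p) (he p') (hFa p') f g.1.symm hf'
      (MIdx.lab_symm g) y w⟩
  · intro p p' f
    -- An arrow preserves both k and a = k b. Since k > 0 it preserves b, hence the label.
    have hl : ∀ i, p.lab i = p'.lab ((e p').symm (Orb.equiv f.1 f.2.1 (e p i))) := fun i => by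
      have h1 := (he p i).symm.trans ((Orb.len_equiv f.1 f.2.1 rfl).trans (hlen p' _))
      have h2 := (hFa p i).symm.trans (TateIdx.a_eq f (e p i) _ rfl)
      have h3 : Λ.k (p.lab i) * Λ.b (p.lab i) = Λ.k (p.lab i) *
          Λ.b (p'.lab ((e p').symm (Orb.equiv f.1 f.2.1 (e p i)))) := by
        refine h2.trans ?_
        rw [h1]
      exact hinj _ _ h1 (Nat.eq_of_mul_eq_mul_left (Λ.k_pos _) h3)
    refine ⟨⟨(e p).trans ((Orb.equiv f.1 f.2.1).trans (e p').symm), hl⟩, fun y v => ?_⟩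
    let g : p ⟶ p' := ⟨(e p).trans ((Orb.equiv f.1 f.2.1).trans (e p').symm), hl⟩
    refine V.T_constAll (p := F p) (p' := F p') (kk := Λ.k) (bb := Λ.b) (lab := p.lab)
      (lab' := p'.lab) (e p) (e p') (hlen p) (fun _ => rfl) (hlen p') (fun _ => rfl) f g.1.symm
      (fun i => ?_) (MIdx.lab_symm g) y v
    rw [← Equiv.eq_symm_apply, ← Equiv.eq_symm_apply]
    rfl
  · intro p
    -- If every length divides its exponent, the index comes from labels (k, a / k). Otherwise one
    -- symmetrization `symOp` is zero, so compatible families vanish at this index.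
    by_cases h : ∀ c, Orb.len c ∣ p.a c
    · left
      let ε := (Fintype.equivFin (Orb p.perm)).symm
      choose lab hk hb using fun i => hsurj (Orb.len (ε i)) (p.a (ε i) / Orb.len (ε i))
        (Orb.len_pos _) (Orb.len_le _)
      let j : MIdx Λ n m := ⟨_, lab, by
          simp_rw [hk]
          rw [Equiv.sum_comp ε Orb.len, Orb.sum_len], by
          simp_rw [hb]
          rw [Equiv.sum_comp ε fun c => p.a c / Orb.len c]
          have h1 := p.sum_eq
          have h2 : ∀ c, (p.a c : ℚ) / Orb.len c = ((p.a c / Orb.len c : ℕ) : ℚ) := fun c =>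
            (Nat.cast_div (h c) (by exact_mod_cast (Orb.len_pos c).ne')).symm
          simp_rw [h2] at h1
          exact_mod_cast h1⟩
      refine ⟨j, ?_⟩
      obtain ⟨f, -⟩ := TateIdx.exists_hom (p := F j) (p' := p) ((e j).symm.trans ε)
        (fun c => by
          change Λ.k (lab ((e j).symm c)) * Λ.b (lab ((e j).symm c)) = _
          rw [hk, hb]
          exact Nat.mul_div_cancel' (h _))
        (fun c => (hlen j c).trans (hk _))
      exact ⟨f⟩
    · right
      intro y w hw
      push Not at h
      obtain ⟨c, hc⟩ := h
      have h1 : V.symAll p y = 0 := by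
        refine (V.tateSystem n m).T_ext fun w => ?_
        refine (V.symAll_tprod p y w).trans ?_
        refine (MultilinearMap.map_coord_zero (PiTensorProduct.tprod ℂ) c ?_).trans
          (LinearMap.zero_apply _).symm
        rw [V.symOp_eq_zero c _ hc]
        rfl
      have h2 := (V.symAll_of_isSec hw p).symm.trans (LinearMap.congr_fun h1 (w p))
      rcases smul_eq_zero.1 (h2.trans (LinearMap.zero_apply _)) with h3 | h3
      · obtain ⟨c', -, h4⟩ := Finset.prod_eq_zero_iff.1 h3
        have := Orb.len_pos c'
        rw [Orb.len_eq_card] at this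
        exact absurd h4 (by exact_mod_cast this.ne')
      · exact h3

/-- The symmetric powers in Tate K-theory in terms of sequences of labels. -/
theorem mk_tateSym {K n : ℕ} (hn : n ≤ K) (m : ℕ) :
    VectIso.mk ((tateSym n V).V m) = VectIso.mk ((LabelSet.block K).SS
      (V.lbun (LabelSet.block K).k (LabelSet.block K).b) n m) :=
  VectIso.mk_eq_of_iso (V.tateSym_V n m) (LabelSet.SS_eq_lim _ _ _ _)
    (V.nonempty_iso_tateSystem m _ (fun _ _ h h' => Prod.ext (Fin.ext (Nat.succ_injective h)) h')
      fun k b hk hk' => ⟨(⟨k - 1, by omega⟩, b), Nat.sub_add_cancel hk, rfl⟩)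

end RotSeries

/-! ### The product formula and the Hecke operators -/

section tate

variable {X : Type u} [TopGpd.{u, v} X] [FiniteRotation X]

namespace RotSeries

variable (V : RotSeries (Inertia X) (Inertia.xi X))

/-- The labels of first degree K + 1 form a column of their own. Splitting it off gives one factor
of the product. -/
lemma sgen_block_succ (K : ℕ) :
    (LabelSet.block (K + 1)).sgen (V.lbun (LabelSet.block (K + 1)).k (LabelSet.block (K + 1)).b) =
      (LabelSet.block K).sgen (V.lbun (LabelSet.block K).k (LabelSet.block K).b) *
        (LabelSet.column K).sgen (V.betaRep (K + 1)).V := by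
  refine Eq.trans ?_ (LabelSet.sgen_sum (LabelSet.block K) (LabelSet.column K)
    (Sum.elim (V.lbun (LabelSet.block K).k (LabelSet.block K).b) (V.betaRep (K + 1)).V))
  refine LabelSet.sgen_congr (Λ := LabelSet.block (K + 1))
    (Λ' := (LabelSet.block K).sum (LabelSet.column K))
    { toFun := Sum.elim (fun l => (l.1.castSucc, l.2)) (fun b => (Fin.last K, b))
      invFun := fun l => if h : l.1.1 < K then Sum.inl (⟨l.1.1, h⟩, l.2) else Sum.inr l.2
      left_inv := ?_
      right_inv := ?_ } ?_ ?_ ?_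
  · rintro (⟨i, b⟩ | b)
    · exact dif_pos i.2
    · exact dif_neg (lt_irrefl K)
  · rintro ⟨⟨i, hi⟩, b⟩
    by_cases h : i < K
    · simp [h]
    · obtain rfl : i = K := by omega
      simp [Fin.last]
  · rintro (l | l) <;> rfl
  · rintro (l | l) <;> rfl
  · rintro (l | l)
    exacts [⟨VBundle.Iso.refl _⟩, ⟨VBundle.Iso.refl _⟩]

/-- The total symmetric power of `β_k(V)`, with `t` replaced by `t ^ k`, where `k = l + 1`. -/
def colSer (l : ℕ) : PowerSeries (RotSemiring (Inertia X) (Inertia.xi X)) :=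
  PowerSeries.mk fun n => if l + 1 ∣ n then (sym (n / (l + 1)) (V.betaRep (l + 1))).cls else 0

lemma unrot_colSer (l : ℕ) :
    unrot (V.colSer l) = (LabelSet.column l).sgen (V.betaRep (l + 1)).V := by
  refine PowerSeries.ext fun n => PowerSeries.ext fun m => ?_
  rw [LabelSet.coeff_sgen, LabelSet.SS_column, unrot, PowerSeries.coeff_map, colSer,
    PowerSeries.coeff_mk]
  split_ifs with h
  · rw [← mk_sym]
    exact PowerSeries.coeff_mk m fun m => VectIso.mk ((sym (n / (l + 1)) (V.betaRep (l + 1))).V m)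
  · exact map_zero _

lemma unrot_prod_colSer (K : ℕ) : unrot (∏ l ∈ Finset.range K, V.colSer l) =
    (LabelSet.block K).sgen (V.lbun (LabelSet.block K).k (LabelSet.block K).b) := by
  induction K with
  | zero =>
    have : IsEmpty (LabelSet.block 0).car := inferInstanceAs (IsEmpty (Fin 0 × ℕ))
    rw [LabelSet.sgen_of_isEmpty, Finset.prod_range_zero, map_one]
  | succ K ih => rw [Finset.prod_range_succ, map_mul, ih, sgen_block_succ, unrot_colSer]

/-- Permutations of n ≤ K letters have only cycles of length at most K, so the factors with k > K do
not contribute to t^n. -/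
lemma coeff_totalSer_tateSym {K n : ℕ} (hn : n ≤ K) :
    PowerSeries.coeff n (totalSer tateSym V) =
      PowerSeries.coeff n (∏ l ∈ Finset.range K, V.colSer l) := by
  have h1 : ∀ S : PowerSeries (RotSemiring (Inertia X) (Inertia.xi X)),
      PowerSeries.coeff n (unrot S) = (PowerSeries.coeff n S).1 := fun S =>
    PowerSeries.coeff_map _ _ _
  refine Subtype.ext ?_
  rw [← h1, ← h1, unrot_prod_colSer]
  refine PowerSeries.ext fun m => ?_
  rw [LabelSet.coeff_sgen, ← V.mk_tateSym hn, h1, totalSer, PowerSeries.coeff_mk]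
  exact PowerSeries.coeff_mk m fun m => VectIso.mk ((tateSym n V).V m)

lemma beta_cls (k : ℕ) : beta k (GRing.of V.cls) = GRing.of (V.betaRep k).cls := by
  rw [cls_betaRep]
  exact GRing.lift_of _ _

lemma map_colSer (l : ℕ) : PowerSeries.map GRing.ofHom (V.colSer l) =
    PowerSeries.expand (l + 1) l.succ_ne_zero (symT (beta (l + 1) (GRing.of V.cls))) := by
  refine PowerSeries.ext fun n => ?_
  rw [beta_cls, isExponentialExtension_symT.map_cls, PowerSeries.coeff_map, colSer,
    PowerSeries.coeff_mk, PowerSeries.coeff_expand, totalClass]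
  split_ifs
  · rw [PowerSeries.coeff_mk]
    rfl
  · exact map_zero _

end RotSeries

/-- The product of the total symmetric powers of `β_k(x)` at `t ^ k`, for `1 ≤ k ≤ K`. -/
def prodSym (K : ℕ) (x : KTate X) : PowerSeries (KTate X) :=
  ∏ l ∈ Finset.range K, PowerSeries.expand (l + 1) l.succ_ne_zero (symT (beta (l + 1) x))

lemma constantCoeff_expand_symT {Y : Type u} [TopGpd.{u, v} Y] {z : CatCenter Y} (l : ℕ)
    (x : KRot Y z) : PowerSeries.constantCoeff
    (PowerSeries.expand (l + 1) l.succ_ne_zero (symT x)) = 1 := by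
  rw [PowerSeries.constantCoeff_expand, constantCoeff_symT]

lemma constantCoeff_prodSym (K : ℕ) (x : KTate X) :
    PowerSeries.constantCoeff (prodSym K x) = 1 :=
  constantCoeff_prod _ fun _ _ => constantCoeff_expand_symT _ _

lemma prodSym_add (K : ℕ) (x y : KTate X) : prodSym K (x + y) = prodSym K x * prodSym K y := by
  rw [prodSym, prodSym, prodSym, ← Finset.prod_mul_distrib]
  refine Finset.prod_congr rfl fun l _ => ?_
  rw [map_add, isExponentialExtension_symT.map_add, map_mul]

lemma coeff_totalClass_tateSym (V : RotSeries (Inertia X) (Inertia.xi X)) {K n : ℕ} (hn : n ≤ K) :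
    PowerSeries.coeff n (totalClass RotSeries.tateSym V) =
      PowerSeries.coeff n (prodSym K (GRing.of V.cls)) := by
  rw [totalClass_eq, PowerSeries.coeff_map, V.coeff_totalSer_tateSym hn, ← PowerSeries.coeff_map,
    map_prod, prodSym]
  simp_rw [V.map_colSer]

lemma constantCoeff_tateSym (V : RotSeries (Inertia X) (Inertia.xi X)) :
    PowerSeries.constantCoeff (totalClass RotSeries.tateSym V) = 1 := by
  rw [← PowerSeries.coeff_zero_eq_constantCoeff_apply, coeff_totalClass_tateSym V le_rfl,
    PowerSeries.coeff_zero_eq_constantCoeff_apply, constantCoeff_prodSym]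

/-- Multiplicativity is inherited from the product formula: each `beta k` is additive and `symT` is
multiplicative. The product is truncated at n to compare the coefficients at t^n. -/
theorem isExponentialExtension_tateSymT : IsExponentialExtension RotSeries.tateSym
    (tateSymT : KTate X → PowerSeries (KTate X)) := by
  refine isExponentialExtension_totalPower constantCoeff_tateSym fun U V W h => ?_
  refine PowerSeries.ext fun n => ?_
  rw [coeff_totalClass_tateSym U le_rfl, h, map_add, prodSym_add]
  exact coeff_mul_congr (fun _ hm => (coeff_totalClass_tateSym V hm).symm)
    (fun _ hm => (coeff_totalClass_tateSym W hm).symm) le_rfl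

/-- The total symmetric power in Tate K-theory is the product of the total symmetric powers of
`β_k(x)` at `t ^ k`. -/
theorem coeff_tateSymT (x : KTate X) {K n : ℕ} (hn : n ≤ K) :
    PowerSeries.coeff n (tateSymT x) = PowerSeries.coeff n (prodSym K x) := by
  obtain ⟨⟨V, W⟩, hx⟩ := exists_sub_cls x
  have hx' : x + GRing.of W.cls = GRing.of V.cls := by rw [hx, sub_add_cancel]
  have h1 : tateSymT x = totalClass RotSeries.tateSym V *
      PowerSeries.invOfUnit (totalClass RotSeries.tateSym W) 1 := by
    rw [← isExponentialExtension_tateSymT.map_cls V, ← hx', isExponentialExtension_tateSymT.map_add,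
      isExponentialExtension_tateSymT.map_cls W, mul_assoc, mul_inv_one (constantCoeff_tateSym W),
      mul_one]
  have h2 : prodSym K x = prodSym K (GRing.of V.cls) *
      PowerSeries.invOfUnit (prodSym K (GRing.of W.cls)) 1 := by
    rw [← hx', prodSym_add, mul_assoc, mul_inv_one (constantCoeff_prodSym K _), mul_one]
  rw [h1, h2]
  exact coeff_mul_congr (fun _ hm => coeff_totalClass_tateSym V hm)
    (fun _ hm => coeff_inv_congr (constantCoeff_tateSym W) (constantCoeff_prodSym K _)
      (fun _ h => coeff_totalClass_tateSym W h) hm) hn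

lemma constantCoeff_tateSymT (x : KTate X) : PowerSeries.constantCoeff (tateSymT x) = 1 :=
  isExponentialExtension_tateSymT.constantCoeff constantCoeff_tateSym x

/-- The logarithmic derivative of the truncated product is a sum over d. By `logD_expand` the factor
S_{t^d}(β_d x) contributes d ψ_{m/d}(β_d x) to t^m if d ∣ m, and nothing otherwise. -/
lemma coeff_logD_tateSymT {m : ℕ} (hm : 0 < m) (x : KTate X) :
    PowerSeries.coeff m (logD (tateSymT x)) =
      ∑ p ∈ m.divisorsAntidiagonal, p.2 • adams p.1 (beta p.2 x) := by
  rw [coeff_logD_congr (constantCoeff_tateSymT x) (constantCoeff_prodSym m x)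
    (fun _ h => coeff_tateSymT x h), prodSym, logD_prod _ fun _ _ => constantCoeff_expand_symT _ _,
    map_sum]
  have h1 : ∀ l, PowerSeries.coeff m (logD (PowerSeries.expand (l + 1) l.succ_ne_zero
      (symT (beta (l + 1) x)))) =
        if l + 1 ∣ m then (l + 1) • adams (m / (l + 1)) (beta (l + 1) x) else 0 := fun l => by
    rw [logD_expand _ (constantCoeff_symT _), map_nsmul, PowerSeries.coeff_expand, adams_eq]
    split_ifs
    · rfl
    · exact smul_zero _
  rw [Finset.sum_congr rfl fun l _ => h1 l, ← Finset.sum_filter,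
    Nat.sum_divisorsAntidiagonal' fun a d => d • adams a (beta d x)]
  -- The factors are numbered from 0, so d = l + 1. All divisors of m occur since the truncation is
  -- at m.
  refine Finset.sum_bij (fun l _ => l + 1) (fun l hl => ?_) (fun _ _ _ _ h => Nat.succ_injective h)
    (fun d hd => ?_) fun _ _ => rfl
  · exact Nat.mem_divisors.2 ⟨(Finset.mem_filter.1 hl).2, hm.ne'⟩
  · have h2 := Nat.pos_of_mem_divisors hd
    have h3 := Nat.divisor_le hd
    exact ⟨d - 1, Finset.mem_filter.2 ⟨Finset.mem_range.2 (by omega),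
      by rw [Nat.sub_add_cancel h2]; exact Nat.dvd_of_mem_divisors hd⟩, Nat.sub_add_cancel h2⟩

/-- The generating function of the Hecke operators. -/
theorem map_toRat_tateSymT (x : KTate X) : PowerSeries.map toRat (tateSymT x) =
    expSeries (PowerSeries.mk fun m => hecke m x) := by
  refine map_toRat_eq_expSeries (constantCoeff_tateSymT x) ?_ fun m hm => ?_
  · rw [PowerSeries.coeff_mk, hecke, Nat.divisorsAntidiagonal_zero, Finset.sum_empty]
  · rw [PowerSeries.coeff_mk, coeff_logD_tateSymT hm, TensorProduct.tmul_sum, hecke]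
    refine Finset.sum_congr rfl fun p hp => ?_
    -- With a d = m the weights satisfy d / m = 1 / a.
    obtain ⟨hp, -⟩ := Nat.mem_divisorsAntidiagonal.1 hp
    rw [← natCast_zsmul, ← TensorProduct.smul_tmul]
    congr 1
    have h1 : (p.1 : ℚ) ≠ 0 := by
      rintro h
      rw [Nat.cast_eq_zero.1 h, zero_mul] at hp
      omega
    have h2 : (p.2 : ℚ) ≠ 0 := by
      rintro h
      rw [Nat.cast_eq_zero.1 h, mul_zero] at hp
      omega
    rw [← hp]
    push_cast
    simp only [zsmul_eq_mul]
    push_cast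
    field_simp

end tate

/-! ### Characters of symmetric powers -/

section trace

variable {Y : Type u} [TopGpd.{u, v} Y]

/-- The trace of an automorphism of an object on the fibres of bundles. -/
def VectIso.trAt (y : Y) (h : y ⟶ y) : VectIso Y →+* ℂ where
  toFun := Quotient.lift (fun E => LinearMap.trace ℂ (E.fib y) (E.act h)) (fun E F ⟨i⟩ => by
    rw [← LinearMap.trace_conj' (E.act h) (i.equiv y)]
    congr 1
    ext w
    rw [LinearEquiv.conj_apply_apply, i.nat, LinearEquiv.apply_symm_apply])
  map_zero' := map_zero (LinearMap.trace ℂ PUnit)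
  map_one' := by
    change LinearMap.trace ℂ ℂ LinearMap.id = 1
    simp
  map_add' := by
    rintro ⟨E⟩ ⟨F⟩
    have := E.finite_fib y
    have := F.finite_fib y
    exact LinearMap.trace_prodMap' _ _
  map_mul' := by
    rintro ⟨E⟩ ⟨F⟩
    have := E.finite_fib y
    have := F.finite_fib y
    exact LinearMap.trace_tensorProduct' _ _

lemma VectIso.trAt_mk (y : Y) (h : y ⟶ y) (E : VBundle Y) :
    trAt y h (mk E) = LinearMap.trace ℂ (E.fib y) (E.act h) := rfl

end trace

/-! ### Restriction of bundles to the powers of one automorphism -/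

/-- The classifying groupoid of the group of integers. -/
abbrev BZ : Type := SingleObj (Multiplicative ℤ)

instance : DiscreteTopology BZ := ⟨rfl⟩

instance : DiscreteTopology (Arr BZ) := ⟨rfl⟩

/-- The generator of the group of integers. -/
def BZ.gen : SingleObj.star (Multiplicative ℤ) ⟶ SingleObj.star (Multiplicative ℤ) :=
  Multiplicative.ofAdd (1 : ℤ)

section ofUnit

variable {W : Type} [AddCommGroup W] [Module ℂ W]

/-- The bundle over the classifying groupoid of the group of integers that is given by an automorphism
of a vector space. -/
abbrev ofUnit [Module.Finite ℂ W] (A : (Module.End ℂ W)ˣ) : VBundle BZ where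
  fib _ := W
  contAt _ := Set.univ
  act f := (A ^ Multiplicative.toAdd (show Multiplicative ℤ from f) : (Module.End ℂ W)ˣ).val
  act_id _ _ := rfl
  act_comp {_ _ _} f g w := by
    change (A ^ (Multiplicative.toAdd (show Multiplicative ℤ from g) +
      Multiplicative.toAdd (show Multiplicative ℤ from f)) : (Module.End ℂ W)ˣ).val w = _
    rw [zpow_add, Units.val_mul]
    rfl
  locallyTrivial b := ⟨_, inferInstance, fun i _ => Module.finBasis ℂ W i,
    Eventually.of_forall fun b => ⟨⟨Module.finBasis ℂ W, fun _ => rfl⟩, fun s =>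
      ⟨fun _ => ⟨fun i y => (Module.finBasis ℂ W).repr (s y) i,
        fun _ => continuous_of_discreteTopology.continuousAt,
        Eventually.of_forall fun y => ((Module.finBasis ℂ W).sum_repr (s y)).symm⟩,
      fun _ => trivial⟩⟩⟩
  act_cont f₀ s _ := ⟨_, inferInstance, fun i f => (Module.finBasis ℂ W).repr
      ((A ^ Multiplicative.toAdd (show Multiplicative ℤ from f.hom) : (Module.End ℂ W)ˣ).val
        (s f.src)) i, fun i _ => Module.finBasis ℂ W i, fun _ => continuous_of_discreteTopology.continuousAt,
    fun _ => trivial, Eventually.of_forall fun f => ((Module.finBasis ℂ W).sum_repr _).symm⟩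

lemma ofUnit_gen [Module.Finite ℂ W] (A : (Module.End ℂ W)ˣ) : (ofUnit A).act BZ.gen = A.val := by
  change (A ^ (1 : ℤ)).val = _
  rw [zpow_one]

variable {W' : Type} [AddCommGroup W'] [Module ℂ W']

/-- Intertwining the generators implies intertwining their positive powers, and the negative ones by
inverting. -/
lemma ofUnit_nat [Module.Finite ℂ W] [Module.Finite ℂ W'] {A : (Module.End ℂ W)ˣ}
    {A' : (Module.End ℂ W')ˣ} (φ : W →ₗ[ℂ] W') (h : ∀ w, φ (A.val w) = A'.val (φ w))
    {x y : BZ} (f : x ⟶ y) (w : W) : φ ((ofUnit A).act f w) = (ofUnit A').act f (φ w) := by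
  have h1 : ∀ (n : ℕ) w, φ ((A ^ n).val w) = (A' ^ n).val (φ w) := by
    intro n
    induction n with
    | zero => exact fun w => rfl
    | succ n ih =>
      intro w
      rw [pow_succ, pow_succ, Units.val_mul, Units.val_mul, Module.End.mul_apply,
        Module.End.mul_apply, ih, h]
  change φ ((A ^ Multiplicative.toAdd (show Multiplicative ℤ from f)).val w) =
    (A' ^ Multiplicative.toAdd (show Multiplicative ℤ from f)).val (φ w)
  generalize Multiplicative.toAdd (show Multiplicative ℤ from f) = k
  obtain ⟨n, rfl | rfl⟩ := k.eq_nat_or_neg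
  · exact h1 n w
  · have h2 : ∀ (B : (Module.End ℂ W')ˣ) v, B⁻¹.val (B.val v) = v := fun B v =>
      LinearMap.congr_fun (B.inv_mul) v
    have h3 : ∀ (B : (Module.End ℂ W)ˣ) v, B.val (B⁻¹.val v) = v := fun B v =>
      LinearMap.congr_fun (B.mul_inv) v
    rw [zpow_neg, zpow_neg, zpow_natCast, zpow_natCast, ← h2 (A' ^ n) (φ _), ← h1, h3]

end ofUnit

section at_

variable {Y : Type u} [TopGpd.{u, v} Y]

/-- The automorphism of a fibre that is given by an automorphism of a point. -/
def VBundle.unitAt (E : VBundle Y) {y : Y} (h : y ⟶ y) : (Module.End ℂ (E.fib y))ˣ where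
  val := E.act h
  inv := E.act (Groupoid.inv h)
  val_inv := LinearMap.ext fun w => by
    rw [Module.End.mul_apply, ← E.act_comp, Groupoid.inv_comp, E.act_id]; rfl
  inv_val := LinearMap.ext fun w => by
    rw [Module.End.mul_apply, ← E.act_comp, Groupoid.comp_inv, E.act_id]; rfl

instance (E : VBundle Y) (y : Y) : Module.Finite ℂ (E.fib y) := E.finite_fib y

/-- The restriction of a bundle to the powers of an automorphism of a point. -/
abbrev VBundle.restrictAt (E : VBundle Y) {y : Y} (h : y ⟶ y) : VBundle BZ := ofUnit (E.unitAt h)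

lemma castE_restrictAt {L : Type} (E : L → VBundle Y) {y : Y} (h : y ⟶ y) {l l' : L} (hl : l = l')
    (w : (E l).fib y) : castE (fun l => (E l).restrictAt h) hl (SingleObj.star _) w =
      castE E hl y w := by
  subst hl
  rfl

lemma LabelSet.diag_restrictAt_T (Λ : LabelSet) (E : Λ.car → VBundle Y) {y : Y} (h : y ⟶ y)
    {n m : ℕ} {p p' : MIdx Λ n m} (f : p ⟶ p') (w : ((Λ.diag E n m).D p).fib y) :
    (Λ.diag (fun l => (E l).restrictAt h) n m).T f (SingleObj.star _) w =
      (Λ.diag E n m).T f y w := by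
  refine LinearMap.congr_fun (VBundle.piTensor_ext (P := fun i => E (p.lab i))
    (φ := (Λ.diag (fun l => (E l).restrictAt h) n m).T f (SingleObj.star _))
    (ψ := (Λ.diag E n m).T f y) fun w => ?_) w
  refine (Λ.diag_T (E := fun l => (E l).restrictAt h) f (SingleObj.star _) w).trans
    (Eq.trans ?_ (Λ.diag_T (E := E) f y w).symm)
  exact congrArg _ (funext fun i => castE_restrictAt E h _ _)

/-- Characters of symmetric powers may be computed on the restrictions. -/
lemma LabelSet.trAt_SS (Λ : LabelSet) (E : Λ.car → VBundle Y) {y : Y} (h : y ⟶ y) (n m : ℕ) :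
    VectIso.trAt y h (VectIso.mk (Λ.SS E n m)) =
      VectIso.trAt _ BZ.gen (VectIso.mk (Λ.SS (fun l => (E l).restrictAt h) n m)) := by
  -- Both fibres consist of the same families, with the same compatibility condition. Over BZ,
  -- however, eigenlines are subbundles, so the decomposition results for labelled collections apply
  -- to them.
  let i : (Λ.SS E n m).fib y ≃ₗ[ℂ]
      (Λ.SS (fun l => (E l).restrictAt h) n m).fib (SingleObj.star _) :=
    { toFun := fun w => ⟨w.1, fun p p' f =>
        (Λ.diag_restrictAt_T E h f (w.1 p)).trans (w.2 p p' f)⟩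
      invFun := fun w => ⟨w.1, fun p p' f =>
        (Λ.diag_restrictAt_T E h f (w.1 p)).symm.trans (w.2 p p' f)⟩
      map_add' := fun _ _ => rfl
      map_smul' := fun _ _ => rfl
      left_inv := fun _ => rfl
      right_inv := fun _ => rfl }
  rw [VectIso.trAt_mk, VectIso.trAt_mk, ← LinearMap.trace_conj' ((Λ.SS E n m).act h) i]
  refine congrArg _ (LinearMap.ext fun w => Subtype.ext (funext fun p => ?_))
  have h1 : ∀ j : Fin p.N, (E (p.lab j)).act h = ((E (p.lab j)).restrictAt h).act BZ.gen := fun j =>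
    (ofUnit_gen ((E (p.lab j)).unitAt h)).symm
  exact LinearMap.congr_fun (f := PiTensorProduct.map fun j => (E (p.lab j)).act h)
    (congrArg PiTensorProduct.map (funext h1)) (w.1 p)

end at_

/-! ### Eigenlines and geometric series -/

/-- X^N - 1 is separable over ℂ, hence squarefree, so an operator of finite order is semisimple.
Over ℂ its eigenspaces then span the space. -/
lemma exists_eigenbasis {W : Type} [AddCommGroup W] [Module ℂ W] [Module.Finite ℂ W]
    (A : Module.End ℂ W) {N : ℕ} (hN : 0 < N) (hA : A ^ N = 1) :
    ∃ (ι : Type) (_ : Fintype ι) (β : Module.Basis ι ℂ W) (lam : ι → ℂ),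
      ∀ i, A (β i) = lam i • β i := by
  classical
  have h1 : A.IsSemisimple := by
    refine Module.End.isSemisimple_of_squarefree_aeval_eq_zero (p := Polynomial.X ^ N - 1) ?_ ?_
    · exact (Polynomial.separable_X_pow_sub_C (F := ℂ) 1 (by exact_mod_cast hN.ne')
        one_ne_zero).squarefree
    · simp [hA]
  have h2 : ⨆ μ, A.eigenspace μ = ⊤ := by
    rw [← Module.End.iSup_maxGenEigenspace_eq_top A]
    exact iSup_congr fun μ =>
      (h1.isFinitelySemisimple.maxGenEigenspace_eq_eigenspace μ).symm
  have h3 : DirectSum.IsInternal A.eigenspace :=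
    DirectSum.isInternal_submodule_of_iSupIndep_of_iSup_eq_top A.eigenspaces_iSupIndep h2
  let β := h3.collectedBasis fun μ => Module.finBasis ℂ (A.eigenspace μ)
  have : Finite (Σ μ : ℂ, Fin (Module.finrank ℂ (A.eigenspace μ))) := Module.Finite.finite_basis β
  refine ⟨_, Fintype.ofFinite _, β, fun x => x.1, fun x => ?_⟩
  exact Module.End.mem_eigenspace_iff.1 (h3.collectedBasis_mem _ x)

lemma trace_pow_of_eigenbasis {W ι : Type} [AddCommGroup W] [Module ℂ W] [Fintype ι]
    (A : Module.End ℂ W) (β : Module.Basis ι ℂ W) (lam : ι → ℂ) (h : ∀ i, A (β i) = lam i • β i)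
    (a : ℕ) : LinearMap.trace ℂ W (A ^ a) = ∑ i, lam i ^ a := by
  classical
  have h1 : ∀ i, (A ^ a) (β i) = lam i ^ a • β i := fun i => by
    induction a with
    | zero => simp
    | succ a ih => rw [pow_succ, Module.End.mul_apply, h, map_smul, ih, smul_smul, pow_succ']
  rw [LinearMap.trace_eq_matrix_trace ℂ β, Matrix.trace]
  refine Finset.sum_congr rfl fun i _ => ?_
  rw [Matrix.diag_apply, LinearMap.toMatrix_apply, h1]
  simp

/-- The geometric series. -/
def geo {A : Type*} [CommRing A] (u : A) : PowerSeries A := PowerSeries.mk fun n => u ^ n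

lemma constantCoeff_geo {A : Type*} [CommRing A] (u : A) :
    PowerSeries.constantCoeff (geo u) = 1 := by
  rw [← PowerSeries.coeff_zero_eq_constantCoeff_apply, geo, PowerSeries.coeff_mk, pow_zero]

/-- The power sum of a single variable: the n terms in the Cauchy product at t^n are all equal to
u^n, in agreement with t d/dt of u^n t^n. -/
lemma coeff_logD_geo {A : Type*} [CommRing A] (u : A) {a : ℕ} (ha : 0 < a) :
    PowerSeries.coeff a (logD (geo u)) = u ^ a := by
  have h : logD (geo u) = PowerSeries.mk fun n => if n = 0 then 0 else u ^ n := by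
    rw [logD_eq_iff (constantCoeff_geo u)]
    refine PowerSeries.ext fun n => ?_
    rw [euler, PowerSeries.coeff_mk, geo, PowerSeries.coeff_mk, PowerSeries.coeff_mul,
      Finset.Nat.sum_antidiagonal_eq_sum_range_succ_mk, Finset.sum_range_succ']
    simp only [PowerSeries.coeff_mk, if_true, zero_mul, add_zero, Nat.succ_ne_zero, if_false]
    rw [Finset.sum_congr rfl fun i hi => by
      rw [← pow_add, Nat.add_sub_cancel' (Nat.succ_le_of_lt (Finset.mem_range.1 hi))]]
    simp
  rw [h, PowerSeries.coeff_mk, if_neg ha.ne']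

/-- The logarithmic derivative modulo a power of the variable of the coefficient ring. -/
lemma coeff_coeff_logD_congr {A : Type*} [CommRing A] {S T : PowerSeries (PowerSeries A)}
    (hS : PowerSeries.constantCoeff S = 1) (hT : PowerSeries.constantCoeff T = 1) {m : ℕ}
    (h : ∀ n, ∀ i ≤ m, PowerSeries.coeff i (PowerSeries.coeff n S) =
      PowerSeries.coeff i (PowerSeries.coeff n T)) (a : ℕ) :
    PowerSeries.coeff m (PowerSeries.coeff a (logD S)) =
      PowerSeries.coeff m (PowerSeries.coeff a (logD T)) := by
  -- Logarithmic derivatives commute with ring homomorphisms, so it suffices to compare the series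
  -- over the quotient by q^(m+1).
  let I : Ideal (PowerSeries A) := Ideal.span {PowerSeries.X ^ (m + 1)}
  have hI : ∀ x y : PowerSeries A, Ideal.Quotient.mk I x = Ideal.Quotient.mk I y ↔
      ∀ i < m + 1, PowerSeries.coeff i x = PowerSeries.coeff i y := fun x y => by
    rw [Ideal.Quotient.eq, Ideal.mem_span_singleton, PowerSeries.X_pow_dvd_iff]
    simp only [map_sub, sub_eq_zero]
  have h1 : PowerSeries.map (Ideal.Quotient.mk I) S = PowerSeries.map (Ideal.Quotient.mk I) T := by
    refine PowerSeries.ext fun n => ?_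
    rw [PowerSeries.coeff_map, PowerSeries.coeff_map, hI]
    exact fun i hi => h n i (Nat.le_of_lt_succ hi)
  have h2 := congrArg (fun S => PowerSeries.coeff a (logD S)) h1
  simp only [logD_map _ hS, logD_map _ hT, PowerSeries.coeff_map] at h2
  exact (hI _ _).1 h2 m (Nat.lt_succ_self m)

/-- The automorphism of a line given by a nonzero number. -/
def lineUnit (c : ℂˣ) : (Module.End ℂ ℂ)ˣ :=
  Units.map (algebraMap ℂ (Module.End ℂ ℂ)).toMonoidHom c

/-- Labels of bidegrees `(1, b)`. -/
abbrev LabelSet.ones (I : Type) [Finite I] (b : I → ℕ) : LabelSet where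
  car := I
  k _ := 1
  b := b
  k_pos _ := Nat.one_pos
  fin _ _ := inferInstance

/-- The generating function of the characters of symmetric powers. -/
def charGen (Λ : LabelSet) (E : Λ.car → VBundle BZ) : PowerSeries (PowerSeries ℂ) :=
  PowerSeries.map (PowerSeries.map (VectIso.trAt _ BZ.gen)) (Λ.sgen E)

lemma coeff_charGen (Λ : LabelSet) (E : Λ.car → VBundle BZ) (n m : ℕ) :
    PowerSeries.coeff m (PowerSeries.coeff n (charGen Λ E)) =
      VectIso.trAt _ BZ.gen (VectIso.mk (Λ.SS E n m)) := by
  rw [charGen, PowerSeries.coeff_map, PowerSeries.coeff_map, LabelSet.coeff_sgen]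

lemma constantCoeff_charGen (Λ : LabelSet) (E : Λ.car → VBundle BZ) :
    PowerSeries.constantCoeff (charGen Λ E) = 1 := by
  rw [← PowerSeries.coeff_zero_eq_constantCoeff_apply, charGen, PowerSeries.coeff_map,
    LabelSet.coeff_zero_sgen, map_one]

lemma tprod_line {n : ℕ} (w : Fin n → ℂ) :
    PiTensorProduct.tprod ℂ w = (∏ i, w i) • PiTensorProduct.tprod ℂ (fun _ : Fin n => (1 : ℂ)) := by
  rw [← MultilinearMap.map_smul_univ]
  simp

/-- The n-th symmetric power of a line in degree b with eigenvalue c is its n-th tensor power, a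
line in degree n b with eigenvalue c^n. -/
lemma charGen_line (b : ℕ) (c : ℂˣ) :
    charGen (LabelSet.ones Unit fun _ => b) (fun _ => ofUnit (lineUnit c)) =
      geo (PowerSeries.C (c : ℂ) * PowerSeries.X ^ b) := by
  refine PowerSeries.ext fun n => PowerSeries.ext fun m => ?_
  have h0 : ∀ p : MIdx (LabelSet.ones Unit fun _ => b) n m, p.N = n ∧ m = n * b := by
    rintro ⟨N, lab, hk, hb⟩
    obtain rfl : N = n := by simpa using hk
    exact ⟨rfl, by simpa using hb.symm⟩
  rw [coeff_charGen, geo, PowerSeries.coeff_mk, mul_pow, ← map_pow, ← pow_mul,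
    PowerSeries.coeff_C_mul, PowerSeries.coeff_X_pow, mul_comm b n]
  split_ifs with h
  · subst h
    let Λ := LabelSet.ones Unit fun _ => b
    let p₀ : MIdx Λ n (n * b) := ⟨n, fun _ => (), by simp [Λ], by simp [Λ]⟩
    have h1 : VectIso.mk (Λ.SS (fun _ => ofUnit (lineUnit c)) n (n * b)) =
        VectIso.mk (VBundle.piTensor fun _ : Fin n => ofUnit (lineUnit c)) := by
      refine VectIso.mk_eq_of_iso (LabelSet.SS_eq_lim _ _ _ _) rfl
        (Diag.lim_of_connected _ p₀ (fun p => ?_) fun f y v => ?_)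
      · obtain ⟨N, lab, hk, hb⟩ := p
        obtain rfl : N = n := (h0 ⟨N, lab, hk, hb⟩).1
        exact ⟨⟨Equiv.refl _, fun _ => rfl⟩⟩
      · refine LinearMap.congr_fun (VBundle.piTensor_ext
          (P := fun i : Fin n => ofUnit (lineUnit c))
          (φ := (Λ.diag (fun _ => ofUnit (lineUnit c)) n (n * b)).T f y) (ψ := LinearMap.id)
          fun w => ?_) v
        refine (Λ.diag_T (E := fun _ => ofUnit (lineUnit c)) f y w).trans ?_
        -- A pure tensor of scalars depends only on their product, so permutations act trivially.
        refine (tprod_line fun i : Fin n => w (f.1.symm i)).trans ?_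
        refine Eq.trans ?_ (tprod_line w).symm
        exact congrArg (· • _) (Equiv.prod_comp f.1.symm w)
    have h2 : (VBundle.piTensor fun _ : Fin n => ofUnit (lineUnit c)).act BZ.gen =
        (c : ℂ) ^ n • LinearMap.id := by
      refine VBundle.piTensor_ext (P := fun _ : Fin n => ofUnit (lineUnit c)) fun w => ?_
      refine (PiTensorProduct.map_tprod _ _).trans ?_
      refine (congrArg (fun A : Module.End ℂ ℂ => PiTensorProduct.tprod ℂ fun i : Fin n => A (w i))
        (ofUnit_gen (lineUnit c))).trans ?_
      refine (tprod_line fun i : Fin n => (c : ℂ) * w i).trans ?_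
      refine Eq.trans ?_ (congrArg ((c : ℂ) ^ n • ·) (tprod_line w)).symm
      refine Eq.trans ?_ (smul_smul _ _ _).symm
      rw [Finset.prod_mul_distrib, Finset.prod_const, Finset.card_univ, Fintype.card_fin]
    have h3 : Module.finrank ℂ (⨂[ℂ] _ : Fin n, ℂ) = 1 :=
      (PiTensorProduct.constantBaseRingEquiv (Fin n) ℂ).toLinearEquiv.finrank_eq.trans
        (Module.finrank_self ℂ)
    rw [h1, VectIso.trAt_mk, h2, map_smul]
    refine (congrArg ((c : ℂ) ^ n • ·) (LinearMap.trace_id ℂ (⨂[ℂ] _ : Fin n, ℂ))).trans ?_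
    rw [h3]
    simp
  · rw [LabelSet.SS_eq_zero _ _ ⟨fun p => h (h0 p).2⟩, map_zero, mul_zero]

/-- Adding one line at a time, `LabelSet.sgen_sum` multiplies the generating function by one
geometric series. -/
lemma charGen_lines {I : Type} [Fintype I] (b : I → ℕ) (c : I → ℂˣ) :
    charGen (LabelSet.ones I b) (fun i => ofUnit (lineUnit (c i))) =
      ∏ i, geo (PowerSeries.C (c i : ℂ) * PowerSeries.X ^ b i) := by
  revert b c
  refine Fintype.induction_empty_option (P := fun I _ => ∀ (b : I → ℕ) (c : I → ℂˣ),
    charGen (LabelSet.ones I b) (fun i => ofUnit (lineUnit (c i))) =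
      ∏ i, geo (PowerSeries.C (c i : ℂ) * PowerSeries.X ^ b i)) ?_ ?_ ?_ I
  · intro α β _ e h b c
    let _ : Fintype α := Fintype.ofEquiv β e.symm
    rw [← Equiv.prod_comp e]
    refine Eq.trans ?_ ((h (b ∘ e) (c ∘ e)).trans (Finset.prod_congr (by ext; simp) fun _ _ => rfl))
    exact congrArg _ (LabelSet.sgen_congr (Λ := LabelSet.ones β b) (Λ' := LabelSet.ones α (b ∘ e)) e
      (fun _ => rfl) (fun _ => rfl) fun _ => ⟨VBundle.Iso.refl _⟩)
  · intro b c
    have : IsEmpty (LabelSet.ones PEmpty b).car := inferInstanceAs (IsEmpty PEmpty)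
    rw [charGen, LabelSet.sgen_of_isEmpty, map_one]
    exact (Finset.prod_empty).symm
  · intro α _ h b c
    rw [Fintype.prod_option, ← h fun a => b (some a), ← charGen_line, charGen, charGen, charGen,
      ← map_mul]
    refine congrArg _ ?_
    refine Eq.trans ?_ (LabelSet.sgen_sum (LabelSet.ones Unit fun _ => b none)
      (LabelSet.ones α fun a => b (some a)) (Sum.elim (fun _ => ofUnit (lineUnit (c none)))
        fun a => ofUnit (lineUnit (c (some a)))))
    refine LabelSet.sgen_congr (Λ := LabelSet.ones (Option α) b)
      (Λ' := (LabelSet.ones Unit fun _ => b none).sum (LabelSet.ones α fun a => b (some a)))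
      ((Equiv.sumComm _ _).trans (Equiv.optionEquivSumPUnit α).symm) ?_ ?_ ?_
    · rintro (_ | _) <;> rfl
    · rintro (_ | _) <;> rfl
    · rintro (_ | _) <;> exact ⟨VBundle.Iso.refl _⟩

section eigenbases

variable {W : ℕ → Type} [∀ l, AddCommGroup (W l)] [∀ l, Module ℂ (W l)]
  [∀ l, Module.Finite ℂ (W l)] (A : ∀ l, (Module.End ℂ (W l))ˣ) {ι : ℕ → Type}
  [∀ l, Fintype (ι l)] (β : ∀ l, Module.Basis (ι l) ℂ (W l)) (lam : ∀ l, ι l → ℂˣ)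

/-- In q-degree at most m only the first m + 1 coefficients are involved. Splitting each into
eigenlines by `SS_sigma` leaves finitely many lines. -/
lemma trAt_SS_column_of_eigenbasis (h : ∀ l i, (A l).val (β l i) = (lam l i : ℂ) • β l i)
    (n : ℕ) {i m : ℕ} (hi : i ≤ m) :
    VectIso.mk ((LabelSet.column 0).SS (fun l => ofUnit (A l)) n i) =
      VectIso.mk ((LabelSet.ones (Σ l : Fin (m + 1), ι l) fun x => x.1).SS
        (fun x => ofUnit (lineUnit (lam x.1 x.2))) n i) := by
  classical
  refine (LabelSet.SS_reindex (Λ := LabelSet.column 0)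
    (Λ' := LabelSet.ones (Fin (m + 1)) fun l => l) (fun l : Fin (m + 1) => (l : ℕ))
    Fin.val_injective (E' := fun l : Fin (m + 1) => ofUnit (A l))
    (fun l => ⟨VBundle.Iso.refl _⟩) (fun N lab => Iff.rfl) (n' := n) (m' := i)
    fun l _ hl => ⟨⟨l, Nat.lt_succ_of_le (hl.trans hi)⟩, rfl⟩).trans ?_
  refine LabelSet.SS_sigma (LabelSet.ones (Fin (m + 1)) fun l => l)
    (fun l : Fin (m + 1) => ι l) (E := fun l : Fin (m + 1) => ofUnit (A l))
    (E' := fun (l : Fin (m + 1)) x => ofUnit (lineUnit (lam l x)))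
    (fun l x _ => (β l).coord x) (fun l x _ => LinearMap.toSpanSingleton ℂ (W l) (β l x))
    (fun l x _ _ a w => ?_) (fun _ _ _ _ _ => trivial) (fun l x _ v => ?_)
    (fun l x x' _ v hx => ?_) (fun l _ v => ?_) n i
  · refine ofUnit_nat ((β (l : ℕ)).coord x) (fun w => ?_) a w
    have h1 : (β (l : ℕ)).coord x ∘ₗ (A l).val = (lam l x : ℂ) • (β (l : ℕ)).coord x := by
      refine (β (l : ℕ)).ext fun j => ?_
      rw [LinearMap.comp_apply, h, map_smul, LinearMap.smul_apply, Module.Basis.coord_apply,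
        Module.Basis.repr_self]
      by_cases hj : j = x
      · rw [hj]
      · rw [Finsupp.single_eq_of_ne (Ne.symm hj), smul_zero, smul_zero]
    exact LinearMap.congr_fun h1 w
  · change (β (l : ℕ)).coord x (v • β (l : ℕ) x) = v
    simp
  · change (β (l : ℕ)).coord x ((v : ℂ) • β (l : ℕ) x') = 0
    simp [Finsupp.single_eq_of_ne hx]
  · exact (β (l : ℕ)).sum_repr v

/-- Modulo q^(m+1) the generating function is a product of geometric series in λ q^l t. The
coefficient of t^a in its logarithmic derivative is ∑ λ^a q^{la}, and q^m selects l = m / a, where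
the sum is the trace of the a-th power. -/
lemma coeff_logD_charGen_column (h : ∀ l i, (A l).val (β l i) = (lam l i : ℂ) • β l i)
    {a : ℕ} (ha : 0 < a) (m : ℕ) :
    PowerSeries.coeff m (PowerSeries.coeff a
      (logD (charGen (LabelSet.column 0) fun l => ofUnit (A l)))) =
      if a ∣ m then LinearMap.trace ℂ (W (m / a)) ((A (m / a)).val ^ a) else 0 := by
  classical
  rw [coeff_coeff_logD_congr (constantCoeff_charGen _ _)
    (T := charGen (LabelSet.ones (Σ l : Fin (m + 1), ι l) fun x => x.1)
      fun x => ofUnit (lineUnit (lam x.1 x.2))) (constantCoeff_charGen _ _)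
    (fun n i hi => by
      rw [coeff_charGen, coeff_charGen]
      exact congrArg _ (trAt_SS_column_of_eigenbasis A β lam h n hi)) a]
  have h1 := charGen_lines (I := Σ l : Fin (m + 1), ι l) (fun x => x.1) fun x => lam x.1 x.2
  refine (congrArg (fun S => PowerSeries.coeff m (PowerSeries.coeff a (logD S))) h1).trans ?_
  rw [logD_prod _ fun _ _ => constantCoeff_geo _, map_sum, map_sum]
  simp_rw [coeff_logD_geo _ ha, mul_pow, ← map_pow, ← pow_mul, PowerSeries.coeff_C_mul,
    PowerSeries.coeff_X_pow]
  refine (Fintype.sum_sigma _).trans ?_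
  dsimp only
  have h2 : ∀ l : Fin (m + 1), (∑ i : ι l, (lam l i : ℂ) ^ a * if m = l * a then 1 else 0) =
      (∑ i : ι l, (lam l i : ℂ) ^ a) * if m = l * a then 1 else 0 := fun l =>
    (Finset.sum_mul _ _ _).symm
  refine (Finset.sum_congr rfl fun l _ => h2 l).trans ?_
  split_ifs with hd
  · obtain ⟨k, rfl⟩ := hd
    -- The degree l = m / a lies below the truncation at m because a ≥ 1.
    have hk : k < a * k + 1 := Nat.lt_succ_of_le (Nat.le_mul_of_pos_left k ha)
    rw [Finset.sum_eq_single (⟨k, hk⟩ : Fin (a * k + 1)), if_pos (mul_comm a k), mul_one,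
      Nat.mul_div_cancel_left _ ha]
    · exact (trace_pow_of_eigenbasis _ (β k) (fun i => (lam k i : ℂ)) (h k) a).symm
    · intro l _ hl
      rw [if_neg, mul_zero]
      rintro h2
      exact hl (Fin.ext (Nat.eq_of_mul_eq_mul_right ha (h2.symm.trans (mul_comm a k))))
    · exact fun h => absurd (Finset.mem_univ _) h
  · refine Finset.sum_eq_zero fun l _ => ?_
    rw [if_neg fun h => hd ⟨l, h.trans (mul_comm _ _)⟩, mul_zero]

end eigenbases

/-- The character of the Adams operations. -/
theorem coeff_logD_trAt_sgen {Y : Type u} [TopGpd.{u, v} Y] (V : ℕ → VBundle Y) {y : Y} (h : y ⟶ y)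
    {N : ℕ} (hN : 0 < N) (hh : ∀ l, (V l).act h ^ N = 1) {a : ℕ} (ha : 0 < a) (m : ℕ) :
    PowerSeries.coeff m (PowerSeries.coeff a (logD (PowerSeries.map
      (PowerSeries.map (VectIso.trAt y h)) ((LabelSet.column 0).sgen V)))) =
      if a ∣ m then LinearMap.trace ℂ ((V (m / a)).fib y) ((V (m / a)).act h ^ a) else 0 := by
  have h1 : PowerSeries.map (PowerSeries.map (VectIso.trAt y h)) ((LabelSet.column 0).sgen V) =
      charGen (LabelSet.column 0) fun l => ofUnit ((V l).unitAt h) := by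
    refine PowerSeries.ext fun n => PowerSeries.ext fun m => ?_
    rw [coeff_charGen, PowerSeries.coeff_map, PowerSeries.coeff_map, LabelSet.coeff_sgen]
    exact LabelSet.trAt_SS (LabelSet.column 0) V h n m
  choose ι hι β lam hlam using fun l => exists_eigenbasis ((V l).act h) hN (hh l)
  -- Eigenvalues of an operator of finite order do not vanish, so they define units acting on lines.
  have h2 : ∀ l i, lam l i ≠ 0 := by
    intro l i h0
    have h3 := hlam l i
    rw [h0, zero_smul] at h3
    have h4 : ((V l).act h ^ N) (β l i) = 0 := by
      obtain ⟨M, rfl⟩ := Nat.exists_eq_succ_of_ne_zero hN.ne'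
      rw [pow_succ, Module.End.mul_apply, h3, map_zero]
    rw [hh] at h4
    exact (β l).ne_zero i h4
  rw [h1]
  exact coeff_logD_charGen_column (fun l => (V l).unitAt h) β
    (fun l i => Units.mk0 (lam l i) (h2 l i)) hlam ha m

/-! ### Characters of Adams operations -/

section characters

variable {G : Type u} [Group G]

/-- The formal power series of the characters of the coefficients. -/
def seriesChar {g h : G} (hc : Commute g h) : KTate (SingleObj G) →+* PowerSeries ℂ where
  toFun x := PowerSeries.mk fun n => coeffChar hc n x
  map_zero' := PowerSeries.ext fun n => by simp
  map_add' x y := PowerSeries.ext fun n => by simp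
  map_one' := PowerSeries.ext fun n => by
    rw [PowerSeries.coeff_mk]
    refine (GRing.lift_of _ _).trans ?_
    refine (PowerSeries.coeff_map (VectIso.trAt (loopAt g) (centArrow hc)) n 1).symm.trans ?_
    rw [map_one]
  map_mul' x y := by
    have hof : ∀ F : RotSemiring (Inertia (SingleObj G)) (Inertia.xi (SingleObj G)),
        (PowerSeries.mk fun n => coeffChar hc n (GRing.of F)) =
          PowerSeries.map (VectIso.trAt (loopAt g) (centArrow hc)) F.1 := fun F =>
      PowerSeries.ext fun n => by
        rw [PowerSeries.coeff_mk, PowerSeries.coeff_map]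
        exact GRing.lift_of _ _
    have hsub : ∀ x y : KTate (SingleObj G),
        (PowerSeries.mk fun n => coeffChar hc n (x - y)) =
          (PowerSeries.mk fun n => coeffChar hc n x) -
            PowerSeries.mk fun n => coeffChar hc n y := fun x y =>
      PowerSeries.ext fun n => by simp
    induction x using GRing.induct with
    | hof F =>
      induction y using GRing.induct with
      | hof F' => rw [← GRing.of_mul, hof, hof, hof]; exact map_mul _ _ _
      | hsub y y' h h' => rw [mul_sub, hsub, hsub, h, h', mul_sub]
    | hsub x x' h h' => rw [sub_mul, hsub, hsub, h, h', sub_mul]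

lemma coeff_seriesChar {g h : G} (hc : Commute g h) (n : ℕ) (x : KTate (SingleObj G)) :
    PowerSeries.coeff n (seriesChar hc x) = coeffChar hc n x :=
  PowerSeries.coeff_mk n fun n => coeffChar hc n x

lemma coeffChar_cls {g h : G} (hc : Commute g h) (n : ℕ)
    (V : RotSeries (Inertia (SingleObj G)) (Inertia.xi (SingleObj G))) :
    coeffChar hc n (GRing.of V.cls) =
      LinearMap.trace ℂ ((V.V n).fib (loopAt g)) ((V.V n).act (centArrow hc)) :=
  (GRing.lift_of _ _).trans (congrArg (bundleChar hc)
    (PowerSeries.coeff_mk n fun n => VectIso.mk (V.V n)))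

/-- For the class of an actual series, the character of the symmetric power can be taken before
group completion. This makes the formula for labelled collections available to Adams operations, and
additivity of ψ_a then covers virtual bundles. -/
lemma map_seriesChar_symT {g h : G} (hc : Commute g h)
    (V : RotSeries (Inertia (SingleObj G)) (Inertia.xi (SingleObj G))) :
    PowerSeries.map (seriesChar hc) (symT (GRing.of V.cls)) = PowerSeries.map
      (PowerSeries.map (VectIso.trAt (loopAt g) (centArrow hc))) ((LabelSet.column 0).sgen V.V) := by
  rw [isExponentialExtension_symT.map_cls, totalClass_eq, ← unrot_sym]
  refine PowerSeries.ext fun n => PowerSeries.ext fun m => ?_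
  rw [PowerSeries.coeff_map, PowerSeries.coeff_map, coeff_seriesChar, PowerSeries.coeff_map,
    PowerSeries.coeff_map, unrot, PowerSeries.coeff_map]
  exact GRing.lift_of _ _

lemma act_centArrow_pow (E : VBundle (Inertia (SingleObj G))) {g h : G} (hc : Commute g h) (a : ℕ) :
    E.act (centArrow hc) ^ a = E.act (centArrow (hc.pow_right a)) := by
  induction a with
  | zero =>
    have h1 : centArrow (hc.pow_right 0) = 𝟙 (loopAt g) := Inertia.hom_ext (pow_zero h)
    refine LinearMap.ext fun w => ?_
    rw [pow_zero, h1, E.act_id]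
    rfl
  | succ a ih =>
    have h1 : centArrow (hc.pow_right (a + 1)) = centArrow hc ≫ centArrow (hc.pow_right a) :=
      Inertia.hom_ext (pow_succ h a)
    refine LinearMap.ext fun w => ?_
    rw [pow_succ, ih, h1, Module.End.mul_apply, E.act_comp]

lemma act_centArrow_orderOf (E : VBundle (Inertia (SingleObj G))) {g h : G} (hc : Commute g h) :
    E.act (centArrow hc) ^ orderOf h = 1 := by
  have h1 : centArrow (hc.pow_right (orderOf h)) = 𝟙 (loopAt g) :=
    Inertia.hom_ext (pow_orderOf_eq_one h)
  refine LinearMap.ext fun w => ?_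
  rw [act_centArrow_pow, h1, E.act_id]
  rfl

/-- The character formula for the Adams operations. -/
theorem coeffChar_adams [Finite G] {g h : G} (hc : Commute g h) {a : ℕ} (ha : 0 < a) (n : ℕ)
    (x : KTate (SingleObj G)) : coeffChar hc n (adams a x) =
      if a ∣ n then coeffChar (hc.pow_right a) (n / a) x else 0 := by
  have key : ∀ V : RotSeries (Inertia (SingleObj G)) (Inertia.xi (SingleObj G)),
      coeffChar hc n (adams a (GRing.of V.cls)) =
        if a ∣ n then coeffChar (hc.pow_right a) (n / a) (GRing.of V.cls) else 0 := by
    intro V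
    rw [adams_eq, ← coeff_seriesChar, ← PowerSeries.coeff_map, ← logD_map _ (constantCoeff_symT _),
      map_seriesChar_symT, coeff_logD_trAt_sgen V.V (centArrow hc) (orderOf_pos h)
        (fun l => act_centArrow_orderOf (V.V l) hc) ha, coeffChar_cls, act_centArrow_pow]
  obtain ⟨⟨V, W⟩, hx⟩ := exists_sub_cls x
  have h1 : adams a x = adams a (GRing.of V.cls) - adams a (GRing.of W.cls) := by
    rw [eq_sub_iff_add_eq, ← adams_add, hx, sub_add_cancel]
  rw [h1, hx, map_sub, key, key]
  split_ifs
  · rw [map_sub]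
  · exact sub_zero 0

end characters

/-! ### Characters of the operators β_d and the equivariant Hecke operators -/

/-- The trace on an eigenspace as an average. -/
lemma sum_trace_eigenspace {W : Type} [AddCommGroup W] [Module ℂ W] [Module.Finite ℂ W]
    {U U' A : Module.End ℂ W} {om : ℂ} {d : ℕ} (hU : U * U' = 1) (hU' : U' * U = 1)
    (hd : U ^ d = om ^ d • (1 : Module.End ℂ W)) (p : Submodule ℂ W) (hp : ∀ w, w ∈ p ↔ U w = om • w)
    (hA : ∀ w ∈ p, A w ∈ p) :
    ∑ b ∈ Finset.range d, om ^ b * LinearMap.trace ℂ W (U' ^ b * A) =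
      d * LinearMap.trace ℂ p (A.restrict hA) := by
  -- T = ω U⁻¹ satisfies T^d = 1 and has the ω-eigenspace p of U as its fixed space, so the sum of
  -- its powers is d times the projection onto p.
  let T : Module.End ℂ W := om • U'
  have hUU : Commute U' U := hU'.trans hU.symm
  have hT : T ^ d = 1 := by
    have h1 : U' ^ d * U ^ d = 1 := by rw [← hUU.mul_pow, hU', one_pow]
    rw [hd, mul_smul_comm, mul_one] at h1
    rw [smul_pow, h1]
  have hfix : ∀ w, T w = w → w ∈ p := fun w hw => by
    rw [hp]
    nth_rewrite 1 [← hw]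
    change U (om • U' w) = _
    rw [map_smul, ← Module.End.mul_apply, hU, Module.End.one_apply]
  have hfix' : ∀ w ∈ p, T w = w := fun w hw => by
    change om • U' w = w
    rw [← map_smul, ← (hp w).1 hw, ← Module.End.mul_apply, hU', Module.End.one_apply]
  let S : Module.End ℂ W := ∑ b ∈ Finset.range d, T ^ b
  have hS : T * S = S := by
    have h1 : (T - 1) * S = 0 := by
      change (T - 1) * ∑ b ∈ Finset.range d, T ^ b = 0
      rw [mul_geom_sum, hT, sub_self]
    rwa [sub_mul, one_mul, sub_eq_zero] at h1
  have hSp : ∀ w, S w ∈ p := fun w => hfix _ (LinearMap.congr_fun hS w)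
  have hS' : ∀ w ∈ p, S w = (d : ℂ) • w := fun w hw => by
    have h1 : ∀ b : ℕ, (T ^ b) w = w := fun b => by
      induction b with
      | zero => rfl
      | succ b ih => rw [pow_succ, Module.End.mul_apply, hfix' w hw, ih]
    simp [S, LinearMap.sum_apply, h1, Nat.cast_smul_eq_nsmul]
  let g : W →ₗ[ℂ] p := (S * A).codRestrict p fun w => hSp _
  have h1 : S * A = p.subtype ∘ₗ g := rfl
  have h2 : g ∘ₗ p.subtype = (d : ℂ) • A.restrict hA :=
    LinearMap.ext fun w => Subtype.ext (hS' _ (hA _ w.2))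
  have h3 : LinearMap.trace ℂ W (S * A) = d * LinearMap.trace ℂ p (A.restrict hA) := by
    -- S A factors through p, so its trace can be computed on p by cyclicity, where S acts as d.
    rw [h1, LinearMap.trace_comp_comm', h2, map_smul, smul_eq_mul]
  rw [← h3]
  simp only [S, T, Finset.sum_mul, map_sum, smul_pow, smul_mul_assoc, map_smul, smul_eq_mul]

section beta

variable {G : Type u} [Group G]

lemma trace_act_congr (E : VBundle (Inertia (SingleObj G))) {g g' h h' : G} (hg : g = g')
    (hh : h = h') (hc : Commute g h) (hc' : Commute g' h') :
    LinearMap.trace ℂ (E.fib (loopAt g)) (E.act (centArrow hc)) =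
      LinearMap.trace ℂ (E.fib (loopAt g')) (E.act (centArrow hc')) := by
  subst hg hh
  rfl

lemma loopPow_eq_pow (g : G) (d : ℕ) :
    Inertia.loopPow (X := SingleObj G) (x := SingleObj.star G) g d = g ^ d := by
  induction d with
  | zero => exact (pow_zero g).symm
  | succ d ih => rw [Inertia.loopPow, ih]; exact (pow_succ' g d).symm

lemma commute_loopPow {g h : G} (hc : Commute g h) (d : ℕ) :
    Commute (show G from Inertia.loopPow (X := SingleObj G) (x := SingleObj.star G) g d) h := by
  rw [loopPow_eq_pow]
  exact hc.pow_left d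

variable (V : RotSeries (Inertia (SingleObj G)) (Inertia.xi (SingleObj G)))

/-- The pullback along the power map has its fibre at the iterated composite of g, which is only
propositionally the group power g^d. -/
lemma coeffChar_pow_cls {g h h' : G} (hc : Commute g h) (hh : h' = h) {d : ℕ}
    (hc' : Commute (g ^ d) h') (j : ℕ) : coeffChar hc' j (GRing.of V.cls) =
      LinearMap.trace ℂ ((V.pullPow d j).fib (loopAt g)) ((V.pullPow d j).act (centArrow hc)) := by
  rw [coeffChar_cls]
  exact trace_act_congr (V.V j) (loopPow_eq_pow g d).symm hh hc' (commute_loopPow hc d)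

lemma act_mul_centArrow (E : VBundle (Inertia (SingleObj G))) {g h h' : G} (hc : Commute g h)
    (hc' : Commute g h') : E.act (centArrow hc) * E.act (centArrow hc') =
      E.act (centArrow (hc.mul_right hc')) := by
  have h1 : centArrow (hc.mul_right hc') = centArrow hc' ≫ centArrow hc := Inertia.hom_ext rfl
  refine LinearMap.ext fun w => ?_
  rw [h1, E.act_comp, Module.End.mul_apply]

lemma act_centArrow_one (E : VBundle (Inertia (SingleObj G))) {g h : G} (hc : Commute g h)
    (hh : h = 1) : E.act (centArrow hc) = 1 := by
  subst hh
  have h1 : centArrow hc = 𝟙 (loopAt g) := Inertia.hom_ext rfl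
  refine LinearMap.ext fun w => ?_
  rw [h1, E.act_id]
  rfl

variable [Finite G]

/-- On V_j at g^d let U be the action of g and ω = e^{2πi j/(rd)}, so that U^d = ω^d by the rotation
condition. The averaged trace of (ω g⁻¹)^b h is a trace on the ω-eigenspace. That eigenspace is the
coefficient of β_d in degree j / d if d ∣ j, and zero otherwise. -/
lemma sum_coeffChar_cls {g h : G} (hc : Commute g h) {d : ℕ} (hd : 0 < d) (j : ℕ)
    (hcb : ∀ b, Commute (g ^ d) ((g ^ b)⁻¹ * h)) :
    ∑ b ∈ Finset.range d, RotSeries.rootPow (SingleObj G) d j ^ b *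
        coeffChar (hcb b) j (GRing.of V.cls) =
      if d ∣ j then d * coeffChar hc (j / d) (GRing.of (V.betaRep d).cls) else 0 := by
  let om := RotSeries.rootPow (SingleObj G) d j
  let U : Module.End ℂ ((V.pullPow d j).fib (loopAt g)) :=
    (V.pullPow d j).act ((Inertia.xi (SingleObj G)).app (loopAt g))
  let U' : Module.End ℂ ((V.pullPow d j).fib (loopAt g)) :=
    (V.pullPow d j).act (centArrow (Commute.refl g).inv_right)
  let A : Module.End ℂ ((V.pullPow d j).fib (loopAt g)) := (V.pullPow d j).act (centArrow hc)
  let p : Submodule ℂ ((V.pullPow d j).fib (loopAt g)) := Module.End.eigenspace U om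
  have hp : ∀ w, w ∈ p ↔ U w = om • w := fun w => Module.End.mem_eigenspace_iff
  have hUA : U * A = A * U := by
    refine (act_mul_centArrow (V.pullPow d j) (Commute.refl g) hc).trans
      (Eq.trans ?_ (act_mul_centArrow (V.pullPow d j) hc (Commute.refl g)).symm)
    exact congrArg (V.pullPow d j).act (Inertia.hom_ext hc.eq)
  have hA : ∀ w ∈ p, A w ∈ p := fun w hw => by
    rw [hp] at hw ⊢
    rw [← Module.End.mul_apply, hUA, Module.End.mul_apply, hw, map_smul]
  have hU : U * U' = 1 := (act_mul_centArrow (V.pullPow d j) (Commute.refl g) _).trans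
    (act_centArrow_one _ _ (mul_inv_cancel g))
  have hU' : U' * U = 1 := (act_mul_centArrow (V.pullPow d j) _ (Commute.refl g)).trans
    (act_centArrow_one _ _ (inv_mul_cancel g))
  have hUd : U ^ d = om ^ d • (1 : Module.End ℂ ((V.pullPow d j).fib (loopAt g))) := by
    rw [RotSeries.rootPow_pow hd]
    refine (VBundle.act_pow_app _ _ _ _).trans (LinearMap.ext fun w => ?_)
    exact V.pullPow_act d j (loopAt g) w
  have key := sum_trace_eigenspace hU hU' hUd p hp hA
  have h1 : ∀ b, coeffChar (hcb b) j (GRing.of V.cls) = LinearMap.trace ℂ _ (U' ^ b * A) := by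
    intro b
    have h2 : U' ^ b * A =
        (V.pullPow d j).act (centArrow (((Commute.refl g).inv_right.pow_right b).mul_right hc)) := by
      rw [← act_mul_centArrow (V.pullPow d j) ((Commute.refl g).inv_right.pow_right b) hc,
        ← act_centArrow_pow]
    rw [h2]
    exact coeffChar_pow_cls V _ (by rw [inv_pow]) (hcb b) j
  simp_rw [h1]
  refine key.trans ?_
  split_ifs with hdj
  · obtain ⟨n, rfl⟩ := hdj
    rw [Nat.mul_div_cancel_left _ hd, coeffChar_cls]
    have hom : om = zetaPow (Inertia.xi (SingleObj G)) n := RotSeries.rootPow_mul hd n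
    let i : p ≃ₗ[ℂ] ((V.betaRep d).V n).fib (loopAt g) :=
      { toFun := fun w => ⟨w.1, ((hp w.1).1 w.2).trans (congrArg (· • w.1) hom)⟩
        invFun := fun w => ⟨w.1, (hp w.1).2 ((show U w.1 =
          zetaPow (Inertia.xi (SingleObj G)) n • w.1 from w.2).trans (congrArg (· • w.1) hom.symm))⟩
        map_add' := fun _ _ => rfl
        map_smul' := fun _ _ => rfl
        left_inv := fun _ => rfl
        right_inv := fun _ => rfl }
    rw [← LinearMap.trace_conj' (A.restrict hA) i]
    rfl
  · have h2 : A.restrict hA = 0 := LinearMap.ext fun w => Subtype.ext <|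
      (congrArg A (V.eq_zero_of_act_pullPow hd hdj ((hp w.1).1 w.2))).trans (map_zero A)
    rw [h2, map_zero, mul_zero]

end beta

section moonshine

variable {G : Type u} [Group G]

lemma coeffCharRat_toRat {g h : G} (hc : Commute g h) (n : ℕ) (x : KTate (SingleObj G)) :
    coeffCharRat hc n (toRat x) = coeffChar hc n x :=
  (coeffCharRat_tmul hc n 1 x).trans (by rw [Rat.cast_one, one_mul])

lemma qExpansion_of_not_exists (F : ℚ ⊗[ℤ] KTate (SingleObj G)) {g h : G} (hc : Commute g h) {s : ℚ}
    (hs : ¬ ∃ n : ℕ, s = n / orderOf (Inertia.xi (SingleObj G))) : qExpansion F hc s = 0 :=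
  dif_neg hs

variable [Finite G]

/-- The character of `β_d` is an average. -/
theorem sum_coeffChar_beta {g h : G} (hc : Commute g h) {d : ℕ} (hd : 0 < d) (j : ℕ)
    (hcb : ∀ b, Commute (g ^ d) ((g ^ b)⁻¹ * h)) (x : KTate (SingleObj G)) :
    ∑ b ∈ Finset.range d, RotSeries.rootPow (SingleObj G) d j ^ b * coeffChar (hcb b) j x =
      if d ∣ j then d * coeffChar hc (j / d) (beta d x) else 0 := by
  obtain ⟨⟨V, W⟩, rfl⟩ := exists_sub_cls x
  simp_rw [map_sub, mul_sub, Finset.sum_sub_distrib]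
  rw [sum_coeffChar_cls V hc hd j hcb, sum_coeffChar_cls W hc hd j hcb, V.beta_cls, W.beta_cls]
  split_ifs
  · rfl
  · exact sub_zero 0

lemma orderOf_xi_ne_zero : (orderOf (Inertia.xi (SingleObj G)) : ℚ) ≠ 0 := by
  exact_mod_cast (FiniteRotation.isOfFinOrder (X := SingleObj G)).orderOf_pos.ne'

/-- Since r ≠ 0 the exponent s determines n, so the choice made in the definition is harmless. -/
lemma qExpansion_apply (F : ℚ ⊗[ℤ] KTate (SingleObj G)) {g h : G} (hc : Commute g h) {s : ℚ} {n : ℕ}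
    (hs : s = n / orderOf (Inertia.xi (SingleObj G))) :
    qExpansion F hc s = coeffCharRat hc n F := by
  have H : ∃ n : ℕ, s = n / orderOf (Inertia.xi (SingleObj G)) := ⟨n, hs⟩
  have h1 : H.choose = n := by
    have h2 := hs.symm.trans H.choose_spec
    rw [div_left_inj' orderOf_xi_ne_zero] at h2
    exact_mod_cast h2.symm
  rw [qExpansion, dif_pos H, h1]

lemma qExpansion_adams {g h : G} (hc : Commute g h) {a : ℕ} (ha : 0 < a) (x : KTate (SingleObj G))
    {s : ℚ} {k : ℕ} (hs : s = a * k / orderOf (Inertia.xi (SingleObj G))) :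
    qExpansion (toRat (adams a x)) hc s = coeffChar (hc.pow_right a) k x := by
  rw [qExpansion_apply _ hc (n := a * k) (by rw [hs, Nat.cast_mul]), coeffCharRat_toRat,
    coeffChar_adams hc ha, if_pos (dvd_mul_right a k), Nat.mul_div_cancel_left _ ha]

lemma qExpansion_adams_eq_zero {g h : G} (hc : Commute g h) {a : ℕ} (ha : 0 < a)
    (x : KTate (SingleObj G)) {s : ℚ}
    (hs : ¬ ∃ k : ℕ, s = a * k / orderOf (Inertia.xi (SingleObj G))) :
    qExpansion (toRat (adams a x)) hc s = 0 := by
  by_cases H : ∃ n : ℕ, s = n / orderOf (Inertia.xi (SingleObj G))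
  · obtain ⟨n, hn⟩ := H
    rw [qExpansion_apply _ hc hn, coeffCharRat_toRat, coeffChar_adams hc ha, if_neg]
    rintro ⟨k, rfl⟩
    exact hs ⟨k, by rw [hn, Nat.cast_mul]⟩
  · exact qExpansion_of_not_exists _ hc H

/-- The term at q^s comes from the exponent s d / a = j / r of F, with phase e^{2πi (j/r) b/d},
which is the b-th power of `rootPow` at (d, j). The sum over b is thus the one evaluated by
`sum_coeffChar_beta`, with h^a in place of h, and ψ_a accounts for h^a and for q^a. -/
lemma sum_substTau_qExpansion {g h : G} (hc : Commute g h) {a d : ℕ} (ha : 0 < a) (hd : 0 < d)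
    (x : KTate (SingleObj G)) (s : ℚ) :
    ∑ b ∈ Finset.range d, substTau a b d (qExpansion (toRat x) (commute_aux hc a b d)) s =
      d * qExpansion (toRat (adams a (beta d x))) hc s := by
  have ha' : (a : ℚ) ≠ 0 := by exact_mod_cast ha.ne'
  have hd' : (d : ℚ) ≠ 0 := by exact_mod_cast hd.ne'
  have hr := orderOf_xi_ne_zero (G := G)
  -- Exponents with d ∣ j on the side of F match the exponents a k / r that ψ_a can produce. All
  -- other terms vanish on both sides.
  have hiff : ∀ k : ℕ, s = a * k / orderOf (Inertia.xi (SingleObj G)) ↔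
      s * d / a = (d * k : ℕ) / orderOf (Inertia.xi (SingleObj G)) := fun k => by
    rw [div_eq_div_iff ha' hr, eq_div_iff hr, Nat.cast_mul]
    constructor
    · intro h1
      linear_combination (d : ℚ) * h1
    · intro h1
      apply mul_left_cancel₀ hd'
      linear_combination h1
  by_cases H : ∃ j : ℕ, s * d / a = j / orderOf (Inertia.xi (SingleObj G))
  · obtain ⟨j, hj⟩ := H
    have h1 : ∀ b, substTau a b d (qExpansion (toRat x) (commute_aux hc a b d)) s =
        RotSeries.rootPow (SingleObj G) d j ^ b * coeffChar (commute_aux hc a b d) j x := by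
      intro b
      rw [substTau, qExpansion_apply _ _ hj, coeffCharRat_toRat, hj, RotSeries.rootPow,
        ← Complex.exp_nat_mul]
      congr 2
      push_cast
      rw [← div_div]
      ring
    rw [Finset.sum_congr rfl fun b _ => h1 b, sum_coeffChar_beta (hc.pow_right a) hd j]
    split_ifs with hdj
    · obtain ⟨k, rfl⟩ := hdj
      rw [qExpansion_adams hc ha _ ((hiff k).2 hj), Nat.mul_div_cancel_left _ hd]
    · rw [qExpansion_adams_eq_zero hc ha, mul_zero]
      rintro ⟨k, hk⟩
      rw [hiff, hj, div_left_inj' hr] at hk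
      exact hdj ⟨k, by exact_mod_cast hk⟩
  · rw [qExpansion_adams_eq_zero hc ha _ fun ⟨k, hk⟩ => H ⟨_, (hiff k).1 hk⟩, mul_zero]
    refine Finset.sum_eq_zero fun b _ => ?_
    rw [substTau, qExpansion_of_not_exists _ _ H, mul_zero]

lemma qExpansion_hecke (m : ℕ) (x : KTate (SingleObj G)) {g h : G} (hc : Commute g h) (s : ℚ) :
    qExpansion (hecke m x) hc s = ∑ p ∈ m.divisorsAntidiagonal,
      (1 / p.1 : ℂ) * qExpansion (toRat (adams p.1 (beta p.2 x))) hc s := by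
  by_cases H : ∃ n : ℕ, s = n / orderOf (Inertia.xi (SingleObj G))
  · obtain ⟨n, hn⟩ := H
    rw [qExpansion_apply _ hc hn, hecke, map_sum]
    refine Finset.sum_congr rfl fun p _ => ?_
    rw [qExpansion_apply _ hc hn, coeffCharRat_tmul, coeffCharRat_toRat]
    push_cast
    rfl
  · rw [qExpansion_of_not_exists _ hc H]
    refine (Finset.sum_eq_zero fun p _ => ?_).symm
    rw [qExpansion_of_not_exists _ hc H, mul_zero]

/-- The Hecke operators of Tate K-theory are the equivariant Hecke operators of generalized
Moonshine. -/
theorem qExpansion_hecke_eq (m : ℕ) (x : KTate (SingleObj G)) {g h : G} (hc : Commute g h) (s : ℚ) :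
    qExpansion (hecke m x) hc s = equivariantHecke m (qExpansion (toRat x)) hc s := by
  rw [qExpansion_hecke, equivariantHecke, Finset.mul_sum]
  refine Finset.sum_congr rfl fun p hp => ?_
  obtain ⟨rfl, hm⟩ := Nat.mem_divisorsAntidiagonal.1 hp
  have ha := Nat.pos_of_ne_zero (left_ne_zero_of_mul hm)
  have hd := Nat.pos_of_ne_zero (right_ne_zero_of_mul hm)
  have hd' : (p.2 : ℂ) ≠ 0 := by exact_mod_cast hd.ne'
  -- For fixed ad = m the sum over b supplies a factor d, and d / m = 1 / a.
  rw [sum_substTau_qExpansion hc ha hd, ← mul_assoc]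
  congr 1
  push_cast
  field_simp

end moonshine

end OrbTate

end

theorem mainTheorem3 (X : Type u) [OrbTate.TopGpd.{u, v} X] [OrbTate.FiniteRotation X]
    (G : Type v) [Group G] [Finite G] :
    -- the total Atiyah symmetric power and the total symmetric power of Tate K-theory are well defined
    OrbTate.IsExponentialExtension OrbTate.RotSeries.sym
        (OrbTate.symT : OrbTate.KTate X → PowerSeries (OrbTate.KTate X)) ∧
      OrbTate.IsExponentialExtension OrbTate.RotSeries.tateSym
        (OrbTate.tateSymT : OrbTate.KTate X → PowerSeries (OrbTate.KTate X)) ∧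
      -- the generating function of the Adams operations
      (∀ x : OrbTate.KTate X, PowerSeries.map OrbTate.toRat (OrbTate.symT x) =
        OrbTate.expSeries (PowerSeries.mk fun m => (1 / (m : ℚ)) ⊗ₜ[ℤ] OrbTate.adams m x)) ∧
      -- the generating function of the Hecke operators
      (∀ F : OrbTate.KTate X, PowerSeries.map OrbTate.toRat (OrbTate.tateSymT F) =
        OrbTate.expSeries (PowerSeries.mk fun m => OrbTate.hecke m F)) ∧
      -- the character formula on coefficient rings
      ∀ (m : ℕ) (F : OrbTate.KTate (SingleObj G)) (g h : G) (hc : Commute g h) (s : ℚ),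
        OrbTate.qExpansion (OrbTate.hecke m F) hc s =
          OrbTate.equivariantHecke m (OrbTate.qExpansion (OrbTate.toRat F)) hc s := by
  exact ⟨OrbTate.isExponentialExtension_symT, OrbTate.isExponentialExtension_tateSymT,
    OrbTate.map_toRat_symT, OrbTate.map_toRat_tateSymT,
    fun m F _ _ hc s => OrbTate.qExpansion_hecke_eq m F hc s⟩
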